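/- **Theorem (security of Eunomia$^{KH}$).** *Setting.* A family of elliptic curves over finite fields is given: a probabilistic polynomial-time (ppt; possibly deterministic) setup outputs from $1^\kappa$ public parameters $pp$, which describe a curve and contain a base point $P$ of prime order $q$; points have polynomial length and are added in polynomial time. Let $\mathsf{DET}(k,v)\in\mathbb Z_q$ be a deterministic keyed function (computable in polynomial time, ppt key generation) and $\mathsf{Encrypt}$ a probabilistic encryption scheme. The adjustable keyed hash (AKH) of $v$ under $k\in\mathbb Z_q^*$ is $\mathsf{Hash}(k,v)=P\cdot\mathsf{DET}(k_{master},v)\cdot k$, and $\mathsf{Token}(k_1,k_2)=k_2k_1^{-1}$. *Logs.* A log is a list of tables, tables are lists of rows, and the schema $\mathcal S$ fixes the columns of each table and says which of them contain (integer) timestamps. An equality scheme $\delta$ is a list of pairs of columns. Let $\sim$ be the equivalence relation on columns generated by $\delta$ and all pairs of timestamp columns. For a set $C$ of constants and a set $D\subseteq C$ of integer displacements, $\mathcal L_1\equiv_{(\delta,C,D)}\mathcal L_2$ means: (1) both logs have the same schema, and corresponding tables have the same number of rows; (2) for each $\sim$-class of columns there is a bijection $M$ from the values of $\mathcal L_1$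 in these columns to those of $\mathcal L_2$ such that a cell of $\mathcal L_1$ with value $v$ has value $M(v)$ in $\mathcal L_2$, $M(v)=v$ if $v\in C$ or $M(v)\in C$, and $|v|=|M(v)|$; (3) if $\vec u,\vec v$ are the sequences of all timestamps of the two logs in the same order, then $u_i+d\ge u_j+d'\Leftrightarrow v_i+d\ge v_j+d'$ for all $d,d'\in D$ and all $i,j$. *Scheme.* Keys: $k_{master}$, a hash key $K_{time}$ common to all timestamp columns, an independent uniform hash key $k_h\in\mathbb Z_q^*$ for every other column, and an independent encryption key $k_e$ for every column. A cell $v$ becomes $\langle\mathsf{Hash}(k_h,v),\mathsf{Encrypt}(k_e,v)\rangle$ with the keys of its column. The mOPED structure maps $(\mathsf{Hash}(K_{time},t),\mathsf{Hash}(K_{time},d))$, for the timestamps $t$ of the log and $d\in D$, to the rank of $t+d$ among all such sums. *Game.* The adversary, given $1^\kappa$ and $pp$, chooses $\mathcal S,C,D,\delta$ and two logs $\mathcal L_0\ne\mathcal L_1$ of schema $\mathcal S$ with $\mathcal L_0\equiv_{(\delta,C,D)}\mathcal L_1$. The challenger generates the keys and a uniform bit $b$ and gives the adversary the encryption of $\mathcal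 L_b$, the mOPED structure of $\mathcal L_b$ together with all its intermediate states while the timestamps are inserted one by one, the tokens $\mathsf{Token}(k_1,k_2)$ for all pairs of columns in $\delta$, where $k_1,k_2$ are the hash keys of the two columns, and, for every $c\in C$ and every column of $\mathcal L_b$ in which $c$ appears, the encryption of $c$ under the keys of this column. The adversary may then ask for the encryption, under the keys of any column, of values that occur neither in $\mathcal L_0$ nor in $\mathcal L_1$, and outputs a guess $b'$. It wins iff $b'=b$. *Claim.* If the decisional Diffie–Hellman assumption holds for the curve family (ECDDH), $\mathsf{DET}$ is a pseudorandom function into $\mathbb Z_q$, and $\mathsf{Encrypt}$ is IND-CPA secure, then Eunomia$^{KH}$ is IND-CPLA$^{KH}$ secure: every ppt adversary wins the game with probability at most $\frac12+\mathsf{negl}(\kappa)$, over the coins of the adversary, the choice of keys (and public parameters), the encryption coins and $b$. -/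

import Mathlib

namespace Eunomia

/-! ## Machine model: data, programs with a step count, probabilistic polynomial time -/

/-- The data handled by programs: finite binary trees whose leaves are integers. -/
inductive Data where
  | int (n : ℤ) : Data
  | pair (a b : Data) : Data
deriving DecidableEq

namespace Data

/-- The length `|d|` of a datum; integers are measured in binary. -/
def size : Data → ℕ
  | int n => n.natAbs.size + 1
  | pair a b => a.size + b.size + 1

def fst : Data → Data
  | int _ => int 0
  | pair a _ => a

def snd : Data → Data
  | int _ => int 0
  | pair _ b => b

def toInt : Data → ℤ
  | int n => n
  | pair _ _ => 0

def toNat (d : Data) : ℕ := d.toInt.toNat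

/-- The datum `0` is read as `false`, everything else as `true`. -/
def toBool (d : Data) : Bool := d ≠ int 0

/-- A right-nested sequence of pairs, ended by a leaf, is read as a list. -/
def toList : Data → List Data
  | int _ => []
  | pair a b => a :: b.toList

def ofList : List Data → Data
  | [] => int 0
  | a :: l => pair a (ofList l)

def ofNat (n : ℕ) : Data := int n

def isInt : Data → Bool
  | int _ => true
  | pair _ _ => false

/-- The security parameter in unary, `1^κ`. -/
def unary (κ : ℕ) : Data := ofList (List.replicate κ (int 1))

theorem finite_size_le (n : ℕ) : {d : Data | d.size ≤ n}.Finite := by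
  induction n with
  | zero =>
    refine Set.Finite.subset Set.finite_empty ?_
    intro d hd
    cases d <;> simp [size] at hd
  | succ n ih =>
    refine Set.Finite.subset
      (((Set.finite_Icc (-(2 ^ n : ℤ)) (2 ^ n)).image int).union (ih.image2 pair ih)) ?_
    intro d hd
    cases d with
    | int m =>
      left
      refine ⟨m, ?_, rfl⟩
      have h1 : m.natAbs.size ≤ n := by simpa [size] using hd
      have h2 : m.natAbs < 2 ^ n := Nat.size_le.mp h1
      have h3 : ((m.natAbs : ℕ) : ℤ) < 2 ^ n := by exact_mod_cast h2
      rw [Int.natCast_natAbs] at h3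
      exact ⟨(abs_lt.mp h3).1.le, (abs_lt.mp h3).2.le⟩
    | pair a b =>
      right
      simp only [Set.mem_ofPred_eq, size] at hd
      exact ⟨a, by simp only [Set.mem_ofPred_eq]; omega, b, by simp only [Set.mem_ofPred_eq]; omega, rfl⟩

instance (n : ℕ) : Finite {d : Data // d.size ≤ n} := finite_size_le n

end Data

/-- Deterministic basic instructions. -/
inductive Prim where
  | id | const (d : Data) | fst | snd | isInt | eq | add | sub | mul | div | mod | le | size

def Prim.eval : Prim → Data → Data
  | .id, x => x
  | .const d, _ => d
  | .fst, x => x.fst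
  | .snd, x => x.snd
  | .isInt, x => .int (if x.isInt then 1 else 0)
  | .eq, x => .int (if x.fst = x.snd then 1 else 0)
  | .add, x => .int (x.fst.toInt + x.snd.toInt)
  | .sub, x => .int (x.fst.toInt - x.snd.toInt)
  | .mul, x => .int (x.fst.toInt * x.snd.toInt)
  | .div, x => .int (x.fst.toInt / x.snd.toInt)
  | .mod, x => .int (x.fst.toInt % x.snd.toInt)
  | .le, x => .int (if x.fst.toInt ≤ x.snd.toInt then 1 else 0)
  | .size, x => .ofNat x.size

/-- Programs (finite syntax trees, so one program serves all security parameters) with loops,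
random sampling and calls to an oracle. Programs always terminate; how long they run is measured
by `Prog.run`. A polynomial-time Turing machine can be simulated step by step in a loop whose
number of iterations is its polynomial clock, so that asking for a polynomial bound on the cost
gives exactly the usual (probabilistic) polynomial time. -/
inductive Prog where
  /-- a basic instruction -/
  | prim (p : Prim) : Prog
  /-- first `f`, then `g` -/
  | comp (f g : Prog) : Prog
  /-- both results on the same input -/
  | pair (f g : Prog) : Prog
  /-- branch on the result of `c` -/
  | ite (c f g : Prog) : Prog
  /-- iterate `f` on the input as many times as the integer computed by `n` says -/
  | loop (n f : Prog) : Prog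
  /-- on input `m > 0`, a uniform integer in `[0, m)` -/
  | rand : Prog
  /-- on input `(u, y)`, ask the oracle for `y`, and read the answer if it is not longer
  than `u` (else the result is `0`) -/
  | oracle : Prog

/-- Run `f` for `k` rounds, adding up the costs. -/
noncomputable def iterate (f : Data → PMF (Data × ℕ)) : ℕ → Data → PMF (Data × ℕ)
  | 0, x => PMF.pure (x, 1 + x.size)
  | k + 1, x => (f x).bind fun r => (iterate f k r.1).map fun s => (s.1, r.2 + s.2 + 1)

/-- Uniform sampling from `{0, …, m - 1}`; the result is `0` when `m = 0`. -/
noncomputable def uniformBelow : ℕ → PMF Data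
  | 0 => PMF.pure (.int 0)
  | m + 1 => (PMF.uniformOfFintype (Fin (m + 1))).map fun i => .ofNat i.val

/-- The joint distribution of the output and of the number of steps of a program with a
(possibly randomized) oracle `O`. An instruction costs at least the length of what it reads and of
what it writes. -/
noncomputable def Prog.run (O : Data → PMF Data) : Prog → Data → PMF (Data × ℕ)
  | .prim p, x => PMF.pure (p.eval x, 1 + x.size + (p.eval x).size)
  | .comp f g, x =>
      (f.run O x).bind fun r => (g.run O r.1).map fun s => (s.1, r.2 + s.2 + 1)
  | .pair f g, x =>
      (f.run O x).bind fun r => (g.run O x).map fun s =>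
        (.pair r.1 s.1, r.2 + s.2 + (Data.pair r.1 s.1).size)
  | .ite c f g, x =>
      (c.run O x).bind fun r =>
        (if r.1.toBool then f.run O x else g.run O x).map fun s => (s.1, r.2 + s.2 + 1)
  | .loop n f, x =>
      (n.run O x).bind fun r =>
        (iterate (f.run O) r.1.toNat x).map fun s => (s.1, r.2 + s.2 + 1)
  | .rand, x => (uniformBelow x.toNat).map fun y => (y, 1 + x.size + y.size)
  | .oracle, x =>
      (O x.snd).map fun z =>
        let y := if z.size ≤ x.fst.size then z else .int 0
        (y, 1 + x.size + y.size)

/-- Output distribution of a program with oracle `O`. -/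
noncomputable def Prog.execWith (A : Prog) (O : Data → PMF Data) (x : Data) : PMF Data :=
  (A.run O x).map Prod.fst

/-- Output distribution of a program without an oracle. -/
noncomputable def Prog.exec (A : Prog) (x : Data) : PMF Data :=
  A.execWith (fun _ => PMF.pure (.int 0)) x

/-- `A` makes at most `t |x|` steps on every input `x`, whatever its random choices and the answers
of its oracle are. -/
def Prog.RunsInTime (A : Prog) (t : Polynomial ℕ) : Prop :=
  ∀ (O : Data → PMF Data) (x : Data), ∀ r ∈ (A.run O x).support, r.2 ≤ t.eval x.size

/-- Probabilistic polynomial time. -/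
def Prog.PPT (A : Prog) : Prop := ∃ t : Polynomial ℕ, A.RunsInTime t

def Negligible (f : ℕ → ℝ) : Prop :=
  ∀ c : ℕ, ∃ K : ℕ, ∀ κ > K, f κ < ((κ : ℝ) ^ c)⁻¹

/-- The probability that a random bit is `true`. -/
noncomputable def prTrue (p : PMF Bool) : ℝ := (p true).toReal

/-- Perform independent random experiments along a list and collect the results. -/
noncomputable def sampleList {α β : Type} (f : α → PMF β) : List α → PMF (List β)
  | [] => PMF.pure []
  | a :: l => (f a).bind fun b => (sampleList f l).map fun bs => b :: bs

/-! ## Elliptic curves and the decisional Diffie-Hellman assumption -/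

/-- An elliptic curve over a finite field with a base point of prime order `q`, and a way of writing
down its points. -/
structure Curve where
  F : Type
  [field : Field F]
  [finite : Finite F]
  [decEq : DecidableEq F]
  W : WeierstrassCurve.Affine F
  [elliptic : W.IsElliptic]
  base : W.Point
  q : ℕ
  [prime : Fact q.Prime]
  order_base : addOrderOf base = q
  encode : W.Point → Data
  encode_injective : Function.Injective encode

attribute [instance] Curve.field Curve.finite Curve.decEq Curve.elliptic Curve.prime

/-- The encoding of the point `X × k`, for a scalar `k` modulo the order of the base point. -/
def Curve.smul (E : Curve) (X : E.W.Point) (k : ZMod E.q) : E.W.Point := k.val • X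

/-- A family of elliptic curves for cryptographic use. The public parameters `pp` are generated from
`1^κ` in polynomial time (deterministically, if the curve is fixed once and for all); they contain a
description of the curve, the order `q` and the base point. Points are written with polynomially
many symbols and can be added in polynomial time. -/
structure CurveFamily where
  setup : Prog
  setup_ppt : setup.PPT
  curve : Data → Curve
  pp_spec : ∀ κ, ∀ pp ∈ (setup.exec (.unary κ)).support, ∃ desc : Data,
    pp = .pair desc (.pair (.ofNat (curve pp).q) ((curve pp).encode (curve pp).base))
  encode_size : ∃ s : Polynomial ℕ, ∀ κ, ∀ pp ∈ (setup.exec (.unary κ)).support,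
    ∀ X, ((curve pp).encode X).size ≤ s.eval κ
  add : Prog
  add_ppt : add.PPT
  add_spec : ∀ κ, ∀ pp ∈ (setup.exec (.unary κ)).support, ∀ X Y,
    add.exec (.pair pp (.pair ((curve pp).encode X) ((curve pp).encode Y))) =
      PMF.pure ((curve pp).encode (X + Y))

/-- A distinguisher `B` gets `1^κ`, the public parameters and `(aP, bP, Z)`, where `Z = abP` if
`real`, and `Z = cP` for an independent `c` otherwise. -/
noncomputable def ddhGame (G : CurveFamily) (B : Prog) (real : Bool) (κ : ℕ) : PMF Bool := do
  let pp ← G.setup.exec (.unary κ)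
  let E := G.curve pp
  let a ← PMF.uniformOfFintype (ZMod E.q)
  let b ← PMF.uniformOfFintype (ZMod E.q)
  let c ← PMF.uniformOfFintype (ZMod E.q)
  let z := if real then a * b else c
  let out ← B.exec (.pair (.unary κ) (.pair pp (.ofList
    [E.encode (E.smul E.base a), E.encode (E.smul E.base b), E.encode (E.smul E.base z)])))
  PMF.pure out.toBool

/-- The ECDDH assumption. -/
def ECDDH (G : CurveFamily) : Prop :=
  ∀ B : Prog, B.PPT →
    Negligible fun κ => |prTrue (ddhGame G B true κ) - prTrue (ddhGame G B false κ)|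

/-! ## Deterministic encryption as a pseudorandom function into the scalars -/

/-- The deterministic function `DET(k, v)`, whose values are used as scalars on the curve. -/
structure DetScheme (G : CurveFamily) where
  gen : Prog
  gen_ppt : gen.PPT
  det : (pp k v : Data) → ZMod (G.curve pp).q
  prog : Prog
  prog_ppt : prog.PPT
  prog_spec : ∀ κ, ∀ pp ∈ (G.setup.exec (.unary κ)).support,
    ∀ k ∈ (gen.exec (.pair (.unary κ) pp)).support, ∀ v,
      prog.exec (.pair pp (.pair k v)) = PMF.pure (.ofNat (det pp k v).val)

open Classical in
/-- A uniformly random function from the data of length at most `n` to `ZMod q`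
(and `0` on longer data). -/
noncomputable def randomFunction (q : ℕ) [Fact q.Prime] (n : ℕ) : PMF (Data → ZMod q) :=
  letI : Fintype {d : Data // d.size ≤ n} := Fintype.ofFinite _
  (PMF.uniformOfFintype ({d : Data // d.size ≤ n} → ZMod q)).map fun f d =>
    if h : d.size ≤ n then f ⟨d, h⟩ else 0

noncomputable def prfReal {G : CurveFamily} (H : DetScheme G) (B : Prog) (κ : ℕ) : PMF Bool := do
  let pp ← G.setup.exec (.unary κ)
  let k ← H.gen.exec (.pair (.unary κ) pp)
  let out ← B.execWith (fun v => PMF.pure (.ofNat (H.det pp k v).val)) (.pair (.unary κ) pp)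
  PMF.pure out.toBool

/-- The distinguisher `B`, running in time `t`, with a random function in place of `DET(k, ·)`. A
query is no longer than the running time, so it is enough to choose the function on such data. -/
noncomputable def prfIdeal (G : CurveFamily) (B : Prog) (t : Polynomial ℕ) (κ : ℕ) :
    PMF Bool := do
  let pp ← G.setup.exec (.unary κ)
  let f ← randomFunction (G.curve pp).q (t.eval (Data.pair (.unary κ) pp).size)
  let out ← B.execWith (fun v => PMF.pure (.ofNat (f v).val)) (.pair (.unary κ) pp)
  PMF.pure out.toBool

/-- `DET` is a pseudorandom function. -/
def DetScheme.IsPRF {G : CurveFamily} (H : DetScheme G) : Prop :=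
  ∀ (B : Prog) (t : Polynomial ℕ), B.RunsInTime t →
    Negligible fun κ => |prTrue (prfReal H B κ) - prTrue (prfIdeal G B t κ)|

/-! ## Probabilistic encryption and IND-CPA security -/

structure EncScheme where
  gen : Prog
  enc : Prog
  dec : Prog
  gen_ppt : gen.PPT
  enc_ppt : enc.PPT
  dec_ppt : dec.PPT
  correct : ∀ κ, ∀ k ∈ (gen.exec (.unary κ)).support, ∀ m,
    ∀ c ∈ (enc.exec (.pair k m)).support, dec.exec (.pair k c) = PMF.pure m

/-- The adversary `(A₁, A₂)` has an encryption oracle throughout. First `A₁` outputs two messages of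
the same length and a state `(m₀, (m₁, st))`, then `A₂` gets the state and an encryption of `m_b`
and guesses `b`. (There is no challenge if the lengths differ.) The result says whether the guess is
right. -/
noncomputable def cpaGame (SE : EncScheme) (A₁ A₂ : Prog) (κ : ℕ) : PMF Bool := do
  let k ← SE.gen.exec (.unary κ)
  let b ← PMF.uniformOfFintype Bool
  let O : Data → PMF Data := fun m => SE.enc.exec (.pair k m)
  let out ← A₁.execWith O (.unary κ)
  let m₀ := out.fst
  let m₁ := out.snd.fst
  let st := out.snd.snd
  let c ← if m₀.size = m₁.size then O (if b then m₁ else m₀) else PMF.pure (.int 0)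
  let guess ← A₂.execWith O (.pair st c)
  PMF.pure (guess.toBool == b)

def EncScheme.INDCPA (SE : EncScheme) : Prop :=
  ∀ A₁ A₂ : Prog, A₁.PPT → A₂.PPT →
    ∃ ν, Negligible ν ∧ ∀ κ, prTrue (cpaGame SE A₁ A₂ κ) ≤ 1 / 2 + ν κ

/-! ## Logs and their equivalence -/

/-- The ordered list of tables; a table is the ordered list of its columns, and a column is marked
`true` if it contains timestamps. -/
abbrev Schema := List (List Bool)

/-- A column, named by the position of its table in the schema and its position in the table. -/
abbrev Column := ℕ × ℕ

/-- A table is a list of rows, and a row is a list of cells. -/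
abbrev Log := List (List (List Data))

def Schema.kind (S : Schema) (c : Column) : Option Bool := (S[c.1]?).bind fun T => T[c.2]?

def Schema.Mem (S : Schema) (c : Column) : Prop := (S.kind c).isSome

def Schema.IsTime (S : Schema) (c : Column) : Prop := S.kind c = some true

instance (S : Schema) (c : Column) : Decidable (S.IsTime c) :=
  inferInstanceAs (Decidable (S.kind c = some true))

/-- All columns, in order. -/
def Schema.columns (S : Schema) : List Column :=
  S.zipIdx.flatMap fun T => T.1.zipIdx.map fun a => (T.2, a.2)

/-- The content of row `i`, column `c`. -/
def Log.cell (L : Log) (c : Column) (i : ℕ) : Option Data :=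
  (L[c.1]?).bind fun T => (T[i]?).bind fun row => row[c.2]?

/-- The values in a column, from top to bottom. -/
def Log.column (L : Log) (c : Column) : List Data :=
  ((L[c.1]?).getD []).filterMap fun row => row[c.2]?

/-- All values of the log. -/
def Log.values (L : Log) : List Data := L.flatten.flatten

/-- `L` has schema `S`, and its timestamp columns contain integers. -/
structure Log.HasSchema (L : Log) (S : Schema) : Prop where
  tables : L.length = S.length
  rows : ∀ (t : ℕ) T cols, L[t]? = some T → S[t]? = some cols →
    ∀ row ∈ T, row.length = cols.length
  times : ∀ c, S.IsTime c → ∀ v ∈ L.column c, v.isInt = true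

/-- The timestamps in the order of tables, rows and columns. -/
def timeStamps (S : Schema) (L : Log) : List Data :=
  L.zipIdx.flatMap fun T => T.1.flatMap fun row => row.zipIdx.filterMap fun v =>
    if S.IsTime (T.2, v.2) then some v.1 else none

/-- Equality up to distances with displacements. -/
def EDD (u v D : List Data) : Prop :=
  u.length = v.length ∧
  ∀ d ∈ D, ∀ e ∈ D, ∀ (i j : ℕ) (ui uj vi vj : Data),
    u[i]? = some ui → u[j]? = some uj → v[i]? = some vi → v[j]? = some vj →
    (ui.toInt + d.toInt ≥ uj.toInt + e.toInt ↔ vi.toInt + d.toInt ≥ vj.toInt + e.toInt)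

/-- The equivalence relation on columns generated by the equality scheme `δ`, where any two timestamp
columns count as comparable. -/
def SameClass (S : Schema) (δ : List (Column × Column)) : Column → Column → Prop :=
  Relation.EqvGen fun c c' => (c, c') ∈ δ ∨ (S.IsTime c ∧ S.IsTime c')

/-- The values which a log has in the columns equivalent to `c`. -/
def classValues (S : Schema) (δ : List (Column × Column)) (L : Log) (c : Column) : Set Data :=
  {v | ∃ c', SameClass S δ c c' ∧ v ∈ L.column c'}

/-- Plaintext log equivalence. -/
structure LogEquiv (S : Schema) (δ : List (Column × Column)) (C D : List Data)
    (L₁ L₂ : Log) : Prop where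
  schema₁ : L₁.HasSchema S
  schema₂ : L₂.HasSchema S
  rows : L₁.map List.length = L₂.map List.length
  bijections : ∃ M : Column → Data → Data,
    (∀ c c', SameClass S δ c c' → M c = M c') ∧
    (∀ c, Set.BijOn (M c) (classValues S δ L₁ c) (classValues S δ L₂ c)) ∧
    (∀ c i v, L₁.cell c i = some v → L₂.cell c i = some (M c v)) ∧
    (∀ c, ∀ v ∈ classValues S δ L₁ c, v ∈ C ∨ M c v ∈ C → M c v = v) ∧
    (∀ c, ∀ v ∈ classValues S δ L₁ c, v.size = (M c v).size)
  times : EDD (timeStamps S L₁) (timeStamps S L₂) D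

/-! ## The scheme -/

section Scheme

variable {G : CurveFamily} (H : DetScheme G) (SE : EncScheme)

/-- The adjustable keyed hash `P × DET(k_master, v) × k`. -/
def akhHash (pp master : Data) (k : (ZMod (G.curve pp).q)ˣ) (v : Data) : (G.curve pp).W.Point :=
  (G.curve pp).smul ((G.curve pp).smul (G.curve pp).base (H.det pp master v)) k

/-- The token `k₂ × k₁⁻¹`, which turns hashes under `k₁` into hashes under `k₂`. -/
def akhToken {q : ℕ} (k₁ k₂ : (ZMod q)ˣ) : (ZMod q)ˣ := k₂ * k₁⁻¹

/-- The keys: the master key, the hash key of timestamps, and the hash key and encryption key of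
each column. -/
structure KeySet (q : ℕ) where
  master : Data
  time : (ZMod q)ˣ
  cols : List (List ((ZMod q)ˣ × Data))

def KeySet.key {q : ℕ} (K : KeySet q) (c : Column) : Option ((ZMod q)ˣ × Data) :=
  (K.cols[c.1]?).bind fun T => T[c.2]?

/-- Key generation: all keys are independent, except that all timestamp columns have the same hash
key. -/
noncomputable def keyGen (κ : ℕ) (pp : Data) (S : Schema) : PMF (KeySet (G.curve pp).q) := do
  let master ← H.gen.exec (.pair (.unary κ) pp)
  let time ← PMF.uniformOfFintype (ZMod (G.curve pp).q)ˣ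
  let cols ← sampleList (fun T : List Bool => sampleList (fun isTime : Bool => do
    let kh ← if isTime then PMF.pure time else PMF.uniformOfFintype (ZMod (G.curve pp).q)ˣ
    let ke ← SE.gen.exec (.unary κ)
    PMF.pure (kh, ke)) T) S
  PMF.pure ⟨master, time, cols⟩

/-- The pair of the hash and an encryption of `v` under the keys of column `c`. -/
noncomputable def encryptCell (pp : Data) (K : KeySet (G.curve pp).q) (c : Column) (v : Data) :
    PMF Data :=
  match K.key c with
  | none => PMF.pure (.int 0)
  | some k => (SE.enc.exec (.pair k.2 v)).map fun ct =>
      .pair ((G.curve pp).encode (akhHash H pp K.master k.1 v)) ct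

/-- The cell-wise encryption of the log. -/
noncomputable def encryptDB (pp : Data) (K : KeySet (G.curve pp).q) (L : Log) : PMF Data :=
  (sampleList (fun T : List (List Data) × ℕ =>
    (sampleList (fun row : List Data =>
      (sampleList (fun v : Data × ℕ => encryptCell H SE pp K (T.2, v.2) v.1) row.zipIdx).map
        Data.ofList) T.1).map Data.ofList) L.zipIdx).map Data.ofList

/-- The set of all values `t + d`. -/
def displaced (ts D : List Data) : Finset ℤ :=
  Finset.image₂ (fun t d => t.toInt + d.toInt) ts.toFinset D.toFinset

/-- The place of `t + d` in the order of all these values. -/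
def rank (ts D : List Data) (t d : Data) : ℕ :=
  ((displaced ts D).filter fun s => s ≤ t.toInt + d.toInt).card

/-- The mOPED map for a sequence of timestamps: the list of all
`(Enc(t), Enc(d), rank of t + d)`. -/
def mopedMap (pp : Data) (K : KeySet (G.curve pp).q) (ts D : List Data) : Data :=
  .ofList (ts.flatMap fun t => D.map fun d => .ofList
    [(G.curve pp).encode (akhHash H pp K.master K.time t),
     (G.curve pp).encode (akhHash H pp K.master K.time d),
     .ofNat (rank ts D t d)])

/-- The construction of the mOPED structure of a log as the cloud observes it: all the states of the
map while the timestamps are inserted one after the other. The last state is the final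
structure. -/
def mopedConstruction (pp : Data) (K : KeySet (G.curve pp).q) (ts D : List Data) : Data :=
  .ofList ((List.range (ts.length + 1)).map fun j => mopedMap H pp K (ts.take j) D)

def columnData (c : Column) : Data := .pair (.ofNat c.1) (.ofNat c.2)

/-- The adjustment tokens for all pairs in `δ`. -/
def generateTokens {q : ℕ} (K : KeySet q) (δ : List (Column × Column)) : Data :=
  .ofList (δ.filterMap fun p => (K.key p.1).bind fun k₁ => (K.key p.2).map fun k₂ =>
    .ofList [columnData p.1, columnData p.2,
      .ofNat (akhToken k₁.1 k₂.1 : ZMod q).val])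

/-- For all constants `v ∈ C` and all columns `c` of `L` in which `v` appears, the encryption of `v`
under the keys of `c`. -/
noncomputable def encryptConstants (pp : Data) (K : KeySet (G.curve pp).q) (S : Schema)
    (C : List Data) (L : Log) : PMF Data :=
  (sampleList (fun p : Column × Data => (encryptCell H SE pp K p.1 p.2).map fun e =>
      Data.ofList [columnData p.1, p.2, e])
    (S.columns.flatMap fun c => (C.filter fun v => v ∈ L.column c).map fun v => (c, v))).map
    Data.ofList

/-! ## The security game -/

/-- What the adversary chooses: the schema, the constants, the displacements, the equality scheme, two
logs, and a state for its second phase. -/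
structure Challenge where
  S : Schema
  C : List Data
  D : List Data
  δ : List (Column × Column)
  L₀ : Log
  L₁ : Log
  state : Data

def Column.ofData (d : Data) : Column := (d.fst.toNat, d.snd.toNat)

def Log.ofData (d : Data) : Log := d.toList.map fun T => T.toList.map Data.toList

/-- The challenge written as `(S, (C, (D, (δ, (L₀, (L₁, state))))))`. -/
def Challenge.ofData (x : Data) : Challenge where
  S := x.fst.toList.map fun T => T.toList.map Data.toBool
  C := x.snd.fst.toList
  D := x.snd.snd.fst.toList
  δ := x.snd.snd.snd.fst.toList.map fun p => (Column.ofData p.fst, Column.ofData p.snd)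
  L₀ := Log.ofData x.snd.snd.snd.snd.fst
  L₁ := Log.ofData x.snd.snd.snd.snd.snd.fst
  state := x.snd.snd.snd.snd.snd.snd

/-- The rules which the choice of the adversary has to obey. -/
structure Challenge.Valid (ch : Challenge) : Prop where
  displacements : ch.D ⊆ ch.C
  ints : ∀ d ∈ ch.D, d.isInt = true
  scheme : ∀ p ∈ ch.δ, ch.S.Mem p.1 ∧ ch.S.Mem p.2
  equiv : LogEquiv ch.S ch.δ ch.C ch.D ch.L₀ ch.L₁
  ne : ch.L₀ ≠ ch.L₁

/-- The encryption oracle: a query is a column and a value `((t, a), v)`. It refuses to encrypt the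
values of the two logs. -/
noncomputable def encOracle (pp : Data) (K : KeySet (G.curve pp).q) (ch : Challenge) (x : Data) :
    PMF Data :=
  if x.snd ∈ ch.L₀.values ∨ x.snd ∈ ch.L₁.values then PMF.pure (.int 0)
  else encryptCell H SE pp K (Column.ofData x.fst) x.snd

/-- The game. The first phase `A₁` of the adversary gets `1^κ` and the public parameters and makes
all its choices (it learns nothing in between them); the second phase `A₂` gets the state left by
`A₁`, the encrypted log, the construction of its mOPED structure, the tokens and the encrypted
constants, has access to the encryption oracle, and guesses the bit `b`. The result says whether the
guess is right. -/
noncomputable def cplaGame (A₁ A₂ : Prog) (κ : ℕ) : PMF Bool := do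
  let pp ← G.setup.exec (.unary κ)
  let choice ← A₁.exec (.pair (.unary κ) pp)
  let ch := Challenge.ofData choice
  let K ← keyGen H SE κ pp ch.S
  let b ← PMF.uniformOfFintype Bool
  let L := if b then ch.L₁ else ch.L₀
  let eDB ← encryptDB H SE pp K L
  let eT := mopedConstruction H pp K (timeStamps ch.S L) ch.D
  let tokens := generateTokens K ch.δ
  let consts ← encryptConstants H SE pp K ch.S ch.C L
  let guess ← A₂.execWith (encOracle H SE pp K ch)
    (.pair ch.state (.ofList [eDB, eT, tokens, consts]))
  PMF.pure (guess.toBool == b)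

/-- IND-CPLA security of the scheme built from `G`, `H` and `SE`: every adversary that runs in
probabilistic polynomial time and obeys the rules wins with probability at most
`1 / 2 + negl(κ)`. -/
def INDCPLA : Prop :=
  ∀ A₁ A₂ : Prog, A₁.PPT → A₂.PPT →
    (∀ κ, ∀ pp ∈ (G.setup.exec (.unary κ)).support,
      ∀ x ∈ (A₁.exec (.pair (.unary κ) pp)).support, (Challenge.ofData x).Valid) →
    ∃ ν, Negligible ν ∧ ∀ κ, prTrue (cplaGame H SE A₁ A₂ κ) ≤ 1 / 2 + ν κ

end Scheme

end Eunomia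

namespace Eunomia

/-! ## Costs of programs -/

/-! Call the logs `L₀` (`firstLog`) and `L₁` (`secondLog`). A split game shows the adversary the
hashes of one log `Lh` together with the ciphertexts of a possibly different log `Lc` (`splitGame`).
Everything else in the view, namely the shape of the log, the ranks in the mOPED structure, the
positions of constants and the tokens, is the same for equivalent logs (`realAttack_eq`,
`EDD.rank_eq`). Hence the winning probability is 1/2 plus half the difference of the split games
with logs `(L₁, L₁)` and `(L₀, L₀)` (`cplaGame_eq`). Two hybrid arguments connect these through
`(L₁, L₀)`.

Ciphertexts (`exists_splitGame_sub_le`). Cells are numbered and their ciphertexts exchanged one at a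
time. An IND-CPA adversary guesses the cell, submits its two contents, which have equal length, and
uses its oracle for all other encryptions in that column. The differences telescope, so the loss is
the polynomial number of possible positions.

Hashes (`close_splitGame`). Hashes are exchanged one class of columns at a time, for a random label
`J`. If the hashes of class `J` came from a random function independent of that used elsewhere, the
exchange would be invisible: the bijection of the equivalence extends to a size-preserving injection
`σ` of all data which fixes the constants and every value that the oracle accepts
(`exists_perm_hybridAttack`), and composition with `σ` preserves a uniform random function
(`randomPair_comp`, `randomPair_hybridBit`). It remains to decouple class `J` from the rest
(`close_randomPairHybrid`). In the scheme both use one function `f`. With `f` random, it may be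
replaced by `a y + y'` outside `J` and `b (a y + y')` inside, where `y`, `y'` are two random
functions obtained from one by tagging its arguments: the first is again random, and the factor `b ≠
0` is absorbed by the uniform hash keys of class `J`, without affecting tokens, because the columns
of a token belong to one class (`hybridBit_scale`). With `DET` in place of the random function,
these hashes can be computed from `(aP, bP, abP)`; DDH replaces `abP` by `cP`, so that class `J`
uses `c y + b y'`. With random functions again, `(a y + y', c y + b y')` is a pair of independent
random functions as soon as `c ≠ ab`, by an invertible 2 × 2 matrix (`randomFunction_linear_pair`).
One Diffie-Hellman triple therefore serves all hashed values at once, and the exceptional events `b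
= 0` and `c = ab` cost `1/q`, which DDH itself makes negligible on average (`negligible_inv_order`).

The reductions have to be actual polynomial-time programs. For this, oracle calls of a program are
answered by another program (`PPT.subst`), bounded loops are implemented (`PPTime.iter`), and
`PolyTime` and `PPTime` are closed under enough operations that the reductions can be written as
ordinary functions and experiments. -/

theorem eval_mono (t : Polynomial ℕ) {a b : ℕ} (h : a ≤ b) : t.eval a ≤ t.eval b := by
  simp only [Polynomial.eval_eq_sum, Polynomial.sum]
  gcongr

theorem Data.size_pos (d : Data) : 0 < d.size := by cases d <;> simp [Data.size]

theorem size_ofNat (n : ℕ) : (Data.ofNat n).size = n.size + 1 := by simp [Data.ofNat, Data.size]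

theorem Nat.size_le_self (n : ℕ) : n.size ≤ n := Nat.size_le.mpr Nat.lt_two_pow_self

theorem size_ofNat_le (n : ℕ) : (Data.ofNat n).size ≤ n + 1 := by
  rw [size_ofNat]; have := Nat.size_le_self n; omega

theorem Data.fst_size (d : Data) : d.fst.size ≤ d.size := by
  cases d
  · simp [Data.fst, Data.size]
  · simp only [Data.fst, Data.size]; omega

theorem Data.snd_size (d : Data) : d.snd.size ≤ d.size := by
  cases d
  · simp [Data.snd, Data.size]
  · simp only [Data.snd, Data.size]; omega

theorem Data.toInt_size (d : Data) : d.toInt.natAbs.size + 1 ≤ d.size := by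
  cases d <;> simp [Data.toInt, Data.size]

@[simp] theorem Data.fst_pair (a b : Data) : (Data.pair a b).fst = a := rfl

@[simp] theorem Data.snd_pair (a b : Data) : (Data.pair a b).snd = b := rfl

@[simp] theorem Data.toInt_int (n : ℤ) : (Data.int n).toInt = n := rfl

namespace Prog

variable {O O' : Data → PMF Data}

@[simp] theorem execWith_prim (p : Prim) (x : Data) :
    (Prog.prim p).execWith O x = PMF.pure (p.eval x) := by
  simp [execWith, run, PMF.pure_map]

theorem execWith_comp (f g : Prog) (x : Data) :
    (Prog.comp f g).execWith O x = (f.execWith O x).bind (g.execWith O) := by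
  simp only [execWith, run, PMF.map_bind, PMF.map_comp, PMF.bind_map]
  rfl

theorem execWith_pair (f g : Prog) (x : Data) :
    (Prog.pair f g).execWith O x =
      (f.execWith O x).bind fun a => (g.execWith O x).map (Data.pair a) := by
  simp only [execWith, run, PMF.map_bind, PMF.map_comp, PMF.bind_map]
  rfl

theorem execWith_ite (c f g : Prog) (x : Data) :
    (Prog.ite c f g).execWith O x =
      (c.execWith O x).bind fun a => if a.toBool then f.execWith O x else g.execWith O x := by
  simp only [execWith, run, PMF.map_bind, PMF.map_comp, PMF.bind_map]
  congr 1; funext r; simp only [Function.comp]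
  split_ifs <;> rfl

/-- `k`-fold iteration of a randomized step. -/
noncomputable def _root_.Eunomia.iterP {σ : Type} (f : σ → PMF σ) : ℕ → σ → PMF σ
  | 0, s => PMF.pure s
  | k + 1, s => (f s).bind (iterP f k)

theorem map_fst_iterate (f : Data → PMF (Data × ℕ)) (k : ℕ) (x : Data) :
    (iterate f k x).map Prod.fst = iterP (fun y => (f y).map Prod.fst) k x := by
  induction k generalizing x with
  | zero => simp [iterate, iterP, PMF.pure_map]
  | succ k ih =>
    simp only [iterate, iterP, PMF.map_bind, PMF.map_comp, PMF.bind_map]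
    congr 1; funext r
    simp only [Function.comp_def, ← ih]

theorem execWith_loop (n f : Prog) (x : Data) :
    (Prog.loop n f).execWith O x =
      (n.execWith O x).bind fun a => iterP (f.execWith O) a.toNat x := by
  simp only [execWith, run, PMF.map_bind, PMF.map_comp, PMF.bind_map]
  congr 1; funext r
  exact map_fst_iterate _ _ _

theorem execWith_rand (x : Data) : Prog.rand.execWith O x = uniformBelow x.toNat := by
  simp only [execWith, run, PMF.map_comp]
  exact PMF.map_id _

theorem execWith_oracle (x : Data) : Prog.oracle.execWith O x =
    (O x.snd).map fun z => if z.size ≤ x.fst.size then z else .int 0 := by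
  simp only [execWith, run, PMF.map_comp]; rfl

/-- No bound on `f` is needed: the last round, number zero, is charged the size of the state that it
returns. -/
theorem iterate_size {f : Data → PMF (Data × ℕ)} (k : ℕ) (x : Data) :
    ∀ r ∈ (iterate f k x).support, r.1.size ≤ r.2 := by
  induction k generalizing x with
  | zero => simp [iterate]
  | succ k ih =>
    intro r hr
    simp only [iterate, PMF.mem_support_bind_iff, PMF.mem_support_map_iff] at hr
    obtain ⟨a, _, s, hs, rfl⟩ := hr
    have := ih _ s hs
    dsimp only; omega

/-- The output of a program is not longer than its running time. -/
theorem size_le_cost (A : Prog) (x : Data) : ∀ r ∈ (A.run O x).support, r.1.size ≤ r.2 := by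
  induction A generalizing x with
  | prim p => simp [run]
  | comp f g ihf ihg =>
    intro r hr
    simp only [run, PMF.mem_support_bind_iff, PMF.mem_support_map_iff] at hr
    obtain ⟨a, _, s, hs, rfl⟩ := hr
    have := ihg _ s hs
    dsimp only; omega
  | pair f g ihf ihg =>
    intro r hr
    simp only [run, PMF.mem_support_bind_iff, PMF.mem_support_map_iff] at hr
    obtain ⟨a, _, s, hs, rfl⟩ := hr
    dsimp only; omega
  | ite c f g ihc ihf ihg =>
    intro r hr
    simp only [run, PMF.mem_support_bind_iff, PMF.mem_support_map_iff] at hr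
    obtain ⟨a, _, s, hs, rfl⟩ := hr
    have : s.1.size ≤ s.2 := by
      split_ifs at hs
      exacts [ihf _ s hs, ihg _ s hs]
    dsimp only; omega
  | loop n f ihn ihf =>
    intro r hr
    simp only [run, PMF.mem_support_bind_iff, PMF.mem_support_map_iff] at hr
    obtain ⟨a, _, s, hs, rfl⟩ := hr
    have := iterate_size _ _ s hs
    dsimp only; omega
  | rand =>
    intro r hr
    simp only [run, PMF.mem_support_map_iff] at hr
    obtain ⟨a, _, rfl⟩ := hr
    dsimp only; omega
  | oracle =>
    intro r hr
    simp only [run, PMF.mem_support_map_iff] at hr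
    obtain ⟨a, _, rfl⟩ := hr
    dsimp only; omega

/-- The hypothesis `h` is the induction hypothesis of `run_congr` for the body of a loop. Since
every distribution has nonempty support, each partial run extends to a complete one, so that a bound
for complete runs also bounds every single round. -/
theorem iterate_congr {f g : Data → PMF (Data × ℕ)} {N : ℕ}
    (h : ∀ x, (∀ r ∈ (f x).support, r.2 ≤ N) → f x = g x) (k : ℕ) (x : Data)
    (hN : ∀ r ∈ (iterate f k x).support, r.2 ≤ N) : iterate f k x = iterate g k x := by
  induction k generalizing x with
  | zero => rfl
  | succ k ih =>
    simp only [iterate, PMF.mem_support_bind_iff, PMF.mem_support_map_iff] at hN ⊢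
    have h1 : f x = g x := by
      apply h
      intro r hr
      obtain ⟨s, hs⟩ := (iterate f k r.1).support_nonempty
      have := hN _ ⟨r, hr, s, hs, rfl⟩
      dsimp only at this; omega
    rw [← h1]
    refine PMF.ext fun y => ?_
    simp only [PMF.bind_apply]
    refine tsum_congr fun r => ?_
    by_cases hr : r ∈ (f x).support
    · rw [ih]
      intro s hs
      have := hN _ ⟨r, hr, s, hs, rfl⟩
      dsimp only at this; omega
    · rw [PMF.mem_support_iff, not_not] at hr; simp [hr]

/-- Used to rewrite under a draw while remembering that the value drawn is possible, e.g. that `pp`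
comes from the setup or that a choice is valid. -/
theorem _root_.Eunomia.bind_congr {α β : Type} {p : PMF α} {f g : α → PMF β}
    (h : ∀ a ∈ p.support, f a = g a) : p.bind f = p.bind g := by
  refine PMF.ext fun y => ?_
  simp only [PMF.bind_apply]
  refine tsum_congr fun r => ?_
  by_cases hr : r ∈ p.support
  · rw [h r hr]
  · rw [PMF.mem_support_iff, not_not] at hr; simp [hr]

/-- A program cannot see a change of the oracle on queries that are longer than its running time. -/
theorem run_congr {N : ℕ} (hO : ∀ y : Data, y.size ≤ N → O y = O' y) (A : Prog) (x : Data)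
    (hN : ∀ r ∈ (A.run O x).support, r.2 ≤ N) : A.run O x = A.run O' x := by
  induction A generalizing x with
  | prim p => rfl
  | comp f g ihf ihg =>
    simp only [run, PMF.mem_support_bind_iff, PMF.mem_support_map_iff] at hN ⊢
    rw [← ihf x]
    · refine bind_congr fun r hr => ?_
      rw [ihg]
      intro s hs
      have := hN _ ⟨r, hr, s, hs, rfl⟩
      dsimp only at this; omega
    · intro r hr
      obtain ⟨s, hs⟩ := (g.run O r.1).support_nonempty
      have := hN _ ⟨r, hr, s, hs, rfl⟩
      dsimp only at this; omega
  | pair f g ihf ihg =>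
    simp only [run, PMF.mem_support_bind_iff, PMF.mem_support_map_iff] at hN ⊢
    rw [← ihf x]
    · refine bind_congr fun r hr => ?_
      rw [ihg]
      intro s hs
      have := hN _ ⟨r, hr, s, hs, rfl⟩
      dsimp only at this; omega
    · intro r hr
      obtain ⟨s, hs⟩ := (g.run O x).support_nonempty
      have := hN _ ⟨r, hr, s, hs, rfl⟩
      dsimp only at this; omega
  | ite c f g ihc ihf ihg =>
    simp only [run, PMF.mem_support_bind_iff, PMF.mem_support_map_iff] at hN ⊢
    rw [← ihc x]
    · refine bind_congr fun r hr => ?_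
      congr 1
      split_ifs with hb
      · rw [ihf]
        intro s hs
        have := hN _ ⟨r, hr, s, by rw [if_pos hb]; exact hs, rfl⟩
        dsimp only at this; omega
      · rw [ihg]
        intro s hs
        have := hN _ ⟨r, hr, s, by rw [if_neg hb]; exact hs, rfl⟩
        dsimp only at this; omega
    · intro r hr
      obtain ⟨s, hs⟩ := (if r.1.toBool then f.run O x else g.run O x).support_nonempty
      have := hN _ ⟨r, hr, s, hs, rfl⟩
      dsimp only at this; omega
  | loop n f ihn ihf =>
    simp only [run, PMF.mem_support_bind_iff, PMF.mem_support_map_iff] at hN ⊢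
    rw [← ihn x]
    · refine bind_congr fun r hr => ?_
      rw [iterate_congr ihf]
      intro s hs
      have := hN _ ⟨r, hr, s, hs, rfl⟩
      dsimp only at this; omega
    · intro r hr
      obtain ⟨s, hs⟩ := (iterate (f.run O) r.1.toNat x).support_nonempty
      have := hN _ ⟨r, hr, s, hs, rfl⟩
      dsimp only at this; omega
  | rand => rfl
  | oracle =>
    simp only [run, PMF.mem_support_map_iff] at hN ⊢
    -- The query is a component of the input, and the length of the input is part of the cost; so a
    -- query longer than `N` cannot be paid for.
    rw [hO]
    obtain ⟨s, hs⟩ := (O x.snd).support_nonempty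
    have := hN _ ⟨s, hs, rfl⟩
    have := x.snd_size
    dsimp only at *; omega

/-- This is why random functions need to be drawn only on data up to a polynomial length. -/
theorem RunsInTime.execWith_congr {A : Prog} {t : Polynomial ℕ} (hA : A.RunsInTime t) (x : Data)
    (hO : ∀ y : Data, y.size ≤ t.eval x.size → O y = O' y) : A.execWith O x = A.execWith O' x := by
  rw [execWith, execWith, run_congr hO A x (hA O x)]

theorem RunsInTime.size_le {A : Prog} {t : Polynomial ℕ} (hA : A.RunsInTime t) (x : Data) :
    ∀ y ∈ (A.execWith O x).support, y.size ≤ t.eval x.size := by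
  intro y hy
  simp only [execWith, PMF.mem_support_map_iff] at hy
  obtain ⟨r, hr, rfl⟩ := hy
  exact (size_le_cost A x r hr).trans (hA O x r hr)

theorem RunsInTime.mono {A : Prog} {t t' : Polynomial ℕ} (hA : A.RunsInTime t)
    (h : ∀ n, t.eval n ≤ t'.eval n) : A.RunsInTime t' :=
  fun O x r hr => (hA O x r hr).trans (h _)

/-! ### Polynomial time is closed under the program constructors -/

theorem PPT.comp {f g : Prog} (hf : f.PPT) (hg : g.PPT) : (Prog.comp f g).PPT := by
  obtain ⟨t, ht⟩ := hf
  obtain ⟨u, hu⟩ := hg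
  refine ⟨t + u.comp t + 1, fun O x r hr => ?_⟩
  simp only [run, PMF.mem_support_bind_iff, PMF.mem_support_map_iff] at hr
  obtain ⟨a, ha, s, hs, rfl⟩ := hr
  have h1 := ht O x a ha
  have h2 := (hu O a.1 s hs).trans (eval_mono u ((size_le_cost f x a ha).trans h1))
  simp only [Polynomial.eval_add, Polynomial.eval_comp, Polynomial.eval_one]
  omega

theorem PPT.pair {f g : Prog} (hf : f.PPT) (hg : g.PPT) : (Prog.pair f g).PPT := by
  obtain ⟨t, ht⟩ := hf
  obtain ⟨u, hu⟩ := hg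
  refine ⟨t + u + (t + u + 1), fun O x r hr => ?_⟩
  simp only [run, PMF.mem_support_bind_iff, PMF.mem_support_map_iff] at hr
  obtain ⟨a, ha, s, hs, rfl⟩ := hr
  have h1 := ht O x a ha
  have h2 := hu O x s hs
  have h3 := size_le_cost f x a ha
  have h4 := size_le_cost g x s hs
  simp only [Polynomial.eval_add, Polynomial.eval_one, Data.size]
  omega

theorem PPT.ite {c f g : Prog} (hc : c.PPT) (hf : f.PPT) (hg : g.PPT) : (Prog.ite c f g).PPT := by
  obtain ⟨v, hv⟩ := hc
  obtain ⟨t, ht⟩ := hf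
  obtain ⟨u, hu⟩ := hg
  refine ⟨v + t + u + 1, fun O x r hr => ?_⟩
  simp only [run, PMF.mem_support_bind_iff, PMF.mem_support_map_iff] at hr
  obtain ⟨a, ha, s, hs, rfl⟩ := hr
  have h1 := hv O x a ha
  simp only [Polynomial.eval_add, Polynomial.eval_one]
  split_ifs at hs
  · have h2 := ht O x s hs
    omega
  · have h2 := hu O x s hs
    omega

theorem PPT.prim_of_size {p : Prim} {u : Polynomial ℕ}
    (h : ∀ x : Data, (p.eval x).size ≤ u.eval x.size) :
    (Prog.prim p).PPT := by
  refine ⟨1 + .X + u, fun O x r hr => ?_⟩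
  simp only [run, PMF.mem_support_pure_iff] at hr
  subst hr
  have := h x
  simp only [Polynomial.eval_add, Polynomial.eval_one, Polynomial.eval_X]
  omega

theorem size_bit (c : Prop) [Decidable c] : (Data.int (if c then 1 else 0)).size ≤ 2 := by
  split_ifs <;> simp [Data.size]

theorem natAbs_add_size (a b : ℤ) : (a + b).natAbs.size ≤ a.natAbs.size + b.natAbs.size + 1 := by
  rw [Nat.size_le]
  have ha := Nat.lt_size_self a.natAbs
  have hb := Nat.lt_size_self b.natAbs
  have h := Int.natAbs_add_le a b
  have h1 : 2 ^ a.natAbs.size ≤ 2 ^ (a.natAbs.size + b.natAbs.size) :=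
    Nat.pow_le_pow_right (by norm_num) (by omega)
  have h2 : 2 ^ b.natAbs.size ≤ 2 ^ (a.natAbs.size + b.natAbs.size) :=
    Nat.pow_le_pow_right (by norm_num) (by omega)
  rw [pow_succ]
  omega

theorem natAbs_mul_size (a b : ℤ) : (a * b).natAbs.size ≤ a.natAbs.size + b.natAbs.size := by
  rw [Nat.size_le, Int.natAbs_mul, pow_add]
  exact Nat.mul_lt_mul'' (Nat.lt_size_self _) (Nat.lt_size_self _)

theorem natAbs_div_size (a b : ℤ) : (a / b).natAbs.size ≤ a.natAbs.size := by
  exact Nat.size_le_size (Int.natAbs_ediv_le_natAbs a b)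

theorem natAbs_mod_size (a b : ℤ) : (a % b).natAbs.size ≤ a.natAbs.size + b.natAbs.size := by
  rcases eq_or_ne b 0 with rfl | hb
  · simp
  · refine le_trans (Nat.size_le_size (m := (a % b).natAbs) (n := b.natAbs) ?_) (by omega)
    have h1 := Int.emod_nonneg a hb
    have h2 := Int.emod_lt_abs a hb
    rw [Int.abs_eq_natAbs] at h2
    omega

theorem PPT.prim (p : Prim) : (Prog.prim p).PPT := by
  have key : ∀ x : Data, x.fst.toInt.natAbs.size + x.snd.toInt.natAbs.size + 2 ≤ 2 * x.size := by
    intro x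
    have := x.fst.toInt_size
    have := x.snd.toInt_size
    have := x.fst_size
    have := x.snd_size
    omega
  cases p with
  | id => exact PPT.prim_of_size (u := .X) (by simp [Prim.eval])
  | const d => exact PPT.prim_of_size (u := .C d.size) (by simp [Prim.eval])
  | fst => exact PPT.prim_of_size (u := .X) (by simpa [Prim.eval] using Data.fst_size)
  | snd => exact PPT.prim_of_size (u := .X) (by simpa [Prim.eval] using Data.snd_size)
  | isInt => exact PPT.prim_of_size (u := .C 2) (fun x => by simpa [Prim.eval] using size_bit _)
  | eq => exact PPT.prim_of_size (u := .C 2) (fun x => by simpa [Prim.eval] using size_bit _)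
  | le => exact PPT.prim_of_size (u := .C 2) (fun x => by simpa [Prim.eval] using size_bit _)
  | add =>
    refine PPT.prim_of_size (u := .C 2 * .X + .C 2) fun x => ?_
    have := natAbs_add_size x.fst.toInt x.snd.toInt
    have := key x
    simp [Prim.eval, Data.size]; omega
  | sub =>
    refine PPT.prim_of_size (u := .C 2 * .X + .C 2) fun x => ?_
    have := natAbs_add_size x.fst.toInt (-x.snd.toInt)
    have := key x
    rw [Int.natAbs_neg, ← sub_eq_add_neg] at *
    simp [Prim.eval, Data.size]; omega
  | mul =>
    refine PPT.prim_of_size (u := .C 2 * .X + .C 2) fun x => ?_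
    have := natAbs_mul_size x.fst.toInt x.snd.toInt
    have := key x
    simp [Prim.eval, Data.size]; omega
  | div =>
    refine PPT.prim_of_size (u := .C 2 * .X + .C 2) fun x => ?_
    have := natAbs_div_size x.fst.toInt x.snd.toInt
    have := key x
    simp [Prim.eval, Data.size]; omega
  | mod =>
    refine PPT.prim_of_size (u := .C 2 * .X + .C 2) fun x => ?_
    have := natAbs_mod_size x.fst.toInt x.snd.toInt
    have := key x
    simp [Prim.eval, Data.size]; omega
  | size =>
    refine PPT.prim_of_size (u := .X + .C 1) fun x => ?_
    simpa [Prim.eval] using size_ofNat_le _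

theorem PPT.rand : Prog.rand.PPT := by
  refine ⟨.C 4 * .X + .C 4, fun O x r hr => ?_⟩
  simp only [run, PMF.mem_support_map_iff] at hr
  obtain ⟨y, hy, rfl⟩ := hr
  have h : y.size ≤ x.size + 1 := by
    have hx : x.toNat.size + 1 ≤ x.size := by
      refine le_trans ?_ x.toInt_size
      gcongr
      apply Nat.size_le_size
      simp only [Data.toNat]; omega
    generalize x.toNat = m at *
    cases m with
    | zero =>
      simp only [uniformBelow, PMF.mem_support_pure_iff] at hy
      subst hy; simp [Data.size]
    | succ m =>
      simp only [uniformBelow, PMF.mem_support_map_iff] at hy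
      obtain ⟨i, _, rfl⟩ := hy
      rw [size_ofNat]
      have := Nat.size_le_size (m := i.val) (n := m + 1) i.isLt.le
      omega
  simp; omega

theorem PPT.oracle : Prog.oracle.PPT := by
  refine ⟨.C 4 * .X + .C 4, fun O x r hr => ?_⟩
  simp only [run, PMF.mem_support_map_iff] at hr
  obtain ⟨y, hy, rfl⟩ := hr
  have := x.fst_size
  have : (if y.size ≤ x.fst.size then y else .int 0).size ≤ x.size + 1 := by
    split_ifs
    · omega
    · simp [Data.size]
  simp; omega

/-! ### Answering the queries of a program by another program -/

/-- On input `(e, z)`: the datum `z.snd`, if it is not longer than `z.fst`, and `0` otherwise. -/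
def truncate : Prog :=
  .ite (.comp (.pair (.comp (.prim .snd) (.prim .size)) (.comp (.prim .fst) (.prim .size)))
    (.prim .le)) (.prim .snd) (.prim (.const (.int 0)))

theorem truncate_ppt : truncate.PPT :=
  .ite (.comp (.pair (.comp (.prim _) (.prim _)) (.comp (.prim _) (.prim _))) (.prim _))
    (.prim _) (.prim _)

theorem toBool_bit (c : Prop) {_ : Decidable c} :
    (Data.int (if c then 1 else 0)).toBool = decide c := by
  by_cases h : c <;> simp [h, Data.toBool]

theorem truncate_exec (u z : Data) : truncate.execWith O (.pair u z) =
    PMF.pure (if z.size ≤ u.size then z else .int 0) := by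
  simp only [truncate, execWith_ite, execWith_comp, execWith_pair, execWith_prim, PMF.pure_bind,
    PMF.pure_map, Prim.eval, Data.fst_pair, Data.snd_pair, toBool_bit, Data.ofNat, Data.toInt_int,
    Nat.cast_le, decide_eq_true_eq]
  split_ifs <;> rfl

/-- The program `A` with its queries answered by the program `h`, which gets an additional input:
on `(e, x)`, run `A` on `x` and answer a query `y` by the result of `h` on `(e, y)`. -/
def subst (h : Prog) : Prog → Prog
  | .prim p => .comp (.prim .snd) (.prim p)
  | .comp f g => .comp (.pair (.prim .fst) (subst h f)) (subst h g)
  | .pair f g => .pair (subst h f) (subst h g)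
  | .ite c f g => .ite (subst h c) (subst h f) (subst h g)
  | .loop n f => .comp (.loop (subst h n) (.pair (.prim .fst) (subst h f))) (.prim .snd)
  | .rand => .comp (.prim .snd) .rand
  | .oracle => .comp (.pair (.comp (.prim .snd) (.prim .fst))
      (.comp (.pair (.prim .fst) (.comp (.prim .snd) (.prim .snd))) h)) truncate

/-- The parameter `e` travels in the first component of the loop state and is never changed. -/
theorem iterP_pair (f : Data → PMF Data) (e : Data) (k : ℕ) (x : Data) :
    (iterP (fun y => (f y).map (Data.pair y.fst)) k (.pair e x)).map Data.snd =
      iterP (fun y => f (.pair e y)) k x := by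
  induction k generalizing x with
  | zero => simp [iterP, PMF.pure_map, Data.snd]
  | succ k ih =>
    simp only [iterP, PMF.map_bind, PMF.bind_map, Function.comp_def, Data.fst_pair, ih]

theorem subst_exec (h A : Prog) (e x : Data) :
    (subst h A).execWith O (.pair e x) = A.execWith (fun y => h.execWith O (.pair e y)) x := by
  induction A generalizing x with
  | prim p => simp [subst, execWith_comp, Prim.eval]
  | comp f g ihf ihg =>
    simp [subst, execWith_comp, execWith_pair, Prim.eval, ihf, ihg, PMF.bind_map,
      Function.comp_def]
  | pair f g ihf ihg => simp [subst, execWith_pair, ihf, ihg]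
  | ite c f g ihc ihf ihg => simp [subst, execWith_ite, ihc, ihf, ihg]
  | loop n f ihn ihf =>
    have h1 : (Prog.pair (.prim .fst) (subst h f)).execWith O =
        fun y => ((subst h f).execWith O y).map (Data.pair y.fst) := by
      funext y; simp [execWith_pair, Prim.eval]
    have h2 : (Prog.prim .snd).execWith O = PMF.pure ∘ Data.snd := by
      funext y; simp [Prim.eval]
    simp only [subst, execWith_comp, execWith_loop, ihn, h1, h2, PMF.bind_pure_comp, PMF.map_bind]
    congr 1; funext a
    have := iterP_pair ((subst h f).execWith O) e a.toNat x
    simp only [ihf] at this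
    exact this
  | rand => simp [subst, execWith_comp, Prim.eval]; rfl
  | oracle =>
    simp only [subst, execWith_comp, execWith_pair, execWith_prim, Prim.eval, Data.fst_pair,
      Data.snd_pair, PMF.pure_bind, PMF.pure_map, PMF.bind_map, Function.comp_def, execWith_oracle, truncate_exec]
    exact PMF.bind_pure_comp _ _

/-- The input of a program is not longer than its running time. -/
theorem input_le_cost (A : Prog) (x : Data) : ∀ r ∈ (A.run O x).support, x.size ≤ r.2 := by
  induction A generalizing x with
  | prim p => simp [run]; omega
  | comp f g ihf _ | pair f g ihf _ | ite f _ _ ihf _ _ | loop f _ ihf _ =>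
    intro r hr
    simp only [run, PMF.mem_support_bind_iff, PMF.mem_support_map_iff] at hr
    obtain ⟨a, ha, s, hs, rfl⟩ := hr
    have := ihf _ a ha
    dsimp only; omega
  | rand | oracle =>
    intro r hr
    simp only [run, PMF.mem_support_map_iff] at hr
    obtain ⟨a, _, rfl⟩ := hr
    dsimp only; omega

/-- An amortised count: a step of the original loop is charged `K` in the new one. Inputs and
outputs of a round are at most its cost, hence at most `N`, so copying `e` and the states costs less
than `K`; it is paid by the `+ 1` which `iterate` adds per round. -/
theorem iterate_subst_cost {F f : Data → PMF (Data × ℕ)} {e : Data} {N K : ℕ}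
    (hK : 3 * e.size + 2 * N + 10 ≤ K)
    (hin : ∀ x, ∀ r ∈ (f x).support, x.size ≤ r.2)
    (hout : ∀ x, ∀ r ∈ (f x).support, r.1.size ≤ r.2)
    (h : ∀ x, ∀ r ∈ (F (.pair e x)).support, ∃ y c, r.1 = .pair e y ∧ (y, c) ∈ (f x).support ∧
      (c ≤ N → r.2 ≤ c * K + 3 * e.size + x.size + y.size + 3)) (k : ℕ) (x : Data) :
    ∀ r ∈ (iterate F k (.pair e x)).support, ∃ y c, r.1 = .pair e y ∧
      (y, c) ∈ (iterate f k x).support ∧ (c ≤ N → r.2 ≤ c * K) := by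
  induction k generalizing x with
  | zero =>
    simp only [iterate, PMF.mem_support_pure_iff]
    rintro r rfl
    refine ⟨x, _, rfl, rfl, fun _ => ?_⟩
    simp only [Data.size]
    nlinarith
  | succ k ih =>
    intro r hr
    simp only [iterate, PMF.mem_support_bind_iff, PMF.mem_support_map_iff] at hr ⊢
    obtain ⟨a, ha, s, hs, rfl⟩ := hr
    obtain ⟨y, c, hy, hc, hcost⟩ := h x a ha
    rw [hy] at hs
    obtain ⟨z, d, hz, hd, hcost'⟩ := ih y s hs
    refine ⟨z, c + d + 1, hz, ⟨_, hc, _, hd, rfl⟩, fun hN => ?_⟩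
    have h1 := hcost (by omega)
    have h2 := hcost' (by omega)
    have h3 := hin _ _ hc
    have h4 := hout _ _ hc
    dsimp only at *
    rw [add_mul, add_mul]
    omega

/-- Every run of the substituted program shadows a run of `A` with oracle `h(e, ·)` of some cost
`c`, and each unit of `c` pays at most `K`. The number `K` covers copies of `e` and of data of size
at most `N`, a call of `h` on an input of size at most `|e| + N + 1`, and the truncation of its
answer. The restriction `c ≤ N` is what bounds those sizes. -/
theorem subst_cost (h A : Prog) {t u : Polynomial ℕ} (ht : h.RunsInTime t)
    (hu : truncate.RunsInTime u) (e : Data) (N K : ℕ)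
    (hK : 10 * (e.size + 3) + 20 * N + 2 * t.eval (e.size + N + 1) +
      u.eval (N + t.eval (e.size + N + 1) + 1) ≤ K) (x : Data) :
    ∀ r ∈ ((subst h A).run O (.pair e x)).support,
      ∃ c, (r.1, c) ∈ (A.run (fun y => h.execWith O (.pair e y)) x).support ∧
        (c ≤ N → r.2 ≤ c * K) := by
  have hcK : ∀ c, 1 ≤ c → e.size + 10 * c ≤ c * K := fun c hc => by nlinarith
  induction A generalizing x with
  | prim p =>
    intro r hr
    simp only [subst, run, PMF.mem_support_bind_iff, PMF.mem_support_map_iff,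
      PMF.mem_support_pure_iff] at hr ⊢
    obtain ⟨_, rfl, _, rfl, rfl⟩ := hr
    refine ⟨_, rfl, fun _ => ?_⟩
    have := hcK (1 + x.size + (p.eval x).size) (by omega)
    have h1 : Prim.snd.eval (e.pair x) = x := rfl
    simp only [h1, Data.size]
    omega
  | comp f g ihf ihg =>
    intro r hr
    simp only [subst, run, PMF.mem_support_bind_iff, PMF.mem_support_map_iff,
      PMF.mem_support_pure_iff] at hr ⊢
    obtain ⟨a, ⟨_, rfl, b, hb, rfl⟩, s, hs, rfl⟩ := hr
    obtain ⟨c, hc, hcost⟩ := ihf x b hb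
    obtain ⟨d, hd, hcost'⟩ := ihg _ s hs
    refine ⟨c + d + 1, ⟨_, hc, _, hd, rfl⟩, fun hN => ?_⟩
    have h1 := hcost (by omega)
    have h2 := hcost' (by omega)
    have h3 := input_le_cost _ _ _ hc
    have h4 := size_le_cost _ _ _ hc
    simp only [Prim.eval, Data.fst_pair, Data.size] at *
    rw [add_mul, add_mul]
    omega
  | pair f g ihf ihg =>
    intro r hr
    simp only [subst, run, PMF.mem_support_bind_iff, PMF.mem_support_map_iff] at hr ⊢
    obtain ⟨a, ha, s, hs, rfl⟩ := hr
    obtain ⟨c, hc, hcost⟩ := ihf x a ha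
    obtain ⟨d, hd, hcost'⟩ := ihg _ s hs
    refine ⟨_, ⟨_, hc, _, hd, rfl⟩, fun hN => ?_⟩
    dsimp only at *
    have h1 := hcost (by omega)
    have h2 := hcost' (by omega)
    have h3 := hcK _ (Data.size_pos (.pair a.1 s.1))
    rw [add_mul, add_mul]
    omega
  | ite q f g ihq ihf ihg =>
    intro r hr
    simp only [subst, run, PMF.mem_support_bind_iff, PMF.mem_support_map_iff] at hr ⊢
    obtain ⟨a, ha, s, hs, rfl⟩ := hr
    obtain ⟨c, hc, hcost⟩ := ihq x a ha
    have : ∃ d, (s.1, d) ∈ (if a.1.toBool then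
        f.run (fun y => h.execWith O (.pair e y)) x
        else g.run (fun y => h.execWith O (.pair e y)) x).support ∧ (d ≤ N → s.2 ≤ d * K) := by
      split_ifs at hs ⊢
      exacts [ihf _ s hs, ihg _ s hs]
    obtain ⟨d, hd, hcost'⟩ := this
    refine ⟨_, ⟨_, hc, _, hd, rfl⟩, fun hN => ?_⟩
    dsimp only at *
    have h1 := hcost (by omega)
    have h2 := hcost' (by omega)
    rw [add_mul, add_mul]
    omega
  | loop n f ihn ihf =>
    intro r hr
    simp only [subst, run, PMF.mem_support_bind_iff, PMF.mem_support_map_iff,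
      PMF.mem_support_pure_iff] at hr ⊢
    obtain ⟨_, ⟨a, ha, s, hs, rfl⟩, _, rfl, rfl⟩ := hr
    obtain ⟨c, hc, hcost⟩ := ihn x a ha
    have := iterate_subst_cost (F := run O (.pair (.prim .fst) (subst h f)))
      (f := f.run (fun y => h.execWith O (.pair e y))) (e := e) (N := N) (K := K) (by omega)
      (input_le_cost f) (size_le_cost f) (fun x r hr => by
        simp only [run, PMF.mem_support_bind_iff, PMF.mem_support_map_iff,
          PMF.mem_support_pure_iff] at hr
        obtain ⟨_, rfl, b, hb, rfl⟩ := hr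
        obtain ⟨c, hc, hcost⟩ := ihf x b hb
        refine ⟨b.1, c, rfl, hc, fun hN => ?_⟩
        have h1 := hcost hN
        simp only [Prim.eval, Data.fst_pair, Data.size] at *
        omega) a.1.toNat x s hs
    obtain ⟨y, d, hy, hd, hcost'⟩ := this
    refine ⟨c + d + 1, ⟨_, hc, _, hd, ?_⟩, fun hN => ?_⟩
    · simp only [Prim.eval, hy, Data.snd_pair]
    · dsimp only at *
      have h1 := hcost (by omega)
      have h2 := hcost' (by omega)
      have h3 := iterate_size _ _ _ hd
      simp only [Prim.eval, hy, Data.snd_pair, Data.size]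
      dsimp only at h3
      rw [add_mul, add_mul]
      omega
  | rand =>
    intro r hr
    simp only [subst, run, PMF.mem_support_bind_iff, PMF.mem_support_map_iff,
      PMF.mem_support_pure_iff] at hr ⊢
    obtain ⟨_, rfl, _, ⟨y, hy, rfl⟩, rfl⟩ := hr
    refine ⟨_, ⟨y, hy, rfl⟩, fun _ => ?_⟩
    have := hcK (1 + x.size + y.size) (by omega)
    simp only [Prim.eval, Data.snd_pair, Data.size]
    omega
  | oracle =>
    intro r hr
    simp only [subst, run, PMF.mem_support_bind_iff, PMF.mem_support_map_iff,
      PMF.mem_support_pure_iff] at hr ⊢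
    obtain ⟨_, ⟨_, ⟨_, rfl, _, rfl, rfl⟩, _, ⟨_, ⟨_, rfl, _, ⟨_, rfl, _, rfl, rfl⟩, rfl⟩, z, hz,
      rfl⟩, rfl⟩, w, hw, rfl⟩ := hr
    simp only [Prim.eval, Data.fst_pair, Data.snd_pair] at hz hw ⊢
    -- The truncation reproduces the rule by which the instruction `oracle` reads answers, so the
    -- shadow run of `A` exists.
    have hw1 : w.1 = if z.1.size ≤ x.fst.size then z.1 else .int 0 := by
      have : w.1 ∈ (truncate.execWith O (.pair x.fst z.1)).support :=
        (PMF.mem_support_map_iff _ _ _).2 ⟨w, hw, rfl⟩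
      rwa [truncate_exec, PMF.mem_support_pure_iff] at this
    refine ⟨_, ⟨z.1, (PMF.mem_support_map_iff _ _ _).2 ⟨z, hz, rfl⟩, by rw [hw1]⟩, fun hN => ?_⟩
    have h1 := ht _ _ _ hz
    have h2 := size_le_cost _ _ _ hz
    have h3 := hu _ _ _ hw
    have h4 := x.fst_size
    have h5 := x.snd_size
    have h6 := h1.trans (eval_mono t (b := e.size + N + 1) (by simp only [Data.size]; omega))
    have h7 := h3.trans (eval_mono u (b := N + t.eval (e.size + N + 1) + 1)
      (by simp only [Data.size]; omega))
    -- An oracle call has cost at least 1 in `A`, and a single `K` already pays for everything.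
    refine le_trans ?_ (Nat.le_mul_of_pos_left K (by omega))
    simp only [Data.size] at *
    omega

/-- The count of `subst_cost` concerns inputs `(e, x)` only, while polynomial time is demanded on
all inputs. Hence the test with `isInt`: integers are returned at once. For a pair, `N` is the time
bound of `A` at the size of the whole pair. -/
theorem PPT.subst {h A : Prog} (hh : h.PPT) (hA : A.PPT) :
    ∃ B : Prog, B.PPT ∧ ∀ (O : Data → PMF Data) (e x : Data),
      B.execWith O (.pair e x) = A.execWith (fun y => h.execWith O (.pair e y)) x := by
  obtain ⟨t, ht⟩ := hh
  obtain ⟨u, hu⟩ := truncate_ppt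
  obtain ⟨v, hv⟩ := hA
  refine ⟨.ite (.prim .isInt) (.prim .id) (Prog.subst h A), ?_, fun O e x => ?_⟩
  · let w : Polynomial ℕ := t.comp (.X + v + 1)
    refine ⟨v * (10 * (.X + 3) + 20 * v + 2 * w + u.comp (v + w + 1)) + (6 * .X + 10),
      fun O x r hr => ?_⟩
    simp only [run, PMF.mem_support_bind_iff, PMF.mem_support_map_iff,
      PMF.mem_support_pure_iff] at hr
    obtain ⟨_, rfl, s, hs, rfl⟩ := hr
    simp only [Polynomial.eval_add, Polynomial.eval_mul, Polynomial.eval_comp, w,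
      Polynomial.eval_one, Polynomial.eval_X, Polynomial.eval_ofNat]
    have hb := size_bit (x.isInt = true)
    cases x with
    | int n =>
      simp only [Prim.eval, Data.isInt, Data.toBool, if_true, PMF.mem_support_pure_iff,
        ne_eq, Data.int.injEq, one_ne_zero, not_false_eq_true, decide_true] at hs
      subst hs
      simp only [Prim.eval, Data.isInt, if_true, Data.size]
      have : (1 : ℤ).natAbs.size = 1 := by simp
      rw [this]
      generalize n.natAbs.size = m
      have := Nat.zero_le (Polynomial.eval (m + 1) v *
        (10 * (m + 1 + 3) + 20 * Polynomial.eval (m + 1) v +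
            2 * Polynomial.eval (m + 1 + Polynomial.eval (m + 1) v + 1) t +
          Polynomial.eval
            (Polynomial.eval (m + 1) v + Polynomial.eval (m + 1 + Polynomial.eval (m + 1) v + 1) t + 1) u))
      omega
    | pair e y =>
      simp only [Prim.eval, Data.isInt, Data.toBool, if_false, Bool.false_eq_true,
        ne_eq, not_true_eq_false, decide_false] at hs
      set z := (Data.pair e y).size with hz
      have hz' : z = e.size + y.size + 1 := rfl
      obtain ⟨c, hc, hcost⟩ := subst_cost h A ht hu e (v.eval z) _ le_rfl y s hs
      have hcv := (hv _ _ _ hc).trans (eval_mono v (show y.size ≤ z by omega))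
      have h1 := hcost hcv
      have h2 := eval_mono t (show e.size + v.eval z + 1 ≤ z + v.eval z + 1 by omega)
      have h3 := eval_mono u (show v.eval z + t.eval (e.size + v.eval z + 1) + 1 ≤
        v.eval z + t.eval (z + v.eval z + 1) + 1 by omega)
      have h4 := h1.trans (Nat.mul_le_mul hcv (show _ ≤ 10 * (z + 3) + 20 * v.eval z +
        2 * t.eval (z + v.eval z + 1) + u.eval (v.eval z + t.eval (z + v.eval z + 1) + 1) by omega))
      simp only [Prim.eval] at *
      omega
  · simp [execWith_ite, Prim.eval, Data.isInt, Data.toBool, subst_exec]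

end Prog
end Eunomia
namespace Eunomia

/-! ## Polynomial-time functions on encoded types -/

theorem Prog.fst_of_execWith_eq_pure {O : Data → PMF Data} {A : Prog} {x y : Data}
    (h : A.execWith O x = PMF.pure y) : ∀ r ∈ (A.run O x).support, r.1 = y := by
  intro r hr
  have : r.1 ∈ (A.execWith O x).support := (PMF.mem_support_map_iff _ _ _).2 ⟨r, hr, rfl⟩
  rwa [h, PMF.mem_support_pure_iff] at this

/-! ### Loops with enforced bounds -/

namespace Prog

variable {O : Data → PMF Data}

/-- On input `(B, s)`: the datum `s` if its size is at most `B`, and `0` otherwise. -/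
def clamp : Prog :=
  .ite (.comp (.pair (.comp (.prim .snd) (.prim .size)) (.prim .fst)) (.prim .le)) (.prim .snd)
    (.prim (.const (.int 0)))

theorem clamp_ppt : clamp.PPT :=
  .ite (.comp (.pair (.comp (.prim _) (.prim _)) (.prim _)) (.prim _)) (.prim _) (.prim _)

theorem clamp_exec (B : ℕ) (s : Data) : clamp.execWith O (.pair (.ofNat B) s) =
    PMF.pure (if s.size ≤ B then s else .int 0) := by
  simp only [clamp, execWith_ite, execWith_comp, execWith_pair, execWith_prim, PMF.pure_bind,
    PMF.pure_map, Prim.eval, Data.fst_pair, Data.snd_pair, toBool_bit, Data.ofNat, Data.toInt_int,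
    Nat.cast_le, decide_eq_true_eq]
  split_ifs <;> rfl

/-- The smaller of the two numbers of the first component of the input. -/
def loopCount : Prog :=
  .comp (.prim .fst) (.ite (.comp (.pair (.prim .snd) (.prim .fst)) (.prim .le)) (.prim .snd)
    (.prim .fst))

theorem loopCount_ppt : loopCount.PPT :=
  .comp (.prim _) (.ite (.comp (.pair (.prim _) (.prim _)) (.prim _)) (.prim _) (.prim _))

theorem loopCount_exec (B n s : Data) : loopCount.execWith O (.pair (.pair B n) s) =
    PMF.pure (if n.toInt ≤ B.toInt then n else B) := by
  simp only [loopCount, execWith_ite, execWith_comp, execWith_pair, execWith_prim, PMF.pure_bind,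
    PMF.pure_map, Prim.eval, Data.fst_pair, Data.snd_pair]
  by_cases h : n.toInt ≤ B.toInt <;> simp [h, Data.toBool]

/-- The state is `((B, n), s)`. The bound `B` and the count `n` are carried along so that `s` can be
clamped to `B` after each round. -/
def loopBody (body : Prog) : Prog :=
  .pair (.prim .fst) (.comp (.pair (.comp (.prim .fst) (.prim .fst)) (.comp (.prim .snd) body))
    clamp)

theorem loopBody_ppt {body : Prog} (h : body.PPT) : (loopBody body).PPT :=
  .pair (.prim _) (.comp (.pair (.comp (.prim _) (.prim _)) (.comp (.prim _) h)) clamp_ppt)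

theorem loopBody_exec (body : Prog) (B : ℕ) (n s : Data) :
    (loopBody body).execWith O (.pair (.pair (.ofNat B) n) s) = (body.execWith O s).map fun s' =>
      .pair (.pair (.ofNat B) n) (if s'.size ≤ B then s' else .int 0) := by
  simp only [loopBody, execWith_comp, execWith_pair, execWith_prim, PMF.pure_bind,
    Prim.eval, Data.fst_pair, Data.snd_pair, Function.comp_def,
    clamp_exec, ← PMF.bind_pure_comp, PMF.bind_bind]

/-- A loop that is stopped by force: the number of rounds and the size of the state are cut down to
the number computed by `bnd`. -/
def boundedLoop (bnd cnt body : Prog) : Prog :=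
  .comp (.pair (.pair bnd cnt) (.prim .id)) (.comp (.loop loopCount (loopBody body)) (.prim .snd))

theorem iterate_cost {f : Data → PMF (Data × ℕ)} {P : Data → Prop} {c S : ℕ}
    (hP : ∀ s, P s → ∀ r ∈ (f s).support, P r.1 ∧ r.2 ≤ c) (hS : ∀ s, P s → s.size ≤ S)
    (k : ℕ) (s : Data) (hs : P s) :
    ∀ r ∈ (iterate f k s).support, P r.1 ∧ r.2 ≤ k * (c + 1) + (1 + S) := by
  induction k generalizing s with
  | zero =>
    simp only [iterate, PMF.mem_support_pure_iff]
    rintro r rfl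
    refine ⟨hs, ?_⟩
    have := hS s hs
    dsimp only; omega
  | succ k ih =>
    intro r hr
    simp only [iterate, PMF.mem_support_bind_iff, PMF.mem_support_map_iff] at hr
    obtain ⟨a, ha, b, hb, rfl⟩ := hr
    obtain ⟨h1, h2⟩ := hP s hs a ha
    obtain ⟨h3, h4⟩ := ih _ h1 b hb
    refine ⟨h3, ?_⟩
    rw [add_mul]
    dsimp only; omega

/-- A loop leaves polynomial time by too many rounds or by a growing state; here both are cut to
`p(|x|)`, whatever `body` and the oracle do. The bound must be computed by `bnd` for every oracle
and every input, since `PPT` quantifies over all of them. -/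
theorem PPT.boundedLoop {bnd cnt body : Prog} (hbnd : bnd.PPT) (hcnt : cnt.PPT) (hbody : body.PPT)
    {p : Polynomial ℕ} (hp : ∀ O x, bnd.execWith O x = PMF.pure (.ofNat (p.eval x.size))) :
    (boundedLoop bnd cnt body).PPT := by
  obtain ⟨t, ht⟩ := (hbnd.pair hcnt).pair (.prim .id)
  obtain ⟨u, hu⟩ := loopCount_ppt
  obtain ⟨v, hv⟩ := loopBody_ppt hbody
  -- A bound for the states `((B, n), s)`: the pair `(B, n)` is part of an output of the
  -- preparation, hence has size at most `t`, and a clamped `s` has size at most `p + 1`.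
  let S : Polynomial ℕ := t + p + .X + 2
  refine ⟨t + (u.comp S + (p * (v.comp S + 1) + (1 + S)) + 1 + (1 + S + S) + 1) + 1,
    fun O x r hr => ?_⟩
  simp only [Prog.boundedLoop, Prog.run.eq_2, Prog.run.eq_5, Prog.run.eq_1,
    PMF.mem_support_bind_iff, PMF.mem_support_map_iff, PMF.mem_support_pure_iff] at hr
  obtain ⟨a, ha, _, ⟨_, ⟨b, hb, s, hs, rfl⟩, _, rfl, rfl⟩, rfl⟩ := hr
  have ha1 := ht _ _ _ ha
  have ha2 := size_le_cost _ _ _ ha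
  have ha3 : ∃ n, a.1 = .pair (.pair (.ofNat (p.eval x.size)) n) x := by
    simp only [run.eq_3, run.eq_1, PMF.mem_support_bind_iff, PMF.mem_support_map_iff,
      PMF.mem_support_pure_iff] at ha
    obtain ⟨_, ⟨c, hc, n, _, rfl⟩, _, rfl, rfl⟩ := ha
    refine ⟨n.1, ?_⟩
    dsimp only
    rw [fst_of_execWith_eq_pure (hp O x) c hc]
    rfl
  obtain ⟨n, hn⟩ := ha3
  generalize hN : x.size = N at *
  have hSN : S.eval N = t.eval N + p.eval N + N + 2 := by simp [S]
  have hb1 := hu _ _ _ hb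
  have hbk : b.1.toNat ≤ p.eval N := by
    rw [hn] at hb
    rw [fst_of_execWith_eq_pure (loopCount_exec _ _ _) b hb]
    split_ifs with h
    · simp only [Data.ofNat, Data.toInt_int] at h
      simp only [Data.toNat]; omega
    · simp [Data.toNat, Data.ofNat]
  have ha4 := ha2.trans ha1
  have hcost := iterate_cost (f := (loopBody body).run O) (c := v.eval (S.eval N)) (S := S.eval N)
    (P := fun s => ∃ s', s = .pair (.pair (.ofNat (p.eval N)) n) s' ∧ s.size ≤ S.eval N) (by
      rintro s ⟨s', rfl, hs'⟩ r hr
      have h1 := (hv _ _ _ hr).trans (eval_mono v hs')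
      have h2 : r.1 ∈ ((loopBody body).execWith O
          (.pair (.pair (.ofNat (p.eval N)) n) s')).support :=
        (PMF.mem_support_map_iff _ _ _).2 ⟨r, hr, rfl⟩
      rw [loopBody_exec, PMF.mem_support_map_iff] at h2
      obtain ⟨z, hz, hzr⟩ := h2
      refine ⟨⟨_, hzr.symm, ?_⟩, h1⟩
      rw [← hzr, hSN]
      have : (if z.size ≤ p.eval N then z else .int 0).size ≤ p.eval N + 1 := by
        split_ifs
        · omega
        · simp [Data.size]
      rw [hn] at ha4
      simp only [Data.size] at ha4 ⊢
      omega) (by rintro s ⟨s', -, h⟩; exact h) b.1.toNat a.1 ⟨x, hn, by omega⟩ s hs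
  obtain ⟨⟨s', hs1, hs2⟩, hs3⟩ := hcost
  have h3 := hb1.trans (eval_mono u (show a.1.size ≤ S.eval N by omega))
  have h4 := Nat.mul_le_mul_right (v.eval (S.eval N) + 1) hbk
  have h5 := s.1.snd_size
  have h6 : ∀ y, Prim.snd.eval y = y.snd := fun _ => rfl
  simp only [Polynomial.eval_add, Polynomial.eval_mul, Polynomial.eval_one,
    Polynomial.eval_comp, h6]
  omega

theorem iterP_loopBody {body : Prog} {B : ℕ} {n : Data} (k : ℕ) (s : Data)
    (h : ∀ j ≤ k, ∀ s' ∈ (iterP (body.execWith O) j s).support, s'.size ≤ B) :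
    iterP ((loopBody body).execWith O) k (.pair (.pair (.ofNat B) n) s) =
      (iterP (body.execWith O) k s).map (Data.pair (.pair (.ofNat B) n)) := by
  induction k generalizing s with
  | zero => simp [iterP, PMF.pure_map]
  | succ k ih =>
    simp only [iterP, loopBody_exec, PMF.bind_map, PMF.map_bind]
    refine bind_congr fun s' hs' => ?_
    have h1 : s'.size ≤ B := h 1 (by omega) s' (by simpa [iterP] using hs')
    rw [Function.comp, if_pos h1, ih]
    intro j hj z hz
    refine h (j + 1) (by omega) z ?_
    simp only [iterP, PMF.mem_support_bind_iff]
    exact ⟨s', hs', hz⟩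

/-- If the count and all reachable states respect the bound, neither cut ever takes effect. -/
theorem boundedLoop_exec {bnd cnt body : Prog} {x : Data} {B k : ℕ}
    (hB : bnd.execWith O x = PMF.pure (.ofNat B)) (hk : cnt.execWith O x = PMF.pure (.ofNat k))
    (hkB : k ≤ B) (h : ∀ j ≤ k, ∀ s ∈ (iterP (body.execWith O) j x).support, s.size ≤ B) :
    (boundedLoop bnd cnt body).execWith O x = iterP (body.execWith O) k x := by
  have h1 : (Prog.prim .snd).execWith O = PMF.pure ∘ Data.snd := by
    funext y; simp [Prim.eval]
  have h2 : k = (Data.ofNat k).toNat := by simp [Data.ofNat, Data.toNat]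
  simp only [boundedLoop, execWith_comp, execWith_loop, h1, execWith_pair, hB, hk, PMF.pure_bind,
    PMF.pure_map, execWith_prim, Prim.eval, loopCount_exec, PMF.bind_pure_comp]
  rw [if_pos (by simpa [Data.ofNat] using hkB), ← h2, iterP_loopBody k x h, PMF.map_comp]
  exact PMF.map_id _

end Prog

/-- Types whose elements are represented by data. -/
class Enc (α : Type) where
  enc : α → Data
  enc_injective : Function.Injective enc

instance : Enc Data := ⟨id, fun _ _ h => h⟩
instance : Enc ℕ := ⟨Data.ofNat, fun a b h => by simpa [Data.ofNat] using h⟩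
instance : Enc ℤ := ⟨Data.int, fun a b h => by simpa using h⟩
instance : Enc Bool := ⟨fun b => .int (if b then 1 else 0), fun a b h => by
  cases a <;> cases b <;> simp_all⟩

open Enc

variable {α β γ σ : Type} [Enc α] [Enc β] [Enc γ] [Enc σ]

instance : Enc (α × β) := ⟨fun p => .pair (enc p.1) (enc p.2), fun a b h => by
  simp only [Data.pair.injEq] at h
  exact Prod.ext (enc_injective h.1) (enc_injective h.2)⟩

theorem ofList_injective : Function.Injective Data.ofList := by
  intro a
  induction a with
  | nil => intro b h; cases b <;> simp_all [Data.ofList]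
  | cons x a ih =>
    intro b h
    cases b with
    | nil => simp [Data.ofList] at h
    | cons y b =>
      simp only [Data.ofList, Data.pair.injEq] at h
      rw [h.1, ih h.2]

instance : Enc (List α) := ⟨fun l => .ofList (l.map enc), fun _ _ h =>
  List.map_injective_iff.2 enc_injective (ofList_injective h)⟩

@[simp] theorem enc_data (d : Data) : enc d = d := rfl
theorem enc_nat (n : ℕ) : enc n = .ofNat n := rfl
theorem enc_int (n : ℤ) : enc n = .int n := rfl
theorem enc_bool (b : Bool) : enc b = .int (if b then 1 else 0) := rfl
theorem enc_prod (p : α × β) : enc p = .pair (enc p.1) (enc p.2) := rfl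
theorem enc_nil : enc ([] : List α) = .int 0 := rfl
theorem enc_cons (a : α) (l : List α) : enc (a :: l) = .pair (enc a) (enc l) := rfl

/-- A randomized function, with access to an oracle, that is computed in polynomial time. -/
def PPTime (F : α → (Data → PMF Data) → PMF β) : Prop :=
  ∃ A : Prog, A.PPT ∧ ∀ a O, A.execWith O (enc a) = (F a O).map enc

/-- A function that is computed in polynomial time. -/
@[fun_prop] def PolyTime (f : α → β) : Prop :=
  ∃ A : Prog, A.PPT ∧ ∀ a O, A.execWith O (enc a) = PMF.pure (enc (f a))

theorem PPTime.size_le {F : α → (Data → PMF Data) → PMF β} (hF : PPTime F) :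
    ∃ p : Polynomial ℕ, ∀ a O, ∀ b ∈ (F a O).support, (enc b).size ≤ p.eval (enc a).size := by
  obtain ⟨A, ⟨t, ht⟩, hA⟩ := hF
  refine ⟨t, fun a O b hb => ?_⟩
  refine ht.size_le (O := O) (enc a) (enc b) ?_
  rw [hA]
  exact (PMF.mem_support_map_iff _ _ _).2 ⟨b, hb, rfl⟩

theorem PPTime.pure {f : α → β} (hf : PolyTime f) : PPTime fun a _ => PMF.pure (f a) := by
  obtain ⟨A, hA, h⟩ := hf
  exact ⟨A, hA, fun a O => by rw [h, PMF.pure_map]⟩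

theorem PolyTime.of_pure {f : α → β} (hf : PPTime fun a _ => PMF.pure (f a)) : PolyTime f := by
  obtain ⟨A, hA, h⟩ := hf
  exact ⟨A, hA, fun a O => by rw [h, PMF.pure_map]⟩

theorem PolyTime.size_le {f : α → β} (hf : PolyTime f) :
    ∃ p : Polynomial ℕ, ∀ a, (enc (f a)).size ≤ p.eval (enc a).size := by
  obtain ⟨p, hp⟩ := (PPTime.pure hf).size_le
  exact ⟨p, fun a => hp a (fun _ => PMF.pure (.int 0)) _ (by simp)⟩

theorem PPTime.bind {F : α → (Data → PMF Data) → PMF β} {G : α → β → (Data → PMF Data) → PMF γ}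
    (hF : PPTime F) (hG : PPTime fun p : α × β => G p.1 p.2) :
    PPTime fun a O => (F a O).bind fun b => G a b O := by
  obtain ⟨A, hA, h⟩ := hF
  obtain ⟨B, hB, h'⟩ := hG
  refine ⟨.comp (.pair (.prim .id) A) B, .comp (.pair (.prim _) hA) hB, fun a O => ?_⟩
  simp only [Prog.execWith_comp, Prog.execWith_pair, Prog.execWith_prim, PMF.pure_bind, Prim.eval,
    h, PMF.map_comp, PMF.bind_map, PMF.map_bind]
  congr 1; funext b
  exact h' (a, b) O

theorem PPTime.comp {F : β → (Data → PMF Data) → PMF γ} {f : α → β} (hF : PPTime F)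
    (hf : PolyTime f) : PPTime fun a O => F (f a) O := by
  obtain ⟨A, hA, h⟩ := hF
  obtain ⟨B, hB, h'⟩ := hf
  exact ⟨.comp B A, .comp hB hA, fun a O => by
    rw [Prog.execWith_comp, h', PMF.pure_bind, h]⟩

theorem PPTime.map {F : α → (Data → PMF Data) → PMF β} {g : α → β → γ} (hF : PPTime F)
    (hg : PolyTime fun p : α × β => g p.1 p.2) : PPTime fun a O => (F a O).map (g a) := by
  have := PPTime.bind (G := fun a b O => PMF.pure (g a b)) hF (PPTime.pure hg)
  exact this

/-- Only the represented data matter. -/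
theorem PolyTime.of_enc {f : α → β} {g : α → γ} (hf : PolyTime f) (h : ∀ a, enc (g a) = enc (f a)) :
    PolyTime g := by
  obtain ⟨A, hA, h'⟩ := hf
  exact ⟨A, hA, fun a O => by rw [h', h]⟩

namespace PolyTime

theorem of_prim (p : Prim) {f : α → β} (h : ∀ a, p.eval (enc a) = enc (f a)) : PolyTime f :=
  ⟨.prim p, .prim p, fun a O => by rw [Prog.execWith_prim, h]⟩

@[fun_prop] theorem id : PolyTime fun a : α => a := of_prim .id fun _ => rfl

@[fun_prop] theorem const (b : β) : PolyTime fun _ : α => b := of_prim (.const (enc b)) fun _ => rfl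

@[fun_prop] theorem comp {f : β → γ} {g : α → β} (hf : PolyTime f) (hg : PolyTime g) :
    PolyTime fun a => f (g a) := by
  obtain ⟨A, hA, h⟩ := hf
  obtain ⟨B, hB, h'⟩ := hg
  exact ⟨.comp B A, .comp hB hA, fun a O => by
    rw [Prog.execWith_comp, h', PMF.pure_bind, h]⟩

@[fun_prop] theorem fst {f : α → β × γ} (hf : PolyTime f) : PolyTime fun a => (f a).1 :=
  comp (of_prim .fst fun _ => rfl) hf

@[fun_prop] theorem snd {f : α → β × γ} (hf : PolyTime f) : PolyTime fun a => (f a).2 :=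
  comp (of_prim .snd fun _ => rfl) hf

@[fun_prop] theorem mk {f : α → β} {g : α → γ} (hf : PolyTime f) (hg : PolyTime g) :
    PolyTime fun a => (f a, g a) := by
  obtain ⟨A, hA, h⟩ := hf
  obtain ⟨B, hB, h'⟩ := hg
  exact ⟨.pair A B, .pair hA hB, fun a O => by
    rw [Prog.execWith_pair, h, h', PMF.pure_bind, PMF.pure_map]; rfl⟩

end PolyTime

theorem toBool_enc (b : Bool) : (enc b : Data).toBool = b := by
  cases b <;> simp [enc_bool, Data.toBool]

theorem PPTime.ite {c : α → Prop} [∀ a, Decidable (c a)] {F G : α → (Data → PMF Data) → PMF β}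
    (hc : PolyTime fun a => decide (c a)) (hF : PPTime F) (hG : PPTime G) :
    PPTime fun a O => if c a then F a O else G a O := by
  obtain ⟨A, hA, h⟩ := hF
  obtain ⟨B, hB, h'⟩ := hG
  obtain ⟨C, hC, h''⟩ := hc
  refine ⟨.ite C A B, .ite hC hA hB, fun a O => ?_⟩
  rw [Prog.execWith_ite, h'', PMF.pure_bind, toBool_enc, h, h']
  by_cases hc : c a <;> simp [hc]

namespace PolyTime

@[fun_prop] theorem ite {c : α → Prop} [∀ a, Decidable (c a)] {f g : α → β}
    (hc : PolyTime fun a => decide (c a)) (hf : PolyTime f) (hg : PolyTime g) :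
    PolyTime fun a => if c a then f a else g a := by
  refine of_pure ?_
  convert PPTime.ite hc (PPTime.pure hf) (PPTime.pure hg) using 3
  split_ifs <;> rfl

@[fun_prop] theorem eq [DecidableEq β] {f g : α → β} (hf : PolyTime f) (hg : PolyTime g) :
    PolyTime fun a => decide (f a = g a) :=
  comp (f := fun p : β × β => decide (p.1 = p.2)) (of_prim .eq fun p => by
    simp [Prim.eval, enc_prod, enc_bool, enc_injective.eq_iff]) (mk hf hg)

@[fun_prop] theorem boolEq {f : α → Bool} (hf : PolyTime f) :
    PolyTime fun a => decide (f a = true) := by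
  simpa using hf

@[fun_prop] theorem not {f : α → Bool} (hf : PolyTime f) : PolyTime fun a => !(f a) := by
  have : PolyTime fun a => if f a = true then false else true := by fun_prop
  convert this using 2 with a
  cases f a <;> rfl

@[fun_prop] theorem and {f g : α → Bool} (hf : PolyTime f) (hg : PolyTime g) :
    PolyTime fun a => (f a && g a) := by
  have : PolyTime fun a => if f a = true then g a else false := by fun_prop
  convert this using 2 with a
  cases f a <;> rfl

@[fun_prop] theorem or {f g : α → Bool} (hf : PolyTime f) (hg : PolyTime g) :
    PolyTime fun a => (f a || g a) := by
  have : PolyTime fun a => if f a = true then true else g a := by fun_prop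
  convert this using 2 with a
  cases f a <;> rfl

@[fun_prop] theorem decideNot {c : α → Prop} [∀ a, Decidable (c a)]
    (hc : PolyTime fun a => decide (c a)) : PolyTime fun a => decide (¬ c a) := by
  simp only [decide_not]; fun_prop

@[fun_prop] theorem decideAnd {c d : α → Prop} [∀ a, Decidable (c a)] [∀ a, Decidable (d a)]
    (hc : PolyTime fun a => decide (c a)) (hd : PolyTime fun a => decide (d a)) :
    PolyTime fun a => decide (c a ∧ d a) := by
  simp only [Bool.decide_and]; fun_prop

@[fun_prop] theorem decideOr {c d : α → Prop} [∀ a, Decidable (c a)] [∀ a, Decidable (d a)]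
    (hc : PolyTime fun a => decide (c a)) (hd : PolyTime fun a => decide (d a)) :
    PolyTime fun a => decide (c a ∨ d a) := by
  simp only [Bool.decide_or]; fun_prop

/-! ### Arithmetic -/

@[fun_prop] theorem intAdd {f g : α → ℤ} (hf : PolyTime f) (hg : PolyTime g) :
    PolyTime fun a => f a + g a :=
  comp (f := fun p : ℤ × ℤ => p.1 + p.2) (of_prim .add fun _ => rfl) (mk hf hg)

@[fun_prop] theorem intLe {f g : α → ℤ} (hf : PolyTime f) (hg : PolyTime g) :
    PolyTime fun a => decide (f a ≤ g a) :=
  comp (f := fun p : ℤ × ℤ => decide (p.1 ≤ p.2)) (of_prim .le fun p => by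
    by_cases h : p.1 ≤ p.2 <;> simp [Prim.eval, enc_prod, enc_bool, enc_int, h]) (mk hf hg)

@[fun_prop] theorem natAdd {f g : α → ℕ} (hf : PolyTime f) (hg : PolyTime g) :
    PolyTime fun a => f a + g a :=
  comp (f := fun p : ℕ × ℕ => p.1 + p.2) (of_prim .add fun p => by
    simp [Prim.eval, enc_prod, enc_nat, Data.ofNat]) (mk hf hg)

@[fun_prop] theorem natMul {f g : α → ℕ} (hf : PolyTime f) (hg : PolyTime g) :
    PolyTime fun a => f a * g a :=
  comp (f := fun p : ℕ × ℕ => p.1 * p.2) (of_prim .mul fun p => by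
    simp [Prim.eval, enc_prod, enc_nat, Data.ofNat]) (mk hf hg)

@[fun_prop] theorem natDiv {f g : α → ℕ} (hf : PolyTime f) (hg : PolyTime g) :
    PolyTime fun a => f a / g a :=
  comp (f := fun p : ℕ × ℕ => p.1 / p.2) (of_prim .div fun p => by
    simp [Prim.eval, enc_prod, enc_nat, Data.ofNat]) (mk hf hg)

@[fun_prop] theorem natMod {f g : α → ℕ} (hf : PolyTime f) (hg : PolyTime g) :
    PolyTime fun a => f a % g a :=
  comp (f := fun p : ℕ × ℕ => p.1 % p.2) (of_prim .mod fun p => by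
    simp [Prim.eval, enc_prod, enc_nat, Data.ofNat]) (mk hf hg)

@[fun_prop] theorem natLe {f g : α → ℕ} (hf : PolyTime f) (hg : PolyTime g) :
    PolyTime fun a => decide (f a ≤ g a) :=
  comp (f := fun p : ℕ × ℕ => decide (p.1 ≤ p.2)) (of_prim .le fun p => by
    simp [Prim.eval, enc_prod, enc_bool, enc_nat, Data.ofNat]) (mk hf hg)

@[fun_prop] theorem natLt {f g : α → ℕ} (hf : PolyTime f) (hg : PolyTime g) :
    PolyTime fun a => decide (f a < g a) := natLe (natAdd hf (const 1)) hg

@[fun_prop] theorem toInt {f : α → Data} (hf : PolyTime f) : PolyTime fun a => (f a).toInt :=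
  comp (f := fun d : Data => d.toInt)
    -- There is no instruction for `toInt`, but `add` reads its arguments through it, so adding 0
    -- has the desired effect.
    ⟨.comp (.pair (.prim .id) (.prim (.const (.int 0)))) (.prim .add),
      .comp (.pair (.prim _) (.prim _)) (.prim _), fun d O => by
      simp [Prog.execWith_comp, Prog.execWith_pair, PMF.pure_map, Prim.eval, enc_int]⟩ hf

@[fun_prop] theorem intToNat {f : α → ℤ} (hf : PolyTime f) : PolyTime fun a => (f a).toNat := by
  have : PolyTime fun a => if (0 : ℤ) ≤ f a then f a else 0 := by fun_prop
  refine of_enc this fun a => ?_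
  simp only [enc_nat, enc_int, Data.ofNat, Data.int.injEq]
  split_ifs <;> omega

@[fun_prop] theorem natSub {f g : α → ℕ} (hf : PolyTime f) (hg : PolyTime g) :
    PolyTime fun a => f a - g a := by
  have : PolyTime fun p : ℕ × ℕ => ((p.1 : ℤ) - p.2) := of_prim .sub fun p => by
    simp [Prim.eval, enc_prod, enc_nat, enc_int, Data.ofNat]
  have h := comp (intToNat this) (mk hf hg)
  convert h using 2 with a
  omega

/-! ### Data -/

@[fun_prop] theorem toNat {f : α → Data} (hf : PolyTime f) : PolyTime fun a => (f a).toNat :=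
  intToNat (toInt hf)

@[fun_prop] theorem dataFst {f : α → Data} (hf : PolyTime f) : PolyTime fun a => (f a).fst :=
  comp (f := fun d : Data => d.fst) (of_prim .fst fun _ => rfl) hf

@[fun_prop] theorem dataSnd {f : α → Data} (hf : PolyTime f) : PolyTime fun a => (f a).snd :=
  comp (f := fun d : Data => d.snd) (of_prim .snd fun _ => rfl) hf

@[fun_prop] theorem dataPair {f g : α → Data} (hf : PolyTime f) (hg : PolyTime g) :
    PolyTime fun a => Data.pair (f a) (g a) := of_enc (mk hf hg) fun _ => rfl

@[fun_prop] theorem dataIsInt {f : α → Data} (hf : PolyTime f) : PolyTime fun a => (f a).isInt :=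
  comp (f := fun d : Data => d.isInt) (of_prim .isInt fun _ => rfl) hf

@[fun_prop] theorem toBool {f : α → Data} (hf : PolyTime f) : PolyTime fun a => (f a).toBool := by
  have : PolyTime fun a => decide (¬ f a = Data.int 0) := by fun_prop
  exact this

/-- The datum that represents a value. -/
@[fun_prop] theorem enc {f : α → β} (hf : PolyTime f) : PolyTime fun a => Enc.enc (f a) :=
  of_enc hf fun _ => rfl

@[fun_prop] theorem ofNat {f : α → ℕ} (hf : PolyTime f) : PolyTime fun a => Data.ofNat (f a) :=
  of_enc hf fun _ => rfl

@[fun_prop] theorem size {f : α → β} (hf : PolyTime f) : PolyTime fun a => (Enc.enc (f a)).size :=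
  comp (f := fun b : β => (Enc.enc b).size) (of_prim .size fun _ => rfl) hf

@[fun_prop] theorem dataSize {f : α → Data} (hf : PolyTime f) : PolyTime fun a => (f a).size :=
  size hf

@[fun_prop] theorem eval (p : Polynomial ℕ) {f : α → ℕ} (hf : PolyTime f) :
    PolyTime fun a => p.eval (f a) := by
  induction p using Polynomial.induction_on' with
  | add p q hp hq => simp only [Polynomial.eval_add]; fun_prop
  | monomial n c =>
    simp only [Polynomial.eval_monomial]
    refine natMul (const c) ?_
    induction n with
    | zero => simpa using const 1
    | succ n ih => simp only [pow_succ]; exact natMul ih hf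

end PolyTime

/-! ### Randomness, oracle calls and subprograms -/

/-- A uniform number below `m` (or `0` if `m = 0`). -/
noncomputable def uniformNat : ℕ → PMF ℕ
  | 0 => PMF.pure 0
  | m + 1 => (PMF.uniformOfFintype (Fin (m + 1))).map fun i => i.val

theorem PPTime.uniformNat {n : α → ℕ} (hn : PolyTime n) :
    PPTime fun a _ => Eunomia.uniformNat (n a) := by
  refine PPTime.comp (F := fun n O => Eunomia.uniformNat n) ⟨.rand, .rand, fun m O => ?_⟩ hn
  rw [Prog.execWith_rand]
  cases m with
  | zero => simp [enc_nat, Data.ofNat, Data.toNat, uniformBelow, Eunomia.uniformNat, PMF.pure_map]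
  | succ m =>
    have : (Enc.enc (m + 1)).toNat = m + 1 := by
      simp [enc_nat, Data.ofNat, Data.toNat]
    rw [this, uniformBelow]
    change _ = ((PMF.uniformOfFintype (Fin (m + 1))).map fun i => i.val).map enc
    rw [PMF.map_comp]; rfl

theorem PPTime.oracle {u y : α → Data} (hu : PolyTime u) (hy : PolyTime y) :
    PPTime fun a O => (O (y a)).map fun z => if z.size ≤ (u a).size then z else .int 0 := by
  have : PPTime fun (p : Data × Data) O =>
      (O p.2).map fun z => if z.size ≤ p.1.size then z else .int 0 :=
    ⟨.oracle, .oracle, fun p O => by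
      rw [Prog.execWith_oracle]; exact (PMF.map_id _).symm⟩
  exact this.comp (hu.mk hy)

/-- This is how a reduction runs the attacker while simulating its oracle: `PPT.subst`, with the
parameter `a` as the additional input of the simulator. -/
theorem PPTime.execWith {A : Prog} (hA : A.PPT) {H : α → Data → (Data → PMF Data) → PMF Data}
    (hH : PPTime fun p : α × Data => H p.1 p.2) {x : α → Data} (hx : PolyTime x) :
    PPTime fun a O => A.execWith (fun y => H a y O) (x a) := by
  obtain ⟨B, hB, h⟩ := hH
  obtain ⟨C, hC, h'⟩ := hB.subst hA
  have : PPTime fun (p : α × Data) O => A.execWith (fun y => H p.1 y O) p.2 := by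
    refine ⟨C, hC, fun p O => ?_⟩
    rw [enc_prod, h']
    have h2 : (fun y => B.execWith O (.pair (Enc.enc p.1) y)) = fun y => H p.1 y O := by
      funext y
      rw [show Data.pair (Enc.enc p.1) y = Enc.enc (p.1, y) from rfl, h]
      exact PMF.map_id _
    rw [h2]; exact (PMF.map_id _).symm
  exact this.comp (PolyTime.id.mk hx)

theorem PPTime.exec {A : Prog} (hA : A.PPT) {x : α → Data} (hx : PolyTime x) :
    PPTime fun a _ => A.exec (x a) :=
  PPTime.execWith hA (PPTime.pure (PolyTime.const (Data.int 0))) hx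

/-! ### Loops -/

theorem iterP_pair_enc {body : Prog} {O : Data → PMF Data} {a : α} {step : σ → PMF σ}
    (h : ∀ s, body.execWith O (enc (a, s)) = (step s).map fun s' => enc (a, s')) (k : ℕ) (s : σ) :
    iterP (body.execWith O) k (enc (a, s)) = (iterP step k s).map fun s' => enc (a, s') := by
  induction k generalizing s with
  | zero => simp [iterP, PMF.pure_map]
  | succ k ih => simp only [iterP, h, PMF.bind_map, PMF.map_bind, Function.comp_def, ih]

/-- The price of a loop is a polynomial which bounds the number of rounds and all reachable states;
with it, the forced bounds of `boundedLoop` are harmless. -/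
theorem PPTime.iter {step : α → σ → (Data → PMF Data) → PMF σ} {init : α → σ} {n : α → ℕ}
    (hs : PPTime fun p : α × σ => step p.1 p.2) (hi : PolyTime init) (hn : PolyTime n)
    (p : Polynomial ℕ) (hp : ∀ a, n a ≤ p.eval (enc a).size)
    (hb : ∀ a O, ∀ k ≤ n a, ∀ s ∈ (iterP (fun s => step a s O) k (init a)).support,
      (enc s).size ≤ p.eval (enc a).size) :
    PPTime fun a O => iterP (fun s => step a s O) (n a) (init a) := by
  obtain ⟨A, hA, h⟩ := hs
  obtain ⟨N, hN, hN'⟩ := hn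
  obtain ⟨I, hI, hI'⟩ := hi
  -- The state of the program is the pair `(a, s)`; `X` and `1` account for `a` and for the pairing.
  let q : Polynomial ℕ := .X + p + 1
  obtain ⟨B, hB, hB'⟩ := PolyTime.eval q (PolyTime.size (PolyTime.id (α := Data)))
  replace hB' : ∀ O x, B.execWith O x = PMF.pure (.ofNat (q.eval x.size)) := fun O x => hB' x O
  have hbody : (Prog.pair (.prim .fst) A).PPT := .pair (.prim _) hA
  refine ⟨.comp (.comp (.pair (.prim .id) I) (.boundedLoop B (.comp (.prim .fst) N)
    (.pair (.prim .fst) A))) (.prim .snd), .comp (.comp (.pair (.prim _) hI)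
    (.boundedLoop hB (.comp (.prim _) hN) hbody hB')) (.prim _), fun a O => ?_⟩
  have hstep : ∀ s, (Prog.pair (.prim .fst) A).execWith O (enc (a, s)) =
      (step a s O).map fun s' => enc (a, s') := by
    intro s
    rw [Prog.execWith_pair, h, Prog.execWith_prim, PMF.pure_bind, PMF.map_comp]; rfl
  have h1 := iterP_pair_enc (step := fun s => step a s O) hstep (n a) (init a)
  have hsize : (enc (a, init a) : Data).size = (enc a).size + (enc (init a)).size + 1 := rfl
  have hmono := eval_mono p (show (enc a).size ≤ (enc (a, init a) : Data).size by omega)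
  have hq : q.eval (enc (a, init a) : Data).size =
      (enc (a, init a) : Data).size + p.eval (enc (a, init a) : Data).size + 1 := by simp [q]
  have h2 := Prog.boundedLoop_exec (O := O) (bnd := B) (cnt := .comp (.prim .fst) N)
    (body := .pair (.prim .fst) A) (x := enc (a, init a)) (k := n a) (hB' _ _)
    (by rw [Prog.execWith_comp, Prog.execWith_prim, PMF.pure_bind]; exact hN' a O)
    (by have := hp a; omega) (by
      intro k hk s hs
      rw [iterP_pair_enc (step := fun s => step a s O) hstep, PMF.mem_support_map_iff] at hs
      obtain ⟨s', hs', rfl⟩ := hs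
      have := hb a O k hk s' hs'
      rw [hq]
      simp only [enc_prod, Data.size] at *
      omega)
  have h3 : (Prog.pair (.prim .id) I).execWith O (enc a) = PMF.pure (enc (a, init a)) := by
    rw [Prog.execWith_pair, hI', Prog.execWith_prim, PMF.pure_bind, PMF.pure_map]; rfl
  have h4 : (Prog.prim .snd).execWith O = PMF.pure ∘ Data.snd := by
    funext y; simp [Prim.eval]
  rw [Prog.execWith_comp, Prog.execWith_comp, h3, PMF.pure_bind, h2, h1, h4, PMF.bind_pure_comp,
    PMF.map_comp]
  rfl

end Eunomia
namespace Eunomia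
open Enc

variable {α β γ σ : Type} [Enc α] [Enc β] [Enc γ] [Enc σ]

/-! ### Lists -/

theorem PPTime.listCases {l : α → List β} {F : α → (Data → PMF Data) → PMF γ}
    {G : α → β → List β → (Data → PMF Data) → PMF γ} (hl : PolyTime l) (hF : PPTime F)
    (hG : PPTime fun p : α × β × List β => G p.1 p.2.1 p.2.2) :
    PPTime fun a O => match l a with
      | [] => F a O
      | b :: t => G a b t O := by
  obtain ⟨A, hA, h⟩ := hF
  obtain ⟨B, hB, h'⟩ := hG
  obtain ⟨L, hL, h''⟩ := hl
  refine ⟨.ite (.comp L (.prim .isInt)) A (.comp (.pair (.prim .id) L) B),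
    .ite (.comp hL (.prim _)) hA (.comp (.pair (.prim _) hL) hB), fun a O => ?_⟩
  rw [Prog.execWith_ite, Prog.execWith_comp, h'', PMF.pure_bind, Prog.execWith_prim, PMF.pure_bind,
    Prog.execWith_comp, Prog.execWith_pair, Prog.execWith_prim, PMF.pure_bind, h'', PMF.pure_map,
    PMF.pure_bind, h]
  dsimp only
  generalize l a = la
  cases la with
  | nil => simp [enc_nil, Prim.eval, Data.isInt, Data.toBool]
  | cons b t =>
    simp only [enc_cons, Prim.eval, Data.isInt, Data.toBool]
    simp only [Bool.false_eq_true, if_false, ne_eq, not_true_eq_false, decide_false]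
    exact h' (a, b, t) O

theorem iterP_pure {σ : Type} (f : σ → σ) (k : ℕ) (s : σ) :
    iterP (fun s => PMF.pure (f s)) k s = PMF.pure (f^[k] s) := by
  induction k generalizing s with
  | zero => rfl
  | succ k ih => simp [iterP, ih]

theorem PolyTime.iter {step : α → σ → σ} {init : α → σ} {n : α → ℕ}
    (hs : PolyTime fun p : α × σ => step p.1 p.2) (hi : PolyTime init) (hn : PolyTime n)
    (p : Polynomial ℕ) (hp : ∀ a, n a ≤ p.eval (Enc.enc a).size)
    (hb : ∀ a, ∀ k ≤ n a, (Enc.enc ((step a)^[k] (init a))).size ≤ p.eval (Enc.enc a).size) :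
    PolyTime fun a => (step a)^[n a] (init a) := by
  refine of_pure ?_
  have := PPTime.iter (step := fun a s O => PMF.pure (step a s)) (PPTime.pure hs) hi hn p hp
    (by
      intro a O k hk s hs
      rw [iterP_pure, PMF.mem_support_pure_iff] at hs
      rw [hs]; exact hb a k hk)
  simpa only [iterP_pure] using this

@[fun_prop] theorem PolyTime.cons {f : α → β} {l : α → List β} (hf : PolyTime f) (hl : PolyTime l) :
    PolyTime fun a => f a :: l a := of_enc (mk hf hl) fun _ => rfl

@[fun_prop] theorem PolyTime.isEmpty {l : α → List β} (hl : PolyTime l) :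
    PolyTime fun a => (l a).isEmpty :=
  comp (f := fun l : List β => l.isEmpty) (of_prim .isInt fun l => by
    cases l <;> rfl) hl

@[fun_prop] theorem PolyTime.headD {l : α → List β} {d : α → β} (hl : PolyTime l)
    (hd : PolyTime d) : PolyTime fun a => (l a).headD (d a) := by
  refine of_pure ?_
  have := PPTime.listCases (G := fun a b t O => PMF.pure b) hl (PPTime.pure hd)
    (PPTime.pure (by fun_prop))
  convert this using 3 with a O
  cases l a <;> rfl

theorem size_list (l : List β) : (enc l).size = (l.map fun b => (enc b).size + 1).sum + 1 := by
  induction l with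
  | nil => simp [enc_nil, Data.size]
  | cons b l ih => rw [enc_cons, Data.size, ih, List.map_cons, List.sum_cons]; omega

theorem length_le_size (l : List β) : l.length ≤ (enc l).size := by
  induction l with
  | nil => simp
  | cons b l ih => rw [enc_cons, Data.size, List.length_cons]; omega

theorem size_list_le {l : List β} {T n : ℕ} (h : ∀ b ∈ l, (enc b).size ≤ T) (hn : l.length ≤ n) :
    (enc l).size ≤ n * (T + 1) + 1 := by
  rw [size_list]
  have := List.sum_le_card_nsmul (l.map fun b => (enc b).size + 1) (T + 1) (by
    simp only [List.mem_map, forall_exists_index, and_imp, forall_apply_eq_imp_iff₂]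
    intro b hb; have := h b hb; omega)
  rw [List.length_map, smul_eq_mul] at this
  have := Nat.mul_le_mul_right (T + 1) hn
  omega

theorem size_mem_le {l : List β} {b : β} (h : b ∈ l) : (enc b).size ≤ (enc l).size := by
  rw [size_list]
  have := List.single_le_sum (l := l.map fun b => (enc b).size + 1) (by simp) _
    (List.mem_map_of_mem (f := fun b => (enc b).size + 1) h)
  omega

theorem size_sublist_le {l l' : List β} (h : l'.Sublist l) : (enc l').size ≤ (enc l).size := by
  rw [size_list, size_list]
  have := (h.map fun b => (enc b).size + 1).sum_le_sum (by simp)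
  omega

/-- Process a list from the left by a randomized step. -/
noncomputable def foldlP (f : σ → β → PMF σ) : σ → List β → PMF σ
  | s, [] => PMF.pure s
  | s, b :: l => (f s b).bind fun s' => foldlP f s' l

/-- One step of the computation of `foldlP`. -/
noncomputable def foldStep (f : σ → β → PMF σ) (x : List β × σ) : PMF (List β × σ) :=
  match x.1 with
  | [] => PMF.pure x
  | b :: t => (f x.2 b).map fun s => (t, s)

theorem iterP_foldStep {β σ : Type} (f : σ → β → PMF σ) (k : ℕ) (l : List β) (s : σ) :
    iterP (foldStep f) k (l, s) = (foldlP f s (l.take k)).map fun s' => (l.drop k, s') := by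
  induction k generalizing l s with
  | zero => simp [iterP, foldlP, PMF.pure_map]
  | succ k ih =>
    cases l with
    | nil => simp only [iterP, foldStep, PMF.pure_bind, ih]; simp
    | cons b t =>
      simp only [iterP, foldStep, List.take_succ_cons, foldlP, List.drop_succ_cons, PMF.bind_map,
        PMF.map_bind, Function.comp_def, ih]

theorem PPTime.foldl {f : α → σ → β → (Data → PMF Data) → PMF σ} {s : α → σ} {l : α → List β}
    (hf : PPTime fun p : α × σ × β => f p.1 p.2.1 p.2.2) (hs : PolyTime s) (hl : PolyTime l)
    (p : Polynomial ℕ) (hb : ∀ a O, ∀ l' : List β, l' <+: l a →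
      ∀ s' ∈ (foldlP (fun s b => f a s b O) (s a) l').support,
        (enc s').size ≤ p.eval (enc a).size) :
    PPTime fun a O => foldlP (fun s b => f a s b O) (s a) (l a) := by
  obtain ⟨q, hq⟩ := hl.size_le
  have := PPTime.iter (step := fun a x O => foldStep (fun s b => f a s b O) x)
    -- The size of the encoded list is an upper bound for its length that a single instruction
    -- computes; the superfluous rounds leave the state unchanged.
    (init := fun a => (l a, s a)) (n := fun a => (enc (l a)).size)
    (by
      refine PPTime.listCases (l := fun p : α × List β × σ => p.2.1)
        (F := fun p O => PMF.pure p.2)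
        (G := fun p b t O => (f p.1 p.2.2 b O).map fun s => (t, s)) (by fun_prop)
        (PPTime.pure (by fun_prop)) ?_
      refine PPTime.map (F := fun (p : (α × List β × σ) × β × List β) O => f p.1.1 p.1.2.2 p.2.1 O)
        (g := fun p s => (p.2.2, s)) ?_ (by fun_prop)
      exact PPTime.comp hf
        (f := fun p : (α × List β × σ) × β × List β => (p.1.1, p.1.2.2, p.2.1)) (by fun_prop))
    (by fun_prop) (by fun_prop) (q + p + 1)
    (by intro a; have := hq a; simp only [Polynomial.eval_add, Polynomial.eval_one]; omega)
    (by
      intro a O k _ x hx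
      rw [iterP_foldStep, PMF.mem_support_map_iff] at hx
      obtain ⟨s', hs', rfl⟩ := hx
      have h1 := hb a O _ (List.take_prefix k (l a)) s' hs'
      have h2 := hq a
      have h3 := size_sublist_le (List.drop_sublist k (l a))
      simp only [Polynomial.eval_add, Polynomial.eval_one, enc_prod, Data.size]
      omega)
  have h2 := PPTime.map (g := fun a x => x.2) this (by fun_prop)
  convert h2 using 3 with a O
  rw [iterP_foldStep, PMF.map_comp, List.take_of_length_le (length_le_size _)]
  exact (PMF.map_id _).symm

theorem foldlP_pure {β σ : Type} (f : σ → β → σ) (s : σ) (l : List β) :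
    foldlP (fun s b => PMF.pure (f s b)) s l = PMF.pure (l.foldl f s) := by
  induction l generalizing s with
  | nil => rfl
  | cons b l ih => simp [foldlP, ih]

theorem PolyTime.foldl {f : α → σ → β → σ} {s : α → σ} {l : α → List β}
    (hf : PolyTime fun p : α × σ × β => f p.1 p.2.1 p.2.2) (hs : PolyTime s) (hl : PolyTime l)
    (p : Polynomial ℕ) (hb : ∀ a, ∀ l' : List β, l' <+: l a →
      (Enc.enc (l'.foldl (f a) (s a))).size ≤ p.eval (Enc.enc a).size) :
    PolyTime fun a => (l a).foldl (f a) (s a) := by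
  refine of_pure ?_
  have := PPTime.foldl (f := fun a s b O => PMF.pure (f a s b)) (PPTime.pure hf) hs hl p
    (by
      intro a O l' hl' s' hs'
      rw [foldlP_pure, PMF.mem_support_pure_iff] at hs'
      rw [hs']; exact hb a l' hl')
  simpa only [foldlP_pure] using this

@[fun_prop] theorem PolyTime.reverse {l : α → List β} (hl : PolyTime l) :
    PolyTime fun a => (l a).reverse := by
  refine comp (f := fun l : List β => l.reverse) ?_ hl
  have : PolyTime fun l : List β => l.foldl (fun acc b => b :: acc) [] := by
    refine foldl (f := fun l acc b => b :: acc) (s := fun _ => ([] : List β)) (by fun_prop)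
      (by fun_prop) (by fun_prop) .X fun l l' hl' => ?_
    rw [List.foldl_flip_cons_eq_append', List.append_nil, Polynomial.eval_X, size_list,
      List.map_reverse, List.sum_reverse, ← size_list]
    exact size_sublist_le hl'.sublist
  simpa [List.foldl_flip_cons_eq_append'] using this

theorem mem_sampleList {β γ : Type} {f : β → PMF γ} {l : List β} {bs : List γ}
    (h : bs ∈ (sampleList f l).support) : List.Forall₂ (fun a b => b ∈ (f a).support) l bs := by
  induction l generalizing bs with
  | nil =>
    simp only [sampleList, PMF.mem_support_pure_iff] at h
    subst h; exact .nil
  | cons a l ih =>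
    simp only [sampleList, PMF.mem_support_bind_iff, PMF.mem_support_map_iff] at h
    obtain ⟨b, hb, bs', hbs', rfl⟩ := h
    exact .cons hb (ih hbs')

theorem foldlP_cons {β γ : Type} (f : β → PMF γ) (acc : List γ) (l : List β) :
    foldlP (fun acc b => (f b).map fun c => c :: acc) acc l =
      (sampleList f l).map fun bs => bs.reverse ++ acc := by
  induction l generalizing acc with
  | nil => simp [foldlP, sampleList, PMF.pure_map]
  | cons b l ih =>
    simp only [foldlP, sampleList, PMF.bind_map, PMF.map_bind, PMF.map_comp, Function.comp_def, ih]
    simp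

/-- The results are accumulated in reverse order by a fold. Each of them is polynomially long by
`PPTime.size_le`, because an entry of `l a` is no longer than `l a`, and this bounds the
accumulator. -/
theorem PPTime.sampleList {f : α → β → (Data → PMF Data) → PMF γ} {l : α → List β}
    (hf : PPTime fun p : α × β => f p.1 p.2) (hl : PolyTime l) :
    PPTime fun a O => Eunomia.sampleList (fun b => f a b O) (l a) := by
  obtain ⟨t, ht⟩ := hf.size_le
  obtain ⟨q, hq⟩ := hl.size_le
  have := PPTime.foldl (f := fun a acc b O => (f a b O).map fun c => c :: acc)
    (s := fun _ => ([] : List γ)) (l := l)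
    (by
      refine PPTime.map (F := fun (p : α × List γ × β) O => f p.1 p.2.2 O)
        (g := fun p c => c :: p.2.1) ?_ (by fun_prop)
      exact PPTime.comp hf (f := fun p : α × List γ × β => (p.1, p.2.2)) (by fun_prop))
    (by fun_prop) hl (q * (t.comp (.X + q + 1) + 1) + 1) (by
      intro a O l' hl' s' hs'
      rw [foldlP_cons, PMF.mem_support_map_iff] at hs'
      obtain ⟨bs, hbs, rfl⟩ := hs'
      have hF := mem_sampleList hbs
      have h1 : ∀ c ∈ bs.reverse ++ [],
          (enc c).size ≤ (t.comp (.X + q + 1)).eval (enc a).size := by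
        intro c hc
        rw [List.append_nil, List.mem_reverse] at hc
        obtain ⟨i, hi, rfl⟩ := List.mem_iff_getElem.1 hc
        have hi' : i < l'.length := by rw [hF.length_eq]; exact hi
        have h3 := (List.forall₂_iff_get.1 hF).2 i hi' hi
        have h2 := ht (a, l'.get ⟨i, hi'⟩) O _ h3
        refine h2.trans ?_
        rw [Polynomial.eval_comp]
        apply eval_mono
        have h4 := size_mem_le (hl'.subset (List.get_mem l' ⟨i, hi'⟩))
        have h5 := hq a
        simp only [enc_prod, Data.size, Polynomial.eval_add, Polynomial.eval_X,
          Polynomial.eval_one]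
        omega
      have h2 : (bs.reverse ++ []).length ≤ q.eval (enc a).size := by
        rw [List.append_nil, List.length_reverse, ← hF.length_eq]
        exact (hl'.length_le.trans (length_le_size _)).trans (hq a)
      have := size_list_le h1 h2
      simpa using this)
  have h2 := PPTime.map (g := fun a bs => bs.reverse) this (by fun_prop)
  convert h2 using 3 with a O
  rw [foldlP_cons, PMF.map_comp]
  simp only [Function.comp_def, List.append_nil, List.reverse_reverse]
  exact (PMF.map_id _).symm

theorem sampleList_pure {β γ : Type} (f : β → γ) (l : List β) :
    sampleList (fun b => PMF.pure (f b)) l = PMF.pure (l.map f) := by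
  induction l with
  | nil => rfl
  | cons b l ih => simp [sampleList, ih, PMF.pure_map]

namespace PolyTime

@[fun_prop] theorem map {f : α → β → γ} {l : α → List β}
    (hf : PolyTime fun p : α × β => f p.1 p.2) (hl : PolyTime l) :
    PolyTime fun a => (l a).map (f a) := by
  refine of_pure ?_
  have := PPTime.sampleList (f := fun a b O => PMF.pure (f a b)) (PPTime.pure hf) hl
  simpa only [sampleList_pure] using this

@[fun_prop] theorem append {l l' : α → List β} (hl : PolyTime l) (hl' : PolyTime l') :
    PolyTime fun a => l a ++ l' a := by
  refine comp (f := fun p : List β × List β => p.1 ++ p.2) ?_ (mk hl hl')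
  have : PolyTime fun p : List β × List β => p.1.reverse.foldl (fun acc b => b :: acc) p.2 := by
    refine foldl (f := fun p acc b => b :: acc) (s := fun p : List β × List β => p.2) (by fun_prop)
      (by fun_prop) (by fun_prop) .X fun p l' hl' => ?_
    rw [List.foldl_flip_cons_eq_append', Polynomial.eval_X, enc_prod, Data.size, size_list,
      size_list p.2, size_list p.1]
    have h := (hl'.sublist.map fun b => (Enc.enc b).size + 1).sum_le_sum (by simp)
    rw [List.map_reverse, List.sum_reverse] at h
    simp only [List.map_append, List.map_reverse, List.sum_append, List.sum_reverse]
    omega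
  simpa [List.foldl_flip_cons_eq_append'] using this

@[fun_prop] theorem flatten {l : α → List (List β)} (hl : PolyTime l) :
    PolyTime fun a => (l a).flatten := by
  refine comp (f := fun l : List (List β) => l.flatten) ?_ hl
  have h0 : ∀ (l : List (List β)) (acc : List β),
      l.foldl (fun acc b => acc ++ b) acc = acc ++ l.flatten := by
    intro l
    induction l with
    | nil => simp
    | cons b l ih => intro acc; simp [ih]
  have : PolyTime fun l : List (List β) => l.foldl (fun acc b => acc ++ b) [] := by
    refine foldl (f := fun l acc b => acc ++ b) (s := fun _ => ([] : List β)) (by fun_prop)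
      (by fun_prop) (by fun_prop) .X fun l l' hl' => ?_
    rw [h0, List.nil_append, Polynomial.eval_X]
    refine le_trans ?_ (size_sublist_le hl'.sublist)
    rw [size_list, size_list]
    clear hl'
    induction l' with
    | nil => simp
    | cons b l' ih =>
      simp only [List.flatten_cons, List.map_append, List.sum_append, List.map_cons, List.sum_cons,
        size_list b]
      omega
  simpa [h0] using this

@[fun_prop] theorem flatMap {f : α → β → List γ} {l : α → List β}
    (hf : PolyTime fun p : α × β => f p.1 p.2) (hl : PolyTime l) :
    PolyTime fun a => (l a).flatMap (f a) := by
  simp only [List.flatMap_def]; fun_prop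

@[fun_prop] theorem filter {f : α → β → Bool} {l : α → List β}
    (hf : PolyTime fun p : α × β => f p.1 p.2) (hl : PolyTime l) :
    PolyTime fun a => (l a).filter (f a) := by
  have : PolyTime fun a => (l a).flatMap fun b => if f a b = true then [b] else [] := by fun_prop
  convert this using 2 with a
  induction l a with
  | nil => rfl
  | cons b l ih =>
    rw [List.filter_cons, List.flatMap_cons, ← ih]
    split_ifs <;> rfl

@[fun_prop] theorem mem [DecidableEq β] {f : α → β} {l : α → List β} (hf : PolyTime f)
    (hl : PolyTime l) : PolyTime fun a => decide (f a ∈ l a) := by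
  have : PolyTime fun a => !((l a).filter fun b => decide (b = f a)).isEmpty := by fun_prop
  convert this using 2 with a
  by_cases h : f a ∈ l a
  · simp only [h, decide_true, Bool.true_eq, Bool.not_eq_true', List.isEmpty_eq_false_iff, ne_eq,
      List.filter_eq_nil_iff, decide_eq_true_eq, not_forall, not_not]
    exact ⟨_, h, rfl⟩
  · simp only [h, decide_false, Bool.false_eq, Bool.not_eq_false', List.isEmpty_iff,
      List.filter_eq_nil_iff, decide_eq_true_eq]
    rintro b hb rfl; exact h hb

@[fun_prop] theorem length {l : α → List β} (hl : PolyTime l) : PolyTime fun a => (l a).length := by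
  refine comp (f := fun l : List β => l.length) ?_ hl
  have h0 : ∀ (l : List β) (n : ℕ), l.foldl (fun n _ => n + 1) n = n + l.length := by
    intro l
    induction l with
    | nil => simp
    | cons b l ih => intro n; simp [ih]; omega
  have : PolyTime fun l : List β => l.foldl (fun n _ => n + 1) 0 := by
    refine foldl (f := fun l n b => n + 1) (s := fun _ => 0) (by fun_prop)
      (by fun_prop) (by fun_prop) (.X + 1) fun l l' hl' => ?_
    rw [h0, zero_add]
    refine (size_ofNat_le _).trans ?_
    have := hl'.length_le.trans (length_le_size l)
    simpa using this
  simpa [h0] using this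

@[fun_prop] theorem zipIdx {l : α → List β} (hl : PolyTime l) :
    PolyTime fun a => (l a).zipIdx := by
  refine comp (f := fun l : List β => l.zipIdx) ?_ hl
  have h0 : ∀ (l : List β) (s : List (β × ℕ) × ℕ),
      l.foldl (fun s b => ((b, s.2) :: s.1, s.2 + 1)) s =
        ((l.zipIdx s.2).reverse ++ s.1, s.2 + l.length) := by
    intro l
    induction l with
    | nil => simp
    | cons b l ih => intro n; simp [ih]; omega
  have : PolyTime fun l : List β =>
      (l.foldl (fun (s : List (β × ℕ) × ℕ) b => ((b, s.2) :: s.1, s.2 + 1)) ([], 0)).1.reverse := by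
    refine reverse (fst ?_)
    refine foldl (f := fun l (s : List (β × ℕ) × ℕ) b => ((b, s.2) :: s.1, s.2 + 1))
      (s := fun _ => ([], 0)) (by fun_prop)
      (by fun_prop) (by fun_prop) (.X * ((.X + (.X + 1) + 1) + 1) + 1 + (.X + 1) + 1) fun l l' hl' => ?_
    rw [h0]
    have h1 := hl'.length_le.trans (length_le_size l)
    have h2 := size_ofNat_le l'.length
    have h3 : (Enc.enc ((l'.zipIdx 0).reverse ++ [])).size ≤
        (Enc.enc l).size * (((Enc.enc l).size + ((Enc.enc l).size + 1) + 1) + 1) + 1 := by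
      refine size_list_le ?_ (by simpa using h1)
      rintro ⟨b, i⟩ hb
      rw [List.append_nil, List.mem_reverse] at hb
      have h4 := List.mem_zipIdx hb
      have h5 := size_mem_le (hl'.subset (h4.2.2 ▸ List.getElem_mem _ : b ∈ l'))
      have h6 := size_ofNat_le i
      simp only [enc_prod, enc_nat, Data.size]
      omega
    simp only [enc_prod, enc_nat, Data.size, zero_add, Polynomial.eval_add, Polynomial.eval_mul,
      Polynomial.eval_X, Polynomial.eval_one] at h3 ⊢
    omega
  simpa [h0] using this

-- Selecting by position is filtering an indexed copy, which avoids a new loop with its size bounds;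
-- likewise for `take`.
@[fun_prop] theorem getD {l : α → List β} {i : α → ℕ} {d : α → β} (hl : PolyTime l)
    (hi : PolyTime i) (hd : PolyTime d) : PolyTime fun a => (l a).getD (i a) (d a) := by
  have : PolyTime fun a =>
      (((l a).zipIdx.filter fun p => decide (p.2 = i a)).map fun p => p.1).headD (d a) := by
    fun_prop
  convert this using 2 with a
  generalize l a = l
  generalize i a = i
  have : ∀ n, l.getD i (d a) =
      (((l.zipIdx n).filter fun p => decide (p.2 = n + i)).map fun p => p.1).headD (d a) := by
    induction l generalizing i with
    | nil => simp
    | cons b l ih =>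
      intro n
      cases i with
      | zero => simp [List.zipIdx_cons]
      | succ i =>
        rw [List.getD_cons_succ, ih i (n + 1), List.zipIdx_cons, List.filter_cons,
          if_neg (by simp)]
        simp only [Nat.add_assoc, Nat.add_comm 1 i]
  simpa using this 0

@[fun_prop] theorem take {l : α → List β} {i : α → ℕ} (hl : PolyTime l)
    (hi : PolyTime i) : PolyTime fun a => (l a).take (i a) := by
  have : PolyTime fun a => ((l a).zipIdx.filter fun p => decide (p.2 < i a)).map fun p => p.1 := by
    fun_prop
  convert this using 2 with a
  generalize l a = l
  generalize i a = i
  have : ∀ n, l.take i =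
      ((l.zipIdx n).filter fun p => decide (p.2 < n + i)).map fun p => p.1 := by
    induction l generalizing i with
    | nil => simp
    | cons b l ih =>
      intro n
      cases i with
      | zero =>
        simp only [List.take_zero, Nat.add_zero]
        symm
        simp only [List.map_eq_nil_iff, List.filter_eq_nil_iff, decide_eq_true_eq, not_lt]
        rintro ⟨x, i⟩ h
        exact (List.mem_zipIdx h).1
      | succ i =>
        rw [List.take_succ_cons, ih i (n + 1), List.zipIdx_cons, List.filter_cons,
          if_pos (by simp), List.map_cons]
        simp only [Nat.add_assoc, Nat.add_comm 1 i]
  simpa using this 0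

@[fun_prop] theorem range {l : α → List β} (hl : PolyTime l) :
    PolyTime fun a => List.range (l a).length := by
  have : PolyTime fun a => (l a).zipIdx.map fun p => p.2 := by fun_prop
  convert this using 2 with a
  simp [List.zipIdx_map_snd, List.range_eq_range']

@[fun_prop] theorem toList {f : α → Data} (hf : PolyTime f) : PolyTime fun a => (f a).toList := by
  refine comp (f := fun d : Data => d.toList) ?_ hf
  let step : Data × List Data → Data × List Data :=
    fun s => if s.1.isInt = true then s else (s.1.snd, s.1.fst :: s.2)
  -- Each round moves one entry from the datum to the accumulator, and the total size is invariant: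
  -- the node that is taken off the datum reappears in the accumulator.
  have h1 : ∀ k s, (step^[k] s).1.size + (Enc.enc (step^[k] s).2).size =
      s.1.size + (Enc.enc s.2).size := by
    intro k
    induction k with
    | zero => simp
    | succ k ih =>
      intro s
      rw [Function.iterate_succ_apply, ih]
      rcases s with ⟨d, l⟩
      cases d with
      | int n => rfl
      | pair a b =>
        simp only [step, Data.isInt, Bool.false_eq_true, if_false, Data.fst_pair, Data.snd_pair,
          enc_cons, Data.size, enc_data]
        omega
  have h2 : ∀ (d : Data) (k : ℕ) (l : List Data), d.size ≤ k →
      (step^[k] (d, l)).2 = d.toList.reverse ++ l := by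
    intro d
    induction d with
    | int n =>
      intro k l _
      have : step (.int n, l) = (.int n, l) := rfl
      rw [Function.iterate_fixed this]; simp [Data.toList]
    | pair a b _ ih =>
      intro k l hk
      cases k with
      | zero => simp [Data.size] at hk
      | succ k =>
        have : step (.pair a b, l) = (b, a :: l) := rfl
        rw [Function.iterate_succ_apply, this, ih]
        · simp [Data.toList]
        · simp only [Data.size] at hk; omega
  have : PolyTime fun d : Data => ((step^[d.size] (d, [])).2).reverse := by
    refine reverse (snd ?_)
    refine iter (step := fun _ => step) (init := fun d : Data => (d, ([] : List Data)))
      (by fun_prop) (by fun_prop) (by fun_prop) (.X + .X + 2) (by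
        intro a; simp only [enc_data, Polynomial.eval_add, Polynomial.eval_X]; omega) ?_
    intro a k _
    have := h1 k (a, [])
    simp only [enc_prod, enc_data, Data.size, enc_nil, Polynomial.eval_add, Polynomial.eval_X,
      Polynomial.eval_ofNat] at this ⊢
    simp at this
    omega
  convert this using 2 with d
  rw [h2 d _ _ le_rfl]; simp

@[fun_prop] theorem ofList {f : α → List Data} (hf : PolyTime f) :
    PolyTime fun a => Data.ofList (f a) :=
  of_enc hf fun a => by simp [Enc.enc]

end PolyTime

end Eunomia
namespace Eunomia
open Enc

variable {α β γ σ : Type} [Enc α] [Enc β] [Enc γ] [Enc σ]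

/-! ## Reading the choice of the adversary -/

def schemaOf (x : Data) : Schema := (Challenge.ofData x).S
def constantsOf (x : Data) : List Data := (Challenge.ofData x).C
def displacementsOf (x : Data) : List Data := (Challenge.ofData x).D
def pairsOf (x : Data) : List (Column × Column) := (Challenge.ofData x).δ
def firstLog (x : Data) : Log := (Challenge.ofData x).L₀
def secondLog (x : Data) : Log := (Challenge.ofData x).L₁
def stateOf (x : Data) : Data := (Challenge.ofData x).state

/-- The content of a cell, with a default value. -/
def Log.cellD (L : Log) (c : Column) (i : ℕ) : Data :=
  ((L.getD c.1 []).getD i []).getD c.2 (.int 0)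

def hasColumn (S : Schema) (c : Column) : Bool := decide (c.2 < (S.getD c.1 []).length)

theorem isTime_iff (S : Schema) (c : Column) :
    S.IsTime c ↔ (S.getD c.1 []).getD c.2 false = true := by
  simp only [Schema.IsTime, Schema.kind, List.getD_eq_getElem?_getD]
  cases h : S[c.1]? with
  | none => simp
  | some T => cases h' : T[c.2]? <;> simp [h']

theorem column_eq (L : Log) (c : Column) : L.column c =
    ((L.getD c.1 []).filter fun row => decide (c.2 < row.length)).map
      fun row => row.getD c.2 (.int 0) := by
  rw [Log.column, List.getD_eq_getElem?_getD]
  induction (L[c.1]?).getD [] with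
  | nil => rfl
  | cons row l ih =>
    by_cases h : c.2 < row.length
    · simp [h, ih]
    · simp [h, ih]

namespace PolyTime

@[fun_prop] theorem filterMapIf {p : α → β → Prop} [∀ a b, Decidable (p a b)] {f : α → β → γ}
    {l : α → List β} (hp : PolyTime fun q : α × β => decide (p q.1 q.2))
    (hf : PolyTime fun p : α × β => f p.1 p.2) (hl : PolyTime l) :
    PolyTime fun a => (l a).filterMap fun b => if p a b then some (f a b) else none := by
  have : PolyTime fun a => ((l a).filter fun b => decide (p a b)).map fun b => f a b := by fun_prop
  convert this using 2 with a
  induction l a with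
  | nil => rfl
  | cons b l ih => by_cases h : p a b <;> simp [h, ih]

@[fun_prop] theorem columnOfData {f : α → Data} (hf : PolyTime f) :
    PolyTime fun a => Column.ofData (f a) := by
  unfold Column.ofData; fun_prop

@[fun_prop] theorem columnData {f : α → Column} (hf : PolyTime f) :
    PolyTime fun a => Eunomia.columnData (f a) := of_enc hf fun _ => rfl

@[fun_prop] theorem logOfData {f : α → Data} (hf : PolyTime f) :
    PolyTime fun a => Log.ofData (f a) := by
  have : PolyTime fun a => (f a).toList.map fun T => T.toList.map fun R => R.toList := by fun_prop
  exact this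

@[fun_prop] theorem schemaOf {x : α → Data} (hx : PolyTime x) :
    PolyTime fun a => schemaOf (x a) := by
  have : PolyTime fun a => (x a).fst.toList.map fun T => T.toList.map fun R => R.toBool := by
    fun_prop
  exact this

@[fun_prop] theorem constantsOf {x : α → Data} (hx : PolyTime x) :
    PolyTime fun a => constantsOf (x a) := by
  have : PolyTime fun a => (x a).snd.fst.toList := by fun_prop
  exact this

@[fun_prop] theorem displacementsOf {x : α → Data} (hx : PolyTime x) :
    PolyTime fun a => displacementsOf (x a) := by
  have : PolyTime fun a => (x a).snd.snd.fst.toList := by fun_prop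
  exact this

@[fun_prop] theorem pairsOf {x : α → Data} (hx : PolyTime x) :
    PolyTime fun a => pairsOf (x a) := by
  have : PolyTime fun a => (x a).snd.snd.snd.fst.toList.map fun p =>
      (Column.ofData p.fst, Column.ofData p.snd) := by fun_prop
  exact this

@[fun_prop] theorem firstLog {x : α → Data} (hx : PolyTime x) :
    PolyTime fun a => firstLog (x a) := by
  have : PolyTime fun a => Log.ofData (x a).snd.snd.snd.snd.fst := by fun_prop
  exact this

@[fun_prop] theorem secondLog {x : α → Data} (hx : PolyTime x) :
    PolyTime fun a => secondLog (x a) := by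
  have : PolyTime fun a => Log.ofData (x a).snd.snd.snd.snd.snd.fst := by fun_prop
  exact this

@[fun_prop] theorem stateOf {x : α → Data} (hx : PolyTime x) :
    PolyTime fun a => stateOf (x a) := by
  have : PolyTime fun a => (x a).snd.snd.snd.snd.snd.snd := by fun_prop
  exact this

@[fun_prop] theorem cellD {L : α → Log} {c : α → Column} {i : α → ℕ} (hL : PolyTime L)
    (hc : PolyTime c) (hi : PolyTime i) : PolyTime fun a => (L a).cellD (c a) (i a) := by
  unfold Log.cellD; fun_prop

@[fun_prop] theorem hasColumn {S : α → Schema} {c : α → Column} (hS : PolyTime S)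
    (hc : PolyTime c) : PolyTime fun a => hasColumn (S a) (c a) := by
  unfold Eunomia.hasColumn; fun_prop

@[fun_prop] theorem isTime {S : α → Schema} {c : α → Column} (hS : PolyTime S)
    (hc : PolyTime c) : PolyTime fun a => decide ((S a).IsTime (c a)) := by
  simp only [isTime_iff]; fun_prop

@[fun_prop] theorem column {L : α → Log} {c : α → Column} (hL : PolyTime L)
    (hc : PolyTime c) : PolyTime fun a => (L a).column (c a) := by
  simp only [column_eq]; fun_prop

@[fun_prop] theorem values {L : α → Log} (hL : PolyTime L) : PolyTime fun a => (L a).values := by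
  unfold Log.values; fun_prop

@[fun_prop] theorem columns {S : α → Schema} (hS : PolyTime S) :
    PolyTime fun a => (S a).columns := by
  unfold Schema.columns; fun_prop

@[fun_prop] theorem timeStamps {S : α → Schema} {L : α → Log} (hS : PolyTime S) (hL : PolyTime L) :
    PolyTime fun a => timeStamps (S a) (L a) := by
  unfold Eunomia.timeStamps; fun_prop

/-! ### The order of the displaced timestamps -/

@[fun_prop] theorem toFinset_card [DecidableEq β] {l : α → List β} (hl : PolyTime l) :
    PolyTime fun a => (l a).toFinset.card := by
  refine comp (f := fun l : List β => l.toFinset.card) ?_ hl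
  have h0 : ∀ l acc : List β, acc.Nodup →
      (l.foldl (fun acc b => if b ∈ acc then acc else b :: acc) acc).Nodup ∧
      (∀ b, b ∈ l.foldl (fun acc b => if b ∈ acc then acc else b :: acc) acc ↔ b ∈ l ∨ b ∈ acc) ∧
      (l.foldl (fun acc b => if b ∈ acc then acc else b :: acc) acc).length ≤
        l.length + acc.length := by
    intro l
    induction l with
    | nil => simp
    | cons b l ih =>
      intro acc hacc
      by_cases h : b ∈ acc
      · have := ih acc hacc
        simp only [List.foldl_cons, h, if_true, List.mem_cons, List.length_cons]
        refine ⟨this.1, fun c => ?_, by omega⟩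
        rw [this.2.1]
        constructor
        · tauto
        · rintro ((rfl | h') | h') <;> tauto
      · have := ih (b :: acc) (List.nodup_cons.2 ⟨h, hacc⟩)
        simp only [List.foldl_cons, h, if_false, List.mem_cons, List.length_cons] at this ⊢
        refine ⟨this.1, fun c => ?_, by omega⟩
        rw [this.2.1]; tauto
  have : PolyTime fun l : List β =>
      (l.foldl (fun acc b => if b ∈ acc then acc else b :: acc) []).length := by
    refine length (foldl (f := fun l acc b => if b ∈ acc then acc else b :: acc)
      (s := fun _ => ([] : List β)) (by fun_prop) (by fun_prop) (by fun_prop)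
      (.X * (.X + 1) + 1) fun l l' hl' => ?_)
    obtain ⟨h1, h2, h3⟩ := h0 l' [] List.nodup_nil
    have := size_list_le (T := (Enc.enc l).size) (n := (Enc.enc l).size)
      (l := l'.foldl (fun acc b => if b ∈ acc then acc else b :: acc) [])
      (fun b hb => by
        rw [h2] at hb
        exact size_mem_le (hl'.subset (by simpa using hb)))
      (by have := hl'.length_le.trans (length_le_size l); simp at h3; omega)
    simpa using this
  convert this using 2 with l
  obtain ⟨h1, h2, -⟩ := h0 l [] List.nodup_nil
  rw [← List.toFinset_card_of_nodup h1]
  congr 1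
  ext b
  simp [h2]

@[fun_prop] theorem rank {ts D : α → List Data} {t d : α → Data} (hts : PolyTime ts)
    (hD : PolyTime D) (ht : PolyTime t) (hd : PolyTime d) :
    PolyTime fun a => rank (ts a) (D a) (t a) (d a) := by
  have : PolyTime fun a => (((ts a).flatMap fun s => (D a).map fun e =>
      s.toInt + e.toInt).filter fun n => decide (n ≤ (t a).toInt + (d a).toInt)).toFinset.card := by
    fun_prop
  convert this using 2 with a
  rw [Eunomia.rank, displaced]
  congr 1
  ext n
  simp

end PolyTime

/-! ## Labels of the classes of columns -/

/-- A number for every column: `0` for timestamps, and different positive numbers for the other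
columns, if these are less than `W`. -/
def initLabel (W : ℕ) (S : Schema) (c : Column) : ℕ :=
  if S.IsTime c then 0 else 1 + c.1 * W + c.2

/-- Apply a list of substitutions to a number. -/
def relabel (R : List (ℕ × ℕ)) (n : ℕ) : ℕ := R.foldl (fun m p => if m = p.1 then p.2 else m) n

/-- The substitutions that identify the labels of the pairs in `δ`. -/
def labelMerges (W : ℕ) (S : Schema) (δ : List (Column × Column)) : List (ℕ × ℕ) :=
  δ.foldl (fun R e => R ++ [(relabel R (initLabel W S e.2), relabel R (initLabel W S e.1))]) []

def classLabel (W : ℕ) (S : Schema) (δ : List (Column × Column)) (c : Column) : ℕ :=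
  relabel (labelMerges W S δ) (initLabel W S c)

/-- The number 0 is the initial label of all timestamp columns. The label of the time class is thus
defined even if the schema has no timestamps. -/
def timeLabel (W : ℕ) (S : Schema) (δ : List (Column × Column)) : ℕ :=
  relabel (labelMerges W S δ) 0

/-- Relabelling creates no new numbers. The predicate is free so that this can be used both for
sizes of labels, in the running time, and for their range. -/
theorem relabel_mem (R : List (ℕ × ℕ)) (n : ℕ) (P : ℕ → Prop) (hn : P n) (hR : ∀ p ∈ R, P p.2) :
    P (relabel R n) := by
  unfold relabel
  induction R generalizing n with
  | nil => exact hn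
  | cons p R ih =>
    refine ih _ ?_ fun q hq => hR q (List.mem_cons_of_mem _ hq)
    dsimp only
    split_ifs
    exacts [hR p List.mem_cons_self, hn]

theorem labelMerges_append (W : ℕ) (S : Schema) (δ : List (Column × Column)) (e : Column × Column) :
    labelMerges W S (δ ++ [e]) = labelMerges W S δ ++
      [(classLabel W S δ e.2, classLabel W S δ e.1)] := by
  simp [labelMerges, classLabel, List.foldl_append]

theorem labelMerges_mem (W : ℕ) (S : Schema) (δ : List (Column × Column)) (P : ℕ → Prop)
    (hP : ∀ e ∈ δ, P (initLabel W S e.1) ∧ P (initLabel W S e.2)) :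
    ∀ p ∈ labelMerges W S δ, P p.1 ∧ P p.2 := by
  induction δ using List.reverseRecOn with
  | nil => simp [labelMerges]
  | append_singleton δ e ih =>
    have h1 := ih fun e he => hP e (by simp [he])
    have h2 := hP e (by simp)
    intro p hp
    rw [labelMerges_append, List.mem_append, List.mem_singleton] at hp
    rcases hp with hp | rfl
    · exact h1 p hp
    · exact ⟨relabel_mem _ _ P h2.2 fun q hq => (h1 q hq).2,
        relabel_mem _ _ P h2.1 fun q hq => (h1 q hq).2⟩

theorem labelMerges_length (W : ℕ) (S : Schema) (δ : List (Column × Column)) :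
    (labelMerges W S δ).length = δ.length := by
  induction δ using List.reverseRecOn with
  | nil => rfl
  | append_singleton δ e ih => rw [labelMerges_append]; simp [ih]

namespace PolyTime

@[fun_prop] theorem initLabel {W : α → ℕ} {S : α → Schema} {c : α → Column} (hW : PolyTime W)
    (hS : PolyTime S) (hc : PolyTime c) : PolyTime fun a => initLabel (W a) (S a) (c a) := by
  unfold Eunomia.initLabel; fun_prop

@[fun_prop] theorem relabel {R : α → List (ℕ × ℕ)} {n : α → ℕ} (hR : PolyTime R)
    (hn : PolyTime n) : PolyTime fun a => relabel (R a) (n a) := by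
  refine comp (f := fun p : List (ℕ × ℕ) × ℕ => Eunomia.relabel p.1 p.2) ?_ (mk hR hn)
  unfold Eunomia.relabel
  refine foldl (f := fun _ (m : ℕ) (p : ℕ × ℕ) => if m = p.1 then p.2 else m) (by fun_prop)
    (by fun_prop) (by fun_prop) .X fun p l hl => ?_
  refine relabel_mem l p.2 (fun m => (Enc.enc m).size ≤ Polynomial.X.eval (Enc.enc p).size) ?_ ?_
  · simp only [enc_prod, Data.size, Polynomial.eval_X]; omega
  · intro q hq
    have := size_mem_le (hl.subset hq)
    simp only [enc_prod, Data.size, Polynomial.eval_X] at this ⊢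
    omega

@[fun_prop] theorem labelMerges {W : α → ℕ} {S : α → Schema} {δ : α → List (Column × Column)}
    (hW : PolyTime W) (hS : PolyTime S) (hδ : PolyTime δ) :
    PolyTime fun a => labelMerges (W a) (S a) (δ a) := by
  refine comp (f := fun p : ℕ × Schema × List (Column × Column) =>
    Eunomia.labelMerges p.1 p.2.1 p.2.2) ?_ (mk hW (mk hS hδ))
  obtain ⟨q, hq⟩ := (initLabel (W := fun p : ℕ × Schema × Column => p.1)
    (S := fun p => p.2.1) (c := fun p => p.2.2) (by fun_prop) (by fun_prop) (by fun_prop)).size_le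
  unfold Eunomia.labelMerges
  refine foldl (f := fun (p : ℕ × Schema × List (Column × Column)) (R : List (ℕ × ℕ))
      (e : Column × Column) =>
      R ++ [(Eunomia.relabel R (Eunomia.initLabel p.1 p.2.1 e.2),
        Eunomia.relabel R (Eunomia.initLabel p.1 p.2.1 e.1))])
    (s := fun _ => ([] : List (ℕ × ℕ))) (l := fun p => p.2.2) (by fun_prop) (by fun_prop) (by fun_prop)
    (.X * ((q + q + 1) + 1) + 1) fun p l hl => ?_
  have h1 := labelMerges_mem p.1 p.2.1 l (fun m => (Enc.enc m).size ≤ q.eval (Enc.enc p).size) (by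
    intro e he
    have h2 := size_mem_le (hl.subset he)
    have h3 := hq (p.1, p.2.1, e.1)
    have h4 := hq (p.1, p.2.1, e.2)
    refine ⟨h3.trans (eval_mono q ?_), h4.trans (eval_mono q ?_)⟩ <;>
    · simp only [enc_prod, Data.size] at h2 ⊢
      omega)
  have h2 : (Eunomia.labelMerges p.1 p.2.1 l).length ≤ (Enc.enc p).size := by
    rw [labelMerges_length]
    have := hl.length_le.trans (length_le_size p.2.2)
    simp only [enc_prod, Data.size]
    omega
  have := size_list_le (l := Eunomia.labelMerges p.1 p.2.1 l)
    (T := q.eval (Enc.enc p).size + q.eval (Enc.enc p).size + 1) (fun r hr => by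
      have := h1 r hr
      have h3 : (Enc.enc r).size = (Enc.enc r.1).size + (Enc.enc r.2).size + 1 := rfl
      omega) h2
  simpa [Eunomia.labelMerges] using this

@[fun_prop] theorem classLabel {W : α → ℕ} {S : α → Schema} {δ : α → List (Column × Column)}
    {c : α → Column} (hW : PolyTime W) (hS : PolyTime S) (hδ : PolyTime δ) (hc : PolyTime c) :
    PolyTime fun a => classLabel (W a) (S a) (δ a) (c a) := by
  unfold Eunomia.classLabel; fun_prop

@[fun_prop] theorem timeLabel {W : α → ℕ} {S : α → Schema} {δ : α → List (Column × Column)}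
    (hW : PolyTime W) (hS : PolyTime S) (hδ : PolyTime δ) :
    PolyTime fun a => timeLabel (W a) (S a) (δ a) := by
  unfold Eunomia.timeLabel; fun_prop

end PolyTime

/-! ## Modular powers and multiples of points -/

/-- One step of binary exponentiation modulo `m + 1`. -/
def powStep (m : ℕ) (s : ℕ × ℕ × ℕ) : ℕ × ℕ × ℕ :=
  (if s.2.2 % 2 = 1 then s.1 * s.2.1 % (m + 1) else s.1, s.2.1 * s.2.1 % (m + 1), s.2.2 / 2)

/-- A number congruent to `b ^ e` modulo `m + 1`. -/
def powMod (m b e : ℕ) : ℕ := ((powStep m)^[(enc e).size] (1, b, e)).1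

/-- The value `a * b ^ e` is invariant under `powStep`. The ring `R` is any ring in which the
modulus vanishes, later `ZMod q`; writing the modulus as `m + 1` keeps it positive. -/
theorem powStep_iterate {m : ℕ} {R : Type} [CommRing R] (hR : ((m + 1 : ℕ) : R) = 0) (k : ℕ)
    (a b e : ℕ) (he : e < 2 ^ k) :
    (((powStep m)^[k] (a, b, e)).1 : R) = a * b ^ e := by
  have hmod : ∀ n : ℕ, ((n % (m + 1) : ℕ) : R) = n := by
    intro n
    conv_rhs => rw [← Nat.div_add_mod n (m + 1), Nat.cast_add, Nat.cast_mul, hR, zero_mul, zero_add]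
  induction k generalizing a b e with
  | zero =>
    have : e = 0 := by simpa using he
    simp [this]
  | succ k ih =>
    rw [Function.iterate_succ_apply, powStep, ih _ _ _ (by dsimp only; rw [pow_succ] at he; omega)]
    dsimp only
    have h2 : (b : R) ^ e = (b * b : R) ^ (e / 2) * b ^ (e % 2) := by
      rw [← pow_two, ← pow_mul, ← pow_add, Nat.div_add_mod]
    rw [hmod, Nat.cast_mul, h2]
    rcases Nat.mod_two_eq_zero_or_one e with h | h
    · simp [h]
    · rw [if_pos h, hmod, h]; push_cast; ring

theorem powMod_cast {m : ℕ} {R : Type} [CommRing R] (hR : ((m + 1 : ℕ) : R) = 0) (b e : ℕ) :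
    (powMod m b e : R) = b ^ e := by
  rw [powMod, powStep_iterate hR, Nat.cast_one, one_mul]
  rw [enc_nat, size_ofNat]
  exact (Nat.lt_size_self e).trans (Nat.pow_lt_pow_right (by norm_num) (by omega))

theorem powStep_bound (m b e k : ℕ) : ((powStep m)^[k] (1, b, e)).1 ≤ m + 1 ∧
    ((powStep m)^[k] (1, b, e)).2.1 ≤ m + b ∧ ((powStep m)^[k] (1, b, e)).2.2 ≤ e := by
  induction k with
  | zero => simp
  | succ k ih =>
    rw [Function.iterate_succ_apply']
    generalize (powStep m)^[k] (1, b, e) = s at *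
    have hm : ∀ n, n % (m + 1) ≤ m := fun n => Nat.lt_succ_iff.1 (Nat.mod_lt n (by omega))
    simp only [powStep]
    refine ⟨?_, (hm _).trans (by omega), by omega⟩
    split_ifs
    · exact (hm _).trans (by omega)
    · exact ih.1

@[fun_prop] theorem PolyTime.powMod {m b e : α → ℕ} (hm : PolyTime m) (hb : PolyTime b)
    (he : PolyTime e) : PolyTime fun a => powMod (m a) (b a) (e a) := by
  refine comp (f := fun p : ℕ × ℕ × ℕ => Eunomia.powMod p.1 p.2.1 p.2.2) ?_ (mk hm (mk hb he))
  have hstep : PolyTime fun p : (ℕ × ℕ × ℕ) × ℕ × ℕ × ℕ => powStep p.1.1 p.2 := by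
    unfold powStep; fun_prop
  obtain ⟨q, hq⟩ := (show PolyTime fun p : ℕ × ℕ × ℕ => (p.1 + 1, p.1 + p.2.1) by fun_prop).size_le
  unfold Eunomia.powMod
  refine fst (iter (step := fun p : ℕ × ℕ × ℕ => powStep p.1)
    (init := fun p : ℕ × ℕ × ℕ => (1, p.2.1, p.2.2))
    (n := fun p : ℕ × ℕ × ℕ => (Enc.enc p.2.2).size) hstep (by fun_prop) (by fun_prop)
    (q + q + .X + 5) ?_ ?_)
  · intro p
    simp only [enc_prod, Data.size, Polynomial.eval_add, Polynomial.eval_X, Polynomial.eval_ofNat]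
    omega
  · intro p k _
    obtain ⟨h1, h2, h3⟩ := powStep_bound p.1 p.2.1 p.2.2 k
    have hs : ∀ {a b : ℕ}, a ≤ b → (Data.ofNat a).size ≤ (Data.ofNat b).size := by
      intro a b h; rw [size_ofNat, size_ofNat]; have := Nat.size_le_size h; omega
    have h4 := hs h1
    have h5 := hs h2
    have h6 := hs h3
    have h7 := hq p
    simp only [enc_prod, enc_nat, Data.size, Polynomial.eval_add, Polynomial.eval_X,
      Polynomial.eval_ofNat] at h7 ⊢
    omega

end Eunomia
namespace Eunomia
open Enc

variable {α β γ σ : Type} [Enc α] [Enc β] [Enc γ] [Enc σ]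

theorem iterP_invariant {σ : Type} {f : σ → PMF σ} {P : σ → Prop}
    (h : ∀ s, P s → ∀ s' ∈ (f s).support, P s') (k : ℕ) (s : σ) (hs : P s) :
    ∀ s' ∈ (iterP f k s).support, P s' := by
  induction k generalizing s with
  | zero => simpa [iterP] using hs
  | succ k ih =>
    intro s' hs'
    simp only [iterP, PMF.mem_support_bind_iff] at hs'
    obtain ⟨t, ht, hs'⟩ := hs'
    exact ih t (h s hs t ht) s' hs'

section Points

variable (G : CurveFamily)

/-- Addition of encoded points. -/
noncomputable def addM (pp X Y : Data) : PMF Data := G.add.exec (.pair pp (.pair X Y))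

/-- The addition program is specified on encoded points only, so on other inputs its answers could
grow from step to step. Cutting keeps double-and-add polynomial there, and it does nothing to
genuine points. -/
def cut (B : ℕ) (d : Data) : Data := if d.size ≤ B then d else .int 0

/-- One step of the double-and-add method; encodings longer than `B` are dropped. -/
noncomputable def smulStep (B : ℕ) (pp : Data) (s : Data × Data × ℕ) : PMF (Data × Data × ℕ) :=
  (if s.2.2 % 2 = 1 then addM G pp s.1 s.2.1 else PMF.pure s.1).bind fun a =>
    (addM G pp s.2.1 s.2.1).map fun b => (cut B a, cut B b, s.2.2 / 2)

/-- Double-and-add computation of the multiple `n • X` of an encoded point of order `q`. -/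
noncomputable def smulM (e : Polynomial ℕ) (κd pp X : Data) (n q : ℕ) : PMF Data :=
  (iterP (smulStep G (e.eval κd.size) pp) (enc (n + q - 1)).size (X, X, n + q - 1)).map
    fun s => s.1

variable {G}

theorem PPTime.addM {pp X Y : α → Data} (hpp : PolyTime pp) (hX : PolyTime X) (hY : PolyTime Y) :
    PPTime fun a _ => addM G (pp a) (X a) (Y a) :=
  PPTime.exec G.add_ppt (by fun_prop)

@[fun_prop] theorem PolyTime.cut {B : α → ℕ} {d : α → Data} (hB : PolyTime B) (hd : PolyTime d) :
    PolyTime fun a => cut (B a) (d a) := by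
  unfold Eunomia.cut; fun_prop

theorem cut_size (B : ℕ) (d : Data) : (cut B d).size ≤ B + 1 := by
  unfold cut; split_ifs
  · omega
  · simp [Data.size]

theorem PPTime.smulM (e : Polynomial ℕ) {κd pp X : α → Data} {n q : α → ℕ} (hκ : PolyTime κd)
    (hpp : PolyTime pp) (hX : PolyTime X) (hn : PolyTime n) (hq : PolyTime q) :
    PPTime fun a _ => smulM G e (κd a) (pp a) (X a) (n a) (q a) := by
  have key : PPTime fun (p : Data × Data × Data × ℕ) (O : Data → PMF Data) =>
      (iterP (smulStep G (e.eval p.1.size) p.2.1) (enc p.2.2.2).size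
        (p.2.2.1, p.2.2.1, p.2.2.2)) := by
    refine PPTime.iter (step := fun (p : Data × Data × Data × ℕ) (s : Data × Data × ℕ) O =>
      smulStep G (e.eval p.1.size) p.2.1 s)
      (init := fun p => (p.2.2.1, p.2.2.1, p.2.2.2)) ?_ (by fun_prop) (by fun_prop)
      (e + .X + 1 + (e + .X + 1) + .X + 2) ?_ ?_
    · unfold smulStep
      refine PPTime.bind (F := fun (p : (Data × Data × Data × ℕ) × Data × Data × ℕ) O =>
        if p.2.2.2 % 2 = 1 then Eunomia.addM G p.1.2.1 p.2.1 p.2.2.1 else PMF.pure p.2.1)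
        (G := fun p a O => (Eunomia.addM G p.1.2.1 p.2.2.1 p.2.2.1).map fun b =>
          (Eunomia.cut (e.eval p.1.1.size) a, Eunomia.cut (e.eval p.1.1.size) b, p.2.2.2 / 2))
        (PPTime.ite (by fun_prop) (PPTime.addM (by fun_prop) (by fun_prop) (by fun_prop))
          (PPTime.pure (by fun_prop)))
        (PPTime.map (PPTime.addM (by fun_prop) (by fun_prop) (by fun_prop)) (by fun_prop))
    · intro p
      simp only [enc_prod, Data.size, Polynomial.eval_add, Polynomial.eval_X, Polynomial.eval_one,
        Polynomial.eval_ofNat]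
      omega
    · intro p O k _ s hs
      have hinv := iterP_invariant (f := smulStep G (e.eval p.1.size) p.2.1)
        (P := fun s => s.1.size ≤ e.eval p.1.size + p.2.2.1.size + 1 ∧
          s.2.1.size ≤ e.eval p.1.size + p.2.2.1.size + 1 ∧ s.2.2 ≤ p.2.2.2) (by
          rintro s ⟨h1, h2, h3⟩ s' hs'
          simp only [smulStep, PMF.mem_support_bind_iff, PMF.mem_support_map_iff] at hs'
          obtain ⟨a, -, b, -, rfl⟩ := hs'
          have ha := cut_size (e.eval p.1.size) a
          have hb := cut_size (e.eval p.1.size) b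
          exact ⟨by dsimp only; omega, by dsimp only; omega, by dsimp only; omega⟩) k
        (p.2.2.1, p.2.2.1, p.2.2.2) ⟨by dsimp only; omega, by dsimp only; omega, le_rfl⟩ s hs
      obtain ⟨h1, h2, h3⟩ := hinv
      have h4 := eval_mono e (show p.1.size ≤ (enc p).size by
        simp only [enc_prod, Data.size, enc_data]; omega)
      have h5 := Nat.size_le_size h3
      simp only [enc_prod, enc_nat, enc_data, Data.size, size_ofNat, Polynomial.eval_add,
        Polynomial.eval_X, Polynomial.eval_one, Polynomial.eval_ofNat] at h4 ⊢
      omega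
  have h2 : PPTime fun (p : Data × Data × Data × ℕ × ℕ) (O : Data → PMF Data) =>
      Eunomia.smulM G e p.1 p.2.1 p.2.2.1 p.2.2.2.1 p.2.2.2.2 := by
    unfold Eunomia.smulM
    refine PPTime.map (F := fun (p : Data × Data × Data × ℕ × ℕ) (O : Data → PMF Data) =>
      (iterP (smulStep G (e.eval p.1.size) p.2.1) (enc (p.2.2.2.1 + p.2.2.2.2 - 1)).size
        (p.2.2.1, p.2.2.1, p.2.2.2.1 + p.2.2.2.2 - 1))) (g := fun p s => s.1) ?_ (by fun_prop)
    exact PPTime.comp key (f := fun p : Data × Data × Data × ℕ × ℕ =>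
      (p.1, p.2.1, p.2.2.1, p.2.2.2.1 + p.2.2.2.2 - 1)) (by fun_prop)
  exact PPTime.comp h2 (f := fun a => (κd a, pp a, X a, n a, q a)) (by fun_prop)

/-- The double-and-add method is correct for parameters produced by the setup. -/
theorem smulM_eq {e : Polynomial ℕ} (he : ∀ κ, ∀ pp ∈ (G.setup.exec (.unary κ)).support,
    ∀ X, ((G.curve pp).encode X).size ≤ e.eval κ) {κ : ℕ} {pp κd : Data}
    (hpp : pp ∈ (G.setup.exec (.unary κ)).support) (hκ : κ ≤ κd.size)
    (X : (G.curve pp).W.Point) (hX : (G.curve pp).q • X = 0) (n : ℕ) :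
    smulM G e κd pp ((G.curve pp).encode X) n (G.curve pp).q =
      PMF.pure ((G.curve pp).encode (n • X)) := by
  have hcut : ∀ Y, cut (e.eval κd.size) ((G.curve pp).encode Y) = (G.curve pp).encode Y := fun Y =>
    if_pos ((he κ pp hpp Y).trans (eval_mono e hκ))
  have hit : ∀ k m (A B : (G.curve pp).W.Point), m < 2 ^ k → ∃ B',
      iterP (smulStep G (e.eval κd.size) pp) k ((G.curve pp).encode A, (G.curve pp).encode B, m) =
        PMF.pure ((G.curve pp).encode (A + m • B), B') := by
    intro k
    induction k with
    | zero =>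
      intro m A B hm
      have : m = 0 := by simpa using hm
      subst this
      exact ⟨_, by simp [iterP]; rfl⟩
    | succ k ih =>
      intro m A B hm
      obtain ⟨B', hB'⟩ := ih (m / 2) (if m % 2 = 1 then A + B else A) (B + B)
        (by rw [pow_succ] at hm; omega)
      refine ⟨B', ?_⟩
      have hstep : smulStep G (e.eval κd.size) pp
          ((G.curve pp).encode A, (G.curve pp).encode B, m) = PMF.pure
          ((G.curve pp).encode (if m % 2 = 1 then A + B else A), (G.curve pp).encode (B + B),
            m / 2) := by
        simp only [smulStep, addM, G.add_spec κ pp hpp, PMF.pure_map]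
        split_ifs <;> simp [hcut]
      rw [iterP, hstep, PMF.pure_bind, hB']
      congr 3
      have h2 : m • B = (m / 2) • (B + B) + (m % 2) • B := by
        conv_lhs => rw [← Nat.div_add_mod m 2]
        rw [add_smul, mul_comm, mul_smul, two_smul]
      rw [h2]
      rcases Nat.mod_two_eq_zero_or_one m with h | h
      · simp [h]
      · simp only [h, if_true, one_smul]; abel
  have hq := (G.curve pp).prime.out.pos
  obtain ⟨B', hB'⟩ := hit (enc (n + (G.curve pp).q - 1)).size (n + (G.curve pp).q - 1) X X (by
    rw [enc_nat, size_ofNat]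
    exact (Nat.lt_size_self _).trans (Nat.pow_lt_pow_right (by norm_num) (by omega)))
  rw [smulM, hB', PMF.pure_map]
  congr 2
  -- The accumulator starts with `X`, since no encoding of the neutral element is at hand for a
  -- program. The excess is a multiple of `q • X = 0`; adding `q - 1` instead of subtracting 1 also
  -- covers `n = 0`.
  have : X + (n + (G.curve pp).q - 1) • X = (n + (G.curve pp).q) • X := by
    rw [← succ_nsmul']; congr 1; omega
  dsimp only
  rw [this, add_smul, hX, add_zero]

end Points

/-! ## The view of the adversary -/

/-- Fill the cells of a log by a random experiment for each position. -/
noncomputable def mapLog (f : Column → ℕ → PMF Data) (L : Log) : PMF Data :=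
  (sampleList (fun T : List (List Data) × ℕ =>
    (sampleList (fun R : List Data × ℕ =>
      (sampleList (fun v : Data × ℕ => f (T.2, v.2) R.2) R.1.zipIdx).map Data.ofList)
      T.1.zipIdx).map Data.ofList) L.zipIdx).map Data.ofList

/-- The construction of the mOPED structure, with given encryptions of the timestamps (named by
their positions) and of the displacements. -/
noncomputable def mopedView (hT : ℕ → PMF Data) (hD : Data → PMF Data) (ts D : List Data) :
    PMF Data :=
  (sampleList (fun j => (sampleList (fun t : Data × ℕ => sampleList (fun d =>
    (hT t.2).bind fun a => (hD d).map fun b =>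
      Data.ofList [a, b, .ofNat (rank (ts.take j) D t.1 d)]) D) (ts.take j).zipIdx).map
    fun l => Data.ofList l.flatten) (List.range (ts.length + 1))).map Data.ofList

noncomputable def constantsView (encr : Column → Data → PMF Data) (S : Schema) (C : List Data)
    (L : Log) : PMF Data :=
  (sampleList (fun p : Column × Data => (encr p.1 p.2).map fun e =>
      Data.ofList [columnData p.1, p.2, e])
    (S.columns.flatMap fun c => (C.filter fun v => v ∈ L.column c).map fun v => (c, v))).map
    Data.ofList

/-- The second phase of the attack for the choice `x`, with given experiments for the cells of the
log, the timestamps, the displacements, and the encryption of other values. -/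
noncomputable def attack (A₂ : Prog) (x : Data) (cell : Column → ℕ → PMF Data)
    (hT : ℕ → PMF Data) (hD : Data → PMF Data) (encr : Column → Data → PMF Data) (toks : Data) :
    PMF Data :=
  (mapLog cell (firstLog x)).bind fun eDB =>
  (mopedView hT hD (timeStamps (schemaOf x) (firstLog x)) (displacementsOf x)).bind fun eT =>
  (constantsView encr (schemaOf x) (constantsOf x) (firstLog x)).bind fun cs =>
  A₂.execWith (fun y =>
      if y.snd ∈ (firstLog x).values ∨ y.snd ∈ (secondLog x).values then PMF.pure (.int 0)
      else if hasColumn (schemaOf x) (Column.ofData y.fst) = true then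
        encr (Column.ofData y.fst) y.snd
      else PMF.pure (.int 0))
    (.pair (stateOf x) (.ofList [eDB, eT, toks, cs]))

theorem PPTime.mapLog {f : α → Column → ℕ → (Data → PMF Data) → PMF Data} {L : α → Log}
    (hf : PPTime fun p : α × Column × ℕ => f p.1 p.2.1 p.2.2) (hL : PolyTime L) :
    PPTime fun a O => mapLog (fun c i => f a c i O) (L a) := by
  unfold Eunomia.mapLog
  refine PPTime.map (g := fun a l => Data.ofList l) ?_ (by fun_prop)
  refine PPTime.sampleList (f := fun a (T : List (List Data) × ℕ) O =>
    (Eunomia.sampleList (fun R : List Data × ℕ =>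
      (Eunomia.sampleList (fun v : Data × ℕ => f a (T.2, v.2) R.2 O) R.1.zipIdx).map Data.ofList)
      T.1.zipIdx).map Data.ofList) ?_ (by fun_prop)
  refine PPTime.map (g := fun a l => Data.ofList l) ?_ (by fun_prop)
  refine PPTime.sampleList (f := fun (p : α × List (List Data) × ℕ) (R : List Data × ℕ) O =>
      (Eunomia.sampleList (fun v : Data × ℕ => f p.1 (p.2.2, v.2) R.2 O) R.1.zipIdx).map
        Data.ofList) ?_ (by fun_prop)
  refine PPTime.map (g := fun a l => Data.ofList l) ?_ (by fun_prop)
  refine PPTime.sampleList (f := fun (p : (α × List (List Data) × ℕ) × List Data × ℕ)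
    (v : Data × ℕ) O => f p.1.1 (p.1.2.2, v.2) p.2.2 O) ?_ (by fun_prop)
  exact PPTime.comp hf (f := fun p : ((α × List (List Data) × ℕ) × List Data × ℕ) × Data × ℕ =>
    (p.1.1.1, (p.1.1.2.2, p.2.2), p.1.2.2)) (by fun_prop)

theorem PPTime.mopedView {hT : α → ℕ → (Data → PMF Data) → PMF Data}
    {hD : α → Data → (Data → PMF Data) → PMF Data} {ts D : α → List Data}
    (hT' : PPTime fun p : α × ℕ => hT p.1 p.2) (hD' : PPTime fun p : α × Data => hD p.1 p.2)
    (hts : PolyTime ts) (hD'' : PolyTime D) :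
    PPTime fun a O => mopedView (fun i => hT a i O) (fun d => hD a d O) (ts a) (D a) := by
  unfold Eunomia.mopedView
  refine PPTime.map (g := fun a l => Data.ofList l) ?_ (by fun_prop)
  have hr : PolyTime fun a => List.range ((ts a).length + 1) := by
    have : PolyTime fun a => List.range ((Data.int 0 :: ts a).length) := by fun_prop
    exact this
  refine PPTime.sampleList (f := fun a j O => (Eunomia.sampleList (fun t : Data × ℕ =>
    Eunomia.sampleList (fun d => (hT a t.2 O).bind fun x => (hD a d O).map fun y =>
      Data.ofList [x, y, .ofNat (Eunomia.rank ((ts a).take j) (D a) t.1 d)]) (D a))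
      ((ts a).take j).zipIdx).map fun l => Data.ofList l.flatten) ?_ hr
  refine PPTime.map (g := fun a (l : List (List Data)) => Data.ofList l.flatten) ?_ (by fun_prop)
  refine PPTime.sampleList (f := fun (p : α × ℕ) (t : Data × ℕ) O =>
    Eunomia.sampleList (fun d => (hT p.1 t.2 O).bind fun x => (hD p.1 d O).map fun y =>
      Data.ofList [x, y, .ofNat (Eunomia.rank ((ts p.1).take p.2) (D p.1) t.1 d)]) (D p.1)) ?_
    (by fun_prop)
  refine PPTime.sampleList (f := fun (p : (α × ℕ) × Data × ℕ) d O =>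
    (hT p.1.1 p.2.2 O).bind fun x => (hD p.1.1 d O).map fun y =>
      Data.ofList [x, y, .ofNat (Eunomia.rank ((ts p.1.1).take p.1.2) (D p.1.1) p.2.1 d)]) ?_
    (by fun_prop)
  refine PPTime.bind (F := fun (p : ((α × ℕ) × Data × ℕ) × Data) O => hT p.1.1.1 p.1.2.2 O)
    (G := fun p x O => (hD p.1.1.1 p.2 O).map fun y =>
      Data.ofList [x, y, .ofNat (Eunomia.rank ((ts p.1.1.1).take p.1.1.2) (D p.1.1.1) p.1.2.1 p.2)])
    (PPTime.comp hT' (f := fun p : ((α × ℕ) × Data × ℕ) × Data => (p.1.1.1, p.1.2.2))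
      (by fun_prop)) ?_
  exact PPTime.map (PPTime.comp hD'
    (f := fun p : (((α × ℕ) × Data × ℕ) × Data) × Data => (p.1.1.1.1, p.1.2)) (by fun_prop))
    (by fun_prop)

theorem PPTime.constantsView {encr : α → Column → Data → (Data → PMF Data) → PMF Data}
    {S : α → Schema} {C : α → List Data} {L : α → Log}
    (he : PPTime fun p : α × Column × Data => encr p.1 p.2.1 p.2.2)
    (hS : PolyTime S) (hC : PolyTime C) (hL : PolyTime L) :
    PPTime fun a O => constantsView (fun c v => encr a c v O) (S a) (C a) (L a) := by
  unfold Eunomia.constantsView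
  refine PPTime.map (g := fun a l => Data.ofList l) ?_ (by fun_prop)
  refine PPTime.sampleList (f := fun a (p : Column × Data) O => (encr a p.1 p.2 O).map fun e =>
      Data.ofList [columnData p.1, p.2, e]) ?_ (by fun_prop)
  exact PPTime.map (g := fun (p : α × Column × Data) e => Data.ofList [columnData p.2.1, p.2.2, e])
    he (by fun_prop)

theorem PPTime.attack {A₂ : Prog} (hA : A₂.PPT) {x : α → Data}
    {cell : α → Column → ℕ → (Data → PMF Data) → PMF Data}
    {hT : α → ℕ → (Data → PMF Data) → PMF Data} {hD : α → Data → (Data → PMF Data) → PMF Data}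
    {encr : α → Column → Data → (Data → PMF Data) → PMF Data} {toks : α → Data}
    (hx : PolyTime x) (hcell : PPTime fun p : α × Column × ℕ => cell p.1 p.2.1 p.2.2)
    (hT' : PPTime fun p : α × ℕ => hT p.1 p.2) (hD' : PPTime fun p : α × Data => hD p.1 p.2)
    (he : PPTime fun p : α × Column × Data => encr p.1 p.2.1 p.2.2) (ht : PolyTime toks) :
    PPTime fun a O => attack A₂ (x a) (fun c i => cell a c i O) (fun i => hT a i O)
      (fun d => hD a d O) (fun c v => encr a c v O) (toks a) := by
  have h1 := PPTime.mopedView (ts := fun a => timeStamps (schemaOf (x a)) (firstLog (x a)))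
    (D := fun a => displacementsOf (x a)) hT' hD' (by fun_prop) (by fun_prop)
  have h2 := PPTime.constantsView (S := fun a => schemaOf (x a)) (C := fun a => constantsOf (x a))
    (L := fun a => firstLog (x a)) he (by fun_prop) (by fun_prop) (by fun_prop)
  unfold Eunomia.attack
  refine PPTime.bind (PPTime.mapLog hcell (by fun_prop)) ?_
  refine PPTime.bind (PPTime.comp h1 (f := fun p : α × Data => p.1) (by fun_prop)) ?_
  refine PPTime.bind (PPTime.comp h2 (f := fun p : (α × Data) × Data => p.1.1) (by fun_prop)) ?_
  refine PPTime.execWith hA (H := fun (p : ((α × Data) × Data) × Data) y O =>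
      if y.snd ∈ (firstLog (x p.1.1.1)).values ∨ y.snd ∈ (secondLog (x p.1.1.1)).values then
        PMF.pure (.int 0)
      else if hasColumn (schemaOf (x p.1.1.1)) (Column.ofData y.fst) = true then
        encr p.1.1.1 (Column.ofData y.fst) y.snd O
      else PMF.pure (.int 0)) ?_ (by fun_prop)
  refine PPTime.ite (by fun_prop) (PPTime.pure (by fun_prop))
    (PPTime.ite (by fun_prop) ?_ (PPTime.pure (by fun_prop)))
  exact PPTime.comp he (f := fun p : (((α × Data) × Data) × Data) × Data =>
    (p.1.1.1.1, Column.ofData p.2.fst, p.2.snd)) (by fun_prop)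

end Eunomia
namespace Eunomia
open Enc

variable {α β γ σ : Type} [Enc α] [Enc β] [Enc γ] [Enc σ]

/-! ## Keys and the hybrid games, with scalars written as natural numbers -/

/-- The key of the timestamps, and the hash key and encryption key of all columns. -/
abbrev KeyTable := ℕ × List (List (ℕ × Data))

/-- The keys of the scheme in a form that programs can handle. A uniform number below `q - 1`, plus
1, represents a uniform unit (`unitNat_eq`), so up to notation this is the law of `keyGen` without
the master key (`keyGen_map`). -/
noncomputable def natKeys (SE : EncScheme) (κd : Data) (q : ℕ) (S : Schema) : PMF KeyTable :=
  (uniformNat (q - 1)).bind fun t =>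
    (sampleList (fun T : List Bool => sampleList (fun isTime : Bool =>
      (if isTime = true then PMF.pure (t + 1) else (uniformNat (q - 1)).map fun n => n + 1).bind
        fun kh => (SE.gen.exec κd).map fun ke => (kh, ke)) T) S).map fun cols => (t + 1, cols)

/-- The default 1 makes hash keys nonzero modulo `q` even for columns that do not exist. -/
def KeyTable.hashKey (K : KeyTable) (c : Column) : ℕ := ((K.2.getD c.1 []).getD c.2 (1, .int 0)).1

def KeyTable.encKey (K : KeyTable) (c : Column) : Data :=
  ((K.2.getD c.1 []).getD c.2 (1, .int 0)).2

/-- The inverse of a key is its power with exponent `q - 2`, by Fermat. Pairs with missing columns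
are not filtered out, as valid choices have none. -/
def tokenData (q : ℕ) (K : KeyTable) (δ : List (Column × Column)) : Data :=
  .ofList (δ.map fun p => .ofList [columnData p.1, columnData p.2,
    .ofNat (K.hashKey p.2 * powMod (q - 1) (K.hashKey p.1) (q - 2) % q)])

/-- The attack where the columns with label below `θ` have the hashes of the first log, the others
have the hashes of the second log, and all ciphertexts are those of the first log. The hash of `v`
under the key `k` is `h b k v`, where `b` says whether the label is `J`. -/
noncomputable def hybridAttack (A₂ : Prog) (SE : EncScheme) (x : Data) (w q J θ : ℕ) (K : KeyTable)
    (h : Bool → ℕ → Data → PMF Data) : PMF Data :=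
  attack A₂ x
    (fun c i => (h (decide (classLabel w (schemaOf x) (pairsOf x) c = J)) (K.hashKey c)
      (if classLabel w (schemaOf x) (pairsOf x) c < θ then (firstLog x).cellD c i
        else (secondLog x).cellD c i)).bind fun p =>
      (SE.enc.exec (.pair (K.encKey c) ((firstLog x).cellD c i))).map (Data.pair p))
    (fun i => h (decide (timeLabel w (schemaOf x) (pairsOf x) = J)) K.1
      ((if timeLabel w (schemaOf x) (pairsOf x) < θ then timeStamps (schemaOf x) (firstLog x)
        else timeStamps (schemaOf x) (secondLog x)).getD i (.int 0)))
    (fun d => h (decide (timeLabel w (schemaOf x) (pairsOf x) = J)) K.1 d)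
    (fun c v => (h (decide (classLabel w (schemaOf x) (pairsOf x) c = J)) (K.hashKey c) v).bind
      fun p => (SE.enc.exec (.pair (K.encKey c) v)).map (Data.pair p))
    (tokenData q K (pairsOf x))

noncomputable def hybridAt (A₁ A₂ : Prog) (SE : EncScheme) (w : ℕ) (d : Data) (q J θ : ℕ)
    (h : Bool → ℕ → Data → PMF Data) : PMF Data :=
  (A₁.exec d).bind fun x => (natKeys SE d.fst q (schemaOf x)).bind fun K =>
    hybridAttack A₂ SE x w q J θ K h

/-- The number of labels that can occur when the numbers of tables and columns are less than `w`. -/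
def labelBound (w : ℕ) : ℕ := w * w + 1

/-- The length of a list, e.g. of the security parameter in unary. -/
def listLength (d : Data) : ℕ := d.toList.length

/-- The hybrid attack at a random class; the hashes in this class are those of the second log if
`side = 0`, and those of the first log if `side = 1`. -/
noncomputable def randomHybrid (A₁ A₂ : Prog) (SE : EncScheme) (W : Polynomial ℕ) (side : ℕ)
    (d : Data) (q : ℕ) (h : Bool → ℕ → Data → PMF Data) : PMF Data :=
  (uniformNat (labelBound (W.eval (listLength d.fst)))).bind fun J =>
    hybridAt A₁ A₂ SE (W.eval (listLength d.fst)) d q J (J + side) h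

namespace PolyTime

@[fun_prop] theorem hashKey {K : α → KeyTable} {c : α → Column} (hK : PolyTime K)
    (hc : PolyTime c) : PolyTime fun a => (K a).hashKey (c a) := by
  unfold KeyTable.hashKey; fun_prop

@[fun_prop] theorem encKey {K : α → KeyTable} {c : α → Column} (hK : PolyTime K)
    (hc : PolyTime c) : PolyTime fun a => (K a).encKey (c a) := by
  unfold KeyTable.encKey; fun_prop

@[fun_prop] theorem tokenData {q : α → ℕ} {K : α → KeyTable} {δ : α → List (Column × Column)}
    (hq : PolyTime q) (hK : PolyTime K) (hδ : PolyTime δ) :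
    PolyTime fun a => tokenData (q a) (K a) (δ a) := by
  unfold Eunomia.tokenData; fun_prop

@[fun_prop] theorem listLength {d : α → Data} (hd : PolyTime d) :
    PolyTime fun a => listLength (d a) := by
  unfold Eunomia.listLength; fun_prop

@[fun_prop] theorem labelBound {w : α → ℕ} (hw : PolyTime w) :
    PolyTime fun a => labelBound (w a) := by
  unfold Eunomia.labelBound; fun_prop

end PolyTime

theorem PPTime.natKeys (SE : EncScheme) {κd : α → Data} {q : α → ℕ} {S : α → Schema}
    (hκ : PolyTime κd) (hq : PolyTime q) (hS : PolyTime S) :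
    PPTime fun a _ => natKeys SE (κd a) (q a) (S a) := by
  unfold Eunomia.natKeys
  refine PPTime.bind (PPTime.uniformNat (by fun_prop)) ?_
  refine PPTime.map (g := fun (p : α × ℕ) cols => (p.2 + 1, cols)) ?_ (by fun_prop)
  refine PPTime.sampleList (f := fun (p : α × ℕ) T O => Eunomia.sampleList (fun isTime : Bool =>
      (if isTime = true then PMF.pure (p.2 + 1)
        else (Eunomia.uniformNat (q p.1 - 1)).map fun n => n + 1).bind
        fun kh => (SE.gen.exec (κd p.1)).map fun ke => (kh, ke)) T) ?_ (by fun_prop)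
  refine PPTime.sampleList (f := fun (p : (α × ℕ) × List Bool) isTime O =>
      (if isTime = true then PMF.pure (p.1.2 + 1)
        else (Eunomia.uniformNat (q p.1.1 - 1)).map fun n => n + 1).bind
        fun kh => (SE.gen.exec (κd p.1.1)).map fun ke => (kh, ke)) ?_ (by fun_prop)
  refine PPTime.bind (F := fun (p : ((α × ℕ) × List Bool) × Bool) O =>
    if p.2 = true then PMF.pure (p.1.1.2 + 1)
        else (Eunomia.uniformNat (q p.1.1.1 - 1)).map fun n => n + 1)
      (G := fun (p : ((α × ℕ) × List Bool) × Bool) (kh : ℕ) O =>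
        (SE.gen.exec (κd p.1.1.1)).map fun ke => (kh, ke))
      (PPTime.ite (by fun_prop) (PPTime.pure (by fun_prop)) ?_) ?_
  · exact PPTime.map (g := fun p n => n + 1) (PPTime.uniformNat (by fun_prop)) (by fun_prop)
  · exact PPTime.map (g := fun (p : (((α × ℕ) × List Bool) × Bool) × ℕ) ke => (p.2, ke))
      (PPTime.exec SE.gen_ppt (by fun_prop)) (by fun_prop)

theorem PPTime.hybridAttack {A₂ : Prog} (hA : A₂.PPT) (SE : EncScheme) {x : α → Data}
    {w q J θ : α → ℕ} {K : α → KeyTable} {h : α → Bool → ℕ → Data → (Data → PMF Data) → PMF Data}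
    (hx : PolyTime x) (hw : PolyTime w) (hq : PolyTime q) (hJ : PolyTime J) (hθ : PolyTime θ)
    (hK : PolyTime K) (hh : PPTime fun p : α × Bool × ℕ × Data => h p.1 p.2.1 p.2.2.1 p.2.2.2) :
    PPTime fun a O => hybridAttack A₂ SE (x a) (w a) (q a) (J a) (θ a) (K a)
      (fun b k v => h a b k v O) := by
  unfold Eunomia.hybridAttack
  have hcol : PPTime fun (p : α × Column × Data × Data) O =>
      (h p.1 (decide (classLabel (w p.1) (schemaOf (x p.1)) (pairsOf (x p.1)) p.2.1 = J p.1))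
        ((K p.1).hashKey p.2.1) p.2.2.1 O).bind fun e =>
      (SE.enc.exec (.pair ((K p.1).encKey p.2.1) p.2.2.2)).map (Data.pair e) := by
    refine PPTime.bind (PPTime.comp hh (f := fun p : α × Column × Data × Data => (p.1,
      decide (classLabel (w p.1) (schemaOf (x p.1)) (pairsOf (x p.1)) p.2.1 = J p.1),
      (K p.1).hashKey p.2.1, p.2.2.1)) (by fun_prop)) ?_
    exact PPTime.map (g := fun (p : (α × Column × Data × Data) × Data) c => Data.pair p.2 c)
      (PPTime.exec SE.enc_ppt (by fun_prop)) (by fun_prop)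
  refine PPTime.attack hA hx ?_ ?_ ?_ ?_ (by fun_prop)
  · exact PPTime.comp hcol (f := fun p : α × Column × ℕ => (p.1, p.2.1,
      (if classLabel (w p.1) (schemaOf (x p.1)) (pairsOf (x p.1)) p.2.1 < θ p.1
        then (firstLog (x p.1)).cellD p.2.1 p.2.2 else (secondLog (x p.1)).cellD p.2.1 p.2.2),
      (firstLog (x p.1)).cellD p.2.1 p.2.2)) (by fun_prop)
  · exact PPTime.comp hh (f := fun p : α × ℕ => (p.1,
      decide (timeLabel (w p.1) (schemaOf (x p.1)) (pairsOf (x p.1)) = J p.1), (K p.1).1,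
      ((if timeLabel (w p.1) (schemaOf (x p.1)) (pairsOf (x p.1)) < θ p.1
        then timeStamps (schemaOf (x p.1)) (firstLog (x p.1))
        else timeStamps (schemaOf (x p.1)) (secondLog (x p.1))).getD p.2 (.int 0)))) (by fun_prop)
  · exact PPTime.comp hh (f := fun p : α × Data => (p.1,
      decide (timeLabel (w p.1) (schemaOf (x p.1)) (pairsOf (x p.1)) = J p.1), (K p.1).1, p.2))
      (by fun_prop)
  · exact PPTime.comp hcol (f := fun p : α × Column × Data => (p.1, p.2.1, p.2.2, p.2.2))
      (by fun_prop)

theorem PPTime.randomHybrid {A₁ A₂ : Prog} (hA₁ : A₁.PPT) (hA₂ : A₂.PPT) (SE : EncScheme)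
    (W : Polynomial ℕ) (side : ℕ) {d : α → Data} {q : α → ℕ}
    {h : α → Bool → ℕ → Data → (Data → PMF Data) → PMF Data} (hd : PolyTime d) (hq : PolyTime q)
    (hh : PPTime fun p : α × Bool × ℕ × Data => h p.1 p.2.1 p.2.2.1 p.2.2.2) :
    PPTime fun a O => randomHybrid A₁ A₂ SE W side (d a) (q a) (fun b k v => h a b k v O) := by
  unfold Eunomia.randomHybrid hybridAt
  refine PPTime.bind (PPTime.uniformNat (by fun_prop)) ?_
  refine PPTime.bind (PPTime.exec (α := α × ℕ) hA₁ (x := fun p => d p.1) (by fun_prop)) ?_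
  refine PPTime.bind (PPTime.natKeys (α := (α × ℕ) × Data) SE (κd := fun p => (d p.1.1).fst)
    (q := fun p => q p.1.1) (S := fun p => schemaOf p.2) (by fun_prop) (by fun_prop)
    (by fun_prop)) ?_
  refine PPTime.hybridAttack (α := ((α × ℕ) × Data) × KeyTable) hA₂ SE (x := fun p => p.1.2)
    (w := fun p => W.eval (Eunomia.listLength (d p.1.1.1).fst)) (q := fun p => q p.1.1.1)
    (J := fun p => p.1.1.2) (θ := fun p => p.1.1.2 + side) (K := fun p => p.2)
    (h := fun p => h p.1.1.1)
    (by fun_prop) (by fun_prop) (by fun_prop) (by fun_prop) (by fun_prop) (by fun_prop) ?_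
  exact PPTime.comp hh (f := fun p : (((α × ℕ) × Data) × KeyTable) × Bool × ℕ × Data =>
    (p.1.1.1.1, p.2)) (by fun_prop)

/-! ## The adversaries against the pseudorandom function and the decisional Diffie-Hellman problem -/

/-- Ask the oracle for a number below `q`. -/
noncomputable def askNat (O : Data → PMF Data) (q : ℕ) (y : Data) : PMF ℕ :=
  ((O y).map fun z => if z.size ≤ (Data.ofNat q).size then z else .int 0).map Data.toNat

/-- The hash `n k P`, where `n` is computed from the hashed value. -/
noncomputable def scalarHash (G : CurveFamily) (e : Polynomial ℕ) (d : Data)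
    (F : Bool → Data → PMF ℕ) (b : Bool) (k : ℕ) (v : Data) : PMF Data :=
  (F b v).bind fun n =>
    smulM G e d.fst d.snd d.snd.snd.snd (k * n) d.snd.snd.fst.toNat

/-- Domain separation: the values of one function at the two tagged copies of `v` play the role of
two functions `y`, `y'` at `v`, so that a single `DET` key suffices. -/
def tagged (b : Bool) (v : Data) : Data := .pair (enc b) v

/-- Linear combinations of two values of the oracle. -/
noncomputable def linearScalar (O : Data → PMF Data) (q a b z : ℕ) (chal : Bool) (v : Data) :
    PMF ℕ :=
  (askNat O q (tagged false v)).bind fun y => (askNat O q (tagged true v)).map fun y' =>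
    if chal = true then z * y + b * y' else a * y + y'

/-- The hash computed from the points `A`, `B`, `Z`. -/
noncomputable def pointHash (G : CurveFamily) (H : DetScheme G) (e : Polynomial ℕ) (d key A B Z : Data)
    (b : Bool) (k : ℕ) (v : Data) : PMF Data :=
  (H.prog.exec (.pair d.snd (.pair key (tagged false v)))).bind fun y =>
  (H.prog.exec (.pair d.snd (.pair key (tagged true v)))).bind fun y' =>
  (smulM G e d.fst d.snd (if b = true then Z else A) (k * y.toNat) d.snd.snd.fst.toNat).bind
    fun X =>
  (smulM G e d.fst d.snd (if b = true then B else d.snd.snd.snd) (k * y'.toNat)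
    d.snd.snd.fst.toNat).bind fun Y => addM G d.snd X Y

theorem PPTime.askNat {q : α → ℕ} {y : α → Data} (hq : PolyTime q) (hy : PolyTime y) :
    PPTime fun a O => askNat O (q a) (y a) := by
  unfold Eunomia.askNat
  exact PPTime.map (g := fun a (z : Data) => z.toNat) (PPTime.oracle (by fun_prop) hy) (by fun_prop)

theorem PPTime.scalarHash (G : CurveFamily) (e : Polynomial ℕ) {d : α → Data}
    {F : α → Bool → Data → (Data → PMF Data) → PMF ℕ} {b : α → Bool} {k : α → ℕ} {v : α → Data}
    (hd : PolyTime d) (hF : PPTime fun p : α × Bool × Data => F p.1 p.2.1 p.2.2) (hb : PolyTime b)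
    (hk : PolyTime k) (hv : PolyTime v) :
    PPTime fun a O => scalarHash G e (d a) (fun b v => F a b v O) (b a) (k a) (v a) := by
  unfold Eunomia.scalarHash
  exact PPTime.bind (PPTime.comp hF (f := fun a => (a, b a, v a)) (by fun_prop))
    (PPTime.smulM e (by fun_prop) (by fun_prop) (by fun_prop) (by fun_prop) (by fun_prop))

@[fun_prop] theorem PolyTime.tagged {b : α → Bool} {v : α → Data} (hb : PolyTime b)
    (hv : PolyTime v) : PolyTime fun a => tagged (b a) (v a) := by
  unfold Eunomia.tagged; fun_prop

/-- The hybrid attack whose hashes are given by the oracle, with separate values for the class `J`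
and for the other classes. -/
theorem exists_taggedAdversary (G : CurveFamily) (SE : EncScheme) {A₁ A₂ : Prog} (hA₁ : A₁.PPT)
    (hA₂ : A₂.PPT) (W e : Polynomial ℕ) (side : ℕ) : ∃ B : Prog, B.PPT ∧ ∀ O d, B.execWith O d =
      randomHybrid A₁ A₂ SE W side d d.snd.snd.fst.toNat
        (scalarHash G e d fun b v => askNat O d.snd.snd.fst.toNat (tagged b v)) := by
  have : PPTime fun (d : Data) O => randomHybrid A₁ A₂ SE W side d d.snd.snd.fst.toNat
        (scalarHash G e d fun b v => askNat O d.snd.snd.fst.toNat (tagged b v)) := by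
    refine PPTime.randomHybrid hA₁ hA₂ SE W side (h := fun d b k v O =>
      scalarHash G e d (fun b v => askNat O d.snd.snd.fst.toNat (tagged b v)) b k v)
      (by fun_prop) (by fun_prop) ?_
    exact PPTime.scalarHash G e (F := fun (p : Data × Bool × ℕ × Data) b v O =>
      askNat O p.1.snd.snd.fst.toNat (tagged b v)) (by fun_prop)
      (PPTime.askNat (by fun_prop) (by fun_prop)) (by fun_prop) (by fun_prop) (by fun_prop)
  obtain ⟨B, hB, h⟩ := this
  exact ⟨B, hB, fun O d => (h d O).trans (PMF.map_id _)⟩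

/-- With oracle `DET` this is the hybrid attack with the hashes of the scheme; it serves the first
replacement of `DET` by a random function. -/
theorem exists_plainAdversary (G : CurveFamily) (SE : EncScheme) {A₁ A₂ : Prog} (hA₁ : A₁.PPT)
    (hA₂ : A₂.PPT) (W e : Polynomial ℕ) (side : ℕ) : ∃ B : Prog, B.PPT ∧ ∀ O d, B.execWith O d =
      randomHybrid A₁ A₂ SE W side d d.snd.snd.fst.toNat
        (scalarHash G e d fun _ v => askNat O d.snd.snd.fst.toNat v) := by
  have : PPTime fun (d : Data) O => randomHybrid A₁ A₂ SE W side d d.snd.snd.fst.toNat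
        (scalarHash G e d fun b v => askNat O d.snd.snd.fst.toNat v) := by
    refine PPTime.randomHybrid hA₁ hA₂ SE W side (h := fun d b k v O =>
      scalarHash G e d (fun b v => askNat O d.snd.snd.fst.toNat v) b k v)
      (by fun_prop) (by fun_prop) ?_
    exact PPTime.scalarHash G e (F := fun (p : Data × Bool × ℕ × Data) b v O =>
      askNat O p.1.snd.snd.fst.toNat v) (by fun_prop)
      (PPTime.askNat (by fun_prop) (by fun_prop)) (by fun_prop) (by fun_prop) (by fun_prop)
  obtain ⟨B, hB, h⟩ := this
  exact ⟨B, hB, fun O d => (h d O).trans (PMF.map_id _)⟩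

/-- The scalars of the Diffie-Hellman triple are drawn by the adversary itself. With oracle `DET` it
therefore agrees with one of the two DDH experiments, and with a random oracle it becomes a purely
statistical game. -/
theorem exists_linearAdversary (G : CurveFamily) (SE : EncScheme) {A₁ A₂ : Prog} (hA₁ : A₁.PPT)
    (hA₂ : A₂.PPT) (W e : Polynomial ℕ) (side : ℕ) (real : Bool) :
    ∃ B : Prog, B.PPT ∧ ∀ O d, B.execWith O d =
      (uniformNat d.snd.snd.fst.toNat).bind fun a => (uniformNat d.snd.snd.fst.toNat).bind fun b =>
      (uniformNat d.snd.snd.fst.toNat).bind fun c =>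
      randomHybrid A₁ A₂ SE W side d d.snd.snd.fst.toNat
        (scalarHash G e d (linearScalar O d.snd.snd.fst.toNat a b
          (if real = true then a * b else c))) := by
  have : PPTime fun (d : Data) O =>
      (uniformNat d.snd.snd.fst.toNat).bind fun a => (uniformNat d.snd.snd.fst.toNat).bind fun b =>
      (uniformNat d.snd.snd.fst.toNat).bind fun c =>
      randomHybrid A₁ A₂ SE W side d d.snd.snd.fst.toNat
        (scalarHash G e d (linearScalar O d.snd.snd.fst.toNat a b
          (if real = true then a * b else c))) := by
    refine PPTime.bind (PPTime.uniformNat (by fun_prop)) ?_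
    refine PPTime.bind (PPTime.uniformNat (n := fun p : Data × ℕ => p.1.snd.snd.fst.toNat)
      (by fun_prop)) ?_
    refine PPTime.bind (PPTime.uniformNat (n := fun p : (Data × ℕ) × ℕ => p.1.1.snd.snd.fst.toNat)
      (by fun_prop)) ?_
    refine PPTime.randomHybrid hA₁ hA₂ SE W side (h := fun (p : ((Data × ℕ) × ℕ) × ℕ) b k v O =>
      scalarHash G e p.1.1.1 (linearScalar O p.1.1.1.snd.snd.fst.toNat p.1.1.2 p.1.2
        (if real = true then p.1.1.2 * p.1.2 else p.2)) b k v)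
      (by fun_prop) (by fun_prop) ?_
    refine PPTime.scalarHash G e (F := fun (p : (((Data × ℕ) × ℕ) × ℕ) × Bool × ℕ × Data) b v O =>
      linearScalar O p.1.1.1.1.snd.snd.fst.toNat p.1.1.1.2 p.1.1.2
        (if real = true then p.1.1.1.2 * p.1.1.2 else p.1.2) b v) (by fun_prop)
      ?_ (by fun_prop) (by fun_prop) (by fun_prop)
    unfold linearScalar
    refine PPTime.bind (PPTime.askNat (by fun_prop) (by fun_prop)) ?_
    refine PPTime.map (PPTime.askNat (by fun_prop) (by fun_prop)) ?_
    cases real <;> simp only [Bool.false_eq_true, if_false, if_true] <;> fun_prop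
  obtain ⟨B, hB, h⟩ := this
  exact ⟨B, hB, fun O d => (h d O).trans (PMF.map_id _)⟩

/-- The public parameters of a Diffie-Hellman challenge. -/
def ddhInput (y : Data) : Data := .pair y.fst y.snd.fst

/-- Here only the points of the triple are known, whereas the `DET` key is chosen by the adversary.
This is enough, because the hashes are linear in those points. -/
theorem exists_ddhAdversary (G : CurveFamily) (H : DetScheme G) (SE : EncScheme) {A₁ A₂ : Prog}
    (hA₁ : A₁.PPT) (hA₂ : A₂.PPT) (W e : Polynomial ℕ) (side : ℕ) :
    ∃ B : Prog, B.PPT ∧ ∀ y, B.exec y =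
      (H.gen.exec (ddhInput y)).bind fun key =>
      randomHybrid A₁ A₂ SE W side (ddhInput y) y.snd.fst.snd.fst.toNat
        (pointHash G H e (ddhInput y) key y.snd.snd.fst y.snd.snd.snd.fst
          y.snd.snd.snd.snd.fst) := by
  have hpair : PolyTime ddhInput := by unfold ddhInput; fun_prop
  have : PPTime fun (y : Data) (O : Data → PMF Data) =>
      (H.gen.exec (ddhInput y)).bind fun key =>
      randomHybrid A₁ A₂ SE W side (ddhInput y) y.snd.fst.snd.fst.toNat
        (pointHash G H e (ddhInput y) key y.snd.snd.fst y.snd.snd.snd.fst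
          y.snd.snd.snd.snd.fst) := by
    refine PPTime.bind (PPTime.exec H.gen_ppt (by fun_prop)) ?_
    refine PPTime.randomHybrid hA₁ hA₂ SE W side (h := fun (p : Data × Data) b k v O =>
      pointHash G H e (ddhInput p.1) p.2 p.1.snd.snd.fst p.1.snd.snd.snd.fst
        p.1.snd.snd.snd.snd.fst b k v) (by fun_prop) (by fun_prop) ?_
    unfold pointHash
    refine PPTime.bind (PPTime.exec H.prog_ppt (by fun_prop)) ?_
    refine PPTime.bind (PPTime.exec H.prog_ppt (by fun_prop)) ?_
    refine PPTime.bind (PPTime.smulM e (by fun_prop) (by fun_prop) (by fun_prop) (by fun_prop)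
      (by fun_prop)) ?_
    refine PPTime.bind (PPTime.smulM e (by fun_prop) (by fun_prop) (by fun_prop) (by fun_prop)
      (by fun_prop)) ?_
    exact PPTime.addM (by fun_prop) (by fun_prop) (by fun_prop)
  obtain ⟨B, hB, h⟩ := this
  exact ⟨B, hB, fun y => (h y _).trans (PMF.map_id _)⟩

end Eunomia
namespace Eunomia
open Enc

/-! ## Expectations -/

/-- The expected value of a real function. -/
noncomputable def expect {α : Type} (p : PMF α) (g : α → ℝ) : ℝ := ∑' a, (p a).toReal * g a

section Expect

variable {α β : Type}

theorem PMF.summable_toReal (p : PMF α) : Summable fun a => (p a).toReal :=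
  ENNReal.summable_toReal (by rw [p.tsum_coe]; exact ENNReal.one_ne_top)

theorem summable_expect (p : PMF α) {g : α → ℝ} {C : ℝ} (hg : ∀ a, |g a| ≤ C) :
    Summable fun a => (p a).toReal * g a := by
  refine Summable.of_norm_bounded ((PMF.summable_toReal p).mul_right C) fun a => ?_
  rw [Real.norm_eq_abs, abs_mul, abs_of_nonneg ENNReal.toReal_nonneg]
  exact mul_le_mul_of_nonneg_left (hg a) ENNReal.toReal_nonneg

theorem expect_const (p : PMF α) (c : ℝ) : expect p (fun _ => c) = c := by
  rw [expect, tsum_mul_right, ← ENNReal.tsum_toReal_eq fun a => p.apply_ne_top a, p.tsum_coe]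
  simp

theorem expect_mono (p : PMF α) {g h : α → ℝ} {C C' : ℝ} (hg : ∀ a, |g a| ≤ C)
    (hh : ∀ a, |h a| ≤ C') (hle : ∀ a ∈ p.support, g a ≤ h a) : expect p g ≤ expect p h := by
  refine (summable_expect p hg).tsum_le_tsum (fun a => ?_) (summable_expect p hh)
  by_cases ha : p a = 0
  · simp [ha]
  · exact mul_le_mul_of_nonneg_left (hle a ((PMF.mem_support_iff _ _).2 ha)) ENNReal.toReal_nonneg

theorem expect_sub (p : PMF α) {g h : α → ℝ} {C C' : ℝ} (hg : ∀ a, |g a| ≤ C)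
    (hh : ∀ a, |h a| ≤ C') : expect p (fun a => g a - h a) = expect p g - expect p h := by
  rw [expect, expect, expect, ← (summable_expect p hg).tsum_sub (summable_expect p hh)]
  exact tsum_congr fun a => mul_sub _ _ _

theorem expect_mul (p : PMF α) (c : ℝ) (g : α → ℝ) :
    expect p (fun a => c * g a) = c * expect p g := by
  rw [expect, expect, ← tsum_mul_left]
  exact tsum_congr fun a => by ring

theorem prTrue_nonneg (p : PMF Bool) : 0 ≤ prTrue p := ENNReal.toReal_nonneg

theorem prTrue_le_one (p : PMF Bool) : prTrue p ≤ 1 :=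
  ENNReal.toReal_le_of_le_ofReal zero_le_one (by simpa using p.coe_le_one true)

theorem abs_prTrue_le (p : PMF Bool) : |prTrue p| ≤ 1 := by
  rw [abs_of_nonneg (prTrue_nonneg p)]; exact prTrue_le_one p

theorem prTrue_bind (p : PMF α) (f : α → PMF Bool) :
    prTrue (p.bind f) = expect p fun a => prTrue (f a) := by
  rw [prTrue, PMF.bind_apply, ENNReal.tsum_toReal_eq]
  · exact tsum_congr fun a => by rw [ENNReal.toReal_mul]; rfl
  · exact fun a => ENNReal.mul_ne_top (p.apply_ne_top a) ((f a).apply_ne_top true)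

theorem prTrue_pure (b : Bool) : prTrue (PMF.pure b) = if b = true then 1 else 0 := by
  cases b <;> simp [prTrue, PMF.pure_apply]

theorem expect_uniform [Fintype α] [Nonempty α] (g : α → ℝ) :
    expect (PMF.uniformOfFintype α) g = (∑ a, g a) / Fintype.card α := by
  rw [expect, tsum_fintype, Finset.sum_div]
  refine Finset.sum_congr rfl fun a _ => ?_
  rw [PMF.uniformOfFintype_apply, ENNReal.toReal_inv, ENNReal.toReal_natCast]
  field_simp

theorem abs_expect_sub_le (p : PMF α) {g h ε : α → ℝ} {C C' C'' : ℝ} (hg : ∀ a, |g a| ≤ C)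
    (hh : ∀ a, |h a| ≤ C') (hε : ∀ a, |ε a| ≤ C'')
    (hle : ∀ a ∈ p.support, |g a - h a| ≤ ε a) : |expect p g - expect p h| ≤ expect p ε := by
  have hb : ∀ a, |g a - h a| ≤ C + C' := fun a =>
    (abs_sub _ _).trans (add_le_add (hg a) (hh a))
  have hb2 : ∀ a, |-1 * ε a| ≤ C'' := fun a => by rw [neg_one_mul, abs_neg]; exact hε a
  rw [← expect_sub p hg hh, abs_le]
  constructor
  · rw [← neg_one_mul, ← expect_mul]
    exact expect_mono p hb2 hb fun a ha => by
      have := (abs_le.1 (hle a ha)).1; linarith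
  · exact expect_mono p hb hε fun a ha => (abs_le.1 (hle a ha)).2

theorem abs_prTrue_bind_sub_le (p : PMF α) {f g : α → PMF Bool} {ε : ℝ}
    (hle : ∀ a ∈ p.support, |prTrue (f a) - prTrue (g a)| ≤ ε) :
    |prTrue (p.bind f) - prTrue (p.bind g)| ≤ ε := by
  rw [prTrue_bind, prTrue_bind]
  refine (abs_expect_sub_le p (fun a => abs_prTrue_le _) (fun a => abs_prTrue_le _)
    (ε := fun _ => ε) (fun _ => le_rfl) hle).trans (expect_const p ε).le

/-- Two experiments that differ only for one of the values of a uniform variable. -/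
theorem abs_prTrue_uniform_sub_le [Fintype α] [Nonempty α] (a₀ : α) {f g : α → PMF Bool}
    (h : ∀ a, a ≠ a₀ → f a = g a) :
    |prTrue ((PMF.uniformOfFintype α).bind f) - prTrue ((PMF.uniformOfFintype α).bind g)| ≤
      1 / Fintype.card α := by
  classical
  rw [prTrue_bind, prTrue_bind, expect_uniform, expect_uniform, ← sub_div, ← Finset.sum_sub_distrib,
    Finset.sum_eq_single a₀ (fun a _ ha => by rw [h a ha, sub_self]) (by simp), abs_div,
    abs_of_nonneg (Nat.cast_nonneg _ : (0 : ℝ) ≤ Fintype.card α)]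
  refine div_le_div_of_nonneg_right ?_ (Nat.cast_nonneg _)
  have h1 := prTrue_nonneg (f a₀)
  have h2 := prTrue_le_one (f a₀)
  have h3 := prTrue_nonneg (g a₀)
  have h4 := prTrue_le_one (g a₀)
  exact abs_le.2 ⟨by linarith, by linarith⟩

/-- A random index turns a game into an average; in this form, without division, the hybrids
telescope. -/
theorem prTrue_uniformNat_bind (m : ℕ) (f : ℕ → PMF Bool) :
    (m + 1 : ℕ) * prTrue ((uniformNat (m + 1)).bind f) =
      ∑ j ∈ Finset.range (m + 1), prTrue (f j) := by
  have : uniformNat (m + 1) = (PMF.uniformOfFintype (Fin (m + 1))).map Fin.val := rfl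
  rw [this, PMF.bind_map, prTrue_bind, expect_uniform, Finset.sum_range, Fintype.card_fin]
  simp only [Function.comp_apply]
  field_simp

/-! ### Uniform distributions -/

theorem uniform_map_equiv [Fintype α] [Nonempty α] [Fintype β] [Nonempty β] (e : α ≃ β) :
    (PMF.uniformOfFintype α).map e = PMF.uniformOfFintype β := by
  classical
  ext b
  rw [PMF.map_apply, tsum_eq_single (e.symm b)]
  · simp [Fintype.card_congr e]
  · intro a ha
    rw [if_neg]
    rintro rfl
    simp at ha

/-- The fibres of `φ` are the cosets of its kernel, so all of them have the same number of elements.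
-/
theorem uniform_map_surjective [AddGroup α] [AddGroup β] [Fintype α] [Fintype β] (φ : α →+ β)
    (hφ : Function.Surjective φ) :
    (PMF.uniformOfFintype α).map φ = PMF.uniformOfFintype β := by
  classical
  have hfib : ∀ b, (Finset.univ.filter fun a => φ a = b).card =
      (Finset.univ.filter fun a => φ a = 0).card := by
    intro b
    obtain ⟨a, rfl⟩ := hφ b
    refine Finset.card_bij' (fun x _ => x - a) (fun x _ => x + a) ?_ ?_ ?_ ?_ <;>
      simp +contextual [map_sub, map_add]
  have hcard : Fintype.card α =
      Fintype.card β * (Finset.univ.filter fun a => φ a = 0).card := by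
    rw [← Finset.card_univ, Finset.card_eq_sum_card_fiberwise (f := φ) (t := Finset.univ) (by simp)]
    simp [hfib, Finset.card_univ]
  have hne : (Finset.univ.filter fun a => φ a = 0).card ≠ 0 := by
    intro h0
    rw [h0, mul_zero] at hcard
    exact Fintype.card_ne_zero hcard
  ext b
  rw [PMF.map_apply, tsum_fintype]
  simp only [PMF.uniformOfFintype_apply]
  rw [← Finset.sum_filter, Finset.sum_const]
  have : (Finset.univ.filter fun a => b = φ a).card =
      (Finset.univ.filter fun a => φ a = 0).card := by
    rw [← hfib b]; congr 1; ext a; simp [eq_comm]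
  rw [this, hcard, nsmul_eq_mul, Nat.cast_mul, ENNReal.mul_inv (by simp) (by simp), mul_comm,
    mul_assoc, ENNReal.inv_mul_cancel (by simpa using hne) (by simp), mul_one]

theorem uniformNat_map {q : ℕ} [NeZero q] {R : Type} (f : ℕ → R) :
    (uniformNat q).map f = (PMF.uniformOfFintype (ZMod q)).map fun a => f a.val := by
  obtain ⟨m, rfl⟩ := Nat.exists_eq_succ_of_ne_zero (NeZero.ne q)
  have : uniformNat (m + 1) = (PMF.uniformOfFintype (Fin (m + 1))).map Fin.val := rfl
  change (uniformNat (m + 1)).map f = _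
  rw [this, PMF.map_comp]
  rfl

end Expect

/-! ## Negligible functions -/

theorem Negligible.mono {f g : ℕ → ℝ} (hg : Negligible g) (h : ∀ κ, f κ ≤ g κ) : Negligible f :=
  fun c => (hg c).imp fun _ hK κ hκ => (h κ).trans_lt (hK κ hκ)

theorem Negligible.poly_mul {f : ℕ → ℝ} (hf : Negligible f) (p : Polynomial ℕ) :
    Negligible fun κ => ((p.eval κ : ℕ) : ℝ) * f κ := by
  intro c
  -- For `κ ≥ p(1)` one has `p(κ) ≤ κ ^ (deg p + 1)`, which explains the middle summand; the last
  -- power of `κ` gives the strict inequality.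
  obtain ⟨K, hK⟩ := hf (c + (p.natDegree + 1) + 1)
  refine ⟨K + p.eval 1 + 1, fun κ hκ => ?_⟩
  have hκ1 : 1 ≤ κ := by omega
  have hp : p.eval κ ≤ κ ^ (p.natDegree + 1) := by
    have h1 : p.eval κ ≤ p.eval 1 * κ ^ p.natDegree := by
      rw [Polynomial.eval_eq_sum_range, Polynomial.eval_eq_sum_range, Finset.sum_mul]
      refine Finset.sum_le_sum fun i hi => ?_
      rw [one_pow, mul_one]
      exact Nat.mul_le_mul_left _ (Nat.pow_le_pow_right hκ1 (by
        have := Finset.mem_range.1 hi; omega))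
    rw [pow_succ, mul_comm]
    exact h1.trans (Nat.mul_le_mul_right _ (by omega))
  have hpos : (0 : ℝ) < κ := by exact_mod_cast hκ1
  have hp' : ((p.eval κ : ℕ) : ℝ) ≤ (κ : ℝ) ^ (p.natDegree + 1) := by exact_mod_cast hp
  have h2 : (1 : ℝ) < κ := by
    have : 1 < κ := by omega
    exact_mod_cast this
  calc ((p.eval κ : ℕ) : ℝ) * f κ ≤ ((p.eval κ : ℕ) : ℝ) * ((κ : ℝ) ^ (c + (p.natDegree + 1) + 1))⁻¹ :=
        mul_le_mul_of_nonneg_left (hK κ (by omega)).le (Nat.cast_nonneg _)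
    _ ≤ (κ : ℝ) ^ (p.natDegree + 1) * ((κ : ℝ) ^ (c + (p.natDegree + 1) + 1))⁻¹ :=
        mul_le_mul_of_nonneg_right hp' (by positivity)
    _ = ((κ : ℝ) ^ c)⁻¹ * (κ : ℝ)⁻¹ := by
        rw [show c + (p.natDegree + 1) + 1 = (p.natDegree + 1) + (c + 1) by ring,
          pow_add (κ : ℝ) (p.natDegree + 1), mul_inv, ← mul_assoc,
          mul_inv_cancel₀ (pow_ne_zero _ hpos.ne'), one_mul, pow_succ, mul_inv]
    _ < ((κ : ℝ) ^ c)⁻¹ := mul_lt_of_lt_one_right (by positivity) (inv_lt_one_of_one_lt₀ h2)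

theorem Negligible.add {f g : ℕ → ℝ} (hf : Negligible f) (hg : Negligible g) :
    Negligible fun κ => f κ + g κ := by
  -- The two functions must share the bound, so each of them is doubled first.
  have h2 : ∀ {f : ℕ → ℝ}, Negligible f → Negligible fun κ => 2 * f κ := fun h => by
    simpa using h.poly_mul 2
  intro c
  obtain ⟨K, hK⟩ := h2 hf c
  obtain ⟨K', hK'⟩ := h2 hg c
  refine ⟨max K K', fun κ hκ => ?_⟩
  have h1 := hK κ (lt_of_le_of_lt (le_max_left _ _) hκ)
  have h2 := hK' κ (lt_of_le_of_lt (le_max_right _ _) hκ)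
  dsimp only at h1 h2
  linarith

/-- Two sequences of probabilities with negligible difference. -/
def Close (f g : ℕ → ℝ) : Prop := Negligible fun κ => |f κ - g κ|

theorem Close.trans {f g h : ℕ → ℝ} (h1 : Close f g) (h2 : Close g h) : Close f h :=
  (Negligible.add h1 h2).mono fun _ => abs_sub_le _ _ _

theorem Close.symm {f g : ℕ → ℝ} (h : Close f g) : Close g f := by
  unfold Close at *
  simpa only [abs_sub_comm] using h

/-! ## Lists of independent experiments -/

section SampleList

variable {α β γ : Type}

theorem sampleList_congr {f g : α → PMF β} {l : List α} (h : ∀ a ∈ l, f a = g a) :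
    sampleList f l = sampleList g l := by
  induction l with
  | nil => rfl
  | cons a l ih =>
    rw [sampleList, sampleList, h a List.mem_cons_self,
      ih fun b hb => h b (List.mem_cons_of_mem _ hb)]

theorem sampleList_map {δ : Type} (f : β → PMF δ) (g : α → β) (l : List α) :
    sampleList f (l.map g) = sampleList (fun a => f (g a)) l := by
  induction l with
  | nil => rfl
  | cons a l ih => rw [List.map_cons, sampleList, sampleList, ih]

theorem sampleList_zipIdx (f : α → PMF β) (l : List α) (n : ℕ) :
    sampleList (fun p : α × ℕ => f p.1) (l.zipIdx n) = sampleList f l := by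
  rw [← sampleList_map, List.zipIdx_map_fst]

/-- A random parameter which matters for one position only can be drawn there. -/
theorem bind_sampleList (p : PMF γ) (F : γ → α × ℕ → PMF β) (l : List α) (j n : ℕ)
    (hF : ∀ a i, (a, i) ∈ l.zipIdx n → i ≠ j → ∀ c c', F c (a, i) = F c' (a, i)) :
    (p.bind fun c => sampleList (F c) (l.zipIdx n)) =
      sampleList (fun a => p.bind fun c => F c a) (l.zipIdx n) := by
  obtain ⟨c₀, -⟩ := p.support_nonempty
  induction l generalizing n with
  | nil => simp [sampleList]
  | cons a l ih =>
    simp only [List.zipIdx_cons, sampleList]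
    have ih' := ih (n + 1) fun a' i h => hF a' i (by simp [h])
    -- At position `j` only the head depends on the parameter; elsewhere the head does not, and its
    -- draw commutes with that of the parameter.
    by_cases hj : n = j
    · have hconst : ∀ c, sampleList (F c) (l.zipIdx (n + 1)) =
          sampleList (F c₀) (l.zipIdx (n + 1)) := fun c => sampleList_congr fun x hx =>
        hF x.1 x.2 (by simp [hx]) (by have := List.le_snd_of_mem_zipIdx hx; omega) c c₀
      rw [← ih']
      simp only [hconst, PMF.bind_const, PMF.bind_bind]
    · have hconst : ∀ c, F c (a, n) = F c₀ (a, n) := fun c => hF a n (by simp) hj c c₀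
      simp only [hconst, PMF.bind_const]
      rw [PMF.bind_comm]
      congr 1
      funext b
      rw [← ih', PMF.map_bind]

end SampleList

end Eunomia
namespace Eunomia
open Enc

/-! ## The labels name the classes of columns -/

theorem relabel_append (R : List (ℕ × ℕ)) (p : ℕ × ℕ) (n : ℕ) :
    relabel (R ++ [p]) n = if relabel R n = p.1 then p.2 else relabel R n := by
  rw [relabel, List.foldl_append]; rfl

theorem classLabel_append (W : ℕ) (S : Schema) (δ : List (Column × Column)) (e : Column × Column)
    (c : Column) : classLabel W S (δ ++ [e]) c =
      if classLabel W S δ c = classLabel W S δ e.2 then classLabel W S δ e.1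
      else classLabel W S δ c := by
  rw [classLabel, labelMerges_append, relabel_append]; rfl

/-- The labels of a pair agree once it has been merged, and later substitutions act on labels only,
hence preserve equalities. -/
theorem classLabel_of_mem {W : ℕ} {S : Schema} {δ : List (Column × Column)} {e : Column × Column}
    (he : e ∈ δ) : classLabel W S δ e.1 = classLabel W S δ e.2 := by
  induction δ using List.reverseRecOn with
  | nil => simp at he
  | append_singleton δ e' ih =>
    simp only [classLabel_append]
    rw [List.mem_append, List.mem_singleton] at he
    rcases he with he | rfl
    · rw [ih he]
    · simp

theorem classLabel_of_isTime {W : ℕ} {S : Schema} {δ : List (Column × Column)} {c : Column}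
    (hc : S.IsTime c) : classLabel W S δ c = timeLabel W S δ := by
  rw [classLabel, timeLabel, initLabel, if_pos hc]

theorem SameClass.mono {S : Schema} {δ δ' : List (Column × Column)} (h : δ ⊆ δ') {c c' : Column}
    (hc : SameClass S δ c c') : SameClass S δ' c c' :=
  Relation.EqvGen.mono (fun _ _ => Or.imp_left fun hm => h hm) _ _ hc

/-- Before any merging, labels are injective on non-time columns, being numbers in base `W` shifted
by 1, and 0 means timestamps; this is where the bound `W` is needed. Merging `e` identifies just the
labels of its two ends, and the edge `e` then connects the columns in question. -/
theorem sameClass_of_classLabel {W : ℕ} {S : Schema} {δ : List (Column × Column)}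
    (hδ : ∀ e ∈ δ, (e.1.1 < W ∧ e.1.2 < W) ∧ (e.2.1 < W ∧ e.2.2 < W)) {c c' : Column}
    (hc : c.1 < W ∧ c.2 < W) (hc' : c'.1 < W ∧ c'.2 < W)
    (h : classLabel W S δ c = classLabel W S δ c') : SameClass S δ c c' := by
  induction δ using List.reverseRecOn generalizing c c' with
  | nil =>
    have h : initLabel W S c = initLabel W S c' := h
    unfold initLabel at h
    split_ifs at h with h1 h2 h2
    · exact .rel _ _ (.inr ⟨h1, h2⟩)
    · omega
    · omega
    · have h3 : c.2 + W * c.1 = c'.2 + W * c'.1 := by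
        rw [mul_comm W, mul_comm W]; omega
      have e1 : c.1 = c'.1 := by
        have := congrArg (· / W) h3
        simpa [Nat.add_mul_div_left _ _ (Nat.zero_lt_of_lt hc.1), Nat.div_eq_of_lt hc.2,
          Nat.div_eq_of_lt hc'.2] using this
      have e2 : c.2 = c'.2 := by rw [e1] at h3; omega
      rw [show c = c' from Prod.ext e1 e2]
      exact .refl _
  | append_singleton δ e ih =>
    have hδ' : ∀ e ∈ δ, (e.1.1 < W ∧ e.1.2 < W) ∧ (e.2.1 < W ∧ e.2.2 < W) :=
      fun e he => hδ e (by simp [he])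
    have he := hδ e (by simp)
    have lift : ∀ {a b}, (a.1 < W ∧ a.2 < W) → (b.1 < W ∧ b.2 < W) →
        classLabel W S δ a = classLabel W S δ b → SameClass S (δ ++ [e]) a b :=
      fun ha hb hab => (ih hδ' ha hb hab).mono (by simp)
    have hedge : SameClass S (δ ++ [e]) e.1 e.2 := .rel _ _ (.inl (by simp))
    rw [classLabel_append, classLabel_append] at h
    split_ifs at h with h1 h2 h2
    · exact lift hc hc' (h1.trans h2.symm)
    · exact (lift hc he.2 h1).trans _ _ _ (hedge.symm.trans _ _ _ (lift he.1 hc' h))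
    · exact ((lift hc' he.2 h2).trans _ _ _ (hedge.symm.trans _ _ _ (lift he.1 hc h.symm))).symm
    · exact lift hc hc' h

theorem initLabel_lt {W : ℕ} {S : Schema} {c : Column} (hc : c.1 < W ∧ c.2 < W) :
    initLabel W S c < labelBound W := by
  unfold initLabel labelBound
  split_ifs
  · omega
  · have : c.1 * W + W ≤ W * W := by
      rw [← Nat.succ_mul]; exact Nat.mul_le_mul_right _ hc.1
    omega

theorem labelMerges_lt {W : ℕ} {S : Schema} {δ : List (Column × Column)}
    (hδ : ∀ e ∈ δ, (e.1.1 < W ∧ e.1.2 < W) ∧ (e.2.1 < W ∧ e.2.2 < W)) :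
    ∀ p ∈ labelMerges W S δ, p.2 < labelBound W := fun p hp =>
  (labelMerges_mem W S δ (· < labelBound W)
    (fun e he => ⟨initLabel_lt (hδ e he).1, initLabel_lt (hδ e he).2⟩) p hp).2

theorem classLabel_lt {W : ℕ} {S : Schema} {δ : List (Column × Column)}
    (hδ : ∀ e ∈ δ, (e.1.1 < W ∧ e.1.2 < W) ∧ (e.2.1 < W ∧ e.2.2 < W)) {c : Column}
    (hc : c.1 < W ∧ c.2 < W) : classLabel W S δ c < labelBound W :=
  relabel_mem _ _ (· < labelBound W) (initLabel_lt hc) (labelMerges_lt hδ)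

theorem timeLabel_lt {W : ℕ} {S : Schema} {δ : List (Column × Column)}
    (hδ : ∀ e ∈ δ, (e.1.1 < W ∧ e.1.2 < W) ∧ (e.2.1 < W ∧ e.2.2 < W)) :
    timeLabel W S δ < labelBound W :=
  relabel_mem _ _ (· < labelBound W) (by simp [labelBound]) (labelMerges_lt hδ)

/-! ## Positions in logs and schemas -/

theorem toList_length_le (d : Data) : d.toList.length ≤ d.size := by
  induction d with
  | int n => simp [Data.toList]
  | pair a b _ ih =>
    simp only [Data.toList, List.length_cons, Data.size]
    have := a.size_pos
    omega

theorem toList_mem_size {d a : Data} (h : a ∈ d.toList) : a.size ≤ d.size := by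
  induction d with
  | int n => simp [Data.toList] at h
  | pair b c _ ih =>
    simp only [Data.toList, List.mem_cons, Data.size] at h ⊢
    rcases h with rfl | h
    · omega
    · have := ih h; omega

theorem mem_iff_hasColumn {S : Schema} {c : Column} : S.Mem c ↔ hasColumn S c = true := by
  simp only [Schema.Mem, Schema.kind, hasColumn, List.getD_eq_getElem?_getD, decide_eq_true_eq]
  cases h : S[c.1]? with
  | none => simp
  | some T =>
    simp only [Option.bind_some, Option.getD_some]
    rw [Option.isSome_iff_exists]
    constructor
    · rintro ⟨a, ha⟩; exact (List.getElem?_eq_some_iff.1 ha).1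
    · intro h; exact ⟨_, List.getElem?_eq_getElem h⟩

theorem mem_lt_size {x : Data} {c : Column} (h : (schemaOf x).Mem c) :
    c.1 < x.size ∧ c.2 < x.size := by
  have hS : schemaOf x = x.fst.toList.map fun T => T.toList.map Data.toBool := rfl
  rw [mem_iff_hasColumn, hasColumn, decide_eq_true_eq, List.getD_eq_getElem?_getD, hS,
    List.getElem?_map] at h
  cases hT : x.fst.toList[c.1]? with
  | none => simp [hT] at h
  | some T =>
    simp only [hT, Option.map_some, Option.getD_some, List.length_map] at h
    have h1 := (List.getElem?_eq_some_iff.1 hT).1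
    have h2 := toList_length_le x.fst
    have h3 := toList_mem_size (List.mem_of_getElem? hT)
    have h4 := toList_length_le T
    have h5 := x.fst_size
    omega

theorem mem_columns {S : Schema} {c : Column} (h : c ∈ S.columns) : S.Mem c := by
  simp only [Schema.columns, List.mem_flatMap, List.mem_map] at h
  obtain ⟨⟨T, t⟩, hT, ⟨a, i⟩, ha, rfl⟩ := h
  rw [List.mk_mem_zipIdx_iff_getElem?] at hT ha
  simp [Schema.Mem, Schema.kind, hT, ha]

theorem cellD_of_cell {L : Log} {c : Column} {i : ℕ} {v : Data} (h : L.cell c i = some v) :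
    L.cellD c i = v := by
  simp only [Log.cell, Log.cellD, List.getD_eq_getElem?_getD] at h ⊢
  cases h1 : L[c.1]? with
  | none => simp [h1] at h
  | some T =>
    cases h2 : T[i]? with
    | none => simp [h1, h2] at h
    | some row =>
      simp only [h1, h2, Option.bind_some] at h
      simp [h2, h]

theorem mem_column_iff {L : Log} {c : Column} {v : Data} :
    v ∈ L.column c ↔ ∃ i, L.cell c i = some v := by
  simp only [Log.column, Log.cell, List.mem_filterMap]
  cases h1 : L[c.1]? with
  | none => simp
  | some T =>
    simp only [Option.getD_some, Option.bind_some]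
    constructor
    · rintro ⟨row, hrow, hv⟩
      obtain ⟨i, hi⟩ := List.mem_iff_getElem?.1 hrow
      exact ⟨i, by simp [hi, hv]⟩
    · rintro ⟨i, hi⟩
      cases h2 : T[i]? with
      | none => simp [h2] at hi
      | some row => exact ⟨row, List.mem_of_getElem? h2, by simpa [h2] using hi⟩

theorem mem_values_of_cell {L : Log} {c : Column} {i : ℕ} {v : Data} (h : L.cell c i = some v) :
    v ∈ L.values := by
  simp only [Log.cell] at h
  cases h1 : L[c.1]? with
  | none => simp [h1] at h
  | some T =>
    cases h2 : T[i]? with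
    | none => simp [h1, h2] at h
    | some row =>
      simp only [h1, h2, Option.bind_some] at h
      simp only [Log.values, List.mem_flatten]
      exact ⟨row, ⟨T, List.mem_of_getElem? h1, List.mem_of_getElem? h2⟩, List.mem_of_getElem? h⟩

theorem Log.HasSchema.mem_of_cell {L : Log} {S : Schema} (h : L.HasSchema S) {c : Column} {i : ℕ}
    {v : Data} (hc : L.cell c i = some v) : S.Mem c := by
  simp only [Log.cell] at hc
  cases h1 : L[c.1]? with
  | none => simp [h1] at hc
  | some T =>
    cases h2 : T[i]? with
    | none => simp [h1, h2] at hc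
    | some row =>
      simp only [h1, h2, Option.bind_some] at hc
      have hlt := (List.getElem?_eq_some_iff.1 h1).1
      rw [h.tables] at hlt
      have h3 := h.rows c.1 T _ h1 (List.getElem?_eq_getElem hlt) row (List.mem_of_getElem? h2)
      have h4 := (List.getElem?_eq_some_iff.1 hc).1
      rw [mem_iff_hasColumn, hasColumn, decide_eq_true_eq, List.getD_eq_getElem?_getD,
        List.getElem?_eq_getElem hlt]
      simp only [Option.getD_some]; omega

/-- Apply a function to all cells of a log. -/
def Log.mapCells (M : Column → Data → Data) (L : Log) : Log :=
  L.mapIdx fun t T => T.map fun row => row.mapIdx fun a v => M (t, a) v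

/-- The hypothesis `hM` speaks of cells of `L₁` only; equal numbers of tables, rows and columns
exclude further cells in `L₂`. -/
theorem eq_mapCells {S : Schema} {L₁ L₂ : Log} (h₁ : L₁.HasSchema S) (h₂ : L₂.HasSchema S)
    (hr : L₁.map List.length = L₂.map List.length) {M : Column → Data → Data}
    (hM : ∀ c i v, L₁.cell c i = some v → L₂.cell c i = some (M c v)) :
    L₂ = L₁.mapCells M := by
  refine List.ext_getElem (by simp [Log.mapCells, h₁.tables, h₂.tables]) fun t ht₂ ht => ?_
  have ht₁ : t < L₁.length := by simpa [Log.mapCells] using ht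
  have hS : t < S.length := h₁.tables ▸ ht₁
  have hlen : L₁[t].length = L₂[t].length := by
    have := congrArg (·[t]?) hr
    simpa [List.getElem?_map, ht₁, ht₂] using this
  simp only [Log.mapCells, List.getElem_mapIdx]
  refine List.ext_getElem (by simp [hlen]) fun i hi₂ hi => ?_
  have hi₁ : i < L₁[t].length := hlen ▸ hi₂
  have hl₁ := h₁.rows t _ _ (List.getElem?_eq_getElem ht₁) (List.getElem?_eq_getElem hS)
    _ (List.getElem_mem hi₁)
  have hl₂ := h₂.rows t _ _ (List.getElem?_eq_getElem ht₂) (List.getElem?_eq_getElem hS)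
    _ (List.getElem_mem hi₂)
  rw [List.getElem_map]
  refine List.ext_getElem (by simp [hl₁, hl₂]) fun a ha₂ ha => ?_
  have ha₁ : a < L₁[t][i].length := by omega
  have := hM (t, a) i L₁[t][i][a] (by simp [Log.cell, ht₁, hi₁, ha₁])
  simpa [Log.cell, ht₂, hi₂, ha₂] using this

theorem zipIdx_mapIdx {α β : Type} (g : ℕ → α → β) (l : List α) :
    (l.mapIdx g).zipIdx = l.zipIdx.map fun p => (g p.2 p.1, p.2) := by
  refine List.ext_getElem (by simp) fun i h1 h2 => by simp

theorem timeStamps_mapCells {S : Schema} (L : Log) {M : Column → Data → Data} {f : Data → Data}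
    (hM : ∀ c, S.IsTime c → M c = f) :
    timeStamps S (L.mapCells M) = (timeStamps S L).map f := by
  unfold timeStamps Log.mapCells
  rw [zipIdx_mapIdx, List.flatMap_map, List.map_flatMap]
  congr 1
  funext T
  rw [List.flatMap_map, List.map_flatMap]
  congr 1
  funext row
  rw [zipIdx_mapIdx, List.filterMap_map, List.map_filterMap]
  congr 1
  funext v
  by_cases h : S.IsTime (T.2, v.2)
  · simp [h, hM _ h]
  · simp [h]

theorem mem_timeStamps {S : Schema} {L : Log} {v : Data} (h : v ∈ timeStamps S L) :
    ∃ c i, S.IsTime c ∧ L.cell c i = some v := by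
  simp only [timeStamps, List.mem_flatMap, List.mem_filterMap] at h
  obtain ⟨⟨T, t⟩, hT, row, hrow, ⟨w, a⟩, hw, hv⟩ := h
  rw [List.mk_mem_zipIdx_iff_getElem?] at hT hw
  obtain ⟨i, hi⟩ := List.mem_iff_getElem?.1 hrow
  split_ifs at hv with ht
  obtain rfl : w = v := by simpa using hv
  exact ⟨(t, a), i, ht, by simp [Log.cell, hT, hi, hw]⟩

/-- Only positions enter `mapLog`; the contents reach it through `f`. -/
theorem mapLog_mapCells (f : Column → ℕ → PMF Data) (M : Column → Data → Data) (L : Log) :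
    mapLog f (L.mapCells M) = mapLog f L := by
  unfold mapLog Log.mapCells
  rw [zipIdx_mapIdx, sampleList_map]
  congr 2
  funext T
  rw [List.zipIdx_map, sampleList_map]
  congr 2
  funext R
  simp only [Prod.map_fst, Prod.map_snd, id_eq]
  rw [zipIdx_mapIdx, sampleList_map]

theorem mapLog_congr {f g : Column → ℕ → PMF Data} {L : Log}
    (h : ∀ c i v, L.cell c i = some v → f c i = g c i) : mapLog f L = mapLog g L := by
  unfold mapLog
  congr 1
  refine sampleList_congr fun T hT => ?_
  congr 1
  refine sampleList_congr fun R hR => ?_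
  congr 1
  refine sampleList_congr fun v hv => ?_
  obtain ⟨T, t⟩ := T
  obtain ⟨R, i⟩ := R
  obtain ⟨v, a⟩ := v
  rw [List.mk_mem_zipIdx_iff_getElem?] at hT hR hv
  dsimp only at hT hR hv
  exact h (t, a) i v (by simp [Log.cell, hT, hR, hv])

/-- Without timestamps no displacement is ever encrypted, so `hD` has to agree only if there are
some. -/
theorem mopedView_congr {hT hT' : ℕ → PMF Data} {hD hD' : Data → PMF Data} {ts ts' D : List Data}
    (hlen : ts.length = ts'.length) (h1 : ∀ i < ts.length, hT i = hT' i)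
    (h2 : ts ≠ [] → ∀ d ∈ D, hD d = hD' d)
    (h3 : ∀ j i (hi : i < ts.length) (hi' : i < ts'.length), ∀ d ∈ D,
      rank (ts.take j) D ts[i] d = rank (ts'.take j) D ts'[i] d) :
    mopedView hT hD ts D = mopedView hT' hD' ts' D := by
  unfold mopedView
  rw [hlen]
  congr 1
  refine sampleList_congr fun j _ => ?_
  congr 1
  have hz : ∀ l : List Data, l.zipIdx = (List.range l.length).map fun i => (l.getD i (.int 0), i) := by
    intro l
    refine List.ext_getElem (by simp) fun i h1 h2 => ?_
    have : i < l.length := by simpa using h1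
    simp [List.getD_eq_getElem?_getD, this]
  rw [hz, hz, sampleList_map, sampleList_map, List.length_take, List.length_take, hlen]
  refine sampleList_congr fun i hi => ?_
  have hi' : i < j ∧ i < ts'.length := by simpa using hi
  have hi'' : i < ts.length := by omega
  refine sampleList_congr fun d hd => ?_
  have e1 : (ts.take j).getD i (.int 0) = ts[i] := by
    simp [List.getD_eq_getElem?_getD, hi'.1, hi'']
  have e2 : (ts'.take j).getD i (.int 0) = ts'[i]'hi'.2 := by
    simp [List.getD_eq_getElem?_getD, hi'.1, hi'.2]
  dsimp only
  rw [e1, e2, h1 i hi'', h2 (List.ne_nil_of_length_pos (by omega)) d hd, h3 j i hi'' hi'.2 d hd]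

theorem constantsView_congr {encr encr' : Column → Data → PMF Data} {S : Schema} {C : List Data}
    {L : Log} (h : ∀ c v, S.Mem c → v ∈ C → v ∈ L.column c → encr c v = encr' c v) :
    constantsView encr S C L = constantsView encr' S C L := by
  unfold constantsView
  congr 1
  refine sampleList_congr fun p hp => ?_
  simp only [List.mem_flatMap, List.mem_map, List.mem_filter, decide_eq_true_eq] at hp
  obtain ⟨c, hc, v, ⟨hv, hv'⟩, rfl⟩ := hp
  rw [h c v (mem_columns hc) hv hv']

/-- The complete list of what the view depends on: existing cells, timestamps, displacements if
there are timestamps, constants that occur, and values foreign to both logs. The steps which replace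
hashes or ciphertexts inside an attack are checked against this list. -/
theorem attack_congr {A₂ : Prog} {x : Data} {cell cell' : Column → ℕ → PMF Data}
    {hT hT' : ℕ → PMF Data} {hD hD' : Data → PMF Data} {encr encr' : Column → Data → PMF Data}
    {toks toks' : Data}
    (h1 : ∀ c i v, (firstLog x).cell c i = some v → cell c i = cell' c i)
    (h2 : ∀ i < (timeStamps (schemaOf x) (firstLog x)).length, hT i = hT' i)
    (h3 : timeStamps (schemaOf x) (firstLog x) ≠ [] → ∀ d ∈ displacementsOf x, hD d = hD' d)
    (h4 : ∀ c v, (schemaOf x).Mem c → v ∈ constantsOf x → v ∈ (firstLog x).column c →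
      encr c v = encr' c v)
    (h5 : ∀ c v, (schemaOf x).Mem c → v ∉ (firstLog x).values → v ∉ (secondLog x).values →
      encr c v = encr' c v) (h6 : toks = toks') :
    attack A₂ x cell hT hD encr toks = attack A₂ x cell' hT' hD' encr' toks' := by
  unfold attack
  rw [mapLog_congr h1, mopedView_congr rfl h2 h3 (fun _ _ _ _ _ _ => rfl), constantsView_congr h4, h6]
  refine congrArg _ (funext fun eDB => congrArg _ (funext fun eT => congrArg _ (funext fun cs => ?_)))
  congr 1
  funext y
  split_ifs with hv hc
  · rfl
  · rw [not_or] at hv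
    exact h5 _ _ (mem_iff_hasColumn.2 hc) hv.1 hv.2
  · rfl

end Eunomia
namespace Eunomia
open Enc

/-! ## Multiples of the base point -/

theorem Curve.q_smul_base (E : Curve) : E.q • E.base = 0 := by
  conv_lhs => rw [← E.order_base]
  exact addOrderOf_nsmul_eq_zero _

theorem Curve.nsmul_base (E : Curve) (n : ℕ) : n • E.base = E.smul E.base (n : ZMod E.q) := by
  rw [Curve.smul, ZMod.val_natCast]
  conv_lhs => rw [← Nat.mod_add_div n E.q, add_smul, mul_comm, mul_smul, E.q_smul_base, smul_zero,
    add_zero]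

theorem Curve.smul_smul_base (E : Curve) (n : ℕ) (s : ZMod E.q) :
    n • E.smul E.base s = E.smul E.base (n * s) := by
  rw [Curve.smul, smul_smul, E.nsmul_base, Nat.cast_mul, ZMod.natCast_zmod_val]

theorem Curve.smul_add_base (E : Curve) (s t : ZMod E.q) :
    E.smul E.base s + E.smul E.base t = E.smul E.base (s + t) := by
  conv_lhs => rw [Curve.smul, Curve.smul, ← add_smul, E.nsmul_base, Nat.cast_add,
    ZMod.natCast_zmod_val, ZMod.natCast_zmod_val]

theorem Curve.q_smul_smul (E : Curve) (s : ZMod E.q) : E.q • E.smul E.base s = 0 := by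
  rw [E.smul_smul_base, ZMod.natCast_self, zero_mul, Curve.smul, ZMod.val_zero, zero_smul]

theorem Curve.smul_base_injective (E : Curve) : Function.Injective (E.smul E.base) := by
  intro s t h
  have h1 : s.val ≡ t.val [MOD addOrderOf E.base] := nsmul_eq_nsmul_iff_modEq.1 h
  rw [E.order_base, ← ZMod.natCast_eq_natCast_iff] at h1
  simpa using h1

/-- The encoded multiple of the base point by `k w(v)` in the class `J`, and by `k u(v)` in the other
classes. -/
noncomputable def pointOf (E : Curve) (u w : Data → ZMod E.q) (b : Bool) (k : ℕ) (v : Data) :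
    PMF Data :=
  PMF.pure (E.encode (E.smul E.base (k * if b = true then w v else u v)))

/-! ## Tables of keys -/

/-- Independent experiments for all columns. -/
noncomputable def sampleCols {β : Type} (f : Column → Bool → PMF β) (S : Schema) :
    PMF (List (List β)) :=
  sampleList (fun T : List Bool × ℕ =>
    sampleList (fun a : Bool × ℕ => f (T.2, a.2) a.1) T.1.zipIdx) S.zipIdx

def mapCols {β γ : Type} (g : Column → β → γ) (l : List (List β)) : List (List γ) :=
  l.mapIdx fun t T => T.mapIdx fun a e => g (t, a) e

/-- The entry of a column. -/
def colEntry {β : Type} (l : List (List β)) (c : Column) : Option β := (l[c.1]?).bind fun T => T[c.2]?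

theorem colEntry_mapCols {β γ : Type} (g : Column → β → γ) (l : List (List β)) (c : Column) :
    colEntry (mapCols g l) c = (colEntry l c).map (g c) := by
  simp only [colEntry, mapCols, List.getElem?_mapIdx]
  cases h : l[c.1]? <;> simp

theorem sampleCols_congr {β : Type} {f f' : Column → Bool → PMF β} {S : Schema}
    (h : ∀ c b, S.kind c = some b → f c b = f' c b) : sampleCols f S = sampleCols f' S := by
  refine sampleList_congr fun T hT => sampleList_congr fun a ha => ?_
  obtain ⟨T, t⟩ := T
  obtain ⟨a, i⟩ := a
  rw [List.mk_mem_zipIdx_iff_getElem?] at hT ha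
  exact h _ _ (by simp only [Schema.kind, hT, Option.bind_some]; exact ha)

theorem map_sampleCols {β γ : Type} (f : Column → Bool → PMF β) (g : Column → β → γ) (S : Schema) :
    (sampleCols f S).map (mapCols g) = sampleCols (fun c b => (f c b).map (g c)) S := by
  have key : ∀ {α β γ : Type} (f : α × ℕ → PMF β) (g : ℕ → β → γ) (l : List α) (n : ℕ),
      (sampleList f (l.zipIdx n)).map (List.mapIdx fun i => g (n + i)) =
        sampleList (fun p => (f p).map (g p.2)) (l.zipIdx n) := by
    intro α β γ f g l
    induction l with
    | nil => intro n; simp [sampleList, PMF.pure_map]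
    | cons a l ih =>
      intro n
      rw [List.zipIdx_cons, sampleList, sampleList, ← ih, PMF.bind_map, PMF.map_bind]
      congr 1
      funext b
      simp only [Function.comp_apply, PMF.map_comp]
      congr 1
      funext bs
      simp [List.mapIdx_cons, add_comm, add_left_comm]
  have h2 := key (fun T : List Bool × ℕ =>
    sampleList (fun a : Bool × ℕ => f (T.2, a.2) a.1) T.1.zipIdx)
    (fun t T => T.mapIdx fun a e => g (t, a) e) S 0
  simp only [zero_add] at h2
  rw [sampleCols, sampleCols, show mapCols g = List.mapIdx fun t T => T.mapIdx fun a e => g (t, a) e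
    from rfl, h2]
  congr 1
  funext T
  have h3 := key (fun a : Bool × ℕ => f (T.2, a.2) a.1) (fun a e => g (T.2, a) e) T.1 0
  simp only [zero_add] at h3
  rw [h3]

theorem mem_sampleCols {β : Type} {f : Column → Bool → PMF β} {S : Schema} {l : List (List β)}
    (hl : l ∈ (sampleCols f S).support) (c : Column) :
    (∃ b e, S.kind c = some b ∧ colEntry l c = some e ∧ e ∈ (f c b).support) ∨
      (S.kind c = none ∧ colEntry l c = none) := by
  have h1 := mem_sampleList hl
  have key : ∀ {α β : Type} {P : α × ℕ → β → Prop} {l : List α} {l' : List β} (i : ℕ),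
      List.Forall₂ P l.zipIdx l' → (∃ a b, l[i]? = some a ∧ l'[i]? = some b ∧ P (a, i) b) ∨
        (l[i]? = none ∧ l'[i]? = none) := by
    intro α β P l l' i h
    have hlen := h.length_eq
    rw [List.length_zipIdx] at hlen
    by_cases hi : i < l.length
    · left
      refine ⟨l[i], l'[i]'(hlen ▸ hi), by simp [hi], by simp [hlen ▸ hi], ?_⟩
      have := List.forall₂_iff_get.1 h
      have h2 := this.2 i (by simpa using hi) (hlen ▸ hi)
      simpa using h2
    · right
      simp only [List.getElem?_eq_none_iff]
      omega
  rcases key c.1 h1 with ⟨T, T', hT, hT', hP⟩ | ⟨hT, hT'⟩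
  · dsimp only at hP
    rcases key c.2 (mem_sampleList hP) with ⟨b, e, hb, he, hQ⟩ | ⟨hb, he⟩
    · exact .inl ⟨b, e, by simp [Schema.kind, hT, hb], by simp [colEntry, hT', he], hQ⟩
    · exact .inr ⟨by simp [Schema.kind, hT, hb], by simp [colEntry, hT', he]⟩
  · exact .inr ⟨by simp [Schema.kind, hT], by simp [colEntry, hT']⟩

/-- An experiment whose parameter matters for one column only. -/
theorem bind_sampleCols {β γ : Type} (p : PMF γ) (F : γ → Column → Bool → PMF β) (S : Schema)
    (c₀ : Column) (hF : ∀ c b, c ≠ c₀ → ∀ x x', F x c b = F x' c b) :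
    (p.bind fun x => sampleCols (F x) S) = sampleCols (fun c b => p.bind fun x => F x c b) S := by
  unfold sampleCols
  rw [bind_sampleList p _ _ c₀.1 0]
  · congr 1
    funext T
    by_cases hT : T.2 = c₀.1
    · rw [bind_sampleList p (fun x (a : Bool × ℕ) => F x (T.2, a.2) a.1) _ c₀.2 0]
      intro a i _ hi x x'
      exact hF _ _ (fun h => hi (congrArg Prod.snd h)) x x'
    · obtain ⟨x₀, -⟩ := p.support_nonempty
      have h : ∀ a i x, F x (T.2, i) a = F x₀ (T.2, i) a := fun a i x =>
        hF _ _ (fun h => hT (congrArg Prod.fst h)) x x₀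
      simp only [h, PMF.bind_const]
  · intro T t _ ht x x'
    congr 1
    funext a
    exact hF _ _ (fun h => ht (congrArg Prod.fst h)) x x'

theorem hashKey_eq (K : KeyTable) (c : Column) :
    K.hashKey c = ((colEntry K.2 c).getD (1, .int 0)).1 := by
  simp only [KeyTable.hashKey, colEntry, List.getD_eq_getElem?_getD]
  cases h : K.2[c.1]? <;> simp

theorem encKey_eq (K : KeyTable) (c : Column) :
    K.encKey c = ((colEntry K.2 c).getD (1, .int 0)).2 := by
  simp only [KeyTable.encKey, colEntry, List.getD_eq_getElem?_getD]
  cases h : K.2[c.1]? <;> simp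

/-- A uniform unit modulo `q`, as a natural number. -/
noncomputable def unitNat (q : ℕ) [Fact q.Prime] : PMF ℕ :=
  (PMF.uniformOfFintype (ZMod q)ˣ).map fun u : (ZMod q)ˣ => (u : ZMod q).val

/-- The keys of a column, for a given key of the timestamps. -/
noncomputable def keyPair (SE : EncScheme) (κd : Data) (q : ℕ) [Fact q.Prime] (t : ℕ) (isTime : Bool) :
    PMF (ℕ × Data) :=
  (if isTime = true then PMF.pure t else unitNat q).bind fun kh =>
    (SE.gen.exec κd).map fun ke => (kh, ke)

/-- For prime `q` the units are the residues `1, …, q - 1`, and subtracting 1 is a bijection onto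
`Fin (q - 1)`. -/
theorem unitNat_eq (q : ℕ) [Fact q.Prime] : (uniformNat (q - 1)).map (fun n => n + 1) = unitNat q := by
  have hq : 2 ≤ q := (Fact.out : q.Prime).two_le
  obtain ⟨m, rfl⟩ : ∃ m, q = m + 2 := ⟨q - 2, by omega⟩
  have h1 : uniformNat (m + 2 - 1) = (PMF.uniformOfFintype (Fin (m + 1))).map Fin.val := rfl
  let e : (ZMod (m + 2))ˣ ≃ Fin (m + 1) := Equiv.ofBijective
    (fun u => ⟨(u : ZMod (m + 2)).val - 1, by
      have := ZMod.val_lt (u : ZMod (m + 2)); omega⟩) (by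
    have hpos : ∀ u : (ZMod (m + 2))ˣ, (u : ZMod (m + 2)).val ≠ 0 := fun u h =>
      u.ne_zero ((ZMod.val_eq_zero _).1 h)
    constructor
    · intro u v h
      have h2 : (u : ZMod (m + 2)).val - 1 = (v : ZMod (m + 2)).val - 1 := congrArg Fin.val h
      have := hpos u
      have := hpos v
      exact Units.ext (ZMod.val_injective _ (by omega))
    · intro i
      have hi : ((i.val + 1 : ℕ) : ZMod (m + 2)) ≠ 0 := by
        rw [Ne, ZMod.natCast_eq_zero_iff]
        intro h
        have := Nat.le_of_dvd (by omega) h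
        omega
      refine ⟨Units.mk0 _ hi, Fin.ext ?_⟩
      simp only [Units.val_mk0]
      rw [ZMod.val_natCast, Nat.mod_eq_of_lt (by omega)]
      rfl)
  rw [h1, unitNat, ← uniform_map_equiv e, PMF.map_comp, PMF.map_comp]
  congr 1
  funext u
  change (u : ZMod (m + 2)).val - 1 + 1 = (u : ZMod (m + 2)).val
  have : (u : ZMod (m + 2)).val ≠ 0 := fun h => u.ne_zero ((ZMod.val_eq_zero _).1 h)
  omega

theorem natKeys_eq (SE : EncScheme) (κd : Data) (q : ℕ) [Fact q.Prime] (S : Schema) :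
    natKeys SE κd q S = (unitNat q).bind fun t =>
      (sampleCols (fun _ => keyPair SE κd q t) S).map fun cols => (t, cols) := by
  unfold natKeys
  simp only [unitNat_eq]
  rw [← unitNat_eq, PMF.bind_map]
  congr 1
  funext n
  simp only [Function.comp_apply]
  congr 1
  rw [sampleCols, ← sampleList_zipIdx _ S 0]
  congr 1
  funext T
  rw [← sampleList_zipIdx _ T.1 0]
  congr 1
  funext a
  simp only [keyPair, unitNat_eq]

theorem mem_unitNat {q : ℕ} [Fact q.Prime] {k : ℕ} (h : k ∈ (unitNat q).support) :
    (k : ZMod q) ≠ 0 := by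
  rw [unitNat, PMF.mem_support_map_iff] at h
  obtain ⟨u, -, rfl⟩ := h
  rw [ZMod.natCast_zmod_val]
  exact u.ne_zero

theorem mem_natKeys {SE : EncScheme} {κd : Data} {q : ℕ} [Fact q.Prime] {S : Schema} {K : KeyTable}
    (hK : K ∈ (natKeys SE κd q S).support) :
    (K.1 : ZMod q) ≠ 0 ∧ (∀ c, (K.hashKey c : ZMod q) ≠ 0) ∧
      (∀ c, S.IsTime c → K.hashKey c = K.1) ∧ (∀ c, (colEntry K.2 c).isSome ↔ S.Mem c) := by
  rw [natKeys_eq] at hK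
  simp only [PMF.mem_support_bind_iff, PMF.mem_support_map_iff] at hK
  obtain ⟨t, ht, cols, hcols, rfl⟩ := hK
  have ht' := mem_unitNat ht
  refine ⟨ht', fun c => ?_, fun c hc => ?_, fun c => ?_⟩
  · rw [hashKey_eq]
    rcases mem_sampleCols hcols c with ⟨b, e, hb, he, hm⟩ | ⟨-, he⟩
    · simp only [he, Option.getD_some]
      simp only [keyPair, PMF.mem_support_bind_iff, PMF.mem_support_map_iff] at hm
      obtain ⟨k, hk, _, _, rfl⟩ := hm
      split_ifs at hk
      · rw [PMF.mem_support_pure_iff] at hk; subst hk; exact ht'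
      · exact mem_unitNat hk
    · simp [he]
  · rw [hashKey_eq]
    rcases mem_sampleCols hcols c with ⟨b, e, hb, he, hm⟩ | ⟨hb, he⟩
    · simp only [he, Option.getD_some]
      rw [Schema.IsTime, hb, Option.some_inj] at hc
      subst hc
      simp only [keyPair, if_true, PMF.pure_bind, PMF.mem_support_map_iff] at hm
      obtain ⟨_, _, rfl⟩ := hm
      rfl
    · rw [Schema.IsTime, hb] at hc; simp at hc
  · rw [Schema.Mem]
    rcases mem_sampleCols hcols c with ⟨b, e, hb, he, hm⟩ | ⟨hb, he⟩ <;> simp [hb, he]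

/-! ## Multiplying the hash keys of a class -/

/-- Multiplication by `b` modulo `q`, if `p` holds. -/
def scaleKey (q b : ℕ) (p : Prop) [Decidable p] (k : ℕ) : ℕ := if p then k * b % q else k

theorem scaleKey_cast (q b : ℕ) (p : Prop) [Decidable p] (k : ℕ) :
    (scaleKey q b p k : ZMod q) = k * if p then (b : ZMod q) else 1 := by
  unfold scaleKey
  split_ifs <;> simp

/-- Multiplication by a nonzero scalar permutes the units, so it preserves the uniform distribution.
-/
theorem unitNat_scaleKey {q : ℕ} [Fact q.Prime] {b : ZMod q} (hb : b ≠ 0) (p : Prop) [Decidable p] :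
    (unitNat q).map (scaleKey q b.val p) = unitNat q := by
  by_cases hp : p
  · rw [unitNat]
    conv_rhs => rw [← uniform_map_equiv (Equiv.mulRight (Units.mk0 b hb))]
    rw [PMF.map_comp, PMF.map_comp]
    congr 1
    funext u
    simp [scaleKey, hp, ZMod.val_mul]
  · have : scaleKey q b.val p = id := by funext k; simp [scaleKey, hp]
    rw [this, PMF.map_id]

/-- Multiply the hash keys of the class `J` by `b`. -/
def scaleTable (w q b J : ℕ) (S : Schema) (δ : List (Column × Column)) (K : KeyTable) : KeyTable :=
  (scaleKey q b (timeLabel w S δ = J) K.1,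
    mapCols (fun c e => (scaleKey q b (classLabel w S δ c = J) e.1, e.2)) K.2)

/-- Hash keys are uniform units, independent except for the common key of the timestamps. The latter
causes no conflict: all timestamp columns have the label `timeLabel`, so their copies of the key and
the key itself are scaled together or not at all. -/
theorem natKeys_scale (SE : EncScheme) (κd : Data) {q : ℕ} [Fact q.Prime] (S : Schema) (w J : ℕ)
    (δ : List (Column × Column)) {b : ZMod q} (hb : b ≠ 0) :
    (natKeys SE κd q S).map (scaleTable w q b.val J S δ) = natKeys SE κd q S := by
  rw [natKeys_eq]
  conv_rhs => rw [← unitNat_scaleKey hb (timeLabel w S δ = J), PMF.bind_map]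
  rw [PMF.map_bind]
  congr 1
  funext t
  simp only [Function.comp_apply]
  have : scaleTable w q b.val J S δ ∘ (fun cols => (t, cols)) =
      (fun cols => (scaleKey q b.val (timeLabel w S δ = J) t, cols)) ∘
        mapCols (fun c e => (scaleKey q b.val (classLabel w S δ c = J) e.1, e.2)) := rfl
  rw [PMF.map_comp, this, ← PMF.map_comp, map_sampleCols]
  congr 1
  refine sampleCols_congr fun c isTime hc => ?_
  unfold keyPair
  rw [PMF.map_bind]
  simp only [PMF.map_comp]
  cases isTime with
  | true =>
    simp only [if_true, PMF.pure_bind]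
    rw [classLabel_of_isTime (c := c) hc]
    rfl
  | false =>
    simp only [Bool.false_eq_true, if_false]
    conv_rhs => rw [← unitNat_scaleKey hb (classLabel w S δ c = J), PMF.bind_map]
    rfl

/-- Residues modulo `q` are compared in `ZMod q`, where the power `q - 2` is the inverse of a
nonzero key. -/
theorem token_scale {q : ℕ} [Fact q.Prime] (a b c d : ℕ)
    (h : (a : ZMod q) * (c : ZMod q)⁻¹ = b * (d : ZMod q)⁻¹) (hc : (c : ZMod q) ≠ 0)
    (hd : (d : ZMod q) ≠ 0) :
    a * powMod (q - 1) c (q - 2) % q = b * powMod (q - 1) d (q - 2) % q := by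
  have hq : 2 ≤ q := (Fact.out : q.Prime).two_le
  have hR : ((q - 1 + 1 : ℕ) : ZMod q) = 0 := by
    rw [Nat.sub_add_cancel (by omega), ZMod.natCast_self]
  have hinv : ∀ n : ℕ, (n : ZMod q) ≠ 0 → (powMod (q - 1) n (q - 2) : ZMod q) = (n : ZMod q)⁻¹ := by
    intro n hn
    rw [powMod_cast hR]
    refine eq_inv_of_mul_eq_one_left ?_
    rw [← pow_succ, show q - 2 + 1 = q - 1 by omega]
    exact ZMod.pow_card_sub_one_eq_one hn
  rw [← Nat.ModEq, ← ZMod.natCast_eq_natCast_iff, Nat.cast_mul, Nat.cast_mul, hinv c hc, hinv d hd, h]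

end Eunomia
namespace Eunomia
open Enc

/-- A size-preserving bijection between two sets of data extends to an injection of all data which is
the identity outside these sets. -/
theorem exists_extension {A B : Set Data} {M : Data → Data} (hM : Set.BijOn M A B)
    (hsize : ∀ v ∈ A, (M v).size = v.size) : ∃ σ : Data → Data, Function.Injective σ ∧
      (∀ v, (σ v).size = v.size) ∧ (∀ v ∈ A, σ v = M v) ∧ ∀ v, v ∉ A → v ∉ B → σ v = v := by
  classical
  -- Data of a fixed size are finite in number, so within size `n` the bijection from the part in
  -- `A` to the part in `B` extends to a permutation of their union. The permutations for all `n`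
  -- are glued together, which preserves sizes.
  let α (n : ℕ) : Type := {v : Data // (v ∈ A ∨ v ∈ B) ∧ v.size = n}
  have hfin : ∀ n, Finite (α n) := fun n =>
    Finite.of_injective (fun v : α n => (⟨v.1, v.2.2.le⟩ : {d : Data // d.size ≤ n}))
      fun a b h => Subtype.ext (congrArg (fun z => z.1) h)
  let _ : ∀ n, Fintype (α n) := fun n => Fintype.ofFinite _
  have hbij : ∀ n, Function.Bijective (fun a : {a : α n // a.1 ∈ A} =>
      (⟨⟨M a.1.1, .inr (hM.mapsTo a.2), (hsize _ a.2).trans a.1.2.2⟩, hM.mapsTo a.2⟩ :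
        {a : α n // a.1 ∈ B})) := by
    intro n
    constructor
    · intro a b h
      have h1 : M a.1.1 = M b.1.1 := congrArg (fun z => z.1.1) h
      exact Subtype.ext (Subtype.ext (hM.injOn a.2 b.2 h1))
    · rintro ⟨⟨b, hb, hn⟩, hB⟩
      obtain ⟨a, ha, rfl⟩ := hM.surjOn hB
      exact ⟨⟨⟨a, .inl ha, (hsize a ha).symm.trans hn⟩, ha⟩, rfl⟩
  let e (n : ℕ) : Equiv.Perm (α n) := (Equiv.ofBijective _ (hbij n)).extendSubtype
  let σ (v : Data) : Data := if h : v ∈ A ∨ v ∈ B then (e v.size ⟨v, h, rfl⟩).1 else v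
  have hσ : ∀ v (h : v ∈ A ∨ v ∈ B) n (hn : v.size = n), σ v = (e n ⟨v, h, hn⟩).1 := by
    rintro v h n rfl
    exact dif_pos h
  have hσ' : ∀ v, ¬ (v ∈ A ∨ v ∈ B) → σ v = v := fun v h => dif_neg h
  have hs : ∀ v, (σ v).size = v.size := fun v => by
    by_cases h : v ∈ A ∨ v ∈ B
    · rw [hσ v h _ rfl]; exact (e v.size ⟨v, h, rfl⟩).2.2
    · rw [hσ' v h]
  have hmem : ∀ v, (σ v ∈ A ∨ σ v ∈ B) ↔ (v ∈ A ∨ v ∈ B) := fun v => by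
    by_cases h : v ∈ A ∨ v ∈ B
    · simp only [h, iff_true]; rw [hσ v h _ rfl]; exact (e v.size ⟨v, h, rfl⟩).2.1
    · rw [hσ' v h]
  refine ⟨σ, fun v v' h => ?_, hs, fun v hv => ?_, fun v hA hB => hσ' v (not_or.2 ⟨hA, hB⟩)⟩
  · have h1 := hmem v
    rw [h, hmem v'] at h1
    by_cases hv : v ∈ A ∨ v ∈ B
    · have hv' := h1.2 hv
      have h2 : v'.size = v.size := by rw [← hs v', ← h, hs]
      rw [hσ v hv _ rfl, hσ v' hv' _ h2] at h
      exact congrArg Subtype.val ((e v.size).injective (Subtype.ext h))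
    · rwa [hσ' v hv, hσ' v' (fun h' => hv (h1.1 h'))] at h
  · rw [hσ v (.inl hv) _ rfl]
    have := (Equiv.ofBijective _ (hbij v.size)).extendSubtype_apply_of_mem
      (⟨v, .inl hv, rfl⟩ : α v.size) hv
    exact congrArg Subtype.val this

section Valid

variable {x : Data}

theorem exists_cellMap (hx : (Challenge.ofData x).Valid) : ∃ M : Column → Data → Data,
    (∀ c c', SameClass (schemaOf x) (pairsOf x) c c' → M c = M c') ∧
    (∀ c, Set.BijOn (M c) (classValues (schemaOf x) (pairsOf x) (firstLog x) c)
      (classValues (schemaOf x) (pairsOf x) (secondLog x) c)) ∧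
    (∀ c, ∀ v ∈ classValues (schemaOf x) (pairsOf x) (firstLog x) c,
      v ∈ constantsOf x ∨ M c v ∈ constantsOf x → M c v = v) ∧
    (∀ c, ∀ v ∈ classValues (schemaOf x) (pairsOf x) (firstLog x) c, (M c v).size = v.size) ∧
    (∀ c i v, (firstLog x).cell c i = some v → (secondLog x).cell c i = some (M c v)) ∧
    secondLog x = (firstLog x).mapCells M := by
  obtain ⟨M, h1, h2, h3, h4, h5⟩ := hx.equiv.bijections
  exact ⟨M, h1, h2, h4, fun c v hv => (h5 c v hv).symm, h3,
    eq_mapCells hx.equiv.schema₁ hx.equiv.schema₂ hx.equiv.rows h3⟩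

theorem mem_classValues {S : Schema} {δ : List (Column × Column)} {L : Log} {c c' : Column} {i : ℕ}
    {v : Data} (hc : SameClass S δ c c') (h : L.cell c' i = some v) : v ∈ classValues S δ L c :=
  ⟨c', hc, mem_column_iff.2 ⟨i, h⟩⟩

theorem pairs_lt (hx : (Challenge.ofData x).Valid) {w : ℕ} (hw : x.size ≤ w) :
    ∀ e ∈ pairsOf x, (e.1.1 < w ∧ e.1.2 < w) ∧ (e.2.1 < w ∧ e.2.2 < w) := by
  intro e he
  obtain ⟨h1, h2⟩ := hx.scheme e he
  have h3 := mem_lt_size h1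
  have h4 := mem_lt_size h2
  omega

theorem mem_lt {w : ℕ} (hw : x.size ≤ w) {c : Column} (hc : (schemaOf x).Mem c) :
    c.1 < w ∧ c.2 < w := by
  have := mem_lt_size hc
  omega

theorem isTime_mem {S : Schema} {c : Column} (h : S.IsTime c) : S.Mem c := by
  rw [Schema.Mem, h]; rfl

variable {A₂ : Prog} {SE : EncScheme}

theorem hashKey_scaleTable {w q b J : ℕ} {S : Schema} {δ : List (Column × Column)} {K : KeyTable}
    {c : Column} (hc : (colEntry K.2 c).isSome) : (scaleTable w q b J S δ K).hashKey c =
      scaleKey q b (classLabel w S δ c = J) (K.hashKey c) := by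
  rw [hashKey_eq, hashKey_eq, scaleTable, colEntry_mapCols]
  obtain ⟨e, he⟩ := Option.isSome_iff_exists.1 hc
  simp [he]

theorem encKey_scaleTable {w q b J : ℕ} {S : Schema} {δ : List (Column × Column)} {K : KeyTable}
    {c : Column} : (scaleTable w q b J S δ K).encKey c = K.encKey c := by
  rw [encKey_eq, encKey_eq, scaleTable, colEntry_mapCols]
  cases colEntry K.2 c <;> rfl

/-- A hash depends on the key and the function only through their product, so a factor can move from
one to the other. -/
theorem pointOf_scaleKey (E : Curve) (u f : Data → ZMod E.q) (b : ZMod E.q) (p : Prop) [Decidable p]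
    (k : ℕ) (v : Data) : pointOf E u f (decide p) (scaleKey E.q b.val p k) v =
      pointOf E u (fun v => b * f v) (decide p) k v := by
  unfold pointOf
  rw [scaleKey_cast, ZMod.natCast_zmod_val]
  by_cases hp : p <;> simp [hp, mul_assoc]

/-- For hashes this is `pointOf_scaleKey`. A token joins two columns of the same label, so either
both keys are multiplied by `b` or neither is, and the quotient stays the same. Encryption keys are
not touched. -/
theorem hybridAttack_scaleTable (hx : (Challenge.ofData x).Valid) (E : Curve) {w J θ : ℕ}
    {κd : Data} {K : KeyTable} (hK : K ∈ (natKeys SE κd E.q (schemaOf x)).support)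
    (u f : Data → ZMod E.q) {b : ZMod E.q} (hb : b ≠ 0) :
    hybridAttack A₂ SE x w E.q J θ (scaleTable w E.q b.val J (schemaOf x) (pairsOf x) K)
      (pointOf E u f) =
    hybridAttack A₂ SE x w E.q J θ K (pointOf E u fun v => b * f v) := by
  obtain ⟨h0, h1, -, h3⟩ := mem_natKeys hK
  have hk : ∀ c, (schemaOf x).Mem c → (scaleTable w E.q b.val J (schemaOf x) (pairsOf x) K).hashKey c =
      scaleKey E.q b.val (classLabel w (schemaOf x) (pairsOf x) c = J) (K.hashKey c) :=
    fun c hc => hashKey_scaleTable ((h3 c).2 hc)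
  have hcol : ∀ c, (schemaOf x).Mem c → ∀ v, pointOf E u f
      (decide (classLabel w (schemaOf x) (pairsOf x) c = J))
      ((scaleTable w E.q b.val J (schemaOf x) (pairsOf x) K).hashKey c) v =
      pointOf E u (fun v => b * f v) (decide (classLabel w (schemaOf x) (pairsOf x) c = J))
        (K.hashKey c) v := fun c hc v => by
    rw [hk c hc, pointOf_scaleKey]
  have htime : ∀ v, pointOf E u f (decide (timeLabel w (schemaOf x) (pairsOf x) = J))
      (scaleTable w E.q b.val J (schemaOf x) (pairsOf x) K).1 v =
      pointOf E u (fun v => b * f v) (decide (timeLabel w (schemaOf x) (pairsOf x) = J)) K.1 v :=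
    fun v => pointOf_scaleKey _ _ _ _ _ _ _
  unfold hybridAttack
  refine attack_congr ?_ ?_ ?_ ?_ ?_ ?_
  · intro c i v hv
    rw [hcol c (hx.equiv.schema₁.mem_of_cell hv), encKey_scaleTable]
  · intro i _; rw [htime]
  · intro _ d _; rw [htime]
  · intro c v hc _ _; rw [hcol c hc, encKey_scaleTable]
  · intro c v hc _ _; rw [hcol c hc, encKey_scaleTable]
  · unfold tokenData
    congr 1
    refine List.map_congr_left fun e he => ?_
    obtain ⟨hc1, hc2⟩ := hx.scheme e he
    have hb1 : ∀ p : Prop, [Decidable p] → (if p then ((b.val : ℕ) : ZMod E.q) else 1) ≠ 0 := by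
      intro p _
      split_ifs
      · rwa [ZMod.natCast_zmod_val]
      · exact one_ne_zero
    have hlab := classLabel_of_mem (W := w) (S := schemaOf x) he
    rw [hk _ hc1, hk _ hc2, token_scale (scaleKey E.q b.val _ (K.hashKey e.2)) (K.hashKey e.2)
      (scaleKey E.q b.val _ (K.hashKey e.1)) (K.hashKey e.1) ?_ ?_ (h1 _)]
    · rw [scaleKey_cast, scaleKey_cast]
      simp only [hlab]
      have := hb1 (classLabel w (schemaOf x) (pairsOf x) e.2 = J)
      have := h1 e.1
      field_simp
    · rw [scaleKey_cast]
      exact mul_ne_zero (h1 _) (hb1 _)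

/-- Replacing the hashes of the class `J` in the second log by those in the first log amounts to a
permutation of the hashed values. -/
theorem exists_perm_hybridAttack (hx : (Challenge.ofData x).Valid) {w : ℕ} (hw : x.size ≤ w)
    (J : ℕ) : ∃ σ : Data → Data, Function.Injective σ ∧ (∀ v, (σ v).size = v.size) ∧
      ∀ (A₂ : Prog) (SE : EncScheme) (E : Curve) (K : KeyTable) (u f : Data → ZMod E.q),
        hybridAttack A₂ SE x w E.q J J K (pointOf E u f) =
          hybridAttack A₂ SE x w E.q J (J + 1) K (pointOf E u (f ∘ σ)) := by
  obtain ⟨M, hM1, hM2, hM3, hM4, hM5, hM6⟩ := exists_cellMap hx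
  have hδ := pairs_lt hx hw
  obtain ⟨σ, hσ1, hσ2, hσ3⟩ : ∃ σ : Data → Data, Function.Injective σ ∧
      (∀ v, (σ v).size = v.size) ∧ ∀ c, (schemaOf x).Mem c →
      classLabel w (schemaOf x) (pairsOf x) c = J →
      (∀ v ∈ classValues (schemaOf x) (pairsOf x) (firstLog x) c, σ v = M c v) ∧
      (∀ v, v ∈ constantsOf x → σ v = v) ∧
      (∀ v, v ∉ (firstLog x).values → v ∉ (secondLog x).values → σ v = v) := by
    -- A random label may belong to no column; then nothing has to be permuted.
    by_cases hJ : ∃ c, (schemaOf x).Mem c ∧ classLabel w (schemaOf x) (pairsOf x) c = J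
    · obtain ⟨c₀, hc₀, hl₀⟩ := hJ
      obtain ⟨σ, h1, h2, h3, h4⟩ := exists_extension (hM2 c₀) (hM4 c₀)
      refine ⟨σ, h1, h2, fun c hc hl => ?_⟩
      have hcc : SameClass (schemaOf x) (pairsOf x) c₀ c :=
        sameClass_of_classLabel hδ (mem_lt hw hc₀) (mem_lt hw hc) (hl₀.trans hl.symm)
      refine ⟨fun v hv => ?_, fun v hv => ?_, fun v hv hv' => h4 v ?_ ?_⟩
      · rw [← hM1 _ _ hcc]
        obtain ⟨c', hc', hv⟩ := hv
        exact h3 v ⟨c', hcc.trans _ _ _ hc', hv⟩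
      -- A constant that occurs in the class of the first log is fixed by `M`. If it occurred only
      -- in the second log, its preimage would be fixed as well, hence equal to it, a contradiction.
      -- If it occurs in neither, the extension is the identity there.
      · by_cases hA : v ∈ classValues (schemaOf x) (pairsOf x) (firstLog x) c₀
        · rw [h3 v hA, hM3 c₀ v hA (.inl hv)]
        · by_cases hB : v ∈ classValues (schemaOf x) (pairsOf x) (secondLog x) c₀
          · obtain ⟨a, ha, rfl⟩ := (hM2 c₀).surjOn hB
            rw [hM3 c₀ a ha (.inr hv)] at hA
            exact absurd ha hA
          · exact h4 v hA hB
      · rintro ⟨c', -, hc'⟩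
        obtain ⟨i, hi⟩ := mem_column_iff.1 hc'
        exact hv (mem_values_of_cell hi)
      · rintro ⟨c', -, hc'⟩
        obtain ⟨i, hi⟩ := mem_column_iff.1 hc'
        exact hv' (mem_values_of_cell hi)
    · exact ⟨id, Function.injective_id, fun _ => rfl, fun c hc hl => absurd ⟨c, hc, hl⟩ hJ⟩
  refine ⟨σ, hσ1, hσ2, fun A₂ SE E K u f => ?_⟩
  have hpt : ∀ (p : Prop) [Decidable p] k v, (p → σ v = v) →
      pointOf E u f (decide p) k v = pointOf E u (f ∘ σ) (decide p) k v := by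
    intro p _ k v h
    unfold pointOf
    by_cases hp : p <;> simp [hp, h]
  have hptJ : ∀ k v v', σ v = v' → pointOf E u f true k v' = pointOf E u (f ∘ σ) true k v := by
    rintro k v _ rfl; rfl
  have hself : ∀ c i v, (firstLog x).cell c i = some v →
      v ∈ classValues (schemaOf x) (pairsOf x) (firstLog x) c := fun c i v h =>
    mem_classValues (.refl _) h
  have htime : ∀ i < (timeStamps (schemaOf x) (firstLog x)).length, ∃ c,
      (schemaOf x).IsTime c ∧
      ((timeStamps (schemaOf x) (firstLog x)).getD i (.int 0)) ∈
        classValues (schemaOf x) (pairsOf x) (firstLog x) c ∧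
      (timeStamps (schemaOf x) (secondLog x)).getD i (.int 0) =
        M c ((timeStamps (schemaOf x) (firstLog x)).getD i (.int 0)) := by
    intro i hi
    obtain ⟨c, j, hc, hcell⟩ := mem_timeStamps (List.getElem_mem hi)
    refine ⟨c, hc, ?_, ?_⟩
    · rw [List.getD_eq_getElem?_getD, List.getElem?_eq_getElem hi]
      exact hself c j _ hcell
    · rw [hM6, timeStamps_mapCells (firstLog x) (f := M c) fun c' hc' =>
        hM1 _ _ (.rel _ _ (.inr ⟨hc', hc⟩))]
      simp [List.getD_eq_getElem?_getD, hi]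
  unfold hybridAttack
  refine attack_congr ?_ ?_ ?_ ?_ ?_ rfl
  · intro c i v hv
    have hc := hx.equiv.schema₁.mem_of_cell hv
    congr 1
    rcases lt_trichotomy (classLabel w (schemaOf x) (pairsOf x) c) J with hlt | heq | hgt
    · rw [if_pos hlt, if_pos (by omega)]
      exact hpt _ _ _ fun h => absurd h hlt.ne
    · rw [if_neg (by omega), if_pos (by omega), cellD_of_cell hv, cellD_of_cell (hM5 _ _ _ hv)]
      simp only [heq, decide_true]
      exact hptJ _ _ _ ((hσ3 c hc heq).1 v (hself c i v hv))
    · rw [if_neg (by omega), if_neg (by omega)]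
      exact hpt _ _ _ fun h => absurd h hgt.ne'
  · intro i hi
    obtain ⟨c, hc, hv, hv'⟩ := htime i hi
    rcases lt_trichotomy (timeLabel w (schemaOf x) (pairsOf x)) J with hlt | heq | hgt
    · rw [if_pos hlt, if_pos (by omega)]
      exact hpt _ _ _ fun h => absurd h hlt.ne
    · rw [if_neg (by omega), if_pos (by omega), hv']
      simp only [heq, decide_true]
      exact hptJ _ _ _ ((hσ3 c (isTime_mem hc) ((classLabel_of_isTime hc).trans heq)).1 _ hv)
    · rw [if_neg (by omega), if_neg (by omega)]
      exact hpt _ _ _ fun h => absurd h hgt.ne'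
  -- Displacements are constants, hence fixed by `σ`. That `σ` fixes constants is known only if `J`
  -- is the label of an actual column, and a timestamp provides one.
  · intro hne d hd
    obtain ⟨c, hc, -⟩ := htime 0 (List.length_pos_of_ne_nil hne)
    refine hpt _ _ _ fun h => ?_
    exact (hσ3 c (isTime_mem hc) ((classLabel_of_isTime hc).trans h)).2.1 d (hx.displacements hd)
  · intro c v hc hv _
    congr 1
    exact hpt _ _ _ fun h => (hσ3 c hc h).2.1 v hv
  · intro c v hc hv hv'
    congr 1
    exact hpt _ _ _ fun h => (hσ3 c hc h).2.2 v hv hv'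

end Valid

end Eunomia
namespace Eunomia
open Enc

theorem size_unary (κ : ℕ) : (Data.unary κ).size = 3 * κ + 1 := by
  unfold Data.unary
  induction κ with
  | zero => rfl
  | succ n ih =>
    rw [List.replicate_succ, Data.ofList, Data.size, ih]
    have : (Data.int 1).size = 2 := by decide
    omega

theorem toList_ofList (l : List Data) : (Data.ofList l).toList = l := by
  induction l with
  | nil => rfl
  | cons a l ih => rw [Data.ofList, Data.toList, ih]

theorem listLength_unary (κ : ℕ) : listLength (.unary κ) = κ := by
  rw [listLength, Data.unary, toList_ofList, List.length_replicate]

/-! ## What the adversaries of the reductions compute -/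

/-- A linear combination of the two halves of a function. -/
def linearPart {q : ℕ} (a b : ZMod q) (f : Data → ZMod q) (v : Data) : ZMod q :=
  a * f (tagged false v) + b * f (tagged true v)

/-- The guess in the hybrid attack at a random class. -/
noncomputable def hybridBit (G : CurveFamily) (A₁ A₂ : Prog) (SE : EncScheme) (W : Polynomial ℕ)
    (side κ : ℕ) (pp : Data) (u f : Data → ZMod (G.curve pp).q) : PMF Bool :=
  (randomHybrid A₁ A₂ SE W side (.pair (.unary κ) pp) (G.curve pp).q
    (pointOf (G.curve pp) u f)).map Data.toBool

/-- The hybrid attack with hashes computed from a (possibly degenerate) Diffie-Hellman triple. -/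
noncomputable def linearGame (G : CurveFamily) (A₁ A₂ : Prog) (SE : EncScheme) (W : Polynomial ℕ)
    (side κ : ℕ) (real : Bool) (pp : Data) (f : Data → ZMod (G.curve pp).q) : PMF Bool :=
  (PMF.uniformOfFintype (ZMod (G.curve pp).q)).bind fun a =>
  (PMF.uniformOfFintype (ZMod (G.curve pp).q)).bind fun b =>
  (PMF.uniformOfFintype (ZMod (G.curve pp).q)).bind fun c =>
    hybridBit G A₁ A₂ SE W side κ pp (linearPart a 1 f)
      (linearPart (if real = true then a * b else c) b f)

theorem toNat_ofNat (n : ℕ) : (Data.ofNat n).toNat = n := by simp [Data.toNat, Data.ofNat]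

theorem askNat_pure {q : ℕ} [Fact q.Prime] {O : Data → PMF Data} {f : Data → ZMod q}
    (hO : ∀ v, O v = PMF.pure (.ofNat (f v).val)) (y : Data) :
    askNat O q y = PMF.pure (f y).val := by
  have hle : (Data.ofNat (f y).val).size ≤ (Data.ofNat q).size := by
    rw [size_ofNat, size_ofNat]
    have := Nat.size_le_size (ZMod.val_lt (f y)).le
    omega
  rw [askNat, hO, PMF.pure_map, PMF.pure_map, if_pos hle, toNat_ofNat]

theorem uniformNat_bind {q : ℕ} [NeZero q] {R : Type} (f : ℕ → PMF R) :
    (uniformNat q).bind f = (PMF.uniformOfFintype (ZMod q)).bind fun a => f a.val := by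
  have := uniformNat_map (q := q) (id : ℕ → ℕ)
  rw [PMF.map_id] at this
  rw [this, PMF.bind_map]
  rfl

section Reductions

variable {G : CurveFamily} {e : Polynomial ℕ} {κ : ℕ} {pp : Data}

theorem pp_order (hpp : pp ∈ (G.setup.exec (.unary κ)).support) :
    pp.snd.fst.toNat = (G.curve pp).q := by
  obtain ⟨desc, h⟩ := G.pp_spec κ pp hpp
  conv_lhs => rw [h]
  simp [Data.toNat, Data.ofNat]

theorem pp_base (hpp : pp ∈ (G.setup.exec (.unary κ)).support) :
    pp.snd.snd = (G.curve pp).encode (G.curve pp).base := by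
  obtain ⟨desc, h⟩ := G.pp_spec κ pp hpp
  conv_lhs => rw [h]
  rfl

theorem smulM_smul_base (he : ∀ κ, ∀ pp ∈ (G.setup.exec (.unary κ)).support, ∀ X,
    ((G.curve pp).encode X).size ≤ e.eval κ) (hpp : pp ∈ (G.setup.exec (.unary κ)).support)
    (s : ZMod (G.curve pp).q) (n : ℕ) :
    smulM G e (.unary κ) pp ((G.curve pp).encode ((G.curve pp).smul (G.curve pp).base s)) n
      (G.curve pp).q =
      PMF.pure ((G.curve pp).encode ((G.curve pp).smul (G.curve pp).base (n * s))) := by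
  rw [smulM_eq he hpp (by rw [size_unary]; omega) _ ((G.curve pp).q_smul_smul s),
    Curve.smul_smul_base]

theorem smul_base_one (E : Curve) : E.smul E.base 1 = E.base := by
  have := E.nsmul_base 1
  rw [one_smul, Nat.cast_one] at this
  exact this.symm

theorem scalarHash_eq (he : ∀ κ, ∀ pp ∈ (G.setup.exec (.unary κ)).support, ∀ X,
    ((G.curve pp).encode X).size ≤ e.eval κ) (hpp : pp ∈ (G.setup.exec (.unary κ)).support)
    {F : Bool → Data → PMF ℕ} {n : Bool → Data → ℕ} (hF : ∀ b v, F b v = PMF.pure (n b v)) :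
    scalarHash G e (.pair (.unary κ) pp) F =
      pointOf (G.curve pp) (fun v => (n false v : ZMod (G.curve pp).q))
        (fun v => (n true v : ZMod (G.curve pp).q)) := by
  funext b k v
  rw [scalarHash, hF, PMF.pure_bind]
  have h1 := smulM_smul_base he hpp 1 (k * n b v)
  rw [smul_base_one, ← pp_base hpp, mul_one] at h1
  simp only [Data.snd_pair, Data.fst_pair]
  rw [pp_order hpp, h1, pointOf, Nat.cast_mul]
  cases b <;> rfl

variable {A₁ A₂ : Prog} {SE : EncScheme} {W : Polynomial ℕ} {side : ℕ}

theorem plainAdversary_exec (he : ∀ κ, ∀ pp ∈ (G.setup.exec (.unary κ)).support, ∀ X,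
    ((G.curve pp).encode X).size ≤ e.eval κ) (hpp : pp ∈ (G.setup.exec (.unary κ)).support)
    {B : Prog} (hB : ∀ O d, B.execWith O d = randomHybrid A₁ A₂ SE W side d d.snd.snd.fst.toNat
        (scalarHash G e d fun _ v => askNat O d.snd.snd.fst.toNat v))
    (f : Data → ZMod (G.curve pp).q) :
    (B.execWith (fun v => PMF.pure (.ofNat (f v).val)) (.pair (.unary κ) pp)).map Data.toBool =
      hybridBit G A₁ A₂ SE W side κ pp f f := by
  rw [hB, hybridBit]
  simp only [Data.snd_pair]
  rw [pp_order hpp, scalarHash_eq he hpp (n := fun b v => (f v).val)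
    fun b v => askNat_pure (fun _ => rfl) v]
  simp only [ZMod.natCast_zmod_val]

theorem taggedAdversary_exec (he : ∀ κ, ∀ pp ∈ (G.setup.exec (.unary κ)).support, ∀ X,
    ((G.curve pp).encode X).size ≤ e.eval κ) (hpp : pp ∈ (G.setup.exec (.unary κ)).support)
    {B : Prog} (hB : ∀ O d, B.execWith O d = randomHybrid A₁ A₂ SE W side d d.snd.snd.fst.toNat
        (scalarHash G e d fun b v => askNat O d.snd.snd.fst.toNat (tagged b v)))
    (f : Data → ZMod (G.curve pp).q) :
    (B.execWith (fun v => PMF.pure (.ofNat (f v).val)) (.pair (.unary κ) pp)).map Data.toBool =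
      hybridBit G A₁ A₂ SE W side κ pp (fun v => f (tagged false v)) fun v => f (tagged true v) := by
  rw [hB, hybridBit]
  simp only [Data.snd_pair]
  rw [pp_order hpp, scalarHash_eq he hpp (n := fun b v => (f (tagged b v)).val)
    fun b v => askNat_pure (fun _ => rfl) _]
  simp only [ZMod.natCast_zmod_val]

theorem linearAdversary_exec (he : ∀ κ, ∀ pp ∈ (G.setup.exec (.unary κ)).support, ∀ X,
    ((G.curve pp).encode X).size ≤ e.eval κ) (hpp : pp ∈ (G.setup.exec (.unary κ)).support)
    {B : Prog} {real : Bool} (hB : ∀ O d, B.execWith O d =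
      (uniformNat d.snd.snd.fst.toNat).bind fun a => (uniformNat d.snd.snd.fst.toNat).bind fun b =>
      (uniformNat d.snd.snd.fst.toNat).bind fun c =>
      randomHybrid A₁ A₂ SE W side d d.snd.snd.fst.toNat
        (scalarHash G e d (linearScalar O d.snd.snd.fst.toNat a b
          (if real = true then a * b else c))))
    (f : Data → ZMod (G.curve pp).q) :
    (B.execWith (fun v => PMF.pure (.ofNat (f v).val)) (.pair (.unary κ) pp)).map Data.toBool =
      linearGame G A₁ A₂ SE W side κ real pp f := by
  rw [hB, linearGame]
  simp only [Data.snd_pair]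
  rw [pp_order hpp]
  simp only [uniformNat_bind, PMF.map_bind]
  refine bind_congr fun a _ => bind_congr fun b _ => bind_congr fun c _ => ?_
  rw [hybridBit, scalarHash_eq he hpp (n := fun chal v => if chal = true then
    (if real = true then a.val * b.val else c.val) * (f (tagged false v)).val +
      b.val * (f (tagged true v)).val else a.val * (f (tagged false v)).val + (f (tagged true v)).val)]
  · have h1 : (fun v => ((if false = true then
        (if real = true then a.val * b.val else c.val) * (f (tagged false v)).val +
        b.val * (f (tagged true v)).val else a.val * (f (tagged false v)).val +
        (f (tagged true v)).val : ℕ) : ZMod (G.curve pp).q)) = linearPart a 1 f := by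
      funext v; simp [linearPart]
    have h2 : (fun v => ((if true = true then
        (if real = true then a.val * b.val else c.val) * (f (tagged false v)).val +
        b.val * (f (tagged true v)).val else a.val * (f (tagged false v)).val +
        (f (tagged true v)).val : ℕ) : ZMod (G.curve pp).q)) =
        linearPart (if real = true then a * b else c) b f := by
      funext v; cases real <;> simp [linearPart]
    rw [h1, h2]
  · intro chal v
    rw [linearScalar, askNat_pure (fun _ => rfl), askNat_pure (fun _ => rfl), PMF.pure_bind,
      PMF.pure_map]

/-- With `A = aP`, `B = bP`, `Z = zP`: outside the class `k y A + k y' P = k (a y + y') P`, and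
inside it `k y Z + k y' B = k (z y + b y') P`. -/
theorem pointHash_eq (he : ∀ κ, ∀ pp ∈ (G.setup.exec (.unary κ)).support, ∀ X,
    ((G.curve pp).encode X).size ≤ e.eval κ) (hpp : pp ∈ (G.setup.exec (.unary κ)).support)
    (H : DetScheme G) {key : Data} (hkey : key ∈ (H.gen.exec (.pair (.unary κ) pp)).support)
    (a b z : ZMod (G.curve pp).q) :
    pointHash G H e (.pair (.unary κ) pp) key
      ((G.curve pp).encode ((G.curve pp).smul (G.curve pp).base a))
      ((G.curve pp).encode ((G.curve pp).smul (G.curve pp).base b))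
      ((G.curve pp).encode ((G.curve pp).smul (G.curve pp).base z)) =
    pointOf (G.curve pp) (linearPart a 1 (H.det pp key)) (linearPart z b (H.det pp key)) := by
  have hb : pp.snd.snd = (G.curve pp).encode ((G.curve pp).smul (G.curve pp).base 1) := by
    rw [smul_base_one, pp_base hpp]
  funext chal k v
  simp only [pointHash, Data.snd_pair, Data.fst_pair]
  rw [H.prog_spec κ pp hpp key hkey, H.prog_spec κ pp hpp key hkey, PMF.pure_bind, PMF.pure_bind,
    toNat_ofNat, toNat_ofNat, pp_order hpp, hb]
  have hmul : ∀ (x y : ZMod (G.curve pp).q) n, smulM G e (.unary κ) pp (if chal = true then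
      (G.curve pp).encode ((G.curve pp).smul (G.curve pp).base x) else
      (G.curve pp).encode ((G.curve pp).smul (G.curve pp).base y)) n (G.curve pp).q =
      PMF.pure ((G.curve pp).encode ((G.curve pp).smul (G.curve pp).base
        (n * if chal = true then x else y))) := by
    intro x y n
    rw [← smulM_smul_base he hpp]
    cases chal <;> rfl
  rw [hmul, hmul, PMF.pure_bind, PMF.pure_bind, addM, G.add_spec κ pp hpp, pointOf,
    Curve.smul_add_base]
  congr 3
  simp only [Nat.cast_mul, ZMod.natCast_zmod_val, linearPart]
  cases chal <;> simp <;> ring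

/-- The `DET` key drawn by the adversary is independent of the triple, so the order of the draws can
be changed; the result is the linear game with oracle `DET`. -/
theorem ddhAdversary_exec (he : ∀ κ, ∀ pp ∈ (G.setup.exec (.unary κ)).support, ∀ X,
    ((G.curve pp).encode X).size ≤ e.eval κ) {H : DetScheme G}
    {B : Prog} (hB : ∀ y, B.exec y =
      (H.gen.exec (ddhInput y)).bind fun key =>
      randomHybrid A₁ A₂ SE W side (ddhInput y) y.snd.fst.snd.fst.toNat
        (pointHash G H e (ddhInput y) key y.snd.snd.fst y.snd.snd.snd.fst
          y.snd.snd.snd.snd.fst)) (real : Bool) (κ : ℕ) :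
    ddhGame G B real κ = (G.setup.exec (.unary κ)).bind fun pp =>
      (H.gen.exec (.pair (.unary κ) pp)).bind fun key =>
        linearGame G A₁ A₂ SE W side κ real pp (H.det pp key) := by
  unfold ddhGame linearGame
  refine bind_congr fun pp hpp => ?_
  rw [PMF.bind_comm]
  refine bind_congr fun a _ => ?_
  rw [PMF.bind_comm]
  refine bind_congr fun b _ => ?_
  rw [PMF.bind_comm]
  refine bind_congr fun c _ => ?_
  change (B.exec _).map Data.toBool = _
  rw [hB, PMF.map_bind]
  refine bind_congr fun key hkey => ?_
  change (randomHybrid A₁ A₂ SE W side (.pair (.unary κ) pp) pp.snd.fst.toNat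
    (pointHash G H e (.pair (.unary κ) pp) key _ _ _)).map _ = _
  rw [pp_order hpp, hybridBit, ← pointHash_eq he hpp H hkey]
  rfl

end Reductions

end Eunomia
namespace Eunomia
open Enc

/-! ## Random functions -/

noncomputable instance (n : ℕ) : Fintype {d : Data // d.size ≤ n} := Fintype.ofFinite _

/-- Extension by zero of a function on short data. -/
def extendFun {R : Type} [Zero R] (n : ℕ) (g : {d : Data // d.size ≤ n} → R) (d : Data) : R :=
  if h : d.size ≤ n then g ⟨d, h⟩ else 0

def restrictFun {q : ℕ} [Fact q.Prime] (n : ℕ) :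
    (Data → ZMod q) →+ ({d : Data // d.size ≤ n} → ZMod q) where
  toFun f d := f d.1
  map_zero' := rfl
  map_add' _ _ := rfl

theorem extendFun_restrictFun {q : ℕ} [Fact q.Prime] {n : ℕ} (f : Data → ZMod q) {v : Data}
    (hv : v.size ≤ n) : extendFun n (restrictFun n f) v = f v := by
  unfold extendFun
  rw [dif_pos hv]
  rfl

theorem randomFunction_eq (q : ℕ) [Fact q.Prime] (n : ℕ) : randomFunction q n =
    (PMF.uniformOfFintype ({d : Data // d.size ≤ n} → ZMod q)).map (extendFun n) := by
  unfold randomFunction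
  congr 1

/-- A random function is a uniform function on short data extended by zero. It is enough that `φ` is
already surjective on such extensions; then `uniform_map_surjective` applies. -/
theorem randomFunction_map {q : ℕ} [Fact q.Prime] {n : ℕ} {X : Type} [AddGroup X] [Fintype X]
    (φ : (Data → ZMod q) →+ X)
    (hφ : ∀ y, ∃ f : Data → ZMod q, (∀ d : Data, n < d.size → f d = 0) ∧ φ f = y) :
    (randomFunction q n).map φ = PMF.uniformOfFintype X := by
  let ψ : ({d : Data // d.size ≤ n} → ZMod q) →+ (Data → ZMod q) :=
    { toFun := extendFun n
      map_zero' := by funext d; simp [extendFun]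
      map_add' := fun f g => by
        funext d
        by_cases h : d.size ≤ n <;> simp [extendFun, h] }
  rw [randomFunction_eq, PMF.map_comp]
  refine uniform_map_surjective (φ.comp ψ) fun y => ?_
  obtain ⟨f, hf, rfl⟩ := hφ y
  refine ⟨fun d => f d.1, congrArg φ (funext fun d => ?_)⟩
  by_cases h : d.size ≤ n
  · exact dif_pos h
  · exact (dif_neg h).trans (hf d (not_le.1 h)).symm

theorem tagged_size (b : Bool) (v : Data) : (tagged b v).size ≤ v.size + 3 := by
  rw [tagged, Data.size]
  have : (enc b : Data).size ≤ 2 := by cases b <;> decide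
  omega

theorem enc_true_ne : (enc false : Data) ≠ enc true := fun h => by
  have := enc_injective h; simp at this

/-- A function with prescribed values on short tagged data. -/
theorem exists_tagged {R : Type} [Zero R] {n N : ℕ} (h : N + 3 ≤ n)
    (g : Bool → {d : Data // d.size ≤ N} → R) :
    ∃ f : Data → R, (∀ d : Data, n < d.size → f d = 0) ∧
      ∀ b (v : {d : Data // d.size ≤ N}), f (tagged b v.1) = g b v := by
  refine ⟨fun d => if h : d.snd.size ≤ N then
    (if n < d.size then 0 else g (decide (d.fst = enc true)) ⟨d.snd, h⟩) else 0, ?_, ?_⟩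
  · intro d hd
    simp [hd]
  · intro b v
    have h1 := tagged_size b v.1
    have h2 := v.2
    simp only [show (tagged b v.1).snd = v.1 from rfl, show (tagged b v.1).fst = enc b from rfl]
    rw [dif_pos h2, if_neg (by omega)]
    cases b with
    | true => simp
    | false => simp [enc_true_ne]

def linearHom {q : ℕ} (a b : ZMod q) : (Data → ZMod q) →+ (Data → ZMod q) where
  toFun := linearPart a b
  map_zero' := by funext v; simp [linearPart]
  map_add' f g := by funext v; simp [linearPart]; ring

/-- The second half has coefficient 1, so it alone can produce any function, whatever `a` is. The
number 3 pays for the tag. -/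
theorem randomFunction_linear {q : ℕ} [Fact q.Prime] {n N : ℕ} (h : N + 3 ≤ n) (a : ZMod q) :
    (randomFunction q n).map (fun f => restrictFun N (linearPart a 1 f)) =
      PMF.uniformOfFintype ({d : Data // d.size ≤ N} → ZMod q) := by
  refine randomFunction_map ((restrictFun N).comp (linearHom a 1)) fun y => ?_
  obtain ⟨f, h1, h2⟩ := exists_tagged h fun b v => if b = true then y v else 0
  refine ⟨f, h1, funext fun v => ?_⟩
  change a * f (tagged false v.1) + 1 * f (tagged true v.1) = y v
  rw [h2, h2]; simp

theorem randomFunction_restrict {q : ℕ} [Fact q.Prime] {n N : ℕ} (h : N ≤ n) :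
    (randomFunction q n).map (restrictFun N) =
      PMF.uniformOfFintype ({d : Data // d.size ≤ N} → ZMod q) := by
  refine randomFunction_map (q := q) (restrictFun (q := q) N) fun y => ⟨extendFun N y, fun d hd => ?_, funext fun v => ?_⟩
  · exact dif_neg (by omega)
  · exact dif_pos v.2

/-- The heart of the DDH step: the matrix with rows `(a, 1)` and `(c, b)` has determinant `ab - c`.
It is invertible exactly when the triple is not a Diffie-Hellman triple, and it then maps two
independent random functions to two independent random functions. -/
theorem randomFunction_linear_pair {q : ℕ} [Fact q.Prime] {n N : ℕ} (h : N + 3 ≤ n) {a b c : ZMod q}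
    (hc : c ≠ a * b) :
    (randomFunction q n).map
      (fun f => (restrictFun N (linearPart a 1 f), restrictFun N (linearPart c b f))) =
      PMF.uniformOfFintype
        (({d : Data // d.size ≤ N} → ZMod q) × ({d : Data // d.size ≤ N} → ZMod q)) := by
  have hdet : a * b - c ≠ 0 := sub_ne_zero.2 hc.symm
  refine randomFunction_map (((restrictFun N).comp (linearHom a 1)).prod
    ((restrictFun N).comp (linearHom c b))) fun y => ?_
  -- Cramer's rule for `a f₀ + f₁ = y₁` and `c f₀ + b f₁ = y₂`.
  obtain ⟨f, h1, h2⟩ := exists_tagged h fun t v =>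
    if t = true then y.1 v - a * ((b * y.1 v - y.2 v) / (a * b - c))
    else (b * y.1 v - y.2 v) / (a * b - c)
  refine ⟨f, h1, Prod.ext (funext fun v => ?_) (funext fun v => ?_)⟩
  · change a * f (tagged false v.1) + 1 * f (tagged true v.1) = y.1 v
    rw [h2, h2]; simp
  · change c * f (tagged false v.1) + b * f (tagged true v.1) = y.2 v
    rw [h2, h2]
    simp only [if_true, Bool.false_eq_true, if_false]
    have := div_mul_cancel₀ (b * y.1 v - y.2 v) hdet
    linear_combination -this

/-- Two independent random functions. -/
noncomputable def randomPair (q : ℕ) [Fact q.Prime] (n : ℕ) :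
    PMF ((Data → ZMod q) × (Data → ZMod q)) :=
  (PMF.uniformOfFintype
    (({d : Data // d.size ≤ n} → ZMod q) × ({d : Data // d.size ≤ n} → ZMod q))).map
    fun g => (extendFun n g.1, extendFun n g.2)

/-- An injective map which preserves sizes permutes the finitely many data of size at most `n`, and
composition with a permutation preserves uniform functions. -/
theorem randomPair_comp {q : ℕ} [Fact q.Prime] (n : ℕ) {σ : Data → Data}
    (hσ : Function.Injective σ) (hs : ∀ v, (σ v).size = v.size) :
    (randomPair q n).map (fun g => (g.1, g.2 ∘ σ)) = randomPair q n := by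
  let τ : {d : Data // d.size ≤ n} → {d : Data // d.size ≤ n} := fun v =>
    ⟨σ v.1, (hs v.1).le.trans v.2⟩
  have hτ : Function.Bijective τ := Finite.injective_iff_bijective.1 fun a b h =>
    Subtype.ext (hσ (congrArg Subtype.val h))
  have hbij : Function.Bijective (fun g : ({d : Data // d.size ≤ n} → ZMod q) ×
      ({d : Data // d.size ≤ n} → ZMod q) => (g.1, g.2 ∘ τ)) := by
    refine Finite.injective_iff_bijective.1 fun a b h => ?_
    rw [Prod.mk.injEq] at h
    exact Prod.ext h.1 (hτ.2.injective_comp_right h.2)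
  rw [randomPair]
  conv_rhs => rw [← uniform_map_equiv (Equiv.ofBijective _ hbij)]
  rw [PMF.map_comp, PMF.map_comp]
  congr 1
  funext g
  refine Prod.ext rfl (funext fun d => ?_)
  change extendFun n g.2 (σ d) = extendFun n (g.2 ∘ τ) d
  unfold extendFun
  by_cases h : d.size ≤ n
  · rw [dif_pos h, dif_pos (by rw [hs]; exact h)]; rfl
  · rw [dif_neg h, dif_neg (by rw [hs]; exact h)]

/-! ## Properties of the hybrid attack at a random class -/

section Hybrid

variable {G : CurveFamily} {e : Polynomial ℕ} {κ : ℕ} {pp : Data} {A₁ A₂ : Prog} {SE : EncScheme}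
  {W : Polynomial ℕ} {side : ℕ}

/-- The hybrid attack looks at the values of the functions on short data only. -/
theorem exists_hybridBit_congr (G : CurveFamily) (SE : EncScheme) (hA₁ : A₁.PPT) (hA₂ : A₂.PPT)
    (W : Polynomial ℕ) (side : ℕ) :
    ∃ t : Polynomial ℕ, ∀ κ, ∀ pp ∈ (G.setup.exec (.unary κ)).support,
      ∀ u u' f f' : Data → ZMod (G.curve pp).q,
      (∀ v : Data, v.size ≤ t.eval (Data.pair (.unary κ) pp).size → u v = u' v ∧ f v = f' v) →
      hybridBit G A₁ A₂ SE W side κ pp u f = hybridBit G A₁ A₂ SE W side κ pp u' f' := by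
  obtain ⟨e, he⟩ := G.encode_size
  obtain ⟨B, ⟨t, ht⟩, hB⟩ := exists_taggedAdversary G SE hA₁ hA₂ W e side
  refine ⟨t, fun κ pp hpp u u' f f' h => ?_⟩
  -- Both functions are merged into one tagged oracle for a program with time bound `t`. Such a
  -- program cannot ask longer queries, so the values of `u` and `f` on longer data are irrelevant.
  have key : ∀ u f : Data → ZMod (G.curve pp).q, hybridBit G A₁ A₂ SE W side κ pp u f =
      (B.execWith (fun v => PMF.pure (.ofNat
        ((fun v : Data => if v.fst = enc true then f v.snd else u v.snd) v).val))
        (.pair (.unary κ) pp)).map Data.toBool := by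
    intro u f
    rw [taggedAdversary_exec he hpp hB]
    congr 1
  rw [key, key, ht.execWith_congr]
  intro y hy
  have := h y.snd (y.snd_size.trans hy)
  dsimp only
  rw [this.1, this.2]

/-- The factor `b` can be moved from the function of class `J` into the hash keys of this class,
whose distribution does not change. -/
theorem hybridBit_scale
    (hA : ∀ x ∈ (A₁.exec (.pair (.unary κ) pp)).support, (Challenge.ofData x).Valid)
    (u f : Data → ZMod (G.curve pp).q) {b : ZMod (G.curve pp).q} (hb : b ≠ 0) :
    hybridBit G A₁ A₂ SE W side κ pp u (fun v => b * f v) =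
      hybridBit G A₁ A₂ SE W side κ pp u f := by
  refine congrArg (PMF.map Data.toBool) ?_
  refine bind_congr fun J _ => bind_congr fun x hx => ?_
  conv_rhs => rw [← natKeys_scale SE _ (schemaOf x)
    (W.eval (listLength (Data.pair (.unary κ) pp).fst)) J (pairsOf x) hb, PMF.bind_map]
  exact bind_congr fun K hK => (hybridAttack_scaleTable (hA x hx) _ hK u f hb).symm

/-- An exact equality. The injection `σ` depends on the choice `x` and on `J`, so the random
functions are drawn last; replacing the second of them by its composition with `σ` exchanges the
logs in class `J`. -/
theorem randomPair_hybridBit (hκ : ∀ x ∈ (A₁.exec (.pair (.unary κ) pp)).support, x.size ≤ W.eval κ)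
    (hA : ∀ x ∈ (A₁.exec (.pair (.unary κ) pp)).support, (Challenge.ofData x).Valid) (n : ℕ) :
    ((randomPair (G.curve pp).q n).bind fun g => hybridBit G A₁ A₂ SE W 0 κ pp g.1 g.2) =
      (randomPair (G.curve pp).q n).bind fun g => hybridBit G A₁ A₂ SE W 1 κ pp g.1 g.2 := by
  have pull : ∀ side, ((randomPair (G.curve pp).q n).bind fun g =>
      hybridBit G A₁ A₂ SE W side κ pp g.1 g.2) =
      ((uniformNat (labelBound (W.eval κ))).bind fun J =>
        (A₁.exec (.pair (.unary κ) pp)).bind fun x =>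
        (natKeys SE (.unary κ) (G.curve pp).q (schemaOf x)).bind fun K =>
        (randomPair (G.curve pp).q n).bind fun g =>
        hybridAttack A₂ SE x (W.eval κ) (G.curve pp).q J (J + side) K
          (pointOf (G.curve pp) g.1 g.2)).map Data.toBool := by
    intro side
    unfold hybridBit randomHybrid hybridAt
    rw [← PMF.map_bind, PMF.bind_comm]
    simp only [Data.fst_pair, listLength_unary]
    refine congrArg (PMF.map Data.toBool) ?_
    refine bind_congr fun J _ => ?_
    rw [PMF.bind_comm]
    refine bind_congr fun x _ => ?_
    rw [PMF.bind_comm]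
  rw [pull, pull]
  refine congrArg (PMF.map Data.toBool) ?_
  refine bind_congr fun J _ => bind_congr fun x hx => bind_congr fun K _ => ?_
  obtain ⟨σ, h1, h2, h3⟩ := exists_perm_hybridAttack (hA x hx) (hκ x hx) J
  conv_rhs => rw [← randomPair_comp n h1 h2, PMF.bind_map]
  exact bind_congr fun g _ => h3 _ _ _ _ _ _

variable {t : Polynomial ℕ} {N : ℕ}

theorem hybridBit_extend (hres : ∀ u u' f f' : Data → ZMod (G.curve pp).q,
      (∀ v : Data, v.size ≤ N → u v = u' v ∧ f v = f' v) →
      hybridBit G A₁ A₂ SE W side κ pp u f = hybridBit G A₁ A₂ SE W side κ pp u' f')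
    (u f : Data → ZMod (G.curve pp).q) : hybridBit G A₁ A₂ SE W side κ pp u f =
      hybridBit G A₁ A₂ SE W side κ pp (extendFun N (restrictFun N u))
        (extendFun N (restrictFun N f)) :=
  hres _ _ _ _ fun _ hv =>
    ⟨(extendFun_restrictFun u hv).symm, (extendFun_restrictFun f hv).symm⟩

theorem randomFunction_hybridBit (hres : ∀ u u' f f' : Data → ZMod (G.curve pp).q,
      (∀ v : Data, v.size ≤ N → u v = u' v ∧ f v = f' v) →
      hybridBit G A₁ A₂ SE W side κ pp u f = hybridBit G A₁ A₂ SE W side κ pp u' f')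
    {n : ℕ} (hn : N ≤ n) : ((randomFunction (G.curve pp).q n).bind fun f =>
      hybridBit G A₁ A₂ SE W side κ pp f f) =
    (PMF.uniformOfFintype ({d : Data // d.size ≤ N} → ZMod (G.curve pp).q)).bind fun g =>
      hybridBit G A₁ A₂ SE W side κ pp (extendFun N g) (extendFun N g) := by
  rw [← randomFunction_restrict hn, PMF.bind_map]
  exact bind_congr fun f _ => hybridBit_extend hres f f

/-- For fixed `a`, the combination `a y + y'` is one random function. Class `J` uses `b` times this
function, and this factor is invisible if `b ≠ 0`. -/
theorem abs_linearGame_real_sub_le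
    (hA : ∀ x ∈ (A₁.exec (.pair (.unary κ) pp)).support, (Challenge.ofData x).Valid)
    (hres : ∀ u u' f f' : Data → ZMod (G.curve pp).q,
      (∀ v : Data, v.size ≤ N → u v = u' v ∧ f v = f' v) →
      hybridBit G A₁ A₂ SE W side κ pp u f = hybridBit G A₁ A₂ SE W side κ pp u' f')
    {n n' : ℕ} (hn : N ≤ n) (hn' : N + 3 ≤ n') :
    |prTrue ((randomFunction (G.curve pp).q n).bind fun f =>
        hybridBit G A₁ A₂ SE W side κ pp f f) -
      prTrue ((randomFunction (G.curve pp).q n').bind fun f =>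
        linearGame G A₁ A₂ SE W side κ true pp f)| ≤ 1 / (G.curve pp).q := by
  rw [randomFunction_hybridBit hres hn]
  unfold linearGame
  rw [PMF.bind_comm]
  -- The experiment without `a` receives an unused draw of it, so that the two can be compared for
  -- each value of `a`; likewise for `b` below.
  conv_lhs => enter [1, 1]; rw [← PMF.bind_const (PMF.uniformOfFintype (ZMod (G.curve pp).q))
    (PMF.bind _ _)]
  refine abs_prTrue_bind_sub_le _ fun a _ => ?_
  rw [PMF.bind_comm]
  conv_lhs => enter [1, 1]; rw [← PMF.bind_const (PMF.uniformOfFintype (ZMod (G.curve pp).q))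
    (PMF.bind _ _)]
  -- Only `b = 0` can make a difference; it has probability `1/q`.
  refine (abs_prTrue_uniform_sub_le 0 fun b hb => ?_).trans (by rw [ZMod.card])
  simp only [if_true, PMF.bind_const]
  rw [← randomFunction_linear hn' a, PMF.bind_map]
  refine bind_congr fun f _ => ?_
  dsimp only [Function.comp_apply]
  rw [← hybridBit_extend hres, ← hybridBit_scale hA _ _ hb]
  congr 1
  funext v
  simp only [linearPart]; ring

/-- For `c ≠ ab` the functions inside and outside of class `J` are independent, by
`randomFunction_linear_pair`; the exception `c = ab` has probability `1/q` for every `a` and `b`. -/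
theorem abs_linearGame_ideal_sub_le
    (hres : ∀ u u' f f' : Data → ZMod (G.curve pp).q,
      (∀ v : Data, v.size ≤ N → u v = u' v ∧ f v = f' v) →
      hybridBit G A₁ A₂ SE W side κ pp u f = hybridBit G A₁ A₂ SE W side κ pp u' f')
    {n : ℕ} (hn : N + 3 ≤ n) :
    |prTrue ((randomPair (G.curve pp).q N).bind fun g =>
        hybridBit G A₁ A₂ SE W side κ pp g.1 g.2) -
      prTrue ((randomFunction (G.curve pp).q n).bind fun f =>
        linearGame G A₁ A₂ SE W side κ false pp f)| ≤ 1 / (G.curve pp).q := by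
  unfold linearGame
  rw [PMF.bind_comm]
  conv_lhs => enter [1, 1]; rw [← PMF.bind_const (PMF.uniformOfFintype (ZMod (G.curve pp).q))
    (PMF.bind _ _)]
  refine abs_prTrue_bind_sub_le _ fun a _ => ?_
  rw [PMF.bind_comm]
  conv_lhs => enter [1, 1]; rw [← PMF.bind_const (PMF.uniformOfFintype (ZMod (G.curve pp).q))
    (PMF.bind _ _)]
  refine abs_prTrue_bind_sub_le _ fun b _ => ?_
  rw [PMF.bind_comm]
  conv_lhs => enter [1, 1]; rw [← PMF.bind_const (PMF.uniformOfFintype (ZMod (G.curve pp).q))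
    (PMF.bind _ _)]
  refine (abs_prTrue_uniform_sub_le (a * b) fun c hc => ?_).trans (by rw [ZMod.card])
  rw [randomPair, ← randomFunction_linear_pair hn hc, PMF.bind_map, PMF.bind_map]
  refine bind_congr fun f _ => ?_
  simp only [Function.comp_apply, Bool.false_eq_true, if_false]
  rw [← hybridBit_extend hres]

end Hybrid

end Eunomia
namespace Eunomia
open Enc

/-! ## The order of the group is large -/

/-- A distinguisher for DDH that only tests whether `A = Z`; see `negligible_inv_order`. -/
theorem exists_firstEqThird : ∃ B : Prog, B.PPT ∧ ∀ y, B.exec y =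
    PMF.pure (enc (decide (y.snd.snd.fst = y.snd.snd.snd.snd.fst))) := by
  have : PPTime fun (y : Data) (O : Data → PMF Data) =>
      PMF.pure (decide (y.snd.snd.fst = y.snd.snd.snd.snd.fst)) := PPTime.pure (by fun_prop)
  obtain ⟨B, hB, h⟩ := this
  exact ⟨B, hB, fun y => (h y _).trans (PMF.pure_map _ _)⟩

theorem prTrue_uniform_eq {q : ℕ} [Fact q.Prime] (a : ZMod q) :
    prTrue ((PMF.uniformOfFintype (ZMod q)).bind fun c => PMF.pure (decide (a = c))) = 1 / q := by
  rw [prTrue_bind, expect_uniform, ZMod.card]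
  congr 1
  rw [Finset.sum_eq_single a]
  · simp [prTrue_pure]
  · intro b _ hb; simp [prTrue_pure, hb.symm]
  · simp

theorem prTrue_uniform_mul {q : ℕ} [Fact q.Prime] {a : ZMod q} (ha : a ≠ 0) :
    prTrue ((PMF.uniformOfFintype (ZMod q)).bind fun b => PMF.pure (decide (a = a * b))) =
      1 / q := by
  rw [← prTrue_uniform_eq (1 : ZMod q)]
  congr 2
  funext b
  congr 2
  rw [eq_iff_iff]
  constructor
  · intro h
    exact (mul_left_cancel₀ ha (h.symm.trans (mul_one a).symm)).symm
  · rintro rfl; exact (mul_one a).symm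

/-- Probabilities of coincidences in a group of prime order. -/
theorem prTrue_mul_sub {q : ℕ} [Fact q.Prime] :
    1 / (2 * q : ℝ) ≤ prTrue ((PMF.uniformOfFintype (ZMod q)).bind fun a =>
      (PMF.uniformOfFintype (ZMod q)).bind fun b => PMF.pure (decide (a = a * b))) - 1 / q := by
  have hq : (2 : ℝ) ≤ q := by exact_mod_cast (Fact.out : q.Prime).two_le
  -- For `a = 0` the coincidence is certain, for other `a` it means `b = 1`. The total probability
  -- is `1/q + (1 - 1/q)/q`, so what remains is `(q - 1)/q²`, which is at least `1/(2q)`.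
  rw [prTrue_bind, expect_uniform, ZMod.card, ← Finset.add_sum_erase _ _ (Finset.mem_univ 0),
    Finset.sum_congr rfl fun a ha => prTrue_uniform_mul (Finset.ne_of_mem_erase ha)]
  have h0 : prTrue ((PMF.uniformOfFintype (ZMod q)).bind fun b =>
      PMF.pure (decide ((0 : ZMod q) = 0 * b))) = 1 := by
    simp [prTrue_pure]
  rw [h0, Finset.sum_const, Finset.card_erase_of_mem (Finset.mem_univ _), Finset.card_univ, ZMod.card,
    nsmul_eq_mul, Nat.cast_sub (Fact.out : q.Prime).one_lt.le, Nat.cast_one]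
  rw [div_le_iff₀ (by positivity)]
  field_simp
  nlinarith

/-- No lower bound on `q` is assumed, but DDH implies one on average: the points `A` and `Z`
coincide with probability `1/q` for random `Z` and with nearly twice this probability for `Z = abP`.
The test for equality thus has an advantage of at least half the expected value of `1/q`. -/
theorem negligible_inv_order (G : CurveFamily) (hDDH : ECDDH G) : Negligible fun κ =>
    expect (G.setup.exec (.unary κ)) fun pp => 1 / (G.curve pp).q := by
  obtain ⟨B, hB, h⟩ := exists_firstEqThird
  have hbd : ∀ pp, |(1 : ℝ) / (G.curve pp).q| ≤ 1 := fun pp => by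
    have : (1 : ℝ) ≤ (G.curve pp).q := by exact_mod_cast (G.curve pp).prime.out.one_lt.le
    rw [abs_of_nonneg (by positivity)]
    exact div_le_one_of_le₀ this (by positivity)
  have hgame : ∀ real κ, ddhGame G B real κ = (G.setup.exec (.unary κ)).bind fun pp =>
      (PMF.uniformOfFintype (ZMod (G.curve pp).q)).bind fun a =>
      (PMF.uniformOfFintype (ZMod (G.curve pp).q)).bind fun b =>
      (PMF.uniformOfFintype (ZMod (G.curve pp).q)).bind fun c =>
        PMF.pure (decide (a = if real = true then a * b else c)) := by
    intro real κ
    unfold ddhGame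
    refine bind_congr fun pp _ => bind_congr fun a _ => bind_congr fun b _ => bind_congr fun c _ => ?_
    change (B.exec _).map Data.toBool = _
    rw [h, PMF.pure_map, toBool_enc]
    congr 2
    rw [eq_iff_iff]
    constructor
    · intro h; exact (G.curve pp).smul_base_injective ((G.curve pp).encode_injective h)
    · intro h
      change (G.curve pp).encode ((G.curve pp).smul (G.curve pp).base a) = (G.curve pp).encode
        ((G.curve pp).smul (G.curve pp).base (if real = true then a * b else c))
      rw [← h]
  have hneg := (hDDH B hB).poly_mul 2
  refine hneg.mono fun κ => ?_
  have hle : expect (G.setup.exec (.unary κ)) (fun pp => 1 / 2 * ((1 : ℝ) / (G.curve pp).q)) ≤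
      prTrue (ddhGame G B true κ) - prTrue (ddhGame G B false κ) := by
    rw [hgame, hgame, prTrue_bind, prTrue_bind, ← expect_sub _ (fun _ => abs_prTrue_le _)
      (fun _ => abs_prTrue_le _)]
    refine expect_mono _ (C := 1) (C' := 2) (fun pp => ?_) (fun pp => ?_) fun pp _ => ?_
    · rw [abs_mul]
      have := hbd pp
      have h2 : |(1 / 2 : ℝ)| = 1 / 2 := abs_of_pos (by norm_num)
      rw [h2]
      nlinarith [abs_nonneg ((1 : ℝ) / (G.curve pp).q)]
    · refine (abs_sub _ _).trans ?_
      have := abs_prTrue_le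
      linarith [abs_prTrue_le ((PMF.uniformOfFintype (ZMod (G.curve pp).q)).bind fun a =>
        (PMF.uniformOfFintype (ZMod (G.curve pp).q)).bind fun b =>
        (PMF.uniformOfFintype (ZMod (G.curve pp).q)).bind fun c =>
        PMF.pure (decide (a = if true = true then a * b else c))),
        abs_prTrue_le ((PMF.uniformOfFintype (ZMod (G.curve pp).q)).bind fun a =>
        (PMF.uniformOfFintype (ZMod (G.curve pp).q)).bind fun b =>
        (PMF.uniformOfFintype (ZMod (G.curve pp).q)).bind fun c =>
        PMF.pure (decide (a = if false = true then a * b else c)))]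
    · simp only [if_true, Bool.false_eq_true, if_false, PMF.bind_const]
      have h1 := prTrue_mul_sub (q := (G.curve pp).q)
      have h2 : prTrue ((PMF.uniformOfFintype (ZMod (G.curve pp).q)).bind fun a =>
          (PMF.uniformOfFintype (ZMod (G.curve pp).q)).bind fun c =>
          PMF.pure (decide (a = c))) = 1 / (G.curve pp).q := by
        rw [prTrue_bind]
        simp only [prTrue_uniform_eq]
        exact expect_const _ _
      rw [h2]
      refine le_trans (le_of_eq ?_) h1
      have : ((G.curve pp).q : ℝ) ≠ 0 := by exact_mod_cast (G.curve pp).prime.out.ne_zero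
      field_simp
  rw [expect_mul] at hle
  have := le_abs_self (prTrue (ddhGame G B true κ) - prTrue (ddhGame G B false κ))
  have h2 : (((2 : Polynomial ℕ).eval κ : ℕ) : ℝ) = 2 := by simp
  rw [h2]
  linarith

/-! ## Hashes of a class are indistinguishable from independent random points -/

section Hybrid

variable {G : CurveFamily} {H : DetScheme G} {A₁ A₂ : Prog} {SE : EncScheme}
  {W : Polynomial ℕ} {side : ℕ}

/-- The hybrid attack at a random class, with the hashes of the scheme. -/
noncomputable def detHybrid (H : DetScheme G) (A₁ A₂ : Prog) (SE : EncScheme) (W : Polynomial ℕ)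
    (side κ : ℕ) : PMF Bool :=
  (G.setup.exec (.unary κ)).bind fun pp => (H.gen.exec (.pair (.unary κ) pp)).bind fun key =>
    hybridBit G A₁ A₂ SE W side κ pp (H.det pp key) (H.det pp key)

/-- The hybrid attack at a random class, with independent random functions for this class and for
the other classes. -/
noncomputable def randomPairHybrid (G : CurveFamily) (A₁ A₂ : Prog) (SE : EncScheme)
    (W t : Polynomial ℕ) (side κ : ℕ) : PMF Bool :=
  (G.setup.exec (.unary κ)).bind fun pp =>
    (randomPair (G.curve pp).q (t.eval (Data.pair (.unary κ) pp).size)).bind fun g =>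
      hybridBit G A₁ A₂ SE W side κ pp g.1 g.2

theorem prfReal_eq (B : Prog) (κ : ℕ) : prfReal H B κ =
    (G.setup.exec (.unary κ)).bind fun pp => (H.gen.exec (.pair (.unary κ) pp)).bind fun key =>
      (B.execWith (fun v => PMF.pure (.ofNat (H.det pp key v).val)) (.pair (.unary κ) pp)).map
        Data.toBool := rfl

theorem close_of_le_inv_order (hDDH : ECDDH G) {X Y : ℕ → Data → PMF Bool}
    (h : ∀ κ, ∀ pp ∈ (G.setup.exec (.unary κ)).support,
      |prTrue (X κ pp) - prTrue (Y κ pp)| ≤ 1 / (G.curve pp).q) :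
    Close (fun κ => prTrue ((G.setup.exec (.unary κ)).bind (X κ)))
      (fun κ => prTrue ((G.setup.exec (.unary κ)).bind (Y κ))) := by
  refine (negligible_inv_order G hDDH).mono fun κ => ?_
  dsimp only
  rw [prTrue_bind, prTrue_bind]
  refine abs_expect_sub_le _ (fun _ => abs_prTrue_le _) (fun _ => abs_prTrue_le _)
    (C'' := 1) (fun pp => ?_) (h κ)
  have : (1 : ℝ) ≤ (G.curve pp).q := by exact_mod_cast (G.curve pp).prime.out.one_lt.le
  rw [abs_of_nonneg (by positivity)]
  exact div_le_one_of_le₀ this (by positivity)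

/-- The chain of games, in which `f` is the function that `DET` or a random function provides:
scheme with `DET`; scheme with random `f`; linear game with random `f` and `z = ab`; the same with
`DET`, which is the real DDH experiment; linear game with `DET` and `z = c`; the same with random
`f`; two independent random functions. The links use PRF, `1/q`, PRF, DDH, PRF and `1/q`. -/
theorem close_randomPairHybrid (hDDH : ECDDH G) (hPRF : H.IsPRF) (hA₁ : A₁.PPT) (hA₂ : A₂.PPT)
    (hA : ∀ κ, ∀ pp ∈ (G.setup.exec (.unary κ)).support,
      ∀ x ∈ (A₁.exec (.pair (.unary κ) pp)).support, (Challenge.ofData x).Valid)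
    {t : Polynomial ℕ} (ht : ∀ κ, ∀ pp ∈ (G.setup.exec (.unary κ)).support,
      ∀ u u' f f' : Data → ZMod (G.curve pp).q,
      (∀ v : Data, v.size ≤ t.eval (Data.pair (.unary κ) pp).size → u v = u' v ∧ f v = f' v) →
      hybridBit G A₁ A₂ SE W side κ pp u f = hybridBit G A₁ A₂ SE W side κ pp u' f') :
    Close (fun κ => prTrue (detHybrid H A₁ A₂ SE W side κ))
      (fun κ => prTrue (randomPairHybrid G A₁ A₂ SE W t side κ)) := by
  obtain ⟨e, he⟩ := G.encode_size
  obtain ⟨B, ⟨tB, htB⟩, hB⟩ := exists_plainAdversary G SE hA₁ hA₂ W e side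
  obtain ⟨B₁, ⟨t₁, ht₁⟩, hB₁⟩ := exists_linearAdversary G SE hA₁ hA₂ W e side true
  obtain ⟨B₀, ⟨t₀, ht₀⟩, hB₀⟩ := exists_linearAdversary G SE hA₁ hA₂ W e side false
  obtain ⟨B', hB'ppt, hB'⟩ := exists_ddhAdversary G H SE hA₁ hA₂ W e side
  -- The time bound in the definition of a PRF also sets the domain of the random function. It is
  -- enlarged so that the domain contains the tagged copies, 3 longer, of all data of size at most
  -- `t`.
  have hmono : ∀ {C : Prog} {s : Polynomial ℕ}, C.RunsInTime s → C.RunsInTime (s + (t + 3)) :=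
    fun h => h.mono fun n => by simp
  have hlt : ∀ (s : Polynomial ℕ) n, t.eval n + 3 ≤ (s + (t + 3)).eval n := fun s n => by simp
  have c1 := hPRF B _ (hmono htB)
  have c2 := hPRF B₁ _ (hmono ht₁)
  have c3 := hPRF B₀ _ (hmono ht₀)
  have c4 := hDDH B' hB'ppt
  have e1 : ∀ κ, prfReal H B κ = detHybrid H A₁ A₂ SE W side κ := fun κ =>
    bind_congr fun pp hpp => bind_congr fun key _ => plainAdversary_exec he hpp hB _
  have e2 : ∀ κ, prfReal H B₁ κ = ddhGame G B' true κ := fun κ => by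
    rw [ddhAdversary_exec he hB', prfReal_eq]
    exact bind_congr fun pp hpp => bind_congr fun key _ => linearAdversary_exec he hpp hB₁ _
  have e3 : ∀ κ, prfReal H B₀ κ = ddhGame G B' false κ := fun κ => by
    rw [ddhAdversary_exec he hB', prfReal_eq]
    exact bind_congr fun pp hpp => bind_congr fun key _ => linearAdversary_exec he hpp hB₀ _
  have e4 : ∀ κ, prfIdeal G B (tB + (t + 3)) κ = (G.setup.exec (.unary κ)).bind fun pp =>
      (randomFunction (G.curve pp).q ((tB + (t + 3)).eval (Data.pair (.unary κ) pp).size)).bind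
        fun f => hybridBit G A₁ A₂ SE W side κ pp f f := fun κ =>
    bind_congr fun pp hpp => bind_congr fun f _ => plainAdversary_exec he hpp hB _
  have e5 : ∀ κ, prfIdeal G B₁ (t₁ + (t + 3)) κ = (G.setup.exec (.unary κ)).bind fun pp =>
      (randomFunction (G.curve pp).q ((t₁ + (t + 3)).eval (Data.pair (.unary κ) pp).size)).bind
        fun f => linearGame G A₁ A₂ SE W side κ true pp f := fun κ =>
    bind_congr fun pp hpp => bind_congr fun f _ => linearAdversary_exec he hpp hB₁ _
  have e6 : ∀ κ, prfIdeal G B₀ (t₀ + (t + 3)) κ = (G.setup.exec (.unary κ)).bind fun pp =>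
      (randomFunction (G.curve pp).q ((t₀ + (t + 3)).eval (Data.pair (.unary κ) pp).size)).bind
        fun f => linearGame G A₁ A₂ SE W side κ false pp f := fun κ =>
    bind_congr fun pp hpp => bind_congr fun f _ => linearAdversary_exec he hpp hB₀ _
  have c5 : Close (fun κ => prTrue (prfIdeal G B (tB + (t + 3)) κ))
      (fun κ => prTrue (prfIdeal G B₁ (t₁ + (t + 3)) κ)) := by
    simp only [e4, e5]
    exact close_of_le_inv_order hDDH fun κ pp hpp => abs_linearGame_real_sub_le (hA κ pp hpp)
      (ht κ pp hpp) ((Nat.le_add_right _ 3).trans (hlt _ _)) (hlt _ _)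
  have c6 : Close (fun κ => prTrue (randomPairHybrid G A₁ A₂ SE W t side κ))
      (fun κ => prTrue (prfIdeal G B₀ (t₀ + (t + 3)) κ)) := by
    simp only [e6]
    exact close_of_le_inv_order hDDH fun κ pp hpp => abs_linearGame_ideal_sub_le
      (ht κ pp hpp) (hlt _ _)
  simp only [e1] at c1
  simp only [e2] at c2
  simp only [e3] at c3
  exact Close.trans c1 (c5.trans ((Close.symm c2).trans (Close.trans c4 (Close.trans c3 c6.symm))))

/-- The hashes of the two logs in a random class are indistinguishable. -/
theorem close_detHybrid (hDDH : ECDDH G) (hPRF : H.IsPRF) (hA₁ : A₁.PPT) (hA₂ : A₂.PPT)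
    (hA : ∀ κ, ∀ pp ∈ (G.setup.exec (.unary κ)).support,
      ∀ x ∈ (A₁.exec (.pair (.unary κ) pp)).support, (Challenge.ofData x).Valid)
    (hW : ∀ κ, ∀ pp ∈ (G.setup.exec (.unary κ)).support,
      ∀ x ∈ (A₁.exec (.pair (.unary κ) pp)).support, x.size ≤ W.eval κ) :
    Close (fun κ => prTrue (detHybrid H A₁ A₂ SE W 0 κ))
      (fun κ => prTrue (detHybrid H A₁ A₂ SE W 1 κ)) := by
  obtain ⟨t₀, ht₀⟩ := exists_hybridBit_congr G SE hA₁ hA₂ W 0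
  obtain ⟨t₁, ht₁⟩ := exists_hybridBit_congr G SE hA₁ hA₂ W 1
  -- Both sides need the same domain for the random pair, hence the common bound `t₀ + t₁`.
  have h0 := close_randomPairHybrid hDDH hPRF hA₁ hA₂ hA (t := t₀ + t₁) (H := H) (SE := SE) (W := W)
    (side := 0) fun κ pp hpp u u' f f' h => ht₀ κ pp hpp u u' f f' fun v hv => h v (by
      rw [Polynomial.eval_add]; omega)
  have h1 := close_randomPairHybrid hDDH hPRF hA₁ hA₂ hA (t := t₀ + t₁) (H := H) (SE := SE) (W := W)
    (side := 1) fun κ pp hpp u u' f f' h => ht₁ κ pp hpp u u' f f' fun v hv => h v (by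
      rw [Polynomial.eval_add]; omega)
  have h2 : ∀ κ, randomPairHybrid G A₁ A₂ SE W (t₀ + t₁) 0 κ =
      randomPairHybrid G A₁ A₂ SE W (t₀ + t₁) 1 κ := fun κ =>
    bind_congr fun pp hpp => randomPair_hybridBit (hW κ pp hpp) (hA κ pp hpp) _
  simp only [h2] at h0
  exact h0.trans h1.symm

end Hybrid

end Eunomia
namespace Eunomia
open Enc

/-! ## The attack with hashes and ciphertexts of different logs -/

/-- The second phase of the attack, with the hashes of the log `L`, the ciphertexts `ct`, and the
encryption `encr` of other values. -/
noncomputable def splitAttack (A₂ : Prog) (x : Data) (q : ℕ) (K : KeyTable) (h : ℕ → Data → PMF Data)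
    (L : Log) (ct : Column → ℕ → PMF Data) (encr : Column → Data → PMF Data) : PMF Data :=
  attack A₂ x (fun c i => (h (K.hashKey c) (L.cellD c i)).bind fun p => (ct c i).map (Data.pair p))
    (fun i => h K.1 ((timeStamps (schemaOf x) L).getD i (.int 0))) (fun d => h K.1 d)
    (fun c v => (h (K.hashKey c) v).bind fun p => (encr c v).map (Data.pair p))
    (tokenData q K (pairsOf x))

/-- Encryption with the keys of a table. -/
noncomputable def tableEnc (SE : EncScheme) (K : KeyTable) (c : Column) (v : Data) : PMF Data :=
  SE.enc.exec (.pair (K.encKey c) v)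

/-- The guess in the attack with the hashes of the log `Lh` and the ciphertexts of the log `Lc`. -/
noncomputable def splitGame {G : CurveFamily} (H : DetScheme G) (SE : EncScheme) (A₁ A₂ : Prog)
    (Lh Lc : Data → Log) (κ : ℕ) : PMF Bool :=
  (G.setup.exec (.unary κ)).bind fun pp => (H.gen.exec (.pair (.unary κ) pp)).bind fun key =>
  (A₁.exec (.pair (.unary κ) pp)).bind fun x =>
  (natKeys SE (.unary κ) (G.curve pp).q (schemaOf x)).bind fun K =>
  (splitAttack A₂ x (G.curve pp).q K (pointOf (G.curve pp) (H.det pp key) (H.det pp key) false)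
    (Lh x) (fun c i => tableEnc SE K c ((Lc x).cellD c i)) (tableEnc SE K)).map Data.toBool

/-! ### Summing the hybrids over the classes of columns -/

section Telescope

variable {G : CurveFamily} {H : DetScheme G} {A₁ A₂ : Prog} {SE : EncScheme} {W : Polynomial ℕ}

/-- The hybrid attack with hashes of the scheme and a fixed threshold. -/
noncomputable def thresholdGame (H : DetScheme G) (SE : EncScheme) (A₁ A₂ : Prog) (W : Polynomial ℕ)
    (κ θ : ℕ) : PMF Bool :=
  (G.setup.exec (.unary κ)).bind fun pp => (H.gen.exec (.pair (.unary κ) pp)).bind fun key =>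
    (hybridAt A₁ A₂ SE (W.eval κ) (.pair (.unary κ) pp) (G.curve pp).q 0 θ
      (pointOf (G.curve pp) (H.det pp key) (H.det pp key))).map Data.toBool

theorem pointOf_self (E : Curve) (u : Data → ZMod E.q) (b b' : Bool) :
    pointOf E u u b = pointOf E u u b' := by
  funext k v
  simp [pointOf]

/-- If class `J` and the others use the same function, `J` is not visible in the attack; in
`detHybrid` it then serves only as a random threshold. -/
theorem hybridAt_self (E : Curve) (u : Data → ZMod E.q) (w : ℕ) (d : Data) (q J J' θ : ℕ) :
    hybridAt A₁ A₂ SE w d q J θ (pointOf E u u) = hybridAt A₁ A₂ SE w d q J' θ (pointOf E u u) := by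
  have : ∀ b, pointOf E u u b = pointOf E u u false := fun b => pointOf_self E u b false
  unfold hybridAt hybridAttack
  simp only [this]

theorem detHybrid_eq (side κ : ℕ) : detHybrid H A₁ A₂ SE W side κ =
    (uniformNat (W.eval κ * W.eval κ + 1)).bind fun J =>
      thresholdGame H SE A₁ A₂ W κ (J + side) := by
  unfold detHybrid thresholdGame hybridBit randomHybrid
  rw [PMF.bind_comm (uniformNat _)]
  refine bind_congr fun pp _ => ?_
  rw [PMF.bind_comm (uniformNat _)]
  refine bind_congr fun key _ => ?_
  rw [PMF.map_bind]
  simp only [Data.fst_pair, listLength_unary]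
  refine bind_congr fun J _ => ?_
  rw [hybridAt_self _ _ _ _ _ J 0]

/-- For `J` random, the two sides average the threshold games at `J` and at `J + 1`, so
multiplication by the number of labels leaves a telescoping sum. -/
theorem thresholdGame_sub (κ : ℕ) : prTrue (thresholdGame H SE A₁ A₂ W κ 0) -
    prTrue (thresholdGame H SE A₁ A₂ W κ (labelBound (W.eval κ))) =
    (labelBound (W.eval κ) : ℕ) * (prTrue (detHybrid H A₁ A₂ SE W 0 κ) -
      prTrue (detHybrid H A₁ A₂ SE W 1 κ)) := by
  rw [detHybrid_eq, detHybrid_eq, mul_sub, labelBound, prTrue_uniformNat_bind, prTrue_uniformNat_bind,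
    ← Finset.sum_sub_distrib]
  exact (Finset.sum_range_sub' (fun n => prTrue (thresholdGame H SE A₁ A₂ W κ n)) _).symm

theorem thresholdGame_zero (κ : ℕ) :
    thresholdGame H SE A₁ A₂ W κ 0 = splitGame H SE A₁ A₂ secondLog firstLog κ := by
  unfold thresholdGame splitGame hybridAt
  refine bind_congr fun pp _ => bind_congr fun key _ => ?_
  rw [PMF.map_bind]
  refine bind_congr fun x _ => ?_
  rw [PMF.map_bind]
  refine bind_congr fun K _ => ?_
  refine congrArg (PMF.map Data.toBool) ?_
  unfold hybridAttack splitAttack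
  simp only [Nat.not_lt_zero, if_false, pointOf_self (G.curve pp) (H.det pp key) _ false]
  rfl

theorem thresholdGame_top (κ : ℕ)
    (hA : ∀ pp ∈ (G.setup.exec (.unary κ)).support,
      ∀ x ∈ (A₁.exec (.pair (.unary κ) pp)).support, (Challenge.ofData x).Valid)
    (hW : ∀ pp ∈ (G.setup.exec (.unary κ)).support,
      ∀ x ∈ (A₁.exec (.pair (.unary κ) pp)).support, x.size ≤ W.eval κ) :
    thresholdGame H SE A₁ A₂ W κ (labelBound (W.eval κ)) =
      splitGame H SE A₁ A₂ firstLog firstLog κ := by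
  unfold thresholdGame splitGame hybridAt
  refine bind_congr fun pp hpp => bind_congr fun key _ => ?_
  rw [PMF.map_bind]
  refine bind_congr fun x hx => ?_
  rw [PMF.map_bind]
  refine bind_congr fun K _ => ?_
  refine congrArg (PMF.map Data.toBool) ?_
  have hδ := pairs_lt (hA pp hpp x hx) (hW pp hpp x hx)
  unfold hybridAttack splitAttack
  simp only [pointOf_self (G.curve pp) (H.det pp key) _ false, timeLabel_lt hδ, if_true]
  refine attack_congr (fun c i v hv => ?_) (fun _ _ => rfl) (fun _ _ _ => rfl)
    (fun _ _ _ _ _ => rfl) (fun _ _ _ _ _ => rfl) rfl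
  rw [if_pos (classLabel_lt hδ (mem_lt (hW pp hpp x hx)
    ((hA pp hpp x hx).equiv.schema₁.mem_of_cell hv)))]
  rfl

/-- The hashes of the two logs are indistinguishable, next to the ciphertexts of the first log. -/
theorem close_splitGame (hDDH : ECDDH G) (hPRF : H.IsPRF) (hA₁ : A₁.PPT) (hA₂ : A₂.PPT)
    (hA : ∀ κ, ∀ pp ∈ (G.setup.exec (.unary κ)).support,
      ∀ x ∈ (A₁.exec (.pair (.unary κ) pp)).support, (Challenge.ofData x).Valid)
    (hW : ∀ κ, ∀ pp ∈ (G.setup.exec (.unary κ)).support,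
      ∀ x ∈ (A₁.exec (.pair (.unary κ) pp)).support, x.size ≤ W.eval κ) :
    Close (fun κ => prTrue (splitGame H SE A₁ A₂ secondLog firstLog κ))
      (fun κ => prTrue (splitGame H SE A₁ A₂ firstLog firstLog κ)) := by
  refine (Negligible.poly_mul (close_detHybrid (SE := SE) hDDH hPRF hA₁ hA₂ hA hW)
    (W * W + 1)).mono fun κ => ?_
  dsimp only
  rw [← thresholdGame_zero (W := W), ← thresholdGame_top κ (hA κ) (hW κ), thresholdGame_sub, abs_mul,
    abs_of_nonneg (Nat.cast_nonneg _)]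
  simp [labelBound]

end Telescope

/-! ## The game in terms of these attacks -/

theorem prTrue_map_not (p : PMF Bool) : prTrue (p.map not) = 1 - prTrue p := by
  have h : ∑' b, p b = 1 := p.tsum_coe
  rw [tsum_bool] at h
  have h1 : prTrue (p.map not) = (p false).toReal := by
    rw [prTrue, PMF.map_apply, tsum_bool]; simp
  have h2 := congrArg ENNReal.toReal h
  rw [ENNReal.toReal_add (p.apply_ne_top _) (p.apply_ne_top _), ENNReal.toReal_one] at h2
  rw [h1, prTrue]; linarith

theorem prTrue_guess (X : Bool → PMF Bool) :
    prTrue ((PMF.uniformOfFintype Bool).bind fun b => (X b).map fun g => g == b) =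
      1 / 2 + (prTrue (X true) - prTrue (X false)) / 2 := by
  rw [prTrue_bind, expect_uniform]
  have h1 : (fun g : Bool => g == true) = id := by funext g; cases g <;> rfl
  have h0 : (fun g : Bool => g == false) = not := by funext g; cases g <;> rfl
  simp only [Fintype.sum_bool, Fintype.card_bool, h1, h0, PMF.map_id, prTrue_map_not, Nat.cast_ofNat]
  ring

section RealGame

variable {G : CurveFamily} {H : DetScheme G} {A₁ A₂ : Prog} {SE : EncScheme} {pp x : Data}

/-- Scalars written as natural numbers. -/
def KeySet.toTable {q : ℕ} [Fact q.Prime] (K : KeySet q) : KeyTable :=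
  ((K.time : ZMod q).val, mapCols (fun _ k => ((k.1 : ZMod q).val, k.2)) K.cols)

/-- Key generation splits into independent parts: the `DET` key, and the table of the other keys
with units read as numbers. -/
theorem keyGen_map (κ : ℕ) (S : Schema) :
    (keyGen H SE κ pp S).map (fun K => (K.master, K.toTable)) =
      (H.gen.exec (.pair (.unary κ) pp)).bind fun key =>
        (natKeys SE (.unary κ) (G.curve pp).q S).map fun K => (key, K) := by
  change ((H.gen.exec (.pair (.unary κ) pp)).bind fun key => _).map _ = _
  rw [PMF.map_bind]
  refine bind_congr fun key _ => ?_
  rw [natKeys_eq, PMF.map_bind, unitNat, PMF.bind_map]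
  change ((PMF.uniformOfFintype (ZMod (G.curve pp).q)ˣ).bind fun t => _).map _ = _
  rw [PMF.map_bind]
  refine bind_congr fun t _ => ?_
  change ((sampleList _ S).bind fun cols => PMF.pure (KeySet.mk key t cols)).map _ = _
  rw [PMF.map_bind]
  simp only [PMF.pure_map, Function.comp_apply]
  change _ = ((sampleCols _ S).map _).map _
  rw [PMF.map_comp]
  have h1 : sampleList (fun T : List Bool => sampleList (fun isTime : Bool =>
      if isTime then (PMF.pure t).bind fun kh =>
        (SE.gen.exec (.unary κ)).bind fun ke => PMF.pure (kh, ke)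
      else (PMF.uniformOfFintype (ZMod (G.curve pp).q)ˣ).bind fun kh =>
        (SE.gen.exec (.unary κ)).bind fun ke => PMF.pure (kh, ke)) T) S =
      sampleCols (fun c isTime => (if isTime = true then PMF.pure t else
        PMF.uniformOfFintype (ZMod (G.curve pp).q)ˣ).bind fun kh =>
        (SE.gen.exec (.unary κ)).bind fun ke => PMF.pure (kh, ke)) S := by
    rw [sampleCols, ← sampleList_zipIdx _ S 0]
    congr 1
    funext T
    rw [← sampleList_zipIdx _ T.1 0]
    congr 1
    funext a
    split_ifs <;> rfl
  have h2 : sampleCols (fun _ => keyPair SE (.unary κ) (G.curve pp).q (t : ZMod (G.curve pp).q).val) S =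
      (sampleCols (fun c isTime => (if isTime = true then PMF.pure t else
        PMF.uniformOfFintype (ZMod (G.curve pp).q)ˣ).bind fun kh =>
        (SE.gen.exec (.unary κ)).bind fun ke => PMF.pure (kh, ke)) S).map
        (mapCols fun _ k => ((k.1 : ZMod (G.curve pp).q).val, k.2)) := by
    rw [map_sampleCols]
    congr 1
    funext c b
    rw [keyPair, PMF.map_bind]
    simp only [PMF.map_bind, PMF.pure_map]
    cases b with
    | true => simp only [if_true, PMF.pure_bind]; rfl
    | false =>
      simp only [Bool.false_eq_true, if_false]
      rw [unitNat, PMF.bind_map]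
      rfl
  refine (congrArg (fun p => PMF.bind p _) h1).trans ?_
  rw [h2, PMF.map_comp]
  rfl

theorem key_isSome {κ : ℕ} {S : Schema} {K : KeySet (G.curve pp).q}
    (hK : K ∈ (keyGen H SE κ pp S).support) (c : Column) : (K.key c).isSome ↔ S.Mem c := by
  have h : (K.master, K.toTable) ∈
      ((keyGen H SE κ pp S).map (fun K => (K.master, K.toTable))).support :=
    (PMF.mem_support_map_iff _ _ _).2 ⟨K, hK, rfl⟩
  rw [keyGen_map] at h
  simp only [PMF.mem_support_bind_iff, PMF.mem_support_map_iff] at h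
  obtain ⟨key, -, K', hK', hKK⟩ := h
  rw [← (mem_natKeys hK').2.2.2 c, show K' = K.toTable from congrArg Prod.snd hKK]
  rw [KeySet.toTable, colEntry_mapCols, Option.isSome_map]
  rfl

/-- The hash function of the scheme. -/
noncomputable abbrev detHash (H : DetScheme G) (pp key : Data) : ℕ → Data → PMF Data :=
  pointOf (G.curve pp) (H.det pp key) (H.det pp key) false

theorem encode_akhHash (K : KeySet (G.curve pp).q) (k : (ZMod (G.curve pp).q)ˣ) (v : Data) :
    detHash H pp K.master (k : ZMod (G.curve pp).q).val v =
      PMF.pure ((G.curve pp).encode (akhHash H pp K.master k v)) := by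
  rw [akhHash, detHash, pointOf]
  rw [ZMod.natCast_zmod_val]
  conv_rhs => rw [Curve.smul, Curve.smul_smul_base, ZMod.natCast_zmod_val]
  rfl

theorem encryptCell_eq {S : Schema} {K : KeySet (G.curve pp).q}
    (hK : ∀ c, (K.key c).isSome ↔ S.Mem c) {c : Column} (hc : S.Mem c) (v : Data) :
    encryptCell H SE pp K c v = (detHash H pp K.master (K.toTable.hashKey c) v).bind fun p =>
      (tableEnc SE K.toTable c v).map (Data.pair p) := by
  obtain ⟨k, hk⟩ := Option.isSome_iff_exists.1 ((hK c).2 hc)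
  have h1 : colEntry K.toTable.2 c = some ((k.1 : ZMod (G.curve pp).q).val, k.2) := by
    rw [KeySet.toTable, colEntry_mapCols, show colEntry K.cols c = some k from hk]; rfl
  rw [encryptCell, hk, tableEnc, hashKey_eq, encKey_eq, h1]
  simp only [Option.getD_some]
  rw [encode_akhHash, PMF.pure_bind]

theorem encryptDB_eq {S : Schema} {K : KeySet (G.curve pp).q}
    (hK : ∀ c, (K.key c).isSome ↔ S.Mem c) {L : Log} (hL : L.HasSchema S) :
    encryptDB H SE pp K L = mapLog (fun c i =>
      (detHash H pp K.master (K.toTable.hashKey c) (L.cellD c i)).bind fun p =>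
        (tableEnc SE K.toTable c (L.cellD c i)).map (Data.pair p)) L := by
  have h1 : encryptDB H SE pp K L = mapLog (fun c i => encryptCell H SE pp K c (L.cellD c i)) L := by
    unfold encryptDB mapLog
    congr 1
    refine sampleList_congr fun T hT => ?_
    congr 1
    rw [← sampleList_zipIdx _ T.1 0]
    refine sampleList_congr fun R hR => ?_
    congr 1
    refine sampleList_congr fun v hv => ?_
    obtain ⟨T, t⟩ := T
    obtain ⟨R, i⟩ := R
    obtain ⟨v, a⟩ := v
    rw [List.mk_mem_zipIdx_iff_getElem?] at hT hR hv
    dsimp only at hT hR hv ⊢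
    rw [cellD_of_cell (v := v) (by simp [Log.cell, hT, hR, hv])]
  rw [h1]
  exact mapLog_congr fun c i v hv => encryptCell_eq hK (hL.mem_of_cell hv) _

/-- Hashing is deterministic once the keys are fixed, so hashing a value afresh at each of its
occurrences gives the same structure. -/
theorem mopedView_pure (K : KeySet (G.curve pp).q) (ts D : List Data) :
    mopedView (fun i => detHash H pp K.master K.toTable.1 (ts.getD i (.int 0)))
      (fun d => detHash H pp K.master K.toTable.1 d) ts D =
      PMF.pure (mopedConstruction H pp K ts D) := by
  have hk : ∀ v, detHash H pp K.master K.toTable.1 v =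
      PMF.pure ((G.curve pp).encode (akhHash H pp K.master K.time v)) := encode_akhHash K K.time
  unfold mopedView mopedConstruction
  simp only [hk, PMF.pure_bind, PMF.pure_map, sampleList_pure]
  congr 2
  refine List.map_congr_left fun j _ => ?_
  unfold mopedMap
  rw [List.flatMap_def]
  congr 2
  have : ts.take j = (ts.take j).zipIdx.map Prod.fst := by rw [List.zipIdx_map_fst]
  conv_rhs => rw [this, List.map_map]
  refine List.map_congr_left fun t ht => ?_
  obtain ⟨t, i⟩ := t
  rw [List.mk_mem_zipIdx_iff_getElem?] at ht
  have hi := (List.getElem?_eq_some_iff.1 ht).1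
  have h2 : ts[i]? = some t := by
    rw [List.length_take] at hi
    rwa [List.getElem?_take, if_pos (by omega)] at ht
  simp [List.getD_eq_getElem?_getD, h2]

/-- All columns in a valid equality scheme have keys, so `filterMap` drops nothing, and inverses are
powers by Fermat. -/
theorem generateTokens_eq {S : Schema} {δ : List (Column × Column)} {K : KeySet (G.curve pp).q}
    (hK : ∀ c, (K.key c).isSome ↔ S.Mem c) (hδ : ∀ p ∈ δ, S.Mem p.1 ∧ S.Mem p.2) :
    generateTokens K δ = tokenData (G.curve pp).q K.toTable δ := by
  unfold generateTokens tokenData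
  congr 1
  induction δ with
  | nil => rfl
  | cons p δ ih =>
    obtain ⟨h1, h2⟩ := hδ p (by simp)
    obtain ⟨k₁, hk₁⟩ := Option.isSome_iff_exists.1 ((hK _).2 h1)
    obtain ⟨k₂, hk₂⟩ := Option.isSome_iff_exists.1 ((hK _).2 h2)
    have hh : ∀ c k, K.key c = some k →
        K.toTable.hashKey c = (k.1 : ZMod (G.curve pp).q).val := fun c k hk => by
      rw [hashKey_eq, KeySet.toTable, colEntry_mapCols, show colEntry K.cols c = some k from hk]; rfl
    have hq : 2 ≤ (G.curve pp).q := (G.curve pp).prime.out.two_le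
    have hR : (((G.curve pp).q - 1 + 1 : ℕ) : ZMod (G.curve pp).q) = 0 := by
      rw [Nat.sub_add_cancel (by omega), ZMod.natCast_self]
    have htok : (akhToken k₁.1 k₂.1 : ZMod (G.curve pp).q).val = K.toTable.hashKey p.2 *
        powMod ((G.curve pp).q - 1) (K.toTable.hashKey p.1) ((G.curve pp).q - 2) %
          (G.curve pp).q := by
      rw [hh _ _ hk₁, hh _ _ hk₂, akhToken, Units.val_mul, ← ZMod.val_natCast]
      refine congrArg ZMod.val ?_
      rw [Nat.cast_mul, powMod_cast hR, ZMod.natCast_zmod_val, ZMod.natCast_zmod_val,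
        Units.val_inv_eq_inv_val, eq_comm]
      refine congrArg ((k₂.1 : ZMod (G.curve pp).q) * ·) ?_
      refine eq_inv_of_mul_eq_one_left ?_
      rw [← pow_succ, show (G.curve pp).q - 2 + 1 = (G.curve pp).q - 1 by omega]
      exact ZMod.pow_card_sub_one_eq_one k₁.1.ne_zero
    rw [List.map_cons, ← ih fun p hp => hδ p (by simp [hp]), ← htok, List.filterMap_cons]
    simp only [hk₁, hk₂, Option.bind_some, Option.map_some]

end RealGame

end Eunomia
namespace Eunomia
open Enc

/-! ### Ranks depend only on the comparisons of displaced timestamps -/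

/-- On `I` the function `g` factors through `f`, so it takes at most as many values. -/
theorem card_image_le_of {ι : Type} (I : Finset ι) {f g : ι → ℤ}
    (h : ∀ a ∈ I, ∀ b ∈ I, f a = f b → g a = g b) : (I.image g).card ≤ (I.image f).card := by
  classical
  let r : ℤ → ℤ := fun s => if h : ∃ a ∈ I, f a = s then g h.choose else 0
  have : I.image g ⊆ (I.image f).image r := by
    intro s hs
    obtain ⟨a, ha, rfl⟩ := Finset.mem_image.1 hs
    refine Finset.mem_image.2 ⟨f a, Finset.mem_image_of_mem _ ha, ?_⟩
    have he : ∃ b ∈ I, f b = f a := ⟨a, ha, rfl⟩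
    exact (dif_pos he).trans (h _ he.choose_spec.1 _ ha he.choose_spec.2)
  exact (Finset.card_le_card this).trans Finset.card_image_le

/-- The sums are indexed by positions of timestamps instead of their values, which gives two logs a
common index set. -/
theorem rank_eq_card (ts D : List Data) (j : ℕ) (t d : Data) : rank (ts.take j) D t d =
    ((((Finset.range (min j ts.length)) ×ˢ D.toFinset).filter fun p =>
      (ts.getD p.1 (.int 0)).toInt + p.2.toInt ≤ t.toInt + d.toInt).image fun p =>
        (ts.getD p.1 (.int 0)).toInt + p.2.toInt).card := by
  rw [rank, displaced]
  congr 1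
  ext s
  simp only [Finset.mem_filter, Finset.mem_image₂, Finset.mem_image, Finset.mem_product,
    Finset.mem_range, List.mem_toFinset, Prod.exists]
  constructor
  · rintro ⟨⟨a, ha, e, he, rfl⟩, hs⟩
    obtain ⟨i, hi, rfl⟩ := List.mem_iff_getElem.1 ha
    rw [List.length_take] at hi
    have h1 : ts.getD i (.int 0) = (ts.take j)[i]'(by rwa [List.length_take]) := by
      rw [List.getElem_take, List.getD_eq_getElem?_getD, List.getElem?_eq_getElem (by omega)]; rfl
    exact ⟨i, e, ⟨⟨hi, he⟩, by rw [h1]; exact hs⟩, by rw [h1]⟩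
  · rintro ⟨i, e, ⟨⟨hi, he⟩, hs⟩, rfl⟩
    have h1 : ts.getD i (.int 0) = (ts.take j)[i]'(by rwa [List.length_take]) := by
      rw [List.getElem_take, List.getD_eq_getElem?_getD, List.getElem?_eq_getElem (by omega)]; rfl
    exact ⟨⟨_, by rw [h1]; exact List.getElem_mem _, e, he, rfl⟩, hs⟩

/-- Equal comparisons select the same index pairs below `u[i] + d` and `v[i] + d`. Two of these
pairs have equal sums in one log iff they do in the other, by comparing in both directions, so the
numbers of distinct sums agree. This holds for every prefix, hence for all intermediate states. -/
theorem EDD.rank_eq {u v D : List Data} (h : EDD u v D) (j i : ℕ) (hi : i < u.length)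
    (hi' : i < v.length) {d : Data} (hd : d ∈ D) :
    rank (u.take j) D u[i] d = rank (v.take j) D v[i] d := by
  obtain ⟨hlen, h⟩ := h
  have key : ∀ a b : ℕ, a < u.length → b < u.length → ∀ d ∈ D, ∀ e ∈ D,
      ((u.getD b (.int 0)).toInt + e.toInt ≤ (u.getD a (.int 0)).toInt + d.toInt ↔
        (v.getD b (.int 0)).toInt + e.toInt ≤ (v.getD a (.int 0)).toInt + d.toInt) := by
    intro a b ha hb d hd e he
    have hu : ∀ a < u.length, u[a]? = some (u.getD a (.int 0)) := fun a ha => by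
      rw [List.getD_eq_getElem?_getD, List.getElem?_eq_getElem ha]; rfl
    have hv : ∀ a < u.length, v[a]? = some (v.getD a (.int 0)) := fun a ha => by
      rw [List.getD_eq_getElem?_getD, List.getElem?_eq_getElem (by omega)]; rfl
    exact h d hd e he a b _ _ _ _ (hu a ha) (hu b hb) (hv a ha) (hv b hb)
  have e1 : u[i] = u.getD i (.int 0) := by
    rw [List.getD_eq_getElem?_getD, List.getElem?_eq_getElem hi]; rfl
  have e2 : v[i] = v.getD i (.int 0) := by
    rw [List.getD_eq_getElem?_getD, List.getElem?_eq_getElem hi']; rfl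
  rw [rank_eq_card, rank_eq_card, ← hlen, e1, e2]
  have hfilter : (((Finset.range (min j u.length)) ×ˢ D.toFinset).filter fun p =>
      (u.getD p.1 (.int 0)).toInt + p.2.toInt ≤ (u.getD i (.int 0)).toInt + d.toInt) =
      (((Finset.range (min j u.length)) ×ˢ D.toFinset).filter fun p =>
      (v.getD p.1 (.int 0)).toInt + p.2.toInt ≤ (v.getD i (.int 0)).toInt + d.toInt) := by
    refine Finset.filter_congr fun p hp => ?_
    rw [Finset.mem_product, Finset.mem_range, List.mem_toFinset] at hp
    exact key i p.1 hi (by omega) d hd p.2 hp.2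
  rw [hfilter]
  have hpair : ∀ p ∈ (((Finset.range (min j u.length)) ×ˢ D.toFinset).filter fun p =>
      (v.getD p.1 (.int 0)).toInt + p.2.toInt ≤ (v.getD i (.int 0)).toInt + d.toInt),
      p.1 < u.length ∧ p.2 ∈ D := fun p hp => by
    have := (Finset.mem_filter.1 hp).1
    rw [Finset.mem_product, Finset.mem_range, List.mem_toFinset] at this
    exact ⟨by omega, this.2⟩
  refine le_antisymm (card_image_le_of _ fun a ha b hb hab => ?_)
    (card_image_le_of _ fun a ha b hb hab => ?_)
  · obtain ⟨ha1, ha2⟩ := hpair a ha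
    obtain ⟨hb1, hb2⟩ := hpair b hb
    exact le_antisymm ((key _ _ hb1 ha1 _ hb2 _ ha2).2 hab.le) ((key _ _ ha1 hb1 _ ha2 _ hb2).2 hab.ge)
  · obtain ⟨ha1, ha2⟩ := hpair a ha
    obtain ⟨hb1, hb2⟩ := hpair b hb
    exact le_antisymm ((key _ _ hb1 ha1 _ hb2 _ ha2).1 hab.le) ((key _ _ ha1 hb1 _ ha2 _ hb2).1 hab.ge)

theorem cell_mapCells (M : Column → Data → Data) (L : Log) (c : Column) (i : ℕ) :
    (L.mapCells M).cell c i = (L.cell c i).map (M c) := by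
  simp only [Log.cell, Log.mapCells, List.getElem?_mapIdx]
  cases h1 : L[c.1]? with
  | none => rfl
  | some T =>
    simp only [Option.map_some, Option.bind_some, List.getElem?_map]
    cases h2 : T[i]? with
    | none => rfl
    | some row => simp [List.getElem?_mapIdx]

/-! ### The game as a pair of split games -/

section RealGame

variable {G : CurveFamily} {H : DetScheme G} {A₁ A₂ : Prog} {SE : EncScheme} {pp x : Data}

/-- Constants appear in the same columns of the two logs. -/
theorem mem_column_secondLog (hx : (Challenge.ofData x).Valid) {c : Column} {v : Data}
    (hv : v ∈ constantsOf x) : v ∈ (secondLog x).column c ↔ v ∈ (firstLog x).column c := by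
  obtain ⟨M, -, -, hM3, -, hM5, hM6⟩ := exists_cellMap hx
  rw [mem_column_iff, mem_column_iff]
  refine exists_congr fun i => ?_
  rw [hM6, cell_mapCells]
  cases h : (firstLog x).cell c i with
  | none => simp
  | some u =>
    have h1 := hM3 c u (mem_classValues (.refl _) h)
    simp only [Option.map_some, Option.some_inj]
    constructor
    · rintro rfl; exact (h1 (.inr hv)).symm
    · rintro rfl; exact h1 (.inl hv)

/-- The view of the adversary in the game is that of an attack with hashes and ciphertexts of the
same log. -/
theorem realAttack_eq (hx : (Challenge.ofData x).Valid) {K : KeySet (G.curve pp).q}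
    (hK : ∀ c, (K.key c).isSome ↔ (schemaOf x).Mem c) (L : Log) (hL : L = firstLog x ∨ L = secondLog x) :
    ((encryptDB H SE pp K L).bind fun eDB =>
      (encryptConstants H SE pp K (schemaOf x) (constantsOf x) L).bind fun cs =>
      A₂.execWith (encOracle H SE pp K (Challenge.ofData x)) (.pair (stateOf x)
        (.ofList [eDB, mopedConstruction H pp K (timeStamps (schemaOf x) L) (displacementsOf x),
          generateTokens K (pairsOf x), cs]))) =
    splitAttack A₂ x (G.curve pp).q K.toTable (detHash H pp K.master) L
      (fun c i => tableEnc SE K.toTable c (L.cellD c i)) (tableEnc SE K.toTable) := by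
  obtain ⟨M, hM1, -, -, -, -, hM6⟩ := exists_cellMap hx
  have hS : L.HasSchema (schemaOf x) := by
    rcases hL with rfl | rfl
    exacts [hx.equiv.schema₁, hx.equiv.schema₂]
  -- The definition of `attack` takes the shape, the timestamps for the ranks and the positions of
  -- constants from the first log. This and the next facts show that those of `L` give the same
  -- view.
  have hmap : ∀ f, mapLog f L = mapLog f (firstLog x) := fun f => by
    rcases hL with rfl | rfl
    · rfl
    · rw [hM6, mapLog_mapCells]
  have hmoped : ∀ hT hD, mopedView hT hD (timeStamps (schemaOf x) (firstLog x)) (displacementsOf x) =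
      mopedView hT hD (timeStamps (schemaOf x) L) (displacementsOf x) := fun hT hD => by
    rcases hL with rfl | rfl
    · rfl
    · exact mopedView_congr hx.equiv.times.1 (fun _ _ => rfl) (fun _ _ _ => rfl)
        fun j i hi hi' d hd => hx.equiv.times.rank_eq j i hi hi' hd
  have hcol : ∀ c v, v ∈ constantsOf x → (v ∈ L.column c ↔ v ∈ (firstLog x).column c) := fun c v hv => by
    rcases hL with rfl | rfl
    · rfl
    · exact mem_column_secondLog hx hv
  have hconst : encryptConstants H SE pp K (schemaOf x) (constantsOf x) L =
      constantsView (fun c v => (detHash H pp K.master (K.toTable.hashKey c) v).bind fun p =>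
        (tableEnc SE K.toTable c v).map (Data.pair p)) (schemaOf x) (constantsOf x) (firstLog x) := by
    rw [← constantsView_congr fun c v hc _ _ => encryptCell_eq hK hc v]
    unfold encryptConstants constantsView
    have : ∀ c, ((constantsOf x).filter fun v => decide (v ∈ L.column c)) =
        (constantsOf x).filter fun v => decide (v ∈ (firstLog x).column c) := fun c =>
      List.filter_congr fun v hv => by rw [decide_eq_decide]; exact hcol c v hv
    simp only [this]
  unfold splitAttack attack
  rw [encryptDB_eq hK hS, hmap, hmoped, mopedView_pure, hconst, generateTokens_eq (δ := pairsOf x) hK hx.scheme]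
  refine bind_congr fun eDB _ => ?_
  rw [PMF.pure_bind]
  refine bind_congr fun cs _ => ?_
  congr 1
  funext y
  unfold encOracle
  refine if_congr Iff.rfl rfl ?_
  by_cases hc : (schemaOf x).Mem (Column.ofData y.fst)
  · rw [if_pos (mem_iff_hasColumn.1 hc), encryptCell_eq hK hc]
  · rw [if_neg fun h => hc (mem_iff_hasColumn.2 h), encryptCell]
    have : K.key (Column.ofData y.fst) = none := by
      rw [← Option.not_isSome_iff_eq_none, hK]; exact hc
    rw [this]

/-- For a uniform bit, guessing correctly is 1/2 plus half the difference between the probabilities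
of the answer `true` in the two cases. -/
theorem cplaGame_eq (κ : ℕ)
    (hA : ∀ pp ∈ (G.setup.exec (.unary κ)).support,
      ∀ x ∈ (A₁.exec (.pair (.unary κ) pp)).support, (Challenge.ofData x).Valid) :
    prTrue (cplaGame H SE A₁ A₂ κ) = 1 / 2 +
      (prTrue (splitGame H SE A₁ A₂ secondLog secondLog κ) -
        prTrue (splitGame H SE A₁ A₂ firstLog firstLog κ)) / 2 := by
  have key : ∀ (Lb : Data → Log), (∀ x, Lb x = firstLog x ∨ Lb x = secondLog x) →
      splitGame H SE A₁ A₂ Lb Lb κ = (G.setup.exec (.unary κ)).bind fun pp =>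
        (A₁.exec (.pair (.unary κ) pp)).bind fun x => (keyGen H SE κ pp (schemaOf x)).bind fun K =>
        ((encryptDB H SE pp K (Lb x)).bind fun eDB =>
          (encryptConstants H SE pp K (schemaOf x) (constantsOf x) (Lb x)).bind fun cs =>
          A₂.execWith (encOracle H SE pp K (Challenge.ofData x)) (.pair (stateOf x)
          (.ofList [eDB, mopedConstruction H pp K (timeStamps (schemaOf x) (Lb x)) (displacementsOf x),
            generateTokens K (pairsOf x), cs]))).map Data.toBool := by
    intro Lb hLb
    unfold splitGame
    refine bind_congr fun pp hpp => ?_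
    rw [PMF.bind_comm]
    refine bind_congr fun x hx => ?_
    refine Eq.trans ?_ (bind_congr fun K hK => congrArg (PMF.map Data.toBool)
      (realAttack_eq (A₂ := A₂) (SE := SE) (hA pp hpp x hx) (key_isSome hK) _ (hLb x))).symm
    have h1 := congrArg (fun p : PMF (Data × KeyTable) => p.bind fun k =>
      (splitAttack A₂ x (G.curve pp).q k.2 (detHash H pp k.1) (Lb x)
        (fun c i => tableEnc SE k.2 c ((Lb x).cellD c i)) (tableEnc SE k.2)).map Data.toBool)
      (keyGen_map (H := H) (SE := SE) (pp := pp) κ (schemaOf x))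
    simp only [PMF.bind_map, PMF.bind_bind] at h1
    exact h1.symm
  have hgame : cplaGame H SE A₁ A₂ κ = (PMF.uniformOfFintype Bool).bind fun b =>
      ((splitGame H SE A₁ A₂ (fun x => if b = true then secondLog x else firstLog x)
        (fun x => if b = true then secondLog x else firstLog x) κ)).map fun g => g == b := by
    have hb : ∀ b : Bool, ∀ x, (if b = true then secondLog x else firstLog x) = firstLog x ∨
        (if b = true then secondLog x else firstLog x) = secondLog x := fun b x => by
      cases b <;> simp
    simp only [key _ (hb _), PMF.map_bind]
    rw [PMF.bind_comm]
    refine bind_congr fun pp _ => ?_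
    rw [PMF.bind_comm]
    refine bind_congr fun x _ => ?_
    rw [PMF.bind_comm]
    refine bind_congr fun K _ => bind_congr fun b _ => ?_
    simp only [PMF.map_comp]
    rfl
  rw [hgame, prTrue_guess]
  simp only [if_true, Bool.false_eq_true, if_false]

end RealGame

end Eunomia
namespace Eunomia
open Enc

/-! ## Positions of cells as numbers -/

/-- Digits in base `w`; if row and column numbers are below `w`, the position can be recovered
(`cellIndex_eq_iff`). -/
def cellIndex (w : ℕ) (c : Column) (i : ℕ) : ℕ := (c.1 * w + i) * w + c.2

def indexColumn (w n : ℕ) : Column := (n / w / w, n % w)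

def indexRow (w n : ℕ) : ℕ := n / w % w

theorem cellIndex_eq_iff {w : ℕ} {c : Column} {i n : ℕ} (hi : i < w) (hc : c.2 < w) :
    cellIndex w c i = n ↔ c = indexColumn w n ∧ i = indexRow w n := by
  have hw : 0 < w := by omega
  constructor
  · rintro rfl
    have h1 : cellIndex w c i / w = c.1 * w + i := by
      rw [cellIndex, mul_comm _ w, Nat.mul_add_div hw, Nat.div_eq_of_lt hc, add_zero]
    have h2 : (c.1 * w + i) / w = c.1 := by
      rw [mul_comm, Nat.mul_add_div hw, Nat.div_eq_of_lt hi, add_zero]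
    refine ⟨Prod.ext ?_ ?_, ?_⟩
    · rw [indexColumn, h1, h2]
    · rw [indexColumn, cellIndex, mul_comm _ w, Nat.mul_add_mod, Nat.mod_eq_of_lt hc]
    · rw [indexRow, h1, mul_comm, Nat.mul_add_mod, Nat.mod_eq_of_lt hi]
  · rintro ⟨rfl, rfl⟩
    rw [cellIndex, indexColumn, indexRow]
    dsimp only
    rw [Nat.div_add_mod', Nat.div_add_mod']

theorem cellIndex_lt {w : ℕ} {c : Column} {i : ℕ} (h1 : c.1 < w) (hi : i < w) (hc : c.2 < w) :
    cellIndex w c i < w * w * w := by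
  unfold cellIndex
  have h2 : c.1 * w + i + 1 ≤ w * w := by
    have : c.1 * w + w ≤ w * w := by rw [← Nat.succ_mul]; exact Nat.mul_le_mul_right _ h1
    omega
  have h3 : (c.1 * w + i + 1) * w ≤ w * w * w := Nat.mul_le_mul_right _ h2
  rw [Nat.succ_mul] at h3
  omega

theorem cell_firstLog_lt {x : Data} {c : Column} {i : ℕ} {v : Data}
    (h : (firstLog x).cell c i = some v) : c.1 < x.size ∧ i < x.size ∧ c.2 < x.size := by
  have hle : (x.snd.snd.snd.snd.fst).size ≤ x.size :=
    (Data.fst_size _).trans ((Data.snd_size _).trans ((Data.snd_size _).trans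
      ((Data.snd_size _).trans (Data.snd_size _))))
  have hL : firstLog x = (x.snd.snd.snd.snd.fst).toList.map fun T => T.toList.map Data.toList := rfl
  rw [hL] at h
  simp only [Log.cell, List.getElem?_map] at h
  cases hT : (x.snd.snd.snd.snd.fst).toList[c.1]? with
  | none => simp [hT] at h
  | some T =>
    simp only [hT, Option.map_some, Option.bind_some, List.getElem?_map] at h
    cases hR : T.toList[i]? with
    | none => simp [hR] at h
    | some R =>
      simp only [hR, Option.map_some, Option.bind_some] at h
      have h1 := (List.getElem?_eq_some_iff.1 hT).1
      have h2 := (List.getElem?_eq_some_iff.1 hR).1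
      have h3 := (List.getElem?_eq_some_iff.1 h).1
      have h4 := toList_length_le (x.snd.snd.snd.snd.fst)
      have h5 := toList_mem_size (List.mem_of_getElem? hT)
      have h6 := toList_mem_size (List.mem_of_getElem? hR)
      have h7 := toList_length_le T
      have h8 := toList_length_le R
      omega

theorem cellD_eq (L : Log) (c : Column) (i : ℕ) : L.cellD c i = (L.cell c i).getD (.int 0) := by
  simp only [Log.cell, Log.cellD, List.getD_eq_getElem?_getD]
  cases h1 : L[c.1]? with
  | none => simp
  | some T => cases h2 : T[i]? <;> simp [h2]

/-- Stated for all positions, since the reduction may guess one where there is no cell; both logs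
then give the default. -/
theorem cellD_size {x : Data} (hx : (Challenge.ofData x).Valid) (c : Column) (i : ℕ) :
    ((firstLog x).cellD c i).size = ((secondLog x).cellD c i).size := by
  obtain ⟨M, -, -, -, hM4, -, hM6⟩ := exists_cellMap hx
  rw [cellD_eq, cellD_eq, hM6, cell_mapCells]
  cases h : (firstLog x).cell c i with
  | none => rfl
  | some v => exact (hM4 c v (mem_classValues (.refl _) h)).symm

/-- An experiment whose parameter matters for one cell only. -/
theorem bind_mapLog {γ : Type} (p : PMF γ) (F : γ → Column → ℕ → PMF Data) (L : Log) (c₀ : Column)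
    (i₀ : ℕ) (hF : ∀ c i, ¬ (c = c₀ ∧ i = i₀) → ∀ x x', F x c i = F x' c i) :
    (p.bind fun x => mapLog (F x) L) = mapLog (fun c i => p.bind fun x => F x c i) L := by
  obtain ⟨x₀, -⟩ := p.support_nonempty
  unfold mapLog
  rw [← PMF.map_bind]
  refine congrArg (PMF.map Data.ofList) ?_
  rw [bind_sampleList p _ _ c₀.1 0]
  · refine sampleList_congr fun T _ => ?_
    rw [← PMF.map_bind]
    refine congrArg (PMF.map Data.ofList) ?_
    by_cases hT : T.2 = c₀.1
    · rw [bind_sampleList p _ _ i₀ 0]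
      · refine sampleList_congr fun R _ => ?_
        rw [← PMF.map_bind]
        refine congrArg (PMF.map Data.ofList) ?_
        by_cases hR : R.2 = i₀
        · rw [bind_sampleList p _ _ c₀.2 0]
          exact fun v a _ ha x x' => hF _ _ (fun h => ha (congrArg Prod.snd h.1)) x x'
        · have h : ∀ a x, F x (T.2, a) R.2 = F x₀ (T.2, a) R.2 := fun a x =>
            hF _ _ (fun h => hR h.2) x x₀
          simp only [h, PMF.bind_const]
      · intro R i _ hi x x'
        refine congrArg (PMF.map Data.ofList) (sampleList_congr fun v _ => ?_)
        exact hF _ _ (fun h => hi h.2) x x'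
    · have h : ∀ a i x, F x (T.2, a) i = F x₀ (T.2, a) i := fun a i x =>
        hF _ _ (fun h => hT (congrArg Prod.fst h.1)) x x₀
      simp only [h, PMF.bind_const]
  · intro T t _ ht x x'
    refine congrArg (PMF.map Data.ofList) (sampleList_congr fun R _ => ?_)
    refine congrArg (PMF.map Data.ofList) (sampleList_congr fun v _ => ?_)
    exact hF _ _ (fun h => ht (congrArg Prod.fst h.1)) x x'

/-! ## Replacing an encryption key -/

def setEncKey (c₀ : Column) (k : Data) (K : KeyTable) : KeyTable :=
  (K.1, mapCols (fun c e => (e.1, if c = c₀ then k else e.2)) K.2)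

/-- The encryption keys of the columns are independent, so one of them may be drawn again. In the
reduction the new key is that of the challenger. -/
theorem natKeys_setEncKey (SE : EncScheme) (κd : Data) (q : ℕ) [Fact q.Prime] (S : Schema)
    (c₀ : Column) : ((natKeys SE κd q S).bind fun K => (SE.gen.exec κd).map fun k =>
      setEncKey c₀ k K) = natKeys SE κd q S := by
  rw [natKeys_eq, PMF.bind_bind]
  refine bind_congr fun t _ => ?_
  rw [PMF.bind_map]
  have h1 : (fun cols => (SE.gen.exec κd).map fun k => setEncKey c₀ k (t, cols)) =
      fun cols => (SE.gen.exec κd).bind fun k => PMF.pure (t, mapCols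
        (fun (c : Column) (e : ℕ × Data) => (e.1, if c = c₀ then k else e.2)) cols) := rfl
  change (PMF.bind _ fun cols => (SE.gen.exec κd).map fun k => setEncKey c₀ k (t, cols)) = _
  rw [h1, PMF.bind_comm]
  have h2 : ∀ k, ((sampleCols (fun _ => keyPair SE κd q t) S).bind fun cols => PMF.pure (t, mapCols
        (fun (c : Column) (e : ℕ × Data) => (e.1, if c = c₀ then k else e.2)) cols)) =
      (sampleCols (fun c b => (keyPair SE κd q t b).map fun e =>
        (e.1, if c = c₀ then k else e.2)) S).map fun cols => (t, cols) := by
    intro k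
    rw [← map_sampleCols (fun _ => keyPair SE κd q t)
      (fun (c : Column) (e : ℕ × Data) => (e.1, if c = c₀ then k else e.2)), PMF.map_comp]
    rfl
  simp only [h2]
  rw [← PMF.map_bind, bind_sampleCols _ _ _ c₀]
  · refine congrArg (PMF.map _) (sampleCols_congr fun c b _ => ?_)
    by_cases hc : c = c₀
    · simp only [hc, if_true, keyPair, PMF.map_bind, PMF.map_comp]
      rw [PMF.bind_comm]
      refine bind_congr fun kh _ => ?_
      have : ∀ k : Data, (PMF.map ((fun e : ℕ × Data => (e.1, k)) ∘ fun ke => (kh, ke))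
          (SE.gen.exec κd)) = PMF.pure (kh, k) := fun k =>
        PMF.bind_const (SE.gen.exec κd) (PMF.pure (kh, k))
      simp only [this]
      rfl
    · simp only [hc, if_false]
      rw [PMF.bind_const]
      exact PMF.map_id _
  · intro c b hc k k'
    simp [hc]

theorem hashKey_setEncKey (c₀ c : Column) (k : Data) (K : KeyTable) :
    (setEncKey c₀ k K).hashKey c = K.hashKey c := by
  rw [hashKey_eq, hashKey_eq, setEncKey, colEntry_mapCols]
  cases colEntry K.2 c <;> rfl

theorem encKey_setEncKey {c₀ c : Column} (k : Data) {K : KeyTable} (hc : (colEntry K.2 c).isSome) :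
    (setEncKey c₀ k K).encKey c = if c = c₀ then k else K.encKey c := by
  rw [encKey_eq, encKey_eq, setEncKey, colEntry_mapCols]
  obtain ⟨e, he⟩ := Option.isSome_iff_exists.1 hc
  simp [he]

/-- Encryption in the column `c₀` by other means. -/
noncomputable def replaceEnc (c₀ : Column) (e : Data → PMF Data) (f : Column → Data → PMF Data)
    (c : Column) (v : Data) : PMF Data := if c = c₀ then e v else f c v

/-- The ciphertext of one cell can be produced beforehand, with a fresh key for its column. -/
theorem splitAttack_challenge {A₂ : Prog} {SE : EncScheme} {x : Data}
    (hx : (Challenge.ofData x).Valid) {w : ℕ} (hw : x.size ≤ w) {q : ℕ} {K : KeyTable}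
    (hK : ∀ c, (colEntry K.2 c).isSome ↔ (schemaOf x).Mem c) (h : ℕ → Data → PMF Data) (J : ℕ)
    (b : Bool) (k : Data) (L : Log) :
    ((SE.enc.exec (.pair k (if b = true then (secondLog x).cellD (indexColumn w J) (indexRow w J)
        else (firstLog x).cellD (indexColumn w J) (indexRow w J)))).bind fun chal =>
      splitAttack A₂ x q K h L
        (fun c i => if c = indexColumn w J ∧ i = indexRow w J then PMF.pure chal else
          replaceEnc (indexColumn w J) (fun v => SE.enc.exec (.pair k v)) (tableEnc SE K) c
            (if cellIndex w c i < J then (secondLog x).cellD c i else (firstLog x).cellD c i))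
        (replaceEnc (indexColumn w J) (fun v => SE.enc.exec (.pair k v)) (tableEnc SE K))) =
    splitAttack A₂ x q (setEncKey (indexColumn w J) k K) h L
      (fun c i => tableEnc SE (setEncKey (indexColumn w J) k K) c
        (if cellIndex w c i < J + b.toNat then (secondLog x).cellD c i
          else (firstLog x).cellD c i))
      (tableEnc SE (setEncKey (indexColumn w J) k K)) := by
  have henc : ∀ c, (schemaOf x).Mem c → ∀ v,
      replaceEnc (indexColumn w J) (fun v => SE.enc.exec (.pair k v)) (tableEnc SE K) c v =
        tableEnc SE (setEncKey (indexColumn w J) k K) c v := by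
    intro c hc v
    unfold replaceEnc tableEnc
    rw [encKey_setEncKey k ((hK c).2 hc)]
    split_ifs <;> rfl
  have htok : tokenData q K (pairsOf x) =
      tokenData q (setEncKey (indexColumn w J) k K) (pairsOf x) := by
    unfold tokenData
    simp only [hashKey_setEncKey]
  unfold splitAttack attack
  rw [← PMF.bind_bind, bind_mapLog _ _ _ (indexColumn w J) (indexRow w J)]
  · refine attack_congr (A₂ := A₂) (x := x)
      (cell := fun c i => (SE.enc.exec (.pair k (if b = true
          then (secondLog x).cellD (indexColumn w J) (indexRow w J)
          else (firstLog x).cellD (indexColumn w J) (indexRow w J)))).bind fun chal =>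
        (h (K.hashKey c) (L.cellD c i)).bind fun p => PMF.map (Data.pair p)
          (if c = indexColumn w J ∧ i = indexRow w J then PMF.pure chal else
            replaceEnc (indexColumn w J) (fun v => SE.enc.exec (.pair k v)) (tableEnc SE K) c
              (if cellIndex w c i < J then (secondLog x).cellD c i else (firstLog x).cellD c i)))
      (encr := fun c v => (h (K.hashKey c) v).bind fun p => PMF.map (Data.pair p)
        (replaceEnc (indexColumn w J) (fun v => SE.enc.exec (.pair k v)) (tableEnc SE K) c v))
      (fun c i v hv => ?_) (fun i _ => rfl)
      (fun _ d _ => rfl) (fun c v hc _ _ => ?_) (fun c v hc _ _ => ?_) htok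
    · have hc := hx.equiv.schema₁.mem_of_cell hv
      have hlt := cell_firstLog_lt hv
      dsimp only
      rw [hashKey_setEncKey, PMF.bind_comm]
      refine bind_congr fun p _ => ?_
      rw [← PMF.map_bind]
      refine congrArg (PMF.map _) ?_
      by_cases hcJ : c = indexColumn w J ∧ i = indexRow w J
      · have hJ : cellIndex w c i = J := (cellIndex_eq_iff (by omega) (by omega)).2 hcJ
        simp only [hcJ, and_self, if_true, PMF.bind_pure]
        rw [← hcJ.1] at henc
        rw [← hcJ.1, ← hcJ.2, hJ, ← henc c hc, replaceEnc, if_pos rfl]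
        cases b <;> simp
      · have hJ : cellIndex w c i ≠ J := fun h =>
          hcJ ((cellIndex_eq_iff (by omega) (by omega)).1 h)
        -- Raising the threshold from `J` to `J + 1` affects the cell number `J` alone, which is the
        -- one filled by the challenge.
        have hiff : cellIndex w c i < J + b.toNat ↔ cellIndex w c i < J := by
          cases b
          · simp
          · simp only [Bool.toNat_true]; omega
        simp only [hcJ, if_false, PMF.bind_const, hiff]
        rw [henc c hc]
    · rw [hashKey_setEncKey, henc c hc]
    · rw [hashKey_setEncKey, henc c hc]
  · intro c i hci chal chal'
    simp only [hci, if_false]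

end Eunomia
namespace Eunomia
open Enc

variable {α : Type} [Enc α]

/-! ## The adversary against the encryption scheme -/

theorem iterate_pair_one (k : ℕ) : (Data.pair (.int 1))^[k] (.int 0) = .unary k := by
  induction k with
  | zero => rfl
  | succ k ih => rw [Function.iterate_succ_apply', ih]; rfl

@[fun_prop] theorem PolyTime.unary (p : Polynomial ℕ) {f : α → Data} (hf : PolyTime f) :
    PolyTime fun a => Data.unary (p.eval (f a).size) := by
  refine comp (f := fun d : Data => Data.unary (p.eval d.size)) ?_ hf
  have := PolyTime.iter (step := fun (_ : Data) s => Data.pair (.int 1) s) (init := fun _ => .int 0)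
    (n := fun d : Data => p.eval d.size) (by fun_prop) (by fun_prop) (by fun_prop) (3 * p + 1)
    (fun d => by simp; omega) (fun d k hk => by
      rw [iterate_pair_one, enc_data, size_unary]
      simp; omega)
  simpa only [iterate_pair_one] using this

/-- The answer of the oracle, if it has at most the expected length. -/
noncomputable def oracleEnc (p : Polynomial ℕ) (κd : Data) (O : Data → PMF Data) (v : Data) :
    PMF Data :=
  (O v).map fun z => if z.size ≤ (Data.unary (p.eval (Data.pair κd v).size)).size then z else .int 0

/-- Keys have length polynomial in `κ`, hence ciphertexts have length polynomial in `κ` and the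
message, and the limit for reading an answer can be chosen so that nothing is cut off. -/
theorem exists_oracleEnc_eq (SE : EncScheme) : ∃ p : Polynomial ℕ, ∀ κ,
    ∀ k ∈ (SE.gen.exec (.unary κ)).support, ∀ v,
      oracleEnc p (.unary κ) (fun m => SE.enc.exec (.pair k m)) v = SE.enc.exec (.pair k v) := by
  obtain ⟨tg, htg⟩ := SE.gen_ppt
  obtain ⟨te, hte⟩ := SE.enc_ppt
  refine ⟨te.comp (tg + .X), fun κ k hk v => ?_⟩
  have h1 := htg.size_le _ k hk
  refine Eq.trans (bind_congr (g := PMF.pure) fun z hz => ?_) (PMF.bind_pure _)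
  have h2 := hte.size_le _ z hz
  have h3 := eval_mono tg (show (Data.unary κ).size ≤ (Data.pair (.unary κ) v).size by
    simp only [Data.size]; omega)
  have h4 := eval_mono te (show (Data.pair k v).size ≤
    tg.eval (Data.pair (.unary κ) v).size + (Data.pair (.unary κ) v).size by
      simp only [Data.size] at *; omega)
  rw [Function.comp_apply, if_pos]
  rw [size_unary, Polynomial.eval_comp, Polynomial.eval_add, Polynomial.eval_X]
  omega

/-- What the first phase leaves: the input, the key of the function `DET`, the choice, the position of
the cell, and the keys of the columns. -/
abbrev CpaState := Data × Data × Data × ℕ × KeyTable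

/-- The reduction produces all keys itself and guesses the cell `J`. The encryption key which it
draws for the column of this cell is not used; the key of the challenger takes its place. -/
noncomputable def cpaChoice (G : CurveFamily) (H : DetScheme G) (SE : EncScheme) (A₁ : Prog)
    (W : Polynomial ℕ) (κd : Data) : PMF (Data × Data × CpaState) :=
  (G.setup.exec κd).bind fun pp => (H.gen.exec (.pair κd pp)).bind fun key =>
  (A₁.exec (.pair κd pp)).bind fun x =>
  (uniformNat (W.eval (listLength κd) * W.eval (listLength κd) * W.eval (listLength κd) + 1)).bind
    fun J =>
  (natKeys SE κd pp.snd.fst.toNat (schemaOf x)).map fun K =>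
    ((firstLog x).cellD (indexColumn (W.eval (listLength κd)) J)
        (indexRow (W.eval (listLength κd)) J),
      (secondLog x).cellD (indexColumn (W.eval (listLength κd)) J)
        (indexRow (W.eval (listLength κd)) J),
      .pair κd pp, key, x, J, K)

/-- All hashes are those of the second log. Cell number `J` holds the challenge, earlier cells hold
ciphertexts of the second log and later ones those of the first; the oracle encrypts everything else
in the column of cell `J`. -/
noncomputable def cpaAttack (G : CurveFamily) (H : DetScheme G) (SE : EncScheme) (A₂ : Prog)
    (W e p : Polynomial ℕ) (d key x : Data) (J : ℕ) (K : KeyTable) (chal : Data)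
    (O : Data → PMF Data) : PMF Data :=
  splitAttack A₂ x d.snd.snd.fst.toNat K
    (scalarHash G e d (fun _ v => (H.prog.exec (.pair d.snd (.pair key v))).map Data.toNat) false)
    (secondLog x)
    (fun c i => if c = indexColumn (W.eval (listLength d.fst)) J ∧
        i = indexRow (W.eval (listLength d.fst)) J then PMF.pure chal else
      replaceEnc (indexColumn (W.eval (listLength d.fst)) J) (oracleEnc p d.fst O) (tableEnc SE K) c
        (if cellIndex (W.eval (listLength d.fst)) c i < J then (secondLog x).cellD c i
          else (firstLog x).cellD c i))
    (replaceEnc (indexColumn (W.eval (listLength d.fst)) J) (oracleEnc p d.fst O) (tableEnc SE K))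

namespace PolyTime

@[fun_prop] theorem indexColumn {w n : α → ℕ} (hw : PolyTime w) (hn : PolyTime n) :
    PolyTime fun a => indexColumn (w a) (n a) := by
  unfold Eunomia.indexColumn; fun_prop

@[fun_prop] theorem indexRow {w n : α → ℕ} (hw : PolyTime w) (hn : PolyTime n) :
    PolyTime fun a => indexRow (w a) (n a) := by
  unfold Eunomia.indexRow; fun_prop

@[fun_prop] theorem cellIndex {w i : α → ℕ} {c : α → Column} (hw : PolyTime w) (hc : PolyTime c)
    (hi : PolyTime i) : PolyTime fun a => cellIndex (w a) (c a) (i a) := by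
  unfold Eunomia.cellIndex; fun_prop

end PolyTime

theorem PPTime.splitAttack {A₂ : Prog} (hA : A₂.PPT) {x : α → Data} {q : α → ℕ} {K : α → KeyTable}
    {h : α → ℕ → Data → (Data → PMF Data) → PMF Data} {L : α → Log}
    {ct : α → Column → ℕ → (Data → PMF Data) → PMF Data}
    {encr : α → Column → Data → (Data → PMF Data) → PMF Data} (hx : PolyTime x) (hq : PolyTime q)
    (hK : PolyTime K) (hh : PPTime fun p : α × ℕ × Data => h p.1 p.2.1 p.2.2) (hL : PolyTime L)
    (hct : PPTime fun p : α × Column × ℕ => ct p.1 p.2.1 p.2.2)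
    (he : PPTime fun p : α × Column × Data => encr p.1 p.2.1 p.2.2) :
    PPTime fun a O => splitAttack A₂ (x a) (q a) (K a) (fun k v => h a k v O) (L a)
      (fun c i => ct a c i O) (fun c v => encr a c v O) := by
  unfold Eunomia.splitAttack
  refine PPTime.attack hA hx ?_ ?_ ?_ ?_ (by fun_prop)
  · refine PPTime.bind (PPTime.comp hh (f := fun p : α × Column × ℕ =>
      (p.1, (K p.1).hashKey p.2.1, (L p.1).cellD p.2.1 p.2.2)) (by fun_prop)) ?_
    exact PPTime.map (g := fun (p : (α × Column × ℕ) × Data) c => Data.pair p.2 c)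
      (PPTime.comp hct (f := fun p : (α × Column × ℕ) × Data => p.1) (by fun_prop)) (by fun_prop)
  · exact PPTime.comp hh (f := fun p : α × ℕ =>
      (p.1, (K p.1).1, (timeStamps (schemaOf (x p.1)) (L p.1)).getD p.2 (.int 0))) (by fun_prop)
  · exact PPTime.comp hh (f := fun p : α × Data => (p.1, (K p.1).1, p.2)) (by fun_prop)
  · refine PPTime.bind (PPTime.comp hh (f := fun p : α × Column × Data =>
      (p.1, (K p.1).hashKey p.2.1, p.2.2)) (by fun_prop)) ?_
    exact PPTime.map (g := fun (p : (α × Column × Data) × Data) c => Data.pair p.2 c)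
      (PPTime.comp he (f := fun p : (α × Column × Data) × Data => p.1) (by fun_prop)) (by fun_prop)

theorem exists_cpaChooser (G : CurveFamily) (H : DetScheme G) (SE : EncScheme) {A₁ : Prog}
    (hA₁ : A₁.PPT) (W : Polynomial ℕ) : ∃ B : Prog, B.PPT ∧ ∀ O κd, B.execWith O κd =
      (cpaChoice G H SE A₁ W κd).map enc := by
  have : PPTime fun (κd : Data) O => cpaChoice G H SE A₁ W κd := by
    unfold cpaChoice
    refine PPTime.bind (PPTime.exec G.setup_ppt (by fun_prop)) ?_
    refine PPTime.bind (PPTime.exec (α := Data × Data) H.gen_ppt (x := fun p => .pair p.1 p.2)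
      (by fun_prop)) ?_
    refine PPTime.bind (PPTime.exec (α := (Data × Data) × Data) hA₁
      (x := fun p => .pair p.1.1 p.1.2) (by fun_prop)) ?_
    refine PPTime.bind (PPTime.uniformNat (α := ((Data × Data) × Data) × Data)
      (n := fun p => W.eval (listLength p.1.1.1) * W.eval (listLength p.1.1.1) *
        W.eval (listLength p.1.1.1) + 1) (by fun_prop)) ?_
    have hcell : ∀ L : Data → Log, PolyTime L → PolyTime fun p : ((((Data × Data) × Data) × Data) ×
        ℕ) × KeyTable => (L p.1.1.2).cellD (indexColumn (W.eval (listLength p.1.1.1.1.1)) p.1.2)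
          (indexRow (W.eval (listLength p.1.1.1.1.1)) p.1.2) := fun L hL => by fun_prop
    have hkeys := PPTime.natKeys (α := (((Data × Data) × Data) × Data) × ℕ) SE
      (κd := fun p => p.1.1.1.1) (q := fun p => p.1.1.1.2.snd.fst.toNat)
      (S := fun p => schemaOf p.1.2) (by fun_prop) (by fun_prop) (by fun_prop)
    exact hkeys.map (.mk (hcell firstLog (by fun_prop)) (.mk (hcell secondLog (by fun_prop))
      (.mk (by fun_prop) (.mk (by fun_prop) (by fun_prop)))))
  obtain ⟨B, hB, h⟩ := this
  exact ⟨B, hB, fun O d => h d O⟩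

theorem exists_cpaGuesser (G : CurveFamily) (H : DetScheme G) (SE : EncScheme) {A₂ : Prog}
    (hA₂ : A₂.PPT) (W e p : Polynomial ℕ) : ∃ B : Prog, B.PPT ∧
      ∀ O d key x J K chal, B.execWith O (.pair (enc ((d, key, x, J, K) : CpaState)) chal) =
        cpaAttack G H SE A₂ W e p d key x J K chal O := by
  have henc : PPTime fun (a : (CpaState × Data) × Column × Data) O =>
      replaceEnc (indexColumn (W.eval (listLength a.1.1.1.fst)) a.1.1.2.2.2.1)
        (oracleEnc p a.1.1.1.fst O) (tableEnc SE a.1.1.2.2.2.2) a.2.1 a.2.2 := by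
    unfold replaceEnc oracleEnc tableEnc
    exact PPTime.ite (by fun_prop) (PPTime.oracle (by fun_prop) (by fun_prop))
      (PPTime.exec SE.enc_ppt (by fun_prop))
  have : PPTime fun (a : CpaState × Data) O =>
      cpaAttack G H SE A₂ W e p a.1.1 a.1.2.1 a.1.2.2.1 a.1.2.2.2.1 a.1.2.2.2.2 a.2 O := by
    unfold cpaAttack
    refine PPTime.splitAttack hA₂ (h := fun (a : CpaState × Data) k v O => scalarHash G e a.1.1
      (fun _ v => (H.prog.exec (.pair a.1.1.snd (.pair a.1.2.1 v))).map Data.toNat) false k v)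
      (ct := fun (a : CpaState × Data) c i O =>
        if c = indexColumn (W.eval (listLength a.1.1.fst)) a.1.2.2.2.1 ∧
          i = indexRow (W.eval (listLength a.1.1.fst)) a.1.2.2.2.1 then PMF.pure a.2 else
        replaceEnc (indexColumn (W.eval (listLength a.1.1.fst)) a.1.2.2.2.1)
          (oracleEnc p a.1.1.fst O) (tableEnc SE a.1.2.2.2.2) c
          (if cellIndex (W.eval (listLength a.1.1.fst)) c i < a.1.2.2.2.1
            then (secondLog a.1.2.2.1).cellD c i else (firstLog a.1.2.2.1).cellD c i))
      (encr := fun (a : CpaState × Data) c v O =>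
        replaceEnc (indexColumn (W.eval (listLength a.1.1.fst)) a.1.2.2.2.1)
          (oracleEnc p a.1.1.fst O) (tableEnc SE a.1.2.2.2.2) c v)
      (by fun_prop) (by fun_prop) (by fun_prop) ?_ (by fun_prop) ?_ henc
    · refine PPTime.scalarHash G e (F := fun (a : (CpaState × Data) × ℕ × Data) _ v O =>
        (H.prog.exec (.pair a.1.1.1.snd (.pair a.1.1.2.1 v))).map Data.toNat)
        (by fun_prop) ?_ (by fun_prop) (by fun_prop) (by fun_prop)
      exact PPTime.map (g := fun a (z : Data) => z.toNat) (PPTime.exec H.prog_ppt (by fun_prop))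
        (by fun_prop)
    · refine PPTime.ite (by fun_prop) (PPTime.pure (by fun_prop)) ?_
      exact PPTime.comp henc (f := fun a : (CpaState × Data) × Column × ℕ => (a.1, a.2.1,
        if cellIndex (W.eval (listLength a.1.1.1.fst)) a.2.1 a.2.2 < a.1.1.2.2.2.1
          then (secondLog a.1.1.2.2.1).cellD a.2.1 a.2.2
          else (firstLog a.1.1.2.2.1).cellD a.2.1 a.2.2)) (by fun_prop)
  obtain ⟨B, hB, h⟩ := this
  exact ⟨B, hB, fun O d key x J K chal => (h ((d, key, x, J, K), chal) O).trans (PMF.map_id _)⟩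

end Eunomia
namespace Eunomia
open Enc

/-! ### Summing the hybrids over the cells -/

section Ciphertexts

variable {G : CurveFamily} {H : DetScheme G} {SE : EncScheme} {A₁ A₂ : Prog} {W : Polynomial ℕ}

/-- The ciphertexts of the cells before position `θ` belong to the second log, the others to the first
one. -/
noncomputable def stepAttack (SE : EncScheme) (A₂ : Prog) (w θ : ℕ) (x : Data) (q : ℕ)
    (h : ℕ → Data → PMF Data) (K : KeyTable) : PMF Data :=
  splitAttack A₂ x q K h (secondLog x)
    (fun c i => tableEnc SE K c
      (if cellIndex w c i < θ then (secondLog x).cellD c i else (firstLog x).cellD c i))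
    (tableEnc SE K)

noncomputable def stepGame (H : DetScheme G) (SE : EncScheme) (A₁ A₂ : Prog) (W : Polynomial ℕ)
    (κ θ : ℕ) : PMF Bool :=
  (G.setup.exec (.unary κ)).bind fun pp => (H.gen.exec (.pair (.unary κ) pp)).bind fun key =>
  (A₁.exec (.pair (.unary κ) pp)).bind fun x =>
  (natKeys SE (.unary κ) (G.curve pp).q (schemaOf x)).bind fun K =>
  (stepAttack SE A₂ (W.eval κ) θ x (G.curve pp).q (detHash H pp key) K).map Data.toBool

theorem stepGame_zero (κ : ℕ) :
    stepGame H SE A₁ A₂ W κ 0 = splitGame H SE A₁ A₂ secondLog firstLog κ := by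
  unfold stepGame stepAttack splitGame
  simp only [Nat.not_lt_zero, if_false]

theorem stepGame_top (κ : ℕ)
    (hW : ∀ pp ∈ (G.setup.exec (.unary κ)).support,
      ∀ x ∈ (A₁.exec (.pair (.unary κ) pp)).support, x.size ≤ W.eval κ) :
    stepGame H SE A₁ A₂ W κ (W.eval κ * W.eval κ * W.eval κ + 1) =
      splitGame H SE A₁ A₂ secondLog secondLog κ := by
  unfold stepGame stepAttack splitGame splitAttack
  refine bind_congr fun pp hpp => bind_congr fun key _ => bind_congr fun x hx =>
    bind_congr fun K _ => congrArg (PMF.map Data.toBool) ?_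
  refine attack_congr (fun c i v hv => ?_) (fun _ _ => rfl) (fun _ _ _ => rfl)
    (fun _ _ _ _ _ => rfl) (fun _ _ _ _ _ => rfl) rfl
  obtain ⟨h1, h2, h3⟩ := cell_firstLog_lt hv
  have hw := hW pp hpp x hx
  have := cellIndex_lt (c := c) (h1.trans_le hw) (h2.trans_le hw) (h3.trans_le hw)
  dsimp only
  rw [if_pos (by omega)]

variable {e p : Polynomial ℕ} {κ : ℕ} {pp key x k chal : Data} {K : KeyTable} {J : ℕ}

theorem cpaAttack_eq (he : ∀ κ, ∀ pp ∈ (G.setup.exec (.unary κ)).support, ∀ X,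
      ((G.curve pp).encode X).size ≤ e.eval κ)
    (hp : ∀ κ, ∀ k ∈ (SE.gen.exec (.unary κ)).support, ∀ v,
      oracleEnc p (.unary κ) (fun m => SE.enc.exec (.pair k m)) v = SE.enc.exec (.pair k v))
    (hk : k ∈ (SE.gen.exec (.unary κ)).support) (hpp : pp ∈ (G.setup.exec (.unary κ)).support)
    (hkey : key ∈ (H.gen.exec (.pair (.unary κ) pp)).support) (hx : (Challenge.ofData x).Valid)
    (hw : x.size ≤ W.eval κ)
    (hK : K ∈ (natKeys SE (.unary κ) (G.curve pp).q (schemaOf x)).support) (b : Bool) :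
    ((SE.enc.exec (.pair k (if b = true
        then (secondLog x).cellD (indexColumn (W.eval κ) J) (indexRow (W.eval κ) J)
        else (firstLog x).cellD (indexColumn (W.eval κ) J) (indexRow (W.eval κ) J)))).bind fun chal =>
      cpaAttack G H SE A₂ W e p (.pair (.unary κ) pp) key x J K chal
        (fun m => SE.enc.exec (.pair k m))) =
      stepAttack SE A₂ (W.eval κ) (J + b.toNat) x (G.curve pp).q (detHash H pp key)
        (setEncKey (indexColumn (W.eval κ) J) k K) := by
  rw [stepAttack, ← splitAttack_challenge hx hw (mem_natKeys hK).2.2.2]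
  refine bind_congr fun chal _ => ?_
  have horacle : oracleEnc p (.unary κ) (fun m => SE.enc.exec (.pair k m)) =
      fun v => SE.enc.exec (.pair k v) := funext (hp κ k hk)
  have hhash : scalarHash G e (.pair (.unary κ) pp)
      (fun _ v => (H.prog.exec (.pair pp (.pair key v))).map Data.toNat) false =
      detHash H pp key := by
    rw [scalarHash_eq he hpp (n := fun _ v => (H.det pp key v).val) fun _ v => by
      rw [H.prog_spec κ pp hpp key hkey, PMF.pure_map, toNat_ofNat]]
    simp only [ZMod.natCast_zmod_val]
  rw [cpaAttack]
  simp only [Data.fst_pair, Data.snd_pair, listLength_unary, horacle, hhash, pp_order hpp]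

/-- The challenge bit moves the threshold from `J` to `J + 1`, so that the IND-CPA game asks to tell
two neighbouring hybrids apart at a random position. -/
theorem cpaGame_eq_step {B₁ B₂ : Prog} (he : ∀ κ, ∀ pp ∈ (G.setup.exec (.unary κ)).support, ∀ X,
      ((G.curve pp).encode X).size ≤ e.eval κ)
    (hp : ∀ κ, ∀ k ∈ (SE.gen.exec (.unary κ)).support, ∀ v,
      oracleEnc p (.unary κ) (fun m => SE.enc.exec (.pair k m)) v = SE.enc.exec (.pair k v))
    (hB₁ : ∀ O κd, B₁.execWith O κd = (cpaChoice G H SE A₁ W κd).map enc)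
    (hB₂ : ∀ O d key x J K chal, B₂.execWith O (.pair (enc ((d, key, x, J, K) : CpaState)) chal) =
        cpaAttack G H SE A₂ W e p d key x J K chal O)
    (hA : ∀ pp ∈ (G.setup.exec (.unary κ)).support,
      ∀ x ∈ (A₁.exec (.pair (.unary κ) pp)).support, (Challenge.ofData x).Valid)
    (hW : ∀ pp ∈ (G.setup.exec (.unary κ)).support,
      ∀ x ∈ (A₁.exec (.pair (.unary κ) pp)).support, x.size ≤ W.eval κ) :
    cpaGame SE B₁ B₂ κ = (PMF.uniformOfFintype Bool).bind fun b =>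
      ((uniformNat (W.eval κ * W.eval κ * W.eval κ + 1)).bind fun J =>
        stepGame H SE A₁ A₂ W κ (J + b.toNat)).map fun g => g == b := by
  have h1 : cpaGame SE B₁ B₂ κ = (SE.gen.exec (.unary κ)).bind fun k =>
      (PMF.uniformOfFintype Bool).bind fun b => (cpaChoice G H SE A₁ W (.unary κ)).bind fun out =>
      (if out.1.size = out.2.1.size then SE.enc.exec (.pair k (if b = true then out.2.1 else out.1))
        else PMF.pure (.int 0)).bind fun c =>
      (B₂.execWith (fun m => SE.enc.exec (.pair k m)) (.pair (enc out.2.2) c)).map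
        fun guess => guess.toBool == b := by
    unfold cpaGame
    refine bind_congr fun k _ => bind_congr fun b _ => ?_
    dsimp only
    change PMF.bind (B₁.execWith _ _) _ = _
    rw [hB₁, PMF.bind_map]
    refine bind_congr fun out _ => ?_
    obtain ⟨m₀, m₁, st⟩ := out
    change (if m₀.size = m₁.size then _ else _) = PMF.bind (if m₀.size = m₁.size then _ else _) _
    split_ifs <;> rfl
  have h2 : ∀ k ∈ (SE.gen.exec (.unary κ)).support, ∀ b : Bool,
      ((cpaChoice G H SE A₁ W (.unary κ)).bind fun out =>
      (if out.1.size = out.2.1.size then SE.enc.exec (.pair k (if b = true then out.2.1 else out.1))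
        else PMF.pure (.int 0)).bind fun c =>
      (B₂.execWith (fun m => SE.enc.exec (.pair k m)) (.pair (enc out.2.2) c)).map
        fun guess => guess.toBool == b) =
      (G.setup.exec (.unary κ)).bind fun pp => (H.gen.exec (.pair (.unary κ) pp)).bind fun key =>
      (A₁.exec (.pair (.unary κ) pp)).bind fun x =>
      (uniformNat (W.eval κ * W.eval κ * W.eval κ + 1)).bind fun J =>
      (natKeys SE (.unary κ) (G.curve pp).q (schemaOf x)).bind fun K =>
      ((stepAttack SE A₂ (W.eval κ) (J + b.toNat) x (G.curve pp).q (detHash H pp key)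
        (setEncKey (indexColumn (W.eval κ) J) k K)).map Data.toBool).map fun g => g == b := by
    intro k hk b
    unfold cpaChoice
    simp only [listLength_unary, PMF.bind_bind, PMF.bind_map]
    refine bind_congr fun pp hpp => bind_congr fun key hkey => bind_congr fun x hx =>
      bind_congr fun J _ => ?_
    rw [pp_order hpp]
    refine bind_congr fun K hK => ?_
    rw [← cpaAttack_eq he hp hk hpp hkey (hA pp hpp x hx) (hW pp hpp x hx) hK b]
    dsimp only [Function.comp_apply]
    -- The challenge is admissible because corresponding cells have equal length.
    rw [if_pos (cellD_size (hA pp hpp x hx) _ _), PMF.map_bind, PMF.map_bind]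
    refine bind_congr fun c _ => ?_
    rw [hB₂, PMF.map_comp]
    rfl
  rw [h1, PMF.bind_comm]
  refine bind_congr fun b _ => ?_
  rw [bind_congr fun k hk => h2 k hk b, PMF.map_bind]
  unfold stepGame
  simp only [PMF.map_bind]
  rw [PMF.bind_comm, PMF.bind_comm (uniformNat _)]
  refine bind_congr fun pp _ => ?_
  rw [PMF.bind_comm, PMF.bind_comm (uniformNat _)]
  refine bind_congr fun key _ => ?_
  rw [PMF.bind_comm, PMF.bind_comm (uniformNat _)]
  refine bind_congr fun x _ => ?_
  rw [PMF.bind_comm]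
  refine bind_congr fun J _ => ?_
  rw [PMF.bind_comm]
  -- The challenger's key, installed at the column of cell `J`, leaves a table distributed like a
  -- freshly generated one.
  conv_rhs => rw [← natKeys_setEncKey SE (.unary κ) (G.curve pp).q (schemaOf x)
    (indexColumn (W.eval κ) J), PMF.bind_bind]
  refine bind_congr fun K _ => ?_
  rw [PMF.bind_map]
  rfl

/-- The hybrids telescope from position 0 to one beyond the bound `w³` for cell numbers. -/
theorem splitGame_sub (κ : ℕ)
    (hW : ∀ pp ∈ (G.setup.exec (.unary κ)).support,
      ∀ x ∈ (A₁.exec (.pair (.unary κ) pp)).support, x.size ≤ W.eval κ) :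
    prTrue (splitGame H SE A₁ A₂ secondLog secondLog κ) -
      prTrue (splitGame H SE A₁ A₂ secondLog firstLog κ) =
    (W.eval κ * W.eval κ * W.eval κ + 1 : ℕ) *
      (prTrue ((uniformNat (W.eval κ * W.eval κ * W.eval κ + 1)).bind fun J =>
        stepGame H SE A₁ A₂ W κ (J + 1)) -
      prTrue ((uniformNat (W.eval κ * W.eval κ * W.eval κ + 1)).bind fun J =>
        stepGame H SE A₁ A₂ W κ J)) := by
  rw [← stepGame_zero (W := W), ← stepGame_top κ hW, mul_sub, prTrue_uniformNat_bind,
    prTrue_uniformNat_bind, ← Finset.sum_sub_distrib]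
  exact (Finset.sum_range_sub (fun n => prTrue (stepGame H SE A₁ A₂ W κ n)) _).symm

/-- Next to the hashes of the second log, the ciphertexts of the two logs are indistinguishable. -/
theorem exists_splitGame_sub_le (hCPA : SE.INDCPA) (hA₁ : A₁.PPT) (hA₂ : A₂.PPT)
    (hA : ∀ κ, ∀ pp ∈ (G.setup.exec (.unary κ)).support,
      ∀ x ∈ (A₁.exec (.pair (.unary κ) pp)).support, (Challenge.ofData x).Valid)
    (hW : ∀ κ, ∀ pp ∈ (G.setup.exec (.unary κ)).support,
      ∀ x ∈ (A₁.exec (.pair (.unary κ) pp)).support, x.size ≤ W.eval κ) :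
    ∃ ν, Negligible ν ∧ ∀ κ, prTrue (splitGame H SE A₁ A₂ secondLog secondLog κ) -
      prTrue (splitGame H SE A₁ A₂ secondLog firstLog κ) ≤ ν κ := by
  obtain ⟨e, he⟩ := G.encode_size
  obtain ⟨p, hp⟩ := exists_oracleEnc_eq SE
  obtain ⟨B₁, hB₁ppt, hB₁⟩ := exists_cpaChooser G H SE hA₁ W
  obtain ⟨B₂, hB₂ppt, hB₂⟩ := exists_cpaGuesser G H SE hA₂ W e p
  obtain ⟨ν, hν, hle⟩ := hCPA B₁ B₂ hB₁ppt hB₂ppt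
  -- The factor 2 stems from the halved difference in `prTrue_guess`, the other factor from the
  -- number of hybrids.
  refine ⟨_, hν.poly_mul (2 * (W * W * W + 1)), fun κ => ?_⟩
  have h1 := hle κ
  rw [cpaGame_eq_step he hp hB₁ hB₂ (hA κ) (hW κ), prTrue_guess] at h1
  rw [splitGame_sub κ (hW κ)]
  simp only [Bool.toNat_true, Bool.toNat_false, add_zero] at h1
  have h2 := mul_le_mul_of_nonneg_left (sub_nonneg.2 h1)
    (Nat.cast_nonneg (α := ℝ) (W.eval κ * W.eval κ * W.eval κ + 1))
  simp only [Polynomial.eval_mul, Polynomial.eval_add, Polynomial.eval_one, Polynomial.eval_ofNat]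
  push_cast at h2 ⊢
  linarith

end Ciphertexts

theorem exists_choice_size (G : CurveFamily) {A₁ : Prog} (hA₁ : A₁.PPT) : ∃ W : Polynomial ℕ, ∀ κ,
    ∀ pp ∈ (G.setup.exec (.unary κ)).support, ∀ x ∈ (A₁.exec (.pair (.unary κ) pp)).support,
      x.size ≤ W.eval κ := by
  obtain ⟨s, hs⟩ := G.setup_ppt
  obtain ⟨t, ht⟩ := hA₁
  -- The security parameter in unary has size `3κ + 1`, and the input of `A₁` is its pair with the
  -- output of the setup.
  refine ⟨(t.comp (.X + s + 1)).comp (3 * .X + 1), fun κ pp hpp x hx => ?_⟩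
  refine (ht.size_le _ x hx).trans ?_
  have h1 := hs.size_le _ pp hpp
  simp only [Polynomial.eval_comp, Polynomial.eval_add, Polynomial.eval_mul, Polynomial.eval_X,
    Polynomial.eval_one, Polynomial.eval_ofNat]
  rw [size_unary] at h1
  refine eval_mono t ?_
  simp only [Data.size, size_unary]
  omega

end Eunomia

theorem theorem3 (G : Eunomia.CurveFamily) (H : Eunomia.DetScheme G) (E : Eunomia.EncScheme)
    (hDDH : Eunomia.ECDDH G) (hPRF : H.IsPRF) (hCPA : E.INDCPA) :
    Eunomia.INDCPLA H E := by
  intro A₁ A₂ hA₁ hA₂ hA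
  obtain ⟨W, hW⟩ := Eunomia.exists_choice_size G hA₁
  obtain ⟨ν, hν, hle⟩ := Eunomia.exists_splitGame_sub_le (H := H) hCPA hA₁ hA₂ hA hW
  have hclose := Eunomia.close_splitGame (SE := E) hDDH hPRF hA₁ hA₂ hA hW
  -- The function `ν` is the halved difference from `cplaGame_eq` itself, so that only its
  -- negligibility remains. It need not be nonnegative.
  refine ⟨_, fun c => ?_, fun κ => (Eunomia.cplaGame_eq κ (hA κ)).le⟩
  refine (hν.add hclose c).imp fun K hK κ hκ => ?_
  have h1 := hK κ hκ
  have h2 := hle κ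
  have h3 := le_abs_self
    (Eunomia.prTrue (Eunomia.splitGame H E A₁ A₂ Eunomia.secondLog Eunomia.firstLog κ) -
      Eunomia.prTrue (Eunomia.splitGame H E A₁ A₂ Eunomia.firstLog Eunomia.firstLog κ))
  -- The bound is for the whole difference; passing to its half uses that `κ ^ (-c)` is nonnegative.
  have h4 : (0 : ℝ) ≤ ((κ : ℝ) ^ c)⁻¹ := by positivity
  dsimp only at h1
  linarith
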